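/- **Conventions.** All spaces are $k$-spaces (topologies coinduced from compact Hausdorff spaces), and products, fibres and pullbacks are $k$-ified. $\mathbb F$ is a field of characteristic $2$, $d\in\mathbb Z$, homology is singular with coefficients in $\mathbb F$, and $\mathbf{grMod}$ is the symmetric monoidal category of $\mathbb Z$-graded $\mathbb F$-vector spaces. For a space $B$ and a locally constant $m\colon B\to\mathbb Z$, $H_{*-m}(B)$ is the graded vector space whose degree $q$ part is $\bigoplus_n H_n(\{b: m(b)+n=q\})$ (so $H_{q-m}(B)$ for constant $m$). Cross products give $H_{*-m}(B)\otimes H_{*-n}(C)\to H_{*-(m+n)}(B\times C)$, where $(m+n)(b,c)=m(b)+n(c)$. Symmetric monoidal functors are strong. **H-graphs.** An *h-graph* is a space homotopy equivalent to a finite CW complex of dimension $\le 1$. A map of h-graphs is *positive* if it is surjective on $\pi_0$. A commutative square is a *homotopy cofibre square* if the induced map from the double mapping cylinder (homotopy pushout) to its last corner is a homotopy equivalence. A map $X\to Y$ is an *h-embedding* if there is a homotopy cofibre square with sides $A\to X$, $A\to B$, $X\to Y$, $B\to Y$ in which $A$ has the homotopy type of a finite set and $B$ is an h-graph. A *family of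 h-graphs* over a weak Hausdorff space $B$ is a Hurewicz fibration over $B$ whose fibres are h-graphs; it *admits basepoints* if finitely many sections together meet every path component of every fibre. Positivity and h-embeddings for maps of families are meant fibrewise. A *good base* is a space homeomorphic to an open subset of a CW complex. **The double category $\mathbb S^d(\mathcal H^{\mathrm{fop}})$.** Objects are pairs $(X,m)$ of a family of h-graphs $X\to B$ over a good base that admits basepoints and a locally constant $m\colon B\to\mathbb Z$. A morphism of the fibrewise opposite category from $X$ over $B$ to $Y$ over $C$ is a map $f\colon B\to C$ with a map $\alpha\colon f^*Y\to X$ over $B$. It is a *vertical* morphism $(X,m)\to(Y,n)$ if $\alpha$ is an h-embedding and $m=n\circ f$. A *horizontal* morphism $(X,m)\to(Y,n)$, for $X,Y$ over the same $B$, is a positive map $Y\to X$ over $B$ with $m-n=-d(\chi(X)-\chi(Y))$, where $\chi$ denotes the fibrewise Euler characteristic. A *2-cell* is a commutative square of horizontal and vertical morphisms that gives a homotopy cofibre square in each fibre. The symmetric monoidal structure is $(X,m)\otimes(Y,n)=(X\,\underline\sqcup\,Y,\,m+n)$ over $B\times C$, where $X\,\underline\sqcup\,Y=(X\times C)\sqcup(B\times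 Y)$; the unit is the empty family over a point with shift $0$. $\mathbb S\mathbf q(\mathbf{grMod})^{\mathrm{hop}}$ is the symmetric monoidal double category of commutative squares of graded vector spaces with the direction of horizontal morphisms reversed. A *symmetric monoidal double functor* $$U\colon\mathbb S^d(\mathcal H^{\mathrm{fop}})\to\mathbb S\mathbf q(\mathbf{grMod})^{\mathrm{hop}}$$ is thus covariantly functorial on vertical and contravariantly functorial on horizontal morphisms, sends 2-cells to commutative squares, and has isomorphisms $U_\otimes\colon U(X,m)\otimes U(Y,n)\cong U((X,m)\otimes(Y,n))$ and $U_I$, natural for vertical and for horizontal morphisms and subject to the axioms of symmetric monoidal functors. It is *homological* if the symmetric monoidal functor $(B,m)\mapsto U(\emptyset_B,m)$, on good bases with locally constant shifts and on maps $f\colon(B,m)\to(C,n)$ with $n\circ f=m$, is identified with $(B,m)\mapsto H_{*-m}(B)$ by a monoidal natural isomorphism; such an identification is fixed. **Field theories.** Let $X,Y$ be h-graphs. A *family of h-graph cobordisms* $S/B\colon X\to Y$ is a family of h-graphs $S\to B$ with maps $i\colon B\times X\to S$ and $j\colon B\times Y\to S$ over $B$ such that $j$ is an h-embedding and $(i,j)\colon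 B\times(X\sqcup Y)\to S$ is a closed fibrewise cofibration; it is *positive* if $i$ is positive. Put $\chi(S,X)(b)=\chi(S_b)-\chi(X)$. The external composite $T\,\underline\circ\,S$ over $C\times B$ of $S/B\colon X\to Y$ and $T/C\colon Y\to Z$ has fibre $T_c\cup_Y S_b$ over $(c,b)$, and the external disjoint union $S\,\underline\sqcup\,S'$ over $B\times B'$ has fibre $S_b\sqcup S'_{b'}$. A *2-cell* $\varphi\colon S/B\Rightarrow S'/B'$ consists of homotopy equivalences $\varphi_X\colon X\to X'$ and $\varphi_Y\colon Y\to Y'$, a map $\varphi_B\colon B\to B'$, and a map $\varphi_S\colon S\to S'$ over $\varphi_B$, compatible with the maps from $B\times X$ and $B\times Y$, that is a homotopy equivalence on each fibre. A *positive homological h-graph field theory of degree $d$* consists of a symmetric monoidal functor $\Phi_*$ from (h-graphs, homotopy equivalences, $\sqcup$) to $(\mathbf{grMod},\otimes)$ and, for every positive family $S/B\colon X\to Y$ over any base, a map $$\Phi(S/B)\colon H_{*-d\chi(S,X)}(B)\otimes\Phi_*(X)\to\Phi_*(Y)$$ satisfying: * *base change*: $\Phi_*(\varphi_Y)\circ\Phi(S/B)=\Phi(S'/B')\circ\big((\varphi_B)_*\otimes\Phi_*(\varphi_X)\big)$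 for every 2-cell $\varphi$; * *gluing*: $\Phi(T/C)\circ(1\otimes\Phi(S/B))=\Phi(T\,\underline\circ\,S)\circ(\times\otimes1)$; * *identity*: for the cylinder $X\times I$ over a point, the composite $\mathbb F\otimes\Phi_*(X)\cong H_*(\mathrm{pt})\otimes\Phi_*(X)\to\Phi_*(X)$ is the left unit isomorphism; * *monoidality*: $\Phi_\otimes\circ(\Phi(S/B)\otimes\Phi(S'/B'))=\Phi(S\,\underline\sqcup\,S')\circ(\times\otimes\Phi_\otimes)\circ\mathrm{perm}$. **Theorem.** Let $U\colon\mathbb S^d(\mathcal H^{\mathrm{fop}})\to\mathbb S\mathbf q(\mathbf{grMod})^{\mathrm{hop}}$ be a homological symmetric monoidal double functor. Then there is a positive homological h-graph field theory $\Phi$ of degree $d$ over $\mathbb F$ such that: 1. $\Phi_*(X)=U(X,0)$ for every h-graph $X$, regarded as a family over a point. 2. For a homotopy equivalence $f\colon X\to Y$, regarded as a vertical morphism $f\colon(Y,0)\to(X,0)$, the map $U(f)$ is invertible and $\Phi_*(f)=U(f)^{-1}$; and $\Phi_\otimes\colon U(X,0)\otimes U(Y,0)\to U(X\sqcup Y,0)$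 is given by $U_\otimes$, followed by $U$ of the canonical identification of $(X,0)\otimes(Y,0)$ with $(X\sqcup Y,0)$. 3. For every positive family $S/B\colon X\to Y$ over a good base $B$ (in particular over any CW complex), $\Phi(S/B)$ is the composite $$H_{*-d\chi(S,X)}(B)\otimes U(X,0)\cong U(\emptyset_B,d\chi(S,X))\otimes U(X,0)\xrightarrow{U_\otimes}U\big((\emptyset_B,d\chi(S,X))\otimes(X,0)\big)\xrightarrow{U(\gamma_S)U(\beta_S)U(\alpha_S)}U(Y,0).$$ Here $\alpha_S\colon(\emptyset_B,d\chi(S,X))\otimes(X,0)\to(B\times X,d\chi(S,X))$ is the vertical morphism given by the canonical identification, $\beta_S\colon(S,0)\to(B\times X,d\chi(S,X))$ is the horizontal morphism given by $i\colon B\times X\to S$, and $\gamma_S\colon(S,0)\to(Y,0)$ is the vertical morphism covering $B\to\mathrm{pt}$ given by $j\colon B\times Y\to S$. -/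

import Mathlib

open CategoryTheory MonoidalCategory Topology
open scoped unitInterval

universe u

namespace HGFT

/-! ### k-spaces -/

/-- The test spaces for k-spaces: all compact Hausdorff spaces. -/
abbrev compHausFamily : CompHaus.{u} → Type u := fun K => K

/-- A k-space is a space whose topology is coinduced by the maps from compact Hausdorff spaces. -/
abbrev IsKSpace (X : Type u) [TopologicalSpace X] : Prop :=
  IsGeneratedBy compHausFamily.{u} X

/-- The k-ification of a space. -/
abbrev Kify (X : Type u) [TopologicalSpace X] : Type u :=
  WithGeneratedByTopology compHausFamily.{u} X

instance isKSpace_of_compact (K : Type u) [TopologicalSpace K] [CompactSpace K] [T2Space K] :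
    IsKSpace K :=
  inferInstanceAs (IsGeneratedBy compHausFamily.{u} (compHausFamily (CompHaus.of K)))

namespace Kify

variable {X Y Z : Type u} [TopologicalSpace X] [TopologicalSpace Y] [TopologicalSpace Z]

/-- The identity map `X → Kify X`. -/
def mk (x : X) : Kify X := (WithGeneratedByTopology.equiv (X := compHausFamily.{u})).symm x

/-- The (continuous) identity map `Kify X → X`. -/
def val (x : Kify X) : X := WithGeneratedByTopology.equiv (X := compHausFamily.{u}) x

@[simp] lemma val_mk (x : X) : val (mk x) = x := rfl
@[simp] lemma mk_val (x : Kify X) : mk (val x) = x := rfl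

lemma ext {x y : Kify X} (h : val x = val y) : x = y := h

@[fun_prop, continuity]
lemma continuous_val : Continuous (val : Kify X → X) :=
  WithGeneratedByTopology.continuous_equiv

@[fun_prop]
lemma continuous_val_comp {T : Type*} [TopologicalSpace T] {f : T → Kify X} (hf : Continuous f) :
    Continuous fun t => val (f t) := continuous_val.comp hf

@[fun_prop]
lemma continuous_mk_comp [IsKSpace Z] {f : Z → X} (hf : Continuous f) :
    Continuous fun z => mk (f z) :=
  (IsGeneratedBy.equiv_symm_comp_continuous_iff compHausFamily.{u} f).2 hf

/-- Continuity out of the k-ification of a space mapping to `U ⊕ V` can be tested on the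
preimages of the two summands. -/
lemma continuous_of_sum {U V : Type u} [TopologicalSpace U] [TopologicalSpace V]
    (s : C(X, U ⊕ V)) (φ : Kify X → Z)
    (hl : ∀ (K : Type u) [TopologicalSpace K] [CompactSpace K] [T2Space K] (k : C(K, X))
      (a : C(K, U)), (∀ t, s (k t) = Sum.inl (a t)) → Continuous fun t => φ (mk (k t)))
    (hr : ∀ (K : Type u) [TopologicalSpace K] [CompactSpace K] [T2Space K] (k : C(K, X))
      (a : C(K, V)), (∀ t, s (k t) = Sum.inr (a t)) → Continuous fun t => φ (mk (k t))) :
    Continuous φ := by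
  rw [WithGeneratedByTopology.continuous_from_iff]
  intro K k
  change Continuous fun t => φ (mk (k t))
  have hs : Continuous fun t => s (k t) := s.continuous.comp k.continuous
  have key : ∀ S : Set K, IsClopen S →
      (Continuous fun t : S => φ (mk (k t))) → ContinuousOn (fun t => φ (mk (k t))) S :=
    fun S _ h => continuousOn_iff_continuous_domRestrict.2 h
  have hL : IsClopen ((fun t => s (k t)) ⁻¹' Set.range Sum.inl) := isClopen_range_inl.preimage hs
  have hR : IsClopen ((fun t => s (k t)) ⁻¹' Set.range Sum.inr) := isClopen_range_inr.preimage hs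
  have cL : ContinuousOn (fun t => φ (mk (k t))) ((fun t => s (k t)) ⁻¹' Set.range Sum.inl) := by
    apply key _ hL
    have := isCompact_iff_compactSpace.1 hL.isClosed.isCompact
    let e := (Topology.IsEmbedding.inl (X := U) (Y := V)).toHomeomorph
    refine hl _ (k.comp ⟨Subtype.val, continuous_subtype_val⟩)
      ⟨fun t => e.symm ⟨s (k t.1), t.2⟩, by fun_prop⟩ fun t => ?_
    exact (congrArg Subtype.val (e.apply_symm_apply ⟨s (k t.1), t.2⟩)).symm
  have cR : ContinuousOn (fun t => φ (mk (k t))) ((fun t => s (k t)) ⁻¹' Set.range Sum.inr) := by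
    apply key _ hR
    have := isCompact_iff_compactSpace.1 hR.isClosed.isCompact
    let e := (Topology.IsEmbedding.inr (X := U) (Y := V)).toHomeomorph
    refine hr _ (k.comp ⟨Subtype.val, continuous_subtype_val⟩)
      ⟨fun t => e.symm ⟨s (k t.1), t.2⟩, by fun_prop⟩ fun t => ?_
    exact (congrArg Subtype.val (e.apply_symm_apply ⟨s (k t.1), t.2⟩)).symm
  rw [← continuousOn_univ]
  have : (Set.univ : Set K) = ((fun t => s (k t)) ⁻¹' Set.range Sum.inl) ∪
      ((fun t => s (k t)) ⁻¹' Set.range Sum.inr) := by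
    rw [← Set.preimage_union, Set.range_inl_union_range_inr, Set.preimage_univ]
  rw [this]
  exact cL.union_of_isOpen cR hL.isOpen hR.isOpen

end Kify

/-- Weak Hausdorff: every continuous image of a compact Hausdorff space is closed. -/
def IsWeakHausdorff (B : Type u) [TopologicalSpace B] : Prop :=
  ∀ (K : Type u) [TopologicalSpace K] [CompactSpace K] [T2Space K] (k : C(K, B)),
    IsClosed (Set.range k)

/-- The type of all k-spaces. -/
structure KSpace : Type (u + 1) where
  carrier : Type u
  [top : TopologicalSpace carrier]
  [isK : IsKSpace carrier]

namespace KSpace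

instance : CoeSort KSpace.{u} (Type u) := ⟨carrier⟩
attribute [instance] top isK

/-- The one-point space. -/
def pt : KSpace.{u} := ⟨PUnit⟩

/-- The empty space. -/
def empty : KSpace.{u} := ⟨PEmpty⟩

/-- The product of k-spaces. -/
def prod (X Y : KSpace.{u}) : KSpace.{u} := ⟨Kify (X × Y)⟩

/-- The fibre of a map over a point. -/
def fibre {E B : KSpace.{u}} (p : C(E, B)) (b : B) : KSpace.{u} := ⟨Kify {e : E // p e = b}⟩

/-- The disjoint union of k-spaces. -/
def sum (X Y : KSpace.{u}) : KSpace.{u} := ⟨X ⊕ Y⟩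

/-- The cylinder `X × I`. -/
def cyl (X : KSpace.{u}) : KSpace.{u} := ⟨Kify (X × I)⟩

variable {X Y Z W A : KSpace.{u}}

/-- The point of the one-point space. -/
def star : pt.{u} := PUnit.unit

instance : Subsingleton (pt.{u}) := inferInstanceAs (Subsingleton PUnit)
instance : IsEmpty (empty.{u}) := inferInstanceAs (IsEmpty PEmpty)

/-- A point of the fibre. -/
def fibreMk {p : C(X, Y)} {b : Y} (e : X) (h : p e = b) : fibre p b := Kify.mk ⟨e, h⟩

/-- The inclusion of the fibre. -/
def fibreVal {p : C(X, Y)} {b : Y} (e : fibre p b) : X := (Kify.val e).1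

@[simp] lemma fibreVal_mk {p : C(X, Y)} {b : Y} (e : X) (h : p e = b) :
    fibreVal (fibreMk e h : fibre p b) = e := rfl

lemma fibre_cond {p : C(X, Y)} {b : Y} (e : fibre p b) : p (fibreVal e) = b := (Kify.val e).2

@[fun_prop]
lemma continuous_fibreVal {p : C(X, Y)} {b : Y} : Continuous (fibreVal : fibre p b → X) :=
  continuous_subtype_val.comp Kify.continuous_val

@[fun_prop]
lemma continuous_fibreMk {p : C(X, Y)} {b : Y} {T : Type u} [TopologicalSpace T] [IsKSpace T]
    {f : T → X} (hf : Continuous f) (h : ∀ t, p (f t) = b) :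
    Continuous fun t => (fibreMk (f t) (h t) : fibre p b) :=
  Kify.continuous_mk_comp (hf.subtype_mk h)

/-- The map induced on fibres by a map compatible with the projections. -/
def fibreMap {E B E' B' : KSpace.{u}} {p : C(E, B)} {p' : C(E', B')} {b : B} {b' : B'}
    (f : C(E, E')) (h : ∀ e, p e = b → p' (f e) = b') : C(fibre p b, fibre p' b') :=
  ⟨fun e => fibreMk (f (fibreVal e)) (h _ (fibre_cond e)), by fun_prop⟩

/-- The first inclusion into a disjoint union. -/
def inl (x : X) : X.sum Y := Sum.inl x

/-- The second inclusion into a disjoint union. -/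
def inr (y : Y) : X.sum Y := Sum.inr y

@[fun_prop]
protected lemma continuous_inl : Continuous (inl : X → X.sum Y) := _root_.continuous_inl

@[fun_prop]
protected lemma continuous_inr : Continuous (inr : Y → X.sum Y) := _root_.continuous_inr

@[elab_as_elim]
lemma sum_ind {p : X.sum Y → Prop} (hl : ∀ x, p (inl x)) (hr : ∀ y, p (inr y)) (z) : p z :=
  Sum.rec hl hr z

/-- Case distinction on a disjoint union. -/
def elim {T : Type*} (f : X → T) (g : Y → T) (z : X.sum Y) : T := Sum.elim f g z

@[simp] lemma elim_inl {T : Type*} (f : X → T) (g : Y → T) (x : X) :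
    elim f g (inl x : X.sum Y) = f x := rfl
@[simp] lemma elim_inr {T : Type*} (f : X → T) (g : Y → T) (y : Y) :
    elim f g (inr y : X.sum Y) = g y := rfl

lemma continuous_elim {T : Type*} [TopologicalSpace T] {f : X → T} {g : Y → T}
    (hf : Continuous f) (hg : Continuous g) : Continuous (elim f g : X.sum Y → T) :=
  hf.sumElim hg

/-- The point `(x, y)` of the product. -/
def pair (x : X) (y : Y) : X.prod Y := Kify.mk (x, y)

/-- The first projection. -/
def fst (p : X.prod Y) : X := (Kify.val p).1

/-- The second projection. -/
def snd (p : X.prod Y) : Y := (Kify.val p).2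

@[simp] lemma fst_pair (x : X) (y : Y) : fst (pair x y) = x := rfl
@[simp] lemma snd_pair (x : X) (y : Y) : snd (pair x y) = y := rfl
@[simp] lemma pair_fst_snd (p : X.prod Y) : pair (fst p) (snd p) = p := rfl

@[ext] lemma prod_ext {p q : X.prod Y} (h₁ : fst p = fst q) (h₂ : snd p = snd q) : p = q :=
  Prod.ext h₁ h₂

@[fun_prop]
protected lemma continuous_fst : Continuous (fst : X.prod Y → X) :=
  _root_.continuous_fst.comp Kify.continuous_val

@[fun_prop]
protected lemma continuous_snd : Continuous (snd : X.prod Y → Y) :=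
  _root_.continuous_snd.comp Kify.continuous_val

@[fun_prop]
lemma continuous_pair {T : Type u} [TopologicalSpace T] [IsKSpace T] {f : T → X} {g : T → Y}
    (hf : Continuous f) (hg : Continuous g) : Continuous fun t => pair (f t) (g t) :=
  Kify.continuous_mk_comp (hf.prodMk hg)

/-- The product of two continuous maps. -/
def prodMap {A B C D : KSpace.{u}} (f : C(A, C)) (g : C(B, D)) :
    C(A.prod B, C.prod D) := ⟨fun p => pair (f (fst p)) (g (snd p)), by fun_prop⟩

lemma continuous_prod_sum {T : Type u} [TopologicalSpace T] (φ : A.prod (X.sum Y) → T)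
    (hl : Continuous fun p : A.prod X => φ (pair (fst p) (inl (snd p))))
    (hr : Continuous fun p : A.prod Y => φ (pair (fst p) (inr (snd p)))) : Continuous φ := by
  refine Kify.continuous_of_sum (⟨Prod.snd, by fun_prop⟩ : C(A × (X ⊕ Y), X ⊕ Y)) φ ?_ ?_
  · intro K _ _ _ k a h
    refine (hl.comp (continuous_pair (X := A) (Y := X) (f := fun t => (k t).1) (g := a)
      (by fun_prop) a.2)).congr fun t => ?_
    exact congrArg (fun p => φ (Kify.mk p)) (Prod.ext rfl (h t).symm)
  · intro K _ _ _ k a h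
    refine (hr.comp (continuous_pair (X := A) (Y := Y) (f := fun t => (k t).1) (g := a)
      (by fun_prop) a.2)).congr fun t => ?_
    exact congrArg (fun p => φ (Kify.mk p)) (Prod.ext rfl (h t).symm)

end KSpace
end HGFT

namespace HGFT

/-! ### Finite graphs and h-graphs -/

/-- The characteristic map of a cell of the first summand, as a cell of a disjoint union. -/
def inlCell {Y Z E : Type*} [Inhabited E] (m : PartialEquiv E Y) : PartialEquiv E (Y ⊕ Z) where
  toFun e := Sum.inl (m e)
  invFun := Sum.elim m.symm fun _ => default
  source := m.source
  target := Sum.inl '' m.target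
  map_source' _ h := ⟨_, m.map_source h, rfl⟩
  map_target' := by rintro _ ⟨y, hy, rfl⟩; exact m.map_target hy
  left_inv' _ h := m.left_inv h
  right_inv' := by rintro _ ⟨y, hy, rfl⟩; exact congrArg Sum.inl (m.right_inv hy)

/-- The characteristic map of a cell of the second summand, as a cell of a disjoint union. -/
def inrCell {Y Z E : Type*} [Inhabited E] (m : PartialEquiv E Z) : PartialEquiv E (Y ⊕ Z) where
  toFun e := Sum.inr (m e)
  invFun := Sum.elim (fun _ => default) m.symm
  source := m.source
  target := Sum.inr '' m.target
  map_source' _ h := ⟨_, m.map_source h, rfl⟩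
  map_target' := by rintro _ ⟨y, hy, rfl⟩; exact m.map_target hy
  left_inv' _ h := m.left_inv h
  right_inv' := by rintro _ ⟨y, hy, rfl⟩; exact congrArg Sum.inr (m.right_inv hy)

/-- A finite graph: a (Hausdorff) finite CW complex of dimension at most one. -/
def IsFiniteGraph (Y : Type u) [TopologicalSpace Y] : Prop :=
  T2Space Y ∧ ∃ _ : CWComplex (Set.univ : Set Y),
    (∀ n, Finite (RelCWComplex.cell (Set.univ : Set Y) n)) ∧
      ∀ n, 2 ≤ n → IsEmpty (RelCWComplex.cell (Set.univ : Set Y) n)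

lemma IsFiniteGraph.sum {Y Z : Type u} [TopologicalSpace Y] [TopologicalSpace Z]
    (hY : IsFiniteGraph Y) (hZ : IsFiniteGraph Z) : IsFiniteGraph (Y ⊕ Z) := by
  obtain ⟨_, cY, fY, dY⟩ := hY
  obtain ⟨_, cZ, fZ, dZ⟩ := hZ
  refine ⟨inferInstance, CWComplex.mkFinite (Set.univ : Set (Y ⊕ Z))
    (fun n => RelCWComplex.cell (Set.univ : Set Y) n ⊕ RelCWComplex.cell (Set.univ : Set Z) n)
    (fun n => Sum.elim (fun i => inlCell (RelCWComplex.map n i))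
      (fun i => inrCell (RelCWComplex.map n i))) ?_ ?_ ?_ ?_ ?_ ?_ ?_ ?_, ?_, ?_⟩
  · filter_upwards [Filter.eventually_ge_atTop 2] with n hn
    have := dY n hn
    have := dZ n hn
    infer_instance
  · exact fun n => inferInstance
  · rintro n (i | i)
    exacts [RelCWComplex.source_eq n i, RelCWComplex.source_eq n i]
  · rintro n (i | i)
    exacts [continuous_inl.comp_continuousOn (RelCWComplex.continuousOn n i),
      continuous_inr.comp_continuousOn (RelCWComplex.continuousOn n i)]
  · rintro n (i | i)
    · rintro _ ⟨y, hy, rfl⟩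
      refine Filter.Tendsto.mono_left ?_ (IsEmbedding.inl.map_nhdsWithin_eq _ y).ge
      exact Filter.tendsto_map'_iff.2 (RelCWComplex.continuousOn_symm n i y hy)
    · rintro _ ⟨y, hy, rfl⟩
      refine Filter.Tendsto.mono_left ?_ (IsEmbedding.inr.map_nhdsWithin_eq _ y).ge
      exact Filter.tendsto_map'_iff.2 (RelCWComplex.continuousOn_symm n i y hy)
  · have h : ∀ (n : ℕ) (i : RelCWComplex.cell (Set.univ : Set Y) n) (m : ℕ)
        (j : RelCWComplex.cell (Set.univ : Set Z) m) (s t : Set _),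
        Disjoint ((fun e => Sum.inl (RelCWComplex.map n i e)) '' s)
          ((fun e => (Sum.inr (RelCWComplex.map m j e) : Y ⊕ Z)) '' t) := by
      intro n i m j s t
      rw [Set.disjoint_left]
      rintro _ ⟨a, -, rfl⟩ ⟨b, -, hb⟩
      exact Sum.inr_ne_inl hb
    rintro ⟨n, i | i⟩ - ⟨m, j | j⟩ - hne
    · have := RelCWComplex.pairwiseDisjoint' (C := (Set.univ : Set Y)) (Set.mem_univ ⟨n, i⟩)
        (Set.mem_univ ⟨m, j⟩) (fun e => hne (by cases e; rfl))
      have := (Set.disjoint_image_iff (Sum.inl_injective (β := Z))).2 this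
      rw [Set.image_image, Set.image_image] at this
      exact this
    · exact h n i m j _ _
    · exact (h m j n i _ _).symm
    · have := RelCWComplex.pairwiseDisjoint' (C := (Set.univ : Set Z)) (Set.mem_univ ⟨n, i⟩)
        (Set.mem_univ ⟨m, j⟩) (fun e => hne (by cases e; rfl))
      have := (Set.disjoint_image_iff (Sum.inr_injective (α := Y))).2 this
      rw [Set.image_image, Set.image_image] at this
      exact this
  · rintro n (i | i) x hx
    · obtain ⟨J, hJ⟩ := CWComplex.mapsTo' (C := (Set.univ : Set Y)) n i
      have := hJ hx
      simp only [Set.mem_iUnion] at this ⊢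
      obtain ⟨m, hm, j, -, y, hy, e⟩ := this
      exact ⟨m, hm, Sum.inl j, y, hy, congrArg Sum.inl e⟩
    · obtain ⟨J, hJ⟩ := CWComplex.mapsTo' (C := (Set.univ : Set Z)) n i
      have := hJ hx
      simp only [Set.mem_iUnion] at this ⊢
      obtain ⟨m, hm, j, -, y, hy, e⟩ := this
      exact ⟨m, hm, Sum.inr j, y, hy, congrArg Sum.inr e⟩
  · rw [Set.eq_univ_iff_forall]
    rintro (y | z)
    · have := (CWComplex.union' (C := (Set.univ : Set Y))).ge (Set.mem_univ y)
      simp only [Set.mem_iUnion] at this ⊢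
      obtain ⟨m, j, x, hx, e⟩ := this
      exact ⟨m, Sum.inl j, x, hx, congrArg Sum.inl e⟩
    · have := (CWComplex.union' (C := (Set.univ : Set Z))).ge (Set.mem_univ z)
      simp only [Set.mem_iUnion] at this ⊢
      obtain ⟨m, j, x, hx, e⟩ := this
      exact ⟨m, Sum.inr j, x, hx, congrArg Sum.inr e⟩
  · exact fun n => inferInstanceAs (Finite (_ ⊕ _))
  · intro n hn
    have := dY n hn
    have := dZ n hn
    exact inferInstanceAs (IsEmpty (_ ⊕ _))

/-- A continuous map is a homotopy equivalence. -/
def IsHomotopyEquiv {X Y : Type*} [TopologicalSpace X] [TopologicalSpace Y] (f : C(X, Y)) : Prop :=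
  ∃ g : C(Y, X), (g.comp f).Homotopic (ContinuousMap.id X) ∧
    (f.comp g).Homotopic (ContinuousMap.id Y)

lemma IsHomotopyEquiv.of_inv {X Y : Type*} [TopologicalSpace X] [TopologicalSpace Y] (f : C(X, Y))
    (g : C(Y, X)) (h₁ : ∀ x, g (f x) = x) (h₂ : ∀ y, f (g y) = y) : IsHomotopyEquiv f := by
  refine ⟨g, ?_, ?_⟩
  · rw [show g.comp f = ContinuousMap.id X from ContinuousMap.ext h₁]
  · rw [show f.comp g = ContinuousMap.id Y from ContinuousMap.ext h₂]

lemma IsHomotopyEquiv.comp {X Y Z : Type*} [TopologicalSpace X] [TopologicalSpace Y]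
    [TopologicalSpace Z] {g : C(Y, Z)} {f : C(X, Y)} (hg : IsHomotopyEquiv g)
    (hf : IsHomotopyEquiv f) : IsHomotopyEquiv (g.comp f) := by
  obtain ⟨f', h₁, h₂⟩ := hf
  obtain ⟨g', k₁, k₂⟩ := hg
  refine ⟨f'.comp g', ?_, ?_⟩
  · exact (((ContinuousMap.Homotopic.refl f').comp
      (k₁.comp (ContinuousMap.Homotopic.refl f)))).trans h₁
  · exact (((ContinuousMap.Homotopic.refl g).comp
      (h₂.comp (ContinuousMap.Homotopic.refl g')))).trans k₂

/-- The disjoint union of two continuous maps. -/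
def sumMap {X Y X' Y' : Type*} [TopologicalSpace X] [TopologicalSpace Y] [TopologicalSpace X']
    [TopologicalSpace Y'] (f : C(X, X')) (g : C(Y, Y')) : C(X ⊕ Y, X' ⊕ Y') :=
  ⟨Sum.map f g, f.2.sumMap g.2⟩

lemma homotopic_sumMap {X Y X' Y' : Type*} [TopologicalSpace X] [TopologicalSpace Y]
    [TopologicalSpace X'] [TopologicalSpace Y'] {f f' : C(X, X')} {g g' : C(Y, Y')}
    (hf : f.Homotopic f') (hg : g.Homotopic g') : (sumMap f g).Homotopic (sumMap f' g') := by
  obtain ⟨H⟩ := hf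
  obtain ⟨K⟩ := hg
  refine ⟨⟨⟨fun p => Sum.elim (fun x => Sum.inl (H (p.1, x))) (fun y => Sum.inr (K (p.1, y))) p.2,
    ?_⟩, ?_, ?_⟩⟩
  · rw [← (Homeomorph.prodSumDistrib (X := I) (Y := X) (Z := Y)).symm.comp_continuous_iff']
    rw [continuous_sum_dom]
    constructor
    · exact continuous_inl.comp H.continuous
    · exact continuous_inr.comp K.continuous
  · rintro (x | y)
    exacts [congrArg Sum.inl (H.map_zero_left x), congrArg Sum.inr (K.map_zero_left y)]
  · rintro (x | y)
    exacts [congrArg Sum.inl (H.map_one_left x), congrArg Sum.inr (K.map_one_left y)]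

lemma IsHomotopyEquiv.sumMap {X Y X' Y' : Type*} [TopologicalSpace X] [TopologicalSpace Y]
    [TopologicalSpace X'] [TopologicalSpace Y'] {f : C(X, X')} {g : C(Y, Y')}
    (hf : IsHomotopyEquiv f) (hg : IsHomotopyEquiv g) : IsHomotopyEquiv (sumMap f g) := by
  obtain ⟨f', h₁, h₂⟩ := hf
  obtain ⟨g', k₁, k₂⟩ := hg
  refine ⟨HGFT.sumMap f' g', ?_, ?_⟩
  · convert homotopic_sumMap h₁ k₁ using 1 <;> ext (x | y) <;> rfl
  · convert homotopic_sumMap h₂ k₂ using 1 <;> ext (x | y) <;> rfl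

/-- An h-graph: a space with the homotopy type of a finite graph. -/
def IsHGraph (X : Type u) [TopologicalSpace X] : Prop :=
  ∃ (Y : Type u) (_ : TopologicalSpace Y), IsFiniteGraph Y ∧ ∃ f : C(X, Y), IsHomotopyEquiv f

lemma IsHGraph.sum {X Y : Type u} [TopologicalSpace X] [TopologicalSpace Y] (hX : IsHGraph X)
    (hY : IsHGraph Y) : IsHGraph (X ⊕ Y) := by
  obtain ⟨X', _, h, f, hf⟩ := hX
  obtain ⟨Y', _, k, g, hg⟩ := hY
  exact ⟨X' ⊕ Y', inferInstance, h.sum k, sumMap f g, hf.sumMap hg⟩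

lemma isHGraph_of_isEmpty (X : Type u) [TopologicalSpace X] [IsEmpty X] : IsHGraph X := by
  refine ⟨X, inferInstance, ⟨⟨fun x => isEmptyElim x⟩, CWComplex.mkFinite Set.univ
    (fun _ => PEmpty) (fun _ i => i.elim) (Filter.Eventually.of_forall fun _ => inferInstance)
    (fun _ => inferInstance) (fun _ i => i.elim) (fun _ i => i.elim) (fun _ i => i.elim)
    (fun i => i.2.elim) (fun _ i => i.elim) (Set.eq_of_subset_of_subset (Set.subset_univ _)
      fun x => isEmptyElim x), fun _ => inferInstanceAs (Finite PEmpty),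
    fun _ _ => inferInstanceAs (IsEmpty PEmpty)⟩, ContinuousMap.id X,
    IsHomotopyEquiv.of_inv _ (ContinuousMap.id X) (fun _ => rfl) fun _ => rfl⟩

/-- A space with the homotopy type of a finite (discrete) set. -/
def IsHFinite (X : Type u) [TopologicalSpace X] : Prop :=
  ∃ (n : ℕ) (f : C(X, Fin n)), IsHomotopyEquiv f

/-- A map that is surjective on path components. -/
def IsPositive {X Y : Type*} [TopologicalSpace X] [TopologicalSpace Y] (f : X → Y) : Prop :=
  ∀ y, ∃ x, Joined (f x) y

section Squares

variable {A X B Y : Type*} [TopologicalSpace A] [TopologicalSpace X] [TopologicalSpace B]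
  [TopologicalSpace Y]

/-- The gluing relation of the double mapping cylinder. -/
inductive CylRel (f : A → X) (g : A → B) : X ⊕ (A × I) ⊕ B → X ⊕ (A × I) ⊕ B → Prop
  | zero (a : A) : CylRel f g (Sum.inr (Sum.inl (a, 0))) (Sum.inl (f a))
  | one (a : A) : CylRel f g (Sum.inr (Sum.inl (a, 1))) (Sum.inr (Sum.inr (g a)))

/-- The double mapping cylinder of `X ← A → B`. -/
abbrev DoubleCylinder (f : A → X) (g : A → B) : Type _ := Quot (CylRel f g)

/-- The map from the double mapping cylinder to the fourth corner of a commutative square. -/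
def cylinderMap (f : C(A, X)) (g : C(A, B)) (h : C(X, Y)) (k : C(B, Y))
    (comm : ∀ a, h (f a) = k (g a)) : C(DoubleCylinder f g, Y) where
  toFun := Quot.lift (Sum.elim h (Sum.elim (fun p => h (f p.1)) k)) (by
    rintro _ _ (a | a)
    exacts [rfl, comm a])
  continuous_toFun := continuous_quot_lift _ (by fun_prop)

/-- The square with sides `f : A → X`, `g : A → B`, `h : X → Y`, `k : B → Y` is a homotopy cofibre
square. -/
def IsHomotopyCofibreSquare (f : C(A, X)) (g : C(A, B)) (h : C(X, Y)) (k : C(B, Y)) : Prop :=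
  ∃ comm : ∀ a, h (f a) = k (g a), IsHomotopyEquiv (cylinderMap f g h k comm)

end Squares

/-- An h-embedding. -/
def IsHEmbedding {X Y : Type u} [TopologicalSpace X] [TopologicalSpace Y] (h : C(X, Y)) : Prop :=
  ∃ (A B : KSpace.{u}) (f : C(A, X)) (g : C(A, B)) (k : C(B, Y)),
    IsHFinite A ∧ IsHGraph B ∧ IsHomotopyCofibreSquare f g h k

/-! ### Spaces over a base -/

section Fibrewise

variable {E B X Y : KSpace.{u}}

/-- A Hurewicz fibration. -/
def IsHurewicz (p : C(E, B)) : Prop :=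
  ∀ (A : KSpace.{u}) (h : C(A × I, B)) (e : C(A, E)), (∀ a, p (e a) = h (a, 0)) →
    ∃ H : C(A × I, E), (∀ x, p (H x) = h x) ∧ ∀ a, H (a, 0) = e a

/-- A family of h-graphs: a Hurewicz fibration over a weak Hausdorff base, with h-graphs as
fibres. -/
structure IsHGraphFamily (p : C(E, B)) : Prop where
  weakHausdorff : IsWeakHausdorff B
  hurewicz : IsHurewicz p
  fibre : ∀ b, IsHGraph (KSpace.fibre p b)

/-- A closed fibrewise cofibration `i : X → Y` of spaces over `B`: a closed inclusion with the
homotopy extension property for fibrewise maps and homotopies. -/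
def IsClosedFibrewiseCofibration (p : C(X, B)) (q : C(Y, B)) (i : C(X, Y)) : Prop :=
  (∀ x, q (i x) = p x) ∧ Topology.IsClosedEmbedding i ∧
    ∀ (E : KSpace.{u}) (r : C(E, B)) (f : C(Y, E)) (h : C(X × I, E)), (∀ y, r (f y) = q y) →
      (∀ x t, r (h (x, t)) = p x) → (∀ x, h (x, 0) = f (i x)) →
      ∃ H : C(Y × I, E), (∀ y t, r (H (y, t)) = q y) ∧ (∀ y, H (y, 0) = f y) ∧
        ∀ x t, H (i x, t) = h (x, t)

/-- A good base space: a space that embeds as an open subset of a CW complex. -/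
def IsGoodBase (B : Type u) [TopologicalSpace B] : Prop :=
  ∃ (Y : Type u) (_ : TopologicalSpace Y) (_ : T2Space Y) (_ : CWComplex (Set.univ : Set Y))
    (f : B → Y), Topology.IsOpenEmbedding f

/-- The fibred space `p` admits basepoints: finitely many sections meet every path component of
every fibre. -/
def AdmitsBasepoints (p : C(E, B)) : Prop :=
  ∃ (n : ℕ) (s : Fin n → C(B, E)) (hs : ∀ i b, p (s i b) = b),
    ∀ b (e : KSpace.fibre p b), ∃ i, Joined (KSpace.fibreMk (s i b) (hs i b)) e

end Fibrewise

end HGFT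

namespace HGFT

open KSpace

/-! ### Families with degree shifts and the fibrewise opposite category -/

/-- A space over `B` together with a degree shift. -/
structure Fam (B : KSpace.{u}) : Type (u + 1) where
  total : KSpace.{u}
  proj : C(total, B)
  shift : B → ℤ

/-- A space over a base space, with a degree shift. -/
structure Obj : Type (u + 1) where
  base : KSpace.{u}
  fam : Fam base

/-- A space over a base with a degree shift, as an object. -/
abbrev Fam.obj {B : KSpace.{u}} (X : Fam B) : Obj.{u} := ⟨B, X⟩

/-- The total space. -/
abbrev Obj.total (X : Obj.{u}) : KSpace.{u} := X.fam.total

/-- The projection. -/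
abbrev Obj.proj (X : Obj.{u}) : C(X.total, X.base) := X.fam.proj

/-- The degree shift. -/
abbrev Obj.shift (X : Obj.{u}) : X.base → ℤ := X.fam.shift

/-- The pullback of a space over `C` along a map `B → C`. -/
def Pullback {B C E : KSpace.{u}} (f : C(B, C)) (p : C(E, C)) : KSpace.{u} :=
  ⟨Kify {z : B × E // f z.1 = p z.2}⟩

namespace Pullback

variable {B C E : KSpace.{u}} {f : C(B, C)} {p : C(E, C)}

/-- The point `(b, e)` of the pullback. -/
def mk (b : B) (e : E) (h : f b = p e) : Pullback f p := Kify.mk ⟨(b, e), h⟩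

/-- The first projection. -/
def fst (z : Pullback f p) : B := (Kify.val z).1.1

/-- The second projection. -/
def snd (z : Pullback f p) : E := (Kify.val z).1.2

@[simp] lemma fst_mk (b : B) (e : E) (h : f b = p e) : fst (mk b e h) = b := rfl
@[simp] lemma snd_mk (b : B) (e : E) (h : f b = p e) : snd (mk b e h) = e := rfl

lemma cond (z : Pullback f p) : f (fst z) = p (snd z) := (Kify.val z).2

@[fun_prop]
protected lemma continuous_fst : Continuous (fst : Pullback f p → B) :=
  continuous_fst.comp (continuous_subtype_val.comp Kify.continuous_val)

@[fun_prop]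
protected lemma continuous_snd : Continuous (snd : Pullback f p → E) :=
  continuous_snd.comp (continuous_subtype_val.comp Kify.continuous_val)

@[fun_prop]
lemma continuous_mk {T : Type u} [TopologicalSpace T] [IsKSpace T] {b : T → B} {e : T → E}
    (hb : Continuous b) (he : Continuous e) (h : ∀ t, f (b t) = p (e t)) :
    Continuous fun t => mk (b t) (e t) (h t) :=
  Kify.continuous_mk_comp ((hb.prodMk he).subtype_mk h)

lemma continuous_of_sum {U V : KSpace.{u}} {p : C(U.sum V, C)} {T : Type u} [TopologicalSpace T]
    (φ : Pullback f p → T)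
    (hl : ∀ (K : KSpace.{u}) (b : C(K, B)) (a : C(K, U)) (h : ∀ t, f (b t) = p (inl (a t))),
      Continuous fun t => φ (mk (b t) (inl (a t)) (h t)))
    (hr : ∀ (K : KSpace.{u}) (b : C(K, B)) (a : C(K, V)) (h : ∀ t, f (b t) = p (inr (a t))),
      Continuous fun t => φ (mk (b t) (inr (a t)) (h t))) : Continuous φ := by
  let s : C({z : B × (U.sum V) // f z.1 = p z.2}, U ⊕ V) :=
    ⟨fun z => z.1.2, continuous_snd.comp continuous_subtype_val⟩
  refine Kify.continuous_of_sum s φ (fun K _ _ _ k a h => ?_) (fun K _ _ _ k a h => ?_)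
  · have e : ∀ t, k t = ⟨((k t).1.1, inl (a t)), (k t).2.trans (congrArg p (h t))⟩ :=
      fun t => Subtype.ext (Prod.ext rfl (h t))
    exact (hl ⟨K⟩ ⟨fun t => (k t).1.1, by fun_prop⟩ a _).congr
      fun t => congrArg (fun z => φ (Kify.mk z)) (e t).symm
  · have e : ∀ t, k t = ⟨((k t).1.1, inr (a t)), (k t).2.trans (congrArg p (h t))⟩ :=
      fun t => Subtype.ext (Prod.ext rfl (h t))
    exact (hr ⟨K⟩ ⟨fun t => (k t).1.1, by fun_prop⟩ a _).congr
      fun t => congrArg (fun z => φ (Kify.mk z)) (e t).symm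

end Pullback

/-- A morphism of the fibrewise opposite category: a continuous map `base` and a map from the
pullback of the target to the source over the base of the source. A class of diagrams
`X ← U → Y` whose right hand map is cartesian has exactly one representative in which `U` is this
pullback. -/
structure FopHom (X Y : Obj.{u}) : Type u where
  base : C(X.base, Y.base)
  map : C(Pullback base Y.proj, X.total)
  proj_map : ∀ z, X.proj (map z) = Pullback.fst z

namespace FopHom

variable {X Y Z W : Obj.{u}}

lemma ext' {f g : FopHom X Y} (hb : ∀ b, f.base b = g.base b)
    (hm : ∀ b y h h', f.map (Pullback.mk b y h) = g.map (Pullback.mk b y h')) : f = g := by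
  cases f with
  | mk f m _ =>
    cases g with
    | mk g n _ =>
      obtain rfl : f = g := ContinuousMap.ext hb
      obtain rfl : m = n := ContinuousMap.ext fun z => hm _ _ (Pullback.cond z) (Pullback.cond z)
      rfl

/-- The identity. -/
def id (X : Obj.{u}) : FopHom X X where
  base := ContinuousMap.id _
  map := ⟨Pullback.snd, by fun_prop⟩
  proj_map z := (Pullback.cond z).symm

/-- The composite. -/
def comp (f : FopHom X Y) (g : FopHom Y Z) : FopHom X Z where
  base := g.base.comp f.base
  map := ⟨fun z => f.map (Pullback.mk (Pullback.fst z)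
      (g.map (Pullback.mk (f.base (Pullback.fst z)) (Pullback.snd z) (Pullback.cond z)))
      (g.proj_map (Pullback.mk _ _ (Pullback.cond z))).symm), by fun_prop⟩
  proj_map z := f.proj_map _

instance : Category Obj.{u} where
  Hom := FopHom
  id := id
  comp := comp
  id_comp _ := ext' (fun _ => rfl) fun _ _ _ _ => rfl
  comp_id _ := ext' (fun _ => rfl) fun _ _ _ _ => rfl
  assoc _ _ _ := ext' (fun _ => rfl) fun _ _ _ _ => rfl

/-- The morphism given by an invertible map of bases and a map of total spaces backwards. -/
def ofInv (g : C(X.base, Y.base)) (k : C(Y.base, X.base)) (h : ∀ b, k (g b) = b)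
    (t : C(Y.total, X.total)) (ht : ∀ y, X.proj (t y) = k (Y.proj y)) : X ⟶ Y where
  base := g
  map := ⟨fun z => t (Pullback.snd z), by fun_prop⟩
  proj_map z := (ht _).trans ((congrArg k (Pullback.cond z).symm).trans (h _))

end FopHom

/-! ### External disjoint union -/

lemma continuous_sum_prod {A X Y : KSpace.{u}} {T : Type u} [TopologicalSpace T]
    (φ : (X.sum Y).prod A → T)
    (hl : Continuous fun p : X.prod A => φ (pair (inl (fst p)) (snd p)))
    (hr : Continuous fun p : Y.prod A => φ (pair (inr (fst p)) (snd p))) : Continuous φ := by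
  have := continuous_prod_sum (A := A) (X := X) (Y := Y) (fun p => φ (pair (snd p) (fst p)))
    (hl.comp (continuous_pair KSpace.continuous_snd KSpace.continuous_fst))
    (hr.comp (continuous_pair KSpace.continuous_snd KSpace.continuous_fst))
  exact this.comp (continuous_pair KSpace.continuous_snd KSpace.continuous_fst)

/-- The external disjoint union of spaces over `B` and over `C`. -/
def Fam.tensor {B C : KSpace.{u}} (X : Fam B) (Y : Fam C) : Fam (B.prod C) where
  total := (X.total.prod C).sum (B.prod Y.total)
  proj := ⟨elim (fun q => pair (X.proj (fst q)) (snd q)) (fun q => pair (fst q) (Y.proj (snd q))),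
    continuous_elim (by fun_prop) (by fun_prop)⟩
  shift p := X.shift (fst p) + Y.shift (snd p)

/-- The empty space over `B`. -/
def emptyFam (B : KSpace.{u}) (m : B → ℤ) : Fam B where
  total := KSpace.empty
  proj := ⟨fun e => isEmptyElim e, by fun_prop⟩
  shift := m

namespace FopHom

variable {X Y Z X' Y' Z' : Obj.{u}}

/-- The underlying function of the external disjoint union of two morphisms. -/
def tensorFun (f : FopHom X X') (g : FopHom Y Y') (b : X.base.prod Y.base) :
    (w : (X'.fam.tensor Y'.fam).total) →
      prodMap f.base g.base b = (X'.fam.tensor Y'.fam).proj w → (X.fam.tensor Y.fam).total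
  | Sum.inl q, h => inl (pair (f.map (Pullback.mk (fst b) (fst q) (congrArg fst h))) (snd b))
  | Sum.inr q, h => inr (pair (fst b) (g.map (Pullback.mk (snd b) (snd q) (congrArg snd h))))

lemma continuous_tensorFun (f : FopHom X X') (g : FopHom Y Y') :
    Continuous fun z : Pullback (prodMap f.base g.base) (X'.fam.tensor Y'.fam).proj =>
      tensorFun f g (Pullback.fst z) (Pullback.snd z) (Pullback.cond z) := by
  refine Pullback.continuous_of_sum (U := X'.total.prod Y'.base) (V := X'.base.prod Y'.total)
    _ ?_ ?_
  · intro K b a h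
    exact KSpace.continuous_inl.comp (continuous_pair (f.map.2.comp (Pullback.continuous_mk
      (by fun_prop) (by fun_prop) fun t => congrArg fst (h t))) (by fun_prop))
  · intro K b a h
    exact KSpace.continuous_inr.comp (continuous_pair (by fun_prop) (g.map.2.comp
      (Pullback.continuous_mk (by fun_prop) (by fun_prop) fun t => congrArg snd (h t))))

lemma proj_tensorFun (f : FopHom X X') (g : FopHom Y Y') (b : X.base.prod Y.base) :
    ∀ (w) (h), (X.fam.tensor Y.fam).proj (tensorFun f g b w h) = b
  | Sum.inl _, _ => KSpace.prod_ext (f.proj_map _) rfl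
  | Sum.inr _, _ => KSpace.prod_ext rfl (g.proj_map _)

/-- The external disjoint union of two morphisms. -/
def tensor (f : FopHom X X') (g : FopHom Y Y') :
    FopHom (X.fam.tensor Y.fam).obj (X'.fam.tensor Y'.fam).obj where
  base := prodMap f.base g.base
  map := ⟨_, continuous_tensorFun f g⟩
  proj_map _ := proj_tensorFun f g _ _ _

end FopHom

/-- Reassociation of products. -/
def prodAssoc (B C D : KSpace.{u}) : C((B.prod C).prod D, B.prod (C.prod D)) :=
  ⟨fun p => pair (fst (fst p)) (pair (snd (fst p)) (snd p)), by fun_prop⟩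

/-- Reassociation of products, in the other direction. -/
def prodAssocInv (B C D : KSpace.{u}) : C(B.prod (C.prod D), (B.prod C).prod D) :=
  ⟨fun p => pair (pair (fst p) (fst (snd p))) (snd (snd p)), by fun_prop⟩

/-- Interchange of the factors of a product. -/
def prodSwap (B C : KSpace.{u}) : C(B.prod C, C.prod B) := ⟨fun p => pair (snd p) (fst p),
  by fun_prop⟩

section Structure

variable (X Y Z : Obj.{u})

/-- The first part of the associativity constraint, on total spaces. -/
def assocTotal : C((X.fam.tensor (Y.fam.tensor Z.fam)).total,
    ((X.fam.tensor Y.fam).tensor Z.fam).total) where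
  toFun := elim
    (fun q => inl (pair (inl (pair (fst q) (fst (snd q)))) (snd (snd q))))
    (fun q => elim (fun r => inl (pair (inr (pair (fst q) (fst r))) (snd r)))
      (fun r => inr (pair (pair (fst q) (fst r)) (snd r))) (snd q))
  continuous_toFun := continuous_elim (by fun_prop)
    (continuous_prod_sum (A := X.base) (X := Y.total.prod Z.base) (Y := Y.base.prod Z.total) _
      (KSpace.continuous_inl.comp (continuous_pair (KSpace.continuous_inr.comp
        (continuous_pair (by fun_prop) (by fun_prop))) (by fun_prop)))
      (KSpace.continuous_inr.comp (continuous_pair (by fun_prop) (by fun_prop))))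

/-- The inverse of `assocTotal`. -/
def assocTotalInv : C(((X.fam.tensor Y.fam).tensor Z.fam).total,
    (X.fam.tensor (Y.fam.tensor Z.fam)).total) where
  toFun := elim
    (fun q => elim (fun r => inl (pair (fst r) (pair (snd r) (snd q))))
      (fun r => inr (pair (fst r) (inl (pair (snd r) (snd q))))) (fst q))
    (fun q => inr (pair (fst (fst q)) (inr (pair (snd (fst q)) (snd q)))))
  continuous_toFun := continuous_elim
    (continuous_sum_prod (A := Z.base) (X := X.total.prod Y.base) (Y := X.base.prod Y.total) _
      (KSpace.continuous_inl.comp (continuous_pair (by fun_prop) (by fun_prop)))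
      (KSpace.continuous_inr.comp (continuous_pair (by fun_prop) (KSpace.continuous_inl.comp
        (continuous_pair (by fun_prop) (by fun_prop)))))) (by fun_prop)

/-- The symmetry, on total spaces. -/
def braidTotal : C((Y.fam.tensor X.fam).total, (X.fam.tensor Y.fam).total) where
  toFun := elim (fun q => inr (pair (snd q) (fst q))) (fun q => inl (pair (snd q) (fst q)))
  continuous_toFun := continuous_elim (by fun_prop) (by fun_prop)

/-- The unit object: the empty space over a point. -/
def unitObj : Obj.{u} := (emptyFam KSpace.pt fun _ => 0).obj

/-- The associativity constraint. -/
def associatorIso : ((X.fam.tensor Y.fam).tensor Z.fam).obj ≅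
    (X.fam.tensor (Y.fam.tensor Z.fam)).obj where
  hom := FopHom.ofInv (prodAssoc _ _ _) (prodAssocInv _ _ _) (fun _ => rfl) (assocTotal X Y Z)
    (by rintro (q | ⟨b, q | q⟩) <;> rfl)
  inv := FopHom.ofInv (prodAssocInv _ _ _) (prodAssoc _ _ _) (fun _ => rfl) (assocTotalInv X Y Z)
    (by rintro (⟨q | q, b⟩ | q) <;> rfl)
  hom_inv_id := FopHom.ext' (fun _ => rfl) (by rintro _ (⟨q | q, b⟩ | q) _ _ <;> rfl)
  inv_hom_id := FopHom.ext' (fun _ => rfl) (by rintro _ (q | ⟨b, q | q⟩) _ _ <;> rfl)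

/-- The symmetry constraint. -/
def braidIso : (X.fam.tensor Y.fam).obj ≅ (Y.fam.tensor X.fam).obj where
  hom := FopHom.ofInv (prodSwap _ _) (prodSwap _ _) (fun _ => rfl) (braidTotal X Y)
    (by rintro (q | q) <;> rfl)
  inv := FopHom.ofInv (prodSwap _ _) (prodSwap _ _) (fun _ => rfl) (braidTotal Y X)
    (by rintro (q | q) <;> rfl)
  hom_inv_id := FopHom.ext' (fun _ => rfl) (by rintro _ (q | q) _ _ <;> rfl)
  inv_hom_id := FopHom.ext' (fun _ => rfl) (by rintro _ (q | q) _ _ <;> rfl)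

/-- The left unit constraint. -/
def leftUnitorIso : (unitObj.fam.tensor X.fam).obj ≅ X where
  hom := FopHom.ofInv ⟨snd, by fun_prop⟩ ⟨fun b => pair star b, by fun_prop⟩
    (fun _ => rfl) ⟨fun x => inr (pair star x), by fun_prop⟩ fun _ => rfl
  inv := FopHom.ofInv ⟨fun b => pair star b, by fun_prop⟩ ⟨snd, by fun_prop⟩ (fun _ => rfl)
    ⟨elim (fun q => isEmptyElim (α := KSpace.empty) (fst q)) snd,
      continuous_elim (continuous_iff_continuousAt.2 fun q =>
        isEmptyElim (α := KSpace.empty) (fst q)) (by fun_prop)⟩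
    (by rintro (⟨⟨⟩, _⟩ | q); rfl)
  hom_inv_id := FopHom.ext' (fun _ => rfl) (by rintro _ (⟨⟨⟩, _⟩ | q) _ _; rfl)
  inv_hom_id := FopHom.ext' (fun _ => rfl) (by rintro _ _ _ _; rfl)

/-- The right unit constraint. -/
def rightUnitorIso : (X.fam.tensor unitObj.fam).obj ≅ X where
  hom := FopHom.ofInv ⟨fst, by fun_prop⟩ ⟨fun b => pair b star, by fun_prop⟩
    (fun _ => rfl) ⟨fun x => inl (pair x star), by fun_prop⟩ fun _ => rfl
  inv := FopHom.ofInv ⟨fun b => pair b star, by fun_prop⟩ ⟨fst, by fun_prop⟩ (fun _ => rfl)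
    ⟨elim fst (fun q => isEmptyElim (α := KSpace.empty) (snd q)),
      continuous_elim (by fun_prop) (continuous_iff_continuousAt.2 fun q =>
        isEmptyElim (α := KSpace.empty) (snd q))⟩
    (by rintro (q | ⟨_, ⟨⟩⟩); rfl)
  hom_inv_id := FopHom.ext' (fun _ => rfl) (by rintro _ (q | ⟨_, ⟨⟩⟩) _ _; rfl)
  inv_hom_id := FopHom.ext' (fun _ => rfl) (by rintro _ _ _ _; rfl)

end Structure
end HGFT

namespace HGFT

section PathSum

variable {A B A' B' M : Type*} [AddCommGroup M]

/-- The sum of the values of `g` over the lattice paths from the lower left to the upper right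
corner of the grid `xs × ys`, a path being recorded as the list of the points it visits. -/
def pathSum (g : List (A × B) → M) : List A → List B → M
  | [], _ => 0
  | _ :: _, [] => 0
  | x :: xs, y :: ys =>
    pathSum (fun l => g ((x, y) :: l)) xs (y :: ys) + pathSum (fun l => g ((x, y) :: l)) (x :: xs) ys
      + if xs.isEmpty && ys.isEmpty then g [(x, y)] else 0
termination_by xs ys => xs.length + ys.length

/-- The sum of the values of `g` over the lists obtained from a list by deleting one entry. -/
def deleteSum (g : List A → M) : List A → M
  | [] => 0
  | a :: l => g l + deleteSum (fun k => g (a :: k)) l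

lemma deleteSum_add (g h : List A → M) (l : List A) :
    deleteSum (fun k => g k + h k) l = deleteSum g l + deleteSum h l := by
  induction l generalizing g h with
  | nil => simp [deleteSum]
  | cons a l ih => simp only [deleteSum, ih]; abel

lemma deleteSum_zero (l : List A) : deleteSum (fun _ => (0 : M)) l = 0 := by
  induction l with
  | nil => rfl
  | cons a l ih => simp [deleteSum, ih]

lemma deleteSum_map (f : A → A') (g : List A' → M) (l : List A) :
    deleteSum g (l.map f) = deleteSum (fun k => g (k.map f)) l := by
  induction l generalizing g with
  | nil => rfl
  | cons a l ih => simp [deleteSum, ih]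

lemma deleteSum_finRange (n : ℕ) (g : List (Fin (n + 1)) → M) :
    deleteSum g (List.finRange (n + 1)) =
      ∑ i : Fin (n + 1), g ((List.finRange n).map (Fin.succAbove i)) := by
  induction n with
  | zero => simp [deleteSum, List.finRange_succ]
  | succ n ih =>
    rw [List.finRange_succ, deleteSum, deleteSum_map, ih, Fin.sum_univ_succ (n := n + 1)]
    refine congrArg₂ (fun a b : M => a + b) ?_ (Finset.sum_congr rfl fun i _ => ?_)
    · rw [Fin.succAbove_zero]
    · rw [List.finRange_succ]
      simp [Function.comp_def]

@[simp] lemma pathSum_nil_left (g : List (A × B) → M) (ys : List B) : pathSum g [] ys = 0 := by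
  rw [pathSum]

@[simp] lemma pathSum_nil_right (g : List (A × B) → M) (xs : List A) : pathSum g xs [] = 0 := by
  cases xs <;> rw [pathSum]

lemma pathSum_add (g h : List (A × B) → M) (xs : List A) (ys : List B) :
    pathSum (fun l => g l + h l) xs ys = pathSum g xs ys + pathSum h xs ys := by
  induction xs generalizing ys g h with
  | nil => simp
  | cons x xs ihx =>
    induction ys generalizing g h with
    | nil => simp
    | cons y ys ihy =>
      simp only [pathSum, ihx, ihy]
      split_ifs <;> abel

lemma pathSum_map (f : A → A') (f' : B → B') (g : List (A' × B') → M) (xs : List A) (ys : List B) :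
    pathSum g (xs.map f) (ys.map f') =
      pathSum (fun l => g (l.map (Prod.map f f'))) xs ys := by
  induction xs generalizing ys g with
  | nil => simp
  | cons x xs ihx =>
    induction ys generalizing g with
    | nil => simp
    | cons y ys ihy =>
      have h₁ := ihx (fun l => g ((f x, f' y) :: l)) (y :: ys)
      have h₂ := ihy (fun l => g ((f x, f' y) :: l))
      simp only [List.map_cons] at h₁ h₂ ⊢
      simp only [pathSum, h₁, h₂]
      simp

lemma pathSum_congr [PartialOrder A] [PartialOrder B] (g h : List (A × B) → M) (xs : List A)
    (ys : List B) (hx : xs.Pairwise (· ≤ ·)) (hy : ys.Pairwise (· ≤ ·))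
    (H : ∀ l : List (A × B), l.Pairwise (· ≤ ·) → (∀ z ∈ l, z.1 ∈ xs ∧ z.2 ∈ ys) → g l = h l) :
    pathSum g xs ys = pathSum h xs ys := by
  induction xs generalizing ys g h with
  | nil => simp
  | cons x xs ihx =>
    induction ys generalizing g h with
    | nil => simp
    | cons y ys ihy =>
      have hx' := List.pairwise_cons.1 hx
      have hy' := List.pairwise_cons.1 hy
      have key : ∀ l : List (A × B), l.Pairwise (· ≤ ·) →
          (∀ z ∈ l, z.1 ∈ x :: xs ∧ z.2 ∈ y :: ys) → g ((x, y) :: l) = h ((x, y) :: l) := by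
        intro l hl hm
        refine H _ (List.pairwise_cons.2 ⟨fun z hz => ?_, hl⟩) fun z hz => ?_
        · refine ⟨?_, ?_⟩
          · rcases List.mem_cons.1 (hm z hz).1 with e | e
            exacts [e.ge, hx'.1 _ e]
          · rcases List.mem_cons.1 (hm z hz).2 with e | e
            exacts [e.ge, hy'.1 _ e]
        · rcases List.mem_cons.1 hz with e | e
          · subst e
            simp
          · exact hm z e
      rw [pathSum, pathSum]
      congr 1
      · congr 1
        · refine ihx _ _ (y :: ys) hx'.2 hy fun l hl hm => key l hl fun z hz => ?_
          exact ⟨List.mem_cons_of_mem _ (hm z hz).1, (hm z hz).2⟩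
        · refine ihy _ _ hy'.2 fun l hl hm => key l hl fun z hz => ?_
          exact ⟨(hm z hz).1, List.mem_cons_of_mem _ (hm z hz).2⟩
      · rw [key [] List.Pairwise.nil (by simp)]

/-- The boundary formula for lattice paths, in characteristic two. -/
lemma pathSum_deleteSum (h2 : ∀ m : M, m + m = 0) (g : List (A × B) → M) (xs : List A)
    (ys : List B) : pathSum (deleteSum g) xs ys =
      deleteSum (fun k => pathSum g k ys) xs + deleteSum (fun k => pathSum g xs k) ys +
        if xs.length = 1 ∧ ys.length = 1 then g [] else 0 := by
  induction xs generalizing ys g with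
  | nil => simp [deleteSum, deleteSum_zero]
  | cons x xs ihx =>
    induction ys generalizing g with
    | nil => simp [deleteSum, deleteSum_zero]
    | cons y ys ihy =>
      have d1 : ∀ (k : List A) (c : M), deleteSum (fun a => if a.isEmpty && ys.isEmpty then c else 0)
          k = if k.length = 1 ∧ ys.isEmpty then c else 0 := by
        rintro (_ | ⟨a, _ | ⟨b, k⟩⟩) c <;> simp [deleteSum, deleteSum_zero]
      have d2 : ∀ (k : List B) (c : M), deleteSum (fun a => if xs.isEmpty && a.isEmpty then c else 0)
          k = if xs.isEmpty ∧ k.length = 1 then c else 0 := by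
        rintro (_ | ⟨a, _ | ⟨b, k⟩⟩) c <;> simp [deleteSum, deleteSum_zero]
      have i1 := ihx (fun l => g ((x, y) :: l)) (y :: ys)
      have i2 := ihy (fun l => g ((x, y) :: l))
      have c := h2 (pathSum (fun l => g ((x, y) :: l)) xs ys)
      have c1 : (if (xs.isEmpty && ys.isEmpty) = true then deleteSum g [(x, y)] else 0) =
          if (x :: xs).length = 1 ∧ (y :: ys).length = 1 then g [] else 0 := by
        simp [deleteSum]
      have c2 : (if xs.length = 1 ∧ (y :: ys).length = 1 then g [(x, y)] else 0) =
          if xs.length = 1 ∧ ys.isEmpty then g [(x, y)] else 0 := by simp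
      have c3 : (if (x :: xs).length = 1 ∧ ys.length = 1 then g [(x, y)] else 0) =
          if xs.isEmpty ∧ ys.length = 1 then g [(x, y)] else 0 := by simp
      simp only [deleteSum] at i1 i2
      rw [c2] at i1
      rw [c3] at i2
      rw [pathSum, c1]
      simp only [deleteSum, pathSum_add, i1, i2]
      simp only [pathSum, deleteSum_add, d1, d2]
      rw [← sub_eq_zero]
      abel_nf
      rw [two_smul]
      exact c

end PathSum
end HGFT

namespace HGFT

open Simplicial Opposite

section Chains

variable (F : Type u) [Field F]

/-- The simplicial chains of a simplicial set. -/
noncomputable abbrev Chains (X : SSet.{u}) : ChainComplex (ModuleCat.{u} F) ℕ :=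
  X.chainComplex (ModuleCat.of F F)

variable {F} {X Y T : SSet.{u}}

/-- The basis element given by a simplex. -/
noncomputable def basisChain {n : ℕ} (x : X _⦋n⦌) : (Chains F X).X n :=
  (X.ιChainComplex (R := ModuleCat.of F F) x).hom (1 : F)

/-- The linear map on chains with prescribed values on simplices. -/
noncomputable def chainDesc {n : ℕ} {M : Type u} [AddCommGroup M] [Module F M]
    (f : X _⦋n⦌ → M) : (Chains F X).X n →ₗ[F] M :=
  (Limits.Cofan.IsColimit.desc (X.isColimitChainComplexXCofan (ModuleCat.of F F) n)
    (A := ModuleCat.of F M) fun x => ModuleCat.ofHom (LinearMap.toSpanSingleton F M (f x))).hom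

@[simp] lemma chainDesc_basisChain {n : ℕ} {M : Type u} [AddCommGroup M] [Module F M]
    (f : X _⦋n⦌ → M) (x : X _⦋n⦌) : chainDesc (F := F) f (basisChain x) = f x := by
  have := Limits.Cofan.IsColimit.fac (X.isColimitChainComplexXCofan (ModuleCat.of F F) n)
    (A := ModuleCat.of F M) (fun x => ModuleCat.ofHom (LinearMap.toSpanSingleton F M (f x))) x
  have := congrArg (fun g => g.hom (1 : F)) this
  exact this.trans (one_smul F (f x))

lemma chain_ext {n : ℕ} {M : Type u} [AddCommGroup M] [Module F M]
    {f g : (Chains F X).X n →ₗ[F] M} (h : ∀ x : X _⦋n⦌, f (basisChain x) = g (basisChain x)) :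
    f = g := by
  have : ModuleCat.ofHom f = ModuleCat.ofHom g := by
    refine SSet.chainComplex_hom_ext fun x => ?_
    ext
    exact h x
  exact congrArg ModuleCat.Hom.hom this

lemma add_self_chain [CharP F 2] {M : Type*} [AddCommGroup M] [Module F M] (m : M) : m + m = 0 := by
  rw [← two_smul F m, CharTwo.two_eq_zero, zero_smul]

lemma d_basisChain [CharP F 2] {n : ℕ} (x : X _⦋n + 1⦌) :
    ((Chains F X).d (n + 1) n).hom (basisChain x) = ∑ i : Fin (n + 2), basisChain (X.δ i x) := by
  have := congrArg (fun g => g.hom (1 : F)) (X.ιChainComplex_d (R := ModuleCat.of F F) x)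
  simp only [ModuleCat.hom_comp, LinearMap.comp_apply] at this
  refine this.trans ?_
  rw [ModuleCat.hom_sum, LinearMap.sum_apply]
  refine Finset.sum_congr rfl fun i _ => ?_
  rcases Nat.even_or_odd i.1 with h | h
  · rw [h.neg_one_pow, one_smul]
    rfl
  · rw [h.neg_one_pow, neg_smul, one_smul]
    exact neg_eq_of_add_eq_zero_left (add_self_chain (F := F) _)

section Cross

variable (μ : ∀ n : SimplexCategoryᵒᵖ, X.obj n → Y.obj n → T.obj n) {p q : ℕ}

/-- The simplex of `T` obtained by pairing the simplices along a monotone map to the grid. -/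
def pathSimplex (x : X _⦋p⦌) (y : Y _⦋q⦌) {n : ℕ} (a : Fin (n + 1) →o Fin (p + 1) × Fin (q + 1)) :
    T _⦋n⦌ :=
  μ _ (X.map (SimplexCategory.mkHom (OrderHom.fst.comp a)).op x)
    (Y.map (SimplexCategory.mkHom (OrderHom.snd.comp a)).op y)

open Classical in
/-- The chain given by a lattice path of length `n`. -/
noncomputable def pathChain (x : X _⦋p⦌) (y : Y _⦋q⦌) (n : ℕ)
    (l : List (Fin (p + 1) × Fin (q + 1))) : (Chains F T).X n :=
  if h : ∃ a : Fin (n + 1) →o Fin (p + 1) × Fin (q + 1), l = List.ofFn a then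
    basisChain (pathSimplex μ x y h.choose)
  else 0

lemma pathChain_ofFn (x : X _⦋p⦌) (y : Y _⦋q⦌) (n : ℕ)
    (a : Fin (n + 1) →o Fin (p + 1) × Fin (q + 1)) :
    pathChain (F := F) μ x y n (List.ofFn a) = basisChain (pathSimplex μ x y a) := by
  have h : ∃ b : Fin (n + 1) →o Fin (p + 1) × Fin (q + 1), List.ofFn a = List.ofFn b := ⟨a, rfl⟩
  rw [pathChain, dif_pos h]
  have : h.choose = a := DFunLike.coe_injective (List.ofFn_injective h.choose_spec).symm
  rw [this]

lemma pathChain_of_length (x : X _⦋p⦌) (y : Y _⦋q⦌) (n : ℕ)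
    (l : List (Fin (p + 1) × Fin (q + 1))) (h : l.length ≠ n + 1) :
    pathChain (F := F) μ x y n l = 0 := by
  rw [pathChain, dif_neg]
  rintro ⟨a, rfl⟩
  exact h (by simp)

lemma exists_ofFn {A : Type*} [PartialOrder A] (l : List A) (hl : l.Pairwise (· ≤ ·)) {n : ℕ}
    (h : l.length = n) : ∃ a : Fin n →o A, l = List.ofFn a := by
  subst h
  refine ⟨⟨l.get, fun i j hij => ?_⟩, (List.ofFn_get l).symm⟩
  rcases hij.eq_or_lt with e | e
  · rw [e]
  · exact List.pairwise_iff_get.1 hl i j e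

lemma deleteSum_eq_zero {A M : Type*} [AddCommGroup M] (g : List A → M) (l : List A)
    (h : ∀ k, k.length + 1 = l.length → g k = 0) : deleteSum g l = 0 := by
  induction l generalizing g with
  | nil => rfl
  | cons a l ih =>
    rw [deleteSum, h l (by simp), ih _ fun k hk => h _ (by simp [hk]), add_zero]

lemma map_pathSum {A B M N : Type*} [AddCommGroup M] [AddCommGroup N] (φ : M →+ N)
    (g : List (A × B) → M) (xs : List A) (ys : List B) :
    φ (pathSum g xs ys) = pathSum (fun l => φ (g l)) xs ys := by
  induction xs generalizing ys g with
  | nil => simp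
  | cons x xs ihx =>
    induction ys generalizing g with
    | nil => simp
    | cons y ys ihy =>
      simp only [pathSum, map_add, ihx, ihy]
      split_ifs <;> simp

/-- The shuffle product of two simplices, in degree `n` (zero unless `n = p + q`). -/
noncomputable def shuffle (x : X _⦋p⦌) (y : Y _⦋q⦌) (n : ℕ) : (Chains F T).X n :=
  pathSum (pathChain μ x y n) (List.finRange (p + 1)) (List.finRange (q + 1))

lemma d_pathChain [CharP F 2] (x : X _⦋p⦌) (y : Y _⦋q⦌) (n : ℕ) (l : List (Fin (p + 1) × Fin (q + 1)))
    (hμ : ∀ {m n : SimplexCategoryᵒᵖ} (f : m ⟶ n) (x : X.obj m) (y : Y.obj m),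
      T.map f (μ m x y) = μ n (X.map f x) (Y.map f y)) (hl : l.Pairwise (· ≤ ·)) :
    ((Chains F T).d (n + 1) n).hom (pathChain μ x y (n + 1) l) =
      deleteSum (pathChain μ x y n) l := by
  by_cases h : l.length = n + 1 + 1
  · obtain ⟨a, rfl⟩ := exists_ofFn l hl h
    rw [pathChain_ofFn, d_basisChain, List.ofFn_eq_map, deleteSum_map, deleteSum_finRange]
    refine Finset.sum_congr rfl fun i _ => ?_
    have : ((List.finRange (n + 1)).map (Fin.succAbove i)).map a =
        List.ofFn (a.comp (Fin.succAboveOrderEmb i).toOrderHom) := by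
      rw [List.map_map, List.ofFn_eq_map]
      rfl
    rw [this, pathChain_ofFn]
    congr 1
    refine (hμ _ _ _).trans ?_
    simp only [pathSimplex]
    congr 1
    · rw [← Functor.map_comp_apply]
      rfl
    · rw [← Functor.map_comp_apply]
      rfl
  · rw [pathChain_of_length μ x y _ l h, map_zero, deleteSum_eq_zero]
    intro k hk
    exact pathChain_of_length μ x y n k (by omega)

lemma pathChain_δ_left (x : X _⦋p + 1⦌) (y : Y _⦋q⦌) (n : ℕ) (i : Fin (p + 2))
    (l : List (Fin (p + 1) × Fin (q + 1))) (hl : l.Pairwise (· ≤ ·)) :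
    pathChain (F := F) μ x y n (l.map (Prod.map (Fin.succAbove i) _root_.id)) =
      pathChain μ (X.δ i x) y n l := by
  by_cases h : l.length = n + 1
  · obtain ⟨a, rfl⟩ := exists_ofFn l hl h
    have : (List.ofFn a).map (Prod.map (Fin.succAbove i) _root_.id) =
        List.ofFn (((Fin.succAboveOrderEmb i).toOrderHom.prodMap OrderHom.id).comp a) := by
      rw [List.map_ofFn]
      rfl
    rw [this, pathChain_ofFn, pathChain_ofFn]
    congr 1
    simp only [pathSimplex]
    congr 1
    exact Functor.map_comp_apply X (SimplexCategory.δ i).op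
      (SimplexCategory.mkHom (OrderHom.fst.comp a)).op x
  · rw [pathChain_of_length μ _ y _ l h, pathChain_of_length μ _ y _ _ (by simpa using h)]

lemma pathChain_δ_right (x : X _⦋p⦌) (y : Y _⦋q + 1⦌) (n : ℕ) (i : Fin (q + 2))
    (l : List (Fin (p + 1) × Fin (q + 1))) (hl : l.Pairwise (· ≤ ·)) :
    pathChain (F := F) μ x y n (l.map (Prod.map _root_.id (Fin.succAbove i))) =
      pathChain μ x (Y.δ i y) n l := by
  by_cases h : l.length = n + 1
  · obtain ⟨a, rfl⟩ := exists_ofFn l hl h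
    have : (List.ofFn a).map (Prod.map _root_.id (Fin.succAbove i)) =
        List.ofFn ((OrderHom.id.prodMap (Fin.succAboveOrderEmb i).toOrderHom).comp a) := by
      rw [List.map_ofFn]
      rfl
    rw [this, pathChain_ofFn, pathChain_ofFn]
    congr 1
    simp only [pathSimplex]
    congr 1
    exact Functor.map_comp_apply Y (SimplexCategory.δ i).op
      (SimplexCategory.mkHom (OrderHom.snd.comp a)).op y
  · rw [pathChain_of_length μ x _ _ l h, pathChain_of_length μ x _ _ _ (by simpa using h)]

lemma pairwise_finRange (n : ℕ) : (List.finRange n).Pairwise (· ≤ ·) :=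
  (List.pairwise_lt_finRange n).imp le_of_lt

lemma deleteSum_shuffle_left (x : X _⦋p + 1⦌) (y : Y _⦋q⦌) (n : ℕ) :
    deleteSum (fun k => pathSum (pathChain (F := F) μ x y n) k (List.finRange (q + 1)))
      (List.finRange (p + 2)) = ∑ i : Fin (p + 2), shuffle μ (X.δ i x) y n := by
  rw [deleteSum_finRange]
  refine Finset.sum_congr rfl fun i _ => ?_
  have := pathSum_map (Fin.succAbove i) (_root_.id : Fin (q + 1) → Fin (q + 1))
    (pathChain (F := F) μ x y n) (List.finRange (p + 1)) (List.finRange (q + 1))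
  rw [List.map_id] at this
  rw [this]
  exact pathSum_congr _ _ _ _ (pairwise_finRange _) (pairwise_finRange _)
    fun l hl _ => pathChain_δ_left μ x y n i l hl

lemma deleteSum_shuffle_right (x : X _⦋p⦌) (y : Y _⦋q + 1⦌) (n : ℕ) :
    deleteSum (fun k => pathSum (pathChain (F := F) μ x y n) (List.finRange (p + 1)) k)
      (List.finRange (q + 2)) = ∑ i : Fin (q + 2), shuffle μ x (Y.δ i y) n := by
  rw [deleteSum_finRange]
  refine Finset.sum_congr rfl fun i _ => ?_
  have := pathSum_map (_root_.id : Fin (p + 1) → Fin (p + 1)) (Fin.succAbove i)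
    (pathChain (F := F) μ x y n) (List.finRange (p + 1)) (List.finRange (q + 1))
  rw [List.map_id] at this
  rw [this]
  exact pathSum_congr _ _ _ _ (pairwise_finRange _) (pairwise_finRange _)
    fun l hl _ => pathChain_δ_right μ x y n i l hl

/-- The shuffle product of chains, as a bilinear map. -/
noncomputable def chainCross (p q n : ℕ) :
    (Chains F X).X p →ₗ[F] (Chains F Y).X q →ₗ[F] (Chains F T).X n :=
  chainDesc fun x => chainDesc fun y => shuffle μ x y n

lemma d_chainCross [CharP F 2] (hμ : ∀ {m n : SimplexCategoryᵒᵖ} (f : m ⟶ n) (x : X.obj m) (y : Y.obj m),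
      T.map f (μ m x y) = μ n (X.map f x) (Y.map f y)) (p q n : ℕ) (a : (Chains F X).X p)
    (b : (Chains F Y).X q) : ((Chains F T).d (n + 1) n).hom (chainCross μ p q (n + 1) a b) =
      chainCross μ (p - 1) q n (((Chains F X).d p (p - 1)).hom a) b +
        chainCross μ p (q - 1) n a (((Chains F Y).d q (q - 1)).hom b) := by
  have : (chainCross μ p q (n + 1)).compr₂ ((Chains F T).d (n + 1) n).hom =
      (chainCross μ (p - 1) q n).comp ((Chains F X).d p (p - 1)).hom +
        (chainCross μ p (q - 1) n).compl₂ ((Chains F Y).d q (q - 1)).hom := by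
    refine chain_ext fun x => chain_ext fun y => ?_
    have h1 : ((Chains F T).d (n + 1) n).hom (shuffle μ x y (n + 1)) =
        deleteSum (fun k => pathSum (pathChain μ x y n) k (List.finRange (q + 1)))
          (List.finRange (p + 1)) +
        deleteSum (fun k => pathSum (pathChain μ x y n) (List.finRange (p + 1)) k)
          (List.finRange (q + 1)) := by
      have e := map_pathSum ((Chains F T).d (n + 1) n).hom.toAddMonoidHom
        (pathChain μ x y (n + 1)) (List.finRange (p + 1)) (List.finRange (q + 1))
      refine e.trans ((pathSum_congr _ _ _ _ (pairwise_finRange _) (pairwise_finRange _)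
        fun l hl _ => d_pathChain μ x y n l hμ hl).trans ?_)
      rw [pathSum_deleteSum (add_self_chain (F := F))]
      have z : pathChain (F := F) μ x y n [] = 0 := pathChain_of_length μ x y n _ (by simp)
      rw [z, ite_self, add_zero]
    have h2 : deleteSum (fun k => pathSum (pathChain (F := F) μ x y n) k (List.finRange (q + 1)))
          (List.finRange (p + 1)) =
        chainCross μ (p - 1) q n (((Chains F X).d p (p - 1)).hom (basisChain x))
          (basisChain y) := by
      cases p with
      | zero =>
        rw [(Chains F X).shape 0 (0 - 1) (by simp)]
        simp [List.finRange_succ, deleteSum]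
      | succ p =>
        rw [deleteSum_shuffle_left]
        refine Eq.trans ?_ (congrArg (fun c => chainCross μ p q n c (basisChain y))
          (d_basisChain x)).symm
        simp [chainCross]
    have h3 : deleteSum (fun k => pathSum (pathChain (F := F) μ x y n) (List.finRange (p + 1)) k)
          (List.finRange (q + 1)) =
        chainCross μ p (q - 1) n (basisChain x)
          (((Chains F Y).d q (q - 1)).hom (basisChain y)) := by
      cases q with
      | zero =>
        rw [(Chains F Y).shape 0 (0 - 1) (by simp)]
        simp [List.finRange_succ, deleteSum]
      | succ q =>
        rw [deleteSum_shuffle_right]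
        refine Eq.trans ?_ (congrArg (fun c => chainCross μ p q n (basisChain x) c)
          (d_basisChain y)).symm
        simp [chainCross]
    have h4 : chainCross (F := F) μ p q (n + 1) (basisChain x) (basisChain y) =
        shuffle μ x y (n + 1) := by simp [chainCross]
    simp only [LinearMap.compr₂_apply, LinearMap.add_apply, LinearMap.comp_apply,
      LinearMap.compl₂_apply]
    rw [h4, h1, h2, h3]
  exact LinearMap.congr_fun₂ this a b


end Cross

end Chains

end HGFT

namespace HGFT

open Simplicial Opposite

section Homology

variable {F : Type u} [Field F] (K : ChainComplex (ModuleCat.{u} F) ℕ) (n : ℕ)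

lemma next_down (n : ℕ) : (ComplexShape.down ℕ).next n = n - 1 := by
  cases n with
  | zero => exact ChainComplex.next_nat_zero
  | succ n => exact ChainComplex.next_nat_succ n

/-- The cycles. -/
def Cyc : Submodule F (K.X n) := LinearMap.ker (K.d n (n - 1)).hom

/-- The homology class of a cycle. -/
noncomputable def cls : Cyc K n →ₗ[F] K.homology n :=
  (K.liftCycles (A := ModuleCat.of F (Cyc K n)) (ModuleCat.ofHom (Cyc K n).subtype) (n - 1)
    (next_down n) (by ext z; exact z.2) ≫ K.homologyπ n).hom

lemma cls_surjective : Function.Surjective (cls K n) := by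
  intro h
  have : Function.Surjective (K.homologyπ n) := (ModuleCat.epi_iff_surjective _).1 inferInstance
  obtain ⟨c, rfl⟩ := this h
  have hc : (K.iCycles n).hom c ∈ Cyc K n :=
    congrArg (fun g : K.cycles n ⟶ K.X (n - 1) => g.hom c) (K.iCycles_d n (n - 1))
  refine ⟨⟨_, hc⟩, congrArg (K.homologyπ n).hom ?_⟩
  have inj : Function.Injective (K.iCycles n) := (ModuleCat.mono_iff_injective _).1 inferInstance
  apply inj
  exact congrArg (fun g => g.hom (⟨_, hc⟩ : Cyc K n))
    (K.liftCycles_i (A := ModuleCat.of F (Cyc K n)) (ModuleCat.ofHom (Cyc K n).subtype) (n - 1)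
      (next_down n) (by ext z; exact z.2))

lemma cls_boundary (w : K.X (n + 1)) (hw : (K.d (n + 1) n).hom w ∈ Cyc K n) :
    cls K n ⟨(K.d (n + 1) n).hom w, hw⟩ = 0 := by
  have e := congrArg (fun g => g.hom w) (K.toCycles_comp_homologyπ (n + 1) n)
  refine Eq.trans (congrArg (K.homologyπ n).hom ?_) e
  have inj : Function.Injective (K.iCycles n) := (ModuleCat.mono_iff_injective _).1 inferInstance
  apply inj
  refine (congrArg (fun g => g.hom (⟨_, hw⟩ : Cyc K n))
    (K.liftCycles_i (A := ModuleCat.of F (Cyc K n)) (ModuleCat.ofHom (Cyc K n).subtype) (n - 1)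
      (next_down n) (by ext z; exact z.2))).trans ?_
  exact (congrArg (fun g => g.hom w) (K.toCycles_i (n + 1) n)).symm

lemma exists_of_cls_eq_zero (z : Cyc K n) (hz : cls K n z = 0) :
    ∃ w, (K.d (n + 1) n).hom w = z.1 := by
  have ex := ShortComplex.exact_of_g_is_cokernel (ShortComplex.mk _ _
    (K.toCycles_comp_homologyπ (n + 1) n)) (K.homologyIsCokernel (n + 1) n (ChainComplex.prev _ n))
  obtain ⟨w, hw⟩ := (ShortComplex.moduleCat_exact_iff _).1 ex _ hz
  refine ⟨w, ?_⟩
  have h1 := congrArg (K.iCycles n).hom hw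
  refine ((congrArg (fun g => g.hom w) (K.toCycles_i (n + 1) n)).symm.trans h1).trans ?_
  exact congrArg (fun g => g.hom z)
    (K.liftCycles_i (A := ModuleCat.of F (Cyc K n)) (ModuleCat.ofHom (Cyc K n).subtype) (n - 1)
      (next_down n) (by ext z; exact z.2))

/-- A linear map on homology defined on cycles. -/
noncomputable def homDesc {M : Type*} [AddCommGroup M] [Module F M] (g : Cyc K n →ₗ[F] M)
    (hg : ∀ w (hw : (K.d (n + 1) n).hom w ∈ Cyc K n), g ⟨_, hw⟩ = 0) : K.homology n →ₗ[F] M :=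
  ((LinearMap.ker (cls K n)).liftQ g (by
    intro z hz
    obtain ⟨w, hw⟩ := exists_of_cls_eq_zero K n z hz
    obtain ⟨z, hz'⟩ := z
    subst hw
    exact hg w hz')).comp
  ((cls K n).quotKerEquivOfSurjective (cls_surjective K n)).symm.toLinearMap

lemma homDesc_cls {M : Type*} [AddCommGroup M] [Module F M] (g : Cyc K n →ₗ[F] M)
    (hg : ∀ w (hw : (K.d (n + 1) n).hom w ∈ Cyc K n), g ⟨_, hw⟩ = 0) (z : Cyc K n) :
    homDesc K n g hg (cls K n z) = g z := by
  have : ((cls K n).quotKerEquivOfSurjective (cls_surjective K n)).symm (cls K n z) =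
      Submodule.Quotient.mk z := by
    rw [LinearEquiv.symm_apply_eq]
    rfl
  simp [homDesc, this]

end Homology

section HomologyCross

/-- A natural pairing of the simplices of `X` and `Y` with values in the simplices of `T`. -/
structure Pairing (X Y T : SSet.{u}) where
  app : ∀ n : SimplexCategoryᵒᵖ, X.obj n → Y.obj n → T.obj n
  natural : ∀ {m n : SimplexCategoryᵒᵖ} (f : m ⟶ n) (x : X.obj m) (y : Y.obj m),
    T.map f (app m x y) = app n (X.map f x) (Y.map f y)

variable {F : Type u} [Field F] [CharP F 2] {X Y T : SSet.{u}} (μ : Pairing X Y T) (p q n : ℕ)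

lemma chainCross_mem (z : Cyc (Chains F X) p) (w : Cyc (Chains F Y) q) :
    chainCross μ.app p q n z.1 w.1 ∈ Cyc (Chains F T) n := by
  cases n with
  | zero =>
    change ((Chains F T).d 0 (0 - 1)).hom _ = 0
    rw [(Chains F T).shape 0 (0 - 1) (by simp)]
    rfl
  | succ n =>
    have hz : ((Chains F X).d p (p - 1)).hom z.1 = 0 := z.2
    have hw : ((Chains F Y).d q (q - 1)).hom w.1 = 0 := w.2
    exact (d_chainCross μ.app μ.natural p q n z.1 w.1).trans (by rw [hz, hw]; simp)

/-- The cross product of cycles. -/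
noncomputable def cycCross :
    Cyc (Chains F X) p →ₗ[F] Cyc (Chains F Y) q →ₗ[F] (Chains F T).homology n :=
  LinearMap.mk₂ F (fun z w => cls _ n ⟨_, chainCross_mem μ p q n z w⟩)
    (fun z z' w => by rw [← map_add]; congr 1; ext; simp)
    (fun c z w => by rw [← map_smul]; congr 1; ext; simp)
    (fun z w w' => by rw [← map_add]; congr 1; ext; simp)
    (fun c z w => by rw [← map_smul]; congr 1; ext; simp)

lemma cycCross_boundary_left (w : (Chains F X).X (p + 1))
    (hw : ((Chains F X).d (p + 1) p).hom w ∈ Cyc (Chains F X) p) (z : Cyc (Chains F Y) q) :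
    cycCross μ p q n ⟨_, hw⟩ z = 0 := by
  have e := d_chainCross μ.app μ.natural (p + 1) q n w z.1
  have hz : ((Chains F Y).d q (q - 1)).hom z.1 = 0 := z.2
  rw [hz, map_zero, add_zero] at e
  have h := cls_boundary (Chains F T) n (chainCross μ.app (p + 1) q (n + 1) w z.1)
    (e ▸ chainCross_mem μ p q n ⟨_, hw⟩ z)
  refine Eq.trans (congrArg (cls _ n) (Subtype.ext ?_)) h
  exact e.symm

lemma cycCross_boundary_right (z : Cyc (Chains F X) p) (w : (Chains F Y).X (q + 1))
    (hw : ((Chains F Y).d (q + 1) q).hom w ∈ Cyc (Chains F Y) q) :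
    cycCross μ p q n z ⟨_, hw⟩ = 0 := by
  have e := d_chainCross μ.app μ.natural p (q + 1) n z.1 w
  have hz : ((Chains F X).d p (p - 1)).hom z.1 = 0 := z.2
  rw [hz, map_zero, LinearMap.zero_apply, zero_add] at e
  have h := cls_boundary (Chains F T) n (chainCross μ.app p (q + 1) (n + 1) z.1 w)
    (e ▸ chainCross_mem μ p q n z ⟨_, hw⟩)
  refine Eq.trans (congrArg (cls _ n) (Subtype.ext ?_)) h
  exact e.symm

/-- The homology cross product induced by a natural pairing of simplices; it vanishes unless
`n = p + q`. -/
noncomputable def homologyCross :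
    (Chains F X).homology p →ₗ[F] (Chains F Y).homology q →ₗ[F] (Chains F T).homology n :=
  homDesc _ p (homDesc _ q (cycCross μ p q n).flip fun w hw =>
      LinearMap.ext fun z => cycCross_boundary_right μ p q n z w hw).flip fun w hw => by
    refine LinearMap.ext fun h => ?_
    obtain ⟨z, rfl⟩ := cls_surjective _ _ h
    rw [LinearMap.flip_apply, homDesc_cls]
    exact cycCross_boundary_left μ p q n w hw z

lemma homologyCross_cls (z : Cyc (Chains F X) p) (w : Cyc (Chains F Y) q) :
    homologyCross μ p q n (cls _ p z) (cls _ q w) =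
      cls _ n ⟨_, chainCross_mem μ p q n z w⟩ := by
  rw [homologyCross, homDesc_cls, LinearMap.flip_apply, homDesc_cls]
  rfl

end HomologyCross

/-! ### Singular homology of spaces, with degree shifts -/

section Singular

variable (F : Type u) [Field F]

/-- Singular homology with coefficients in `F`. -/
noncomputable abbrev HH (n : ℕ) (X : Type u) [TopologicalSpace X] : ModuleCat.{u} F :=
  ((AlgebraicTopology.singularHomologyFunctor (ModuleCat.{u} F) n).obj (ModuleCat.of F F)).obj
    (TopCat.of X)

/-- The map induced on singular homology. -/
noncomputable abbrev HH.map (n : ℕ) {X Y : Type u} [TopologicalSpace X] [TopologicalSpace Y]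
    (f : C(X, Y)) : HH F n X ⟶ HH F n Y :=
  ((AlgebraicTopology.singularHomologyFunctor (ModuleCat.{u} F) n).obj (ModuleCat.of F F)).map
    (TopCat.ofHom f)

lemma HH.map_eq_of_homotopic (n : ℕ) {X Y : Type u} [TopologicalSpace X] [TopologicalSpace Y]
    {f g : C(X, Y)} (h : f.Homotopic g) : HH.map F n f = HH.map F n g := by
  obtain ⟨h⟩ := h
  exact TopCat.Homotopy.congr_homologyMap_singularChainComplexFunctor
    (f := TopCat.ofHom f) (g := TopCat.ofHom g) h (ModuleCat.of F F) n

end Singular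
end HGFT

namespace HGFT

open Simplicial Opposite KSpace DirectSum

section Shifted

variable (F : Type u) [Field F]

/-- Graded `F`-vector spaces, with the usual tensor product. (In characteristic two the symmetry
needs no signs.) -/
abbrev GrMod : Type (u + 1) := GradedObject ℤ (ModuleCat.{u} F)

/-- The homology `H_{*-m}(B)` with a degree shift `m`: in degree `q` it is the homology in degree
`n` of the part of `B` where `m + n = q`, summed over all `n`. For constant `m` this is
`H_{q-m}(B)`. -/
noncomputable def SH (B : KSpace.{u}) (m : B → ℤ) : GrMod F := fun q =>
  ModuleCat.of F (⨁ n : ℕ, HH F n {b : B // m b + n = q})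

variable {F}

/-- The map between the parts of two spaces induced by a map compatible with the shifts. -/
def levelMap {B C : KSpace.{u}} {m : B → ℤ} {n : C → ℤ} (f : C(B, C)) (h : ∀ b, n (f b) = m b)
    (i : ℕ) (q : ℤ) : C({b : B // m b + i = q}, {c : C // n c + i = q}) :=
  ⟨fun b => ⟨f b.1, (congrArg (· + (i : ℤ)) (h b.1)).trans b.2⟩, by fun_prop⟩

/-- The map `H_{*-m}(B) → H_{*-n}(C)` induced by a map `f` with `n ∘ f = m`. -/
noncomputable def SH.map {B C : KSpace.{u}} {m : B → ℤ} {n : C → ℤ} (f : C(B, C))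
    (h : ∀ b, n (f b) = m b) : SH F B m ⟶ SH F C n := fun q =>
  ModuleCat.ofHom (DirectSum.lmap fun i : ℕ => (HH.map F i (levelMap f h i q)).hom)

/-- A pairing of singular simplices from a pairing of points that is continuous on compact
Hausdorff spaces. -/
noncomputable def spacePairing {A B T : Type u} [TopologicalSpace A] [TopologicalSpace B]
    [TopologicalSpace T] (φ : A → B → T)
    (hφ : ∀ (K : Type u) [TopologicalSpace K] [CompactSpace K] [T2Space K] (a : C(K, A))
      (b : C(K, B)), Continuous fun t => φ (a t) (b t)) :
    Pairing (TopCat.toSSet.obj (TopCat.of A)) (TopCat.toSSet.obj (TopCat.of B))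
      (TopCat.toSSet.obj (TopCat.of T)) where
  app n x y := ULift.up (TopCat.ofHom
    ⟨fun t => φ (x.down.hom t) (y.down.hom t), by
      have h1 : CompactSpace (SimplexCategory.toTop.{u}.op.obj n).unop :=
        inferInstanceAs (CompactSpace (ULift (stdSimplex ℝ (Fin (n.unop.len + 1)))))
      have h2 : T2Space (SimplexCategory.toTop.{u}.op.obj n).unop :=
        inferInstanceAs (T2Space (ULift (stdSimplex ℝ (Fin (n.unop.len + 1)))))
      exact hφ _ x.down.hom y.down.hom⟩)
  natural _ _ _ := rfl

/-- The pairing of points with values in the product. -/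
def levelPair {B C : KSpace.{u}} {m : B → ℤ} {n : C → ℤ} {i j : ℕ} {q r : ℤ}
    (b : {b : B // m b + i = q}) (c : {c : C // n c + j = r}) :
    {p : B.prod C // (m (fst p) + n (snd p)) + (i + j : ℕ) = q + r} :=
  ⟨pair b.1 c.1, by
    have h₁ := b.2
    have h₂ := c.2
    simp only [fst_pair, snd_pair]
    push_cast
    omega⟩

variable [CharP F 2]

/-- The cross product `H_{*-m}(B) ⊗ H_{*-n}(C) → H_{*-(m+n)}(B × C)`. -/
noncomputable def SH.cross {B C : KSpace.{u}} (m : B → ℤ) (n : C → ℤ) :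
    SH F B m ⊗ SH F C n ⟶ SH F (B.prod C) (fun p => m (fst p) + n (snd p)) := fun k =>
  GradedObject.Monoidal.tensorObjDesc fun q r h => ModuleCat.ofHom (TensorProduct.lift
    (DirectSum.toModule F ℕ _ fun i => LinearMap.flip (DirectSum.toModule F ℕ _ fun j =>
      LinearMap.flip ((homologyCross (spacePairing
        (A := {b : B // m b + i = q}) (B := {c : C // n c + j = r})
        (T := {p : B.prod C // (m (fst p) + n (snd p)) + (i + j : ℕ) = k})
        (fun b c => ⟨(levelPair b c).1, (levelPair b c).2.trans h⟩)
        (fun K _ _ _ a b => by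
          refine Continuous.subtype_mk ?_ _
          exact continuous_pair (by fun_prop) (by fun_prop))) i j (i + j)).compr₂
        (DirectSum.lof F ℕ (fun l : ℕ => HH F l
          {p : B.prod C // (m (fst p) + n (snd p)) + l = k}) (i + j))))))

/-- The class of a point in `H_0`. -/
noncomputable def pointClass (F : Type u) [Field F] {X : Type u} [TopologicalSpace X] (x : X) :
    HH F 0 X :=
  cls (Chains F (TopCat.toSSet.obj (TopCat.of X))) 0
    ⟨basisChain (ULift.up (TopCat.ofHom (ContinuousMap.const _ x))), by
      change ((Chains F _).d 0 (0 - 1)).hom _ = 0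
      rw [(Chains F _).shape 0 (0 - 1) (by simp)]
      rfl⟩

/-- The canonical isomorphism `F → H_*(pt)`, in degree zero. -/
noncomputable def unitClassZero (F : Type u) [Field F] :
    𝟙_ (ModuleCat.{u} F) ⟶ SH F KSpace.pt (fun _ => 0) 0 :=
  ModuleCat.ofHom ((DirectSum.lof F ℕ (fun n : ℕ => HH F n {b : KSpace.pt.{u} // 0 + (n : ℤ) = 0})
    0).comp (LinearMap.toSpanSingleton F _ (pointClass F ⟨star, by simp⟩)))

/-- The canonical isomorphism `F → H_*(pt)`. -/
noncomputable def unitClass (F : Type u) [Field F] :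
    𝟙_ (GrMod F) ⟶ SH F KSpace.pt (fun _ => 0) := fun i =>
  if h : i = 0 then
    eqToHom (congrArg (𝟙_ (GrMod F)) h) ≫ GradedObject.Monoidal.tensorUnit₀.hom ≫
      unitClassZero F ≫ eqToHom (congrArg (SH F KSpace.pt (fun _ => 0)) h.symm)
  else (GradedObject.Monoidal.isInitialTensorUnitApply i h).to _

/-- The Euler characteristic, for homology with coefficients in `F`. -/
noncomputable def eulerChar (F : Type u) [Field F] (X : Type u) [TopologicalSpace X] : ℤ :=
  ∑ᶠ n : ℕ, (-1) ^ n * (Module.finrank F (HH F n X) : ℤ)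

lemma eulerChar_eq (F : Type u) [Field F] {X Y : Type u} [TopologicalSpace X] [TopologicalSpace Y]
    (f : C(X, Y)) (hf : IsHomotopyEquiv f) : eulerChar F X = eulerChar F Y := by
  obtain ⟨g, h₁, h₂⟩ := hf
  refine finsum_congr fun n => ?_
  have e₁ : HH.map F n f ≫ HH.map F n g = 𝟙 _ := by
    rw [← Functor.map_comp, ← TopCat.ofHom_comp]
    exact (HH.map_eq_of_homotopic F n h₁).trans (CategoryTheory.Functor.map_id _ _)
  have e₂ : HH.map F n g ≫ HH.map F n f = 𝟙 _ := by
    rw [← Functor.map_comp, ← TopCat.ofHom_comp]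
    exact (HH.map_eq_of_homotopic F n h₂).trans (CategoryTheory.Functor.map_id _ _)
  rw [(Iso.toLinearEquiv ⟨HH.map F n f, HH.map F n g, e₁, e₂⟩).finrank_eq]

end Shifted
end HGFT

namespace HGFT

open KSpace

/-! ### The double category of special squares -/

/-- The objects of `ℋ` with degree shifts: families of h-graphs over a good base space admitting
basepoints, with a locally constant degree shift. -/
structure InH (X : Obj.{u}) : Prop where
  good : IsGoodBase X.base
  family : IsHGraphFamily X.proj
  basepoints : AdmitsBasepoints X.proj
  shift : IsLocallyConstant X.shift

/-- The map of fibres `Y_{f(b)} → X_b` underlying a morphism `X → Y` covering `f`. -/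
def FopHom.fibreMap {X Y : Obj.{u}} (f : X ⟶ Y) {b : X.base} {c : Y.base}
    (h : FopHom.base f b = c) : C(fibre Y.proj c, fibre X.proj b) :=
  ⟨fun y => fibreMk (FopHom.map f (Pullback.mk b (fibreVal y) (h.trans (fibre_cond y).symm)))
    (FopHom.proj_map f _), by fun_prop⟩

/-- Vertical morphisms: the map of total spaces is an h-embedding, and the shifts agree. -/
structure IsVertical {X Y : Obj.{u}} (f : X ⟶ Y) : Prop where
  shift : ∀ b, X.shift b = Y.shift (FopHom.base f b)
  hEmbedding : ∀ b, IsHEmbedding (FopHom.fibreMap f (b := b) rfl)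

/-- The maps of spaces over `B` underlying horizontal morphisms `X → Y`: they go from the total
space of `Y` to that of `X`. -/
structure HorMap {B : KSpace.{u}} (X Y : Fam B) where
  map : C(Y.total, X.total)
  proj_map : ∀ y, X.proj (map y) = Y.proj y

namespace HorMap

variable {B C : KSpace.{u}} {X Y Z : Fam B}

/-- The morphism of the fibrewise opposite category given by a horizontal map. -/
def toHom (h : HorMap X Y) : X.obj ⟶ Y.obj :=
  FopHom.ofInv (ContinuousMap.id B) (ContinuousMap.id B) (fun _ => rfl) h.map h.proj_map

/-- The map induced on fibres. -/
def fibreMap (h : HorMap X Y) (b : B) : C(fibre Y.proj b, fibre X.proj b) :=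
  KSpace.fibreMap h.map fun y hy => (h.proj_map y).trans hy

/-- The identity. -/
def id (X : Fam B) : HorMap X X := ⟨ContinuousMap.id _, fun _ => rfl⟩

/-- The composite. -/
def comp (h : HorMap X Y) (k : HorMap Y Z) : HorMap X Z :=
  ⟨h.map.comp k.map, fun z => (h.proj_map _).trans (k.proj_map z)⟩

/-- The external disjoint union. -/
def tensor {X' Y' : Fam C} (h : HorMap X Y) (k : HorMap X' Y') :
    HorMap (X.tensor X') (Y.tensor Y') where
  map := ⟨elim (fun q => inl (pair (h.map (fst q)) (snd q)))
    (fun q => inr (pair (fst q) (k.map (snd q)))),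
    continuous_elim (by fun_prop) (by fun_prop)⟩
  proj_map := by
    rintro (q | q)
    · exact KSpace.prod_ext (h.proj_map _) rfl
    · exact KSpace.prod_ext rfl (k.proj_map _)

end HorMap

/-- Horizontal morphisms: the map of total spaces is positive, and the difference of the shifts is
prescribed by the Euler characteristics of the fibres. -/
structure IsHorizontal (F : Type u) [Field F] (d : ℤ) {B : KSpace.{u}} {X Y : Fam B}
    (h : HorMap X Y) : Prop where
  positive : ∀ b, IsPositive (h.fibreMap b)
  shift : ∀ b, X.shift b - Y.shift b =
    -d * (eulerChar F (fibre X.proj b) - eulerChar F (fibre Y.proj b))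

/-- Two-cells: commuting squares that give homotopy cofibre squares of fibres. -/
structure IsTwoCell {B C : KSpace.{u}} {X Y : Fam B} {Z W : Fam C} (top : HorMap X Y)
    (bot : HorMap Z W) (left : X.obj ⟶ Z.obj) (right : Y.obj ⟶ W.obj) : Prop where
  comm : top.toHom ≫ right = left ≫ bot.toHom
  square : ∀ (b : B) (c : C) (hl : FopHom.base left b = c) (hr : FopHom.base right b = c),
    IsHomotopyCofibreSquare (bot.fibreMap c) (FopHom.fibreMap right hr)
      (FopHom.fibreMap left hl) (top.fibreMap b)

/-- A symmetric monoidal double functor from the double category of special squares of degree `d`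
to the horizontal opposite of the double category of commutative squares of graded vector spaces.
Since the horizontal and vertical morphisms and the two-cells are exactly those morphisms and
squares of the ambient category that satisfy the defining conditions, the functor is given on such
morphisms, and its laws are stated whenever all morphisms involved satisfy the conditions. A
two-cell of commutative squares is determined by its boundary. -/
structure SymmMonDoubleFunctor (F : Type u) [Field F] (d : ℤ) where
  /-- The effect on objects. -/
  obj (X : Obj.{u}) (hX : InH X) : GrMod F
  /-- The effect on vertical morphisms. -/
  vmap {X Y : Obj.{u}} (hX : InH X) (hY : InH Y) (f : X ⟶ Y) (hf : IsVertical f) :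
    obj X hX ⟶ obj Y hY
  /-- The effect on horizontal morphisms. -/
  hmap {B : KSpace.{u}} {X Y : Fam B} (hX : InH X.obj) (hY : InH Y.obj) (f : HorMap X Y)
    (hf : IsHorizontal F d f) : obj Y.obj hY ⟶ obj X.obj hX
  vmap_id {X : Obj.{u}} (hX : InH X) (h : IsVertical (𝟙 X)) : vmap hX hX (𝟙 X) h = 𝟙 _
  vmap_comp {X Y Z : Obj.{u}} (hX : InH X) (hY : InH Y) (hZ : InH Z) (f : X ⟶ Y) (g : Y ⟶ Z)
    (hf : IsVertical f) (hg : IsVertical g) (hfg : IsVertical (f ≫ g)) :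
    vmap hX hZ (f ≫ g) hfg = vmap hX hY f hf ≫ vmap hY hZ g hg
  hmap_id {B : KSpace.{u}} {X : Fam B} (hX : InH X.obj) (h : IsHorizontal F d (HorMap.id X)) :
    hmap hX hX (HorMap.id X) h = 𝟙 _
  hmap_comp {B : KSpace.{u}} {X Y Z : Fam B} (hX : InH X.obj) (hY : InH Y.obj) (hZ : InH Z.obj)
    (f : HorMap X Y) (g : HorMap Y Z) (hf : IsHorizontal F d f) (hg : IsHorizontal F d g)
    (hfg : IsHorizontal F d (f.comp g)) :
    hmap hX hZ (f.comp g) hfg = hmap hY hZ g hg ≫ hmap hX hY f hf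
  /-- The effect on two-cells. -/
  cell {B C : KSpace.{u}} {X Y : Fam B} {Z W : Fam C} (hX : InH X.obj) (hY : InH Y.obj)
    (hZ : InH Z.obj) (hW : InH W.obj) (top : HorMap X Y) (bot : HorMap Z W)
    (left : X.obj ⟶ Z.obj) (right : Y.obj ⟶ W.obj) (ht : IsHorizontal F d top)
    (hb : IsHorizontal F d bot) (hl : IsVertical left) (hr : IsVertical right)
    (hs : IsTwoCell top bot left right) :
    hmap hX hY top ht ≫ vmap hX hZ left hl = vmap hY hW right hr ≫ hmap hZ hW bot hb
  /-- The unit constraint. -/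
  unitIso (h : InH unitObj) : 𝟙_ (GrMod F) ≅ obj unitObj h
  /-- The monoidality constraint. -/
  tensorIso {X Y : Obj.{u}} (hX : InH X) (hY : InH Y) (h : InH (X.fam.tensor Y.fam).obj) :
    obj X hX ⊗ obj Y hY ≅ obj (X.fam.tensor Y.fam).obj h
  tensorIso_vmap {X Y X' Y' : Obj.{u}} (hX : InH X) (hY : InH Y)
    (h : InH (X.fam.tensor Y.fam).obj) (hX' : InH X') (hY' : InH Y')
    (h' : InH (X'.fam.tensor Y'.fam).obj) (f : X ⟶ X') (g : Y ⟶ Y') (hf : IsVertical f)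
    (hg : IsVertical g) (hfg : IsVertical (FopHom.tensor f g : Fam.obj _ ⟶ Fam.obj _)) :
    (vmap hX hX' f hf ⊗ₘ vmap hY hY' g hg) ≫ (tensorIso hX' hY' h').hom =
      (tensorIso hX hY h).hom ≫ vmap h h' (FopHom.tensor f g) hfg
  tensorIso_hmap {B C : KSpace.{u}} {X X' : Fam B} {Y Y' : Fam C} (hX : InH X.obj)
    (hY : InH Y.obj) (h : InH (X.tensor Y).obj) (hX' : InH X'.obj) (hY' : InH Y'.obj)
    (h' : InH (X'.tensor Y').obj) (f : HorMap X X') (g : HorMap Y Y') (hf : IsHorizontal F d f)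
    (hg : IsHorizontal F d g) (hfg : IsHorizontal F d (f.tensor g)) :
    (hmap hX hX' f hf ⊗ₘ hmap hY hY' g hg) ≫
        (tensorIso (X := X.obj) (Y := Y.obj) hX hY h).hom =
      (tensorIso (X := X'.obj) (Y := Y'.obj) hX' hY' h').hom ≫ hmap h h' (f.tensor g) hfg
  associativity {X Y Z : Obj.{u}} (hX : InH X) (hY : InH Y) (hZ : InH Z)
    (hXY : InH (X.fam.tensor Y.fam).obj) (hYZ : InH (Y.fam.tensor Z.fam).obj)
    (h₁ : InH ((X.fam.tensor Y.fam).tensor Z.fam).obj)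
    (h₂ : InH (X.fam.tensor (Y.fam.tensor Z.fam)).obj)
    (ha : IsVertical (associatorIso X Y Z).hom) :
    (tensorIso hX hY hXY).hom ▷ obj Z hZ ≫ (tensorIso hXY hZ h₁).hom ≫
        vmap h₁ h₂ (associatorIso X Y Z).hom ha =
      (α_ _ _ _).hom ≫ obj X hX ◁ (tensorIso hY hZ hYZ).hom ≫ (tensorIso hX hYZ h₂).hom
  left_unitality {X : Obj.{u}} (hI : InH unitObj) (hX : InH X)
    (h : InH (unitObj.fam.tensor X.fam).obj) (hl : IsVertical (leftUnitorIso X).hom) :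
    (λ_ (obj X hX)).hom =
      (unitIso hI).hom ▷ obj X hX ≫ (tensorIso hI hX h).hom ≫ vmap h hX (leftUnitorIso X).hom hl
  right_unitality {X : Obj.{u}} (hI : InH unitObj) (hX : InH X)
    (h : InH (X.fam.tensor unitObj.fam).obj) (hr : IsVertical (rightUnitorIso X).hom) :
    (ρ_ (obj X hX)).hom =
      obj X hX ◁ (unitIso hI).hom ≫ (tensorIso hX hI h).hom ≫ vmap h hX (rightUnitorIso X).hom hr
  symmetry {X Y : Obj.{u}} (hX : InH X) (hY : InH Y) (h : InH (X.fam.tensor Y.fam).obj)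
    (h' : InH (Y.fam.tensor X.fam).obj) (hs : IsVertical (braidIso X Y).hom) :
    (β_ (obj X hX) (obj Y hY)).hom ≫ (tensorIso hY hX h').hom =
      (tensorIso hX hY h).hom ≫ vmap h h' (braidIso X Y).hom hs

/-! ### Homological double functors -/

/-- The morphism to the empty family over `C` given by a map to `C`. -/
def toEmpty (X : Obj.{u}) {C : KSpace.{u}} (f : C(X.base, C)) (n : C → ℤ) :
    X ⟶ (emptyFam C n).obj where
  base := f
  map := ⟨fun z => isEmptyElim (α := KSpace.empty) (Pullback.snd z),
    continuous_iff_continuousAt.2 fun z => isEmptyElim (α := KSpace.empty) (Pullback.snd z)⟩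
  proj_map z := isEmptyElim (α := KSpace.empty) (Pullback.snd z)

/-- `U` is homological: the symmetric monoidal functor `(B, m) ↦ U(∅_B, m)` is identified with
`(B, m) ↦ H_{*-m}(B)`, naturally and compatibly with cross products and units. -/
structure Homological {F : Type u} [Field F] [CharP F 2] {d : ℤ}
    (U : SymmMonDoubleFunctor F d) where
  iso (B : KSpace.{u}) (m : B → ℤ) (h : InH (emptyFam B m).obj) :
    SH F B m ≅ U.obj (emptyFam B m).obj h
  naturality {B C : KSpace.{u}} (m : B → ℤ) (n : C → ℤ) (hB : InH (emptyFam B m).obj)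
    (hC : InH (emptyFam C n).obj) (f : C(B, C)) (hf : ∀ b, n (f b) = m b)
    (hv : IsVertical (toEmpty (emptyFam B m).obj f n)) :
    SH.map f hf ≫ (iso C n hC).hom = (iso B m hB).hom ≫ U.vmap hB hC _ hv
  tensor {B C : KSpace.{u}} (m : B → ℤ) (n : C → ℤ) (hB : InH (emptyFam B m).obj)
    (hC : InH (emptyFam C n).obj) (h : InH ((emptyFam B m).tensor (emptyFam C n)).obj)
    (hBC : InH (emptyFam (B.prod C) fun p => m (fst p) + n (snd p)).obj)
    (hv : IsVertical (toEmpty ((emptyFam B m).tensor (emptyFam C n)).obj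
      (ContinuousMap.id (B.prod C)) fun p => m (fst p) + n (snd p))) :
    SH.cross m n ≫ (iso (B.prod C) _ hBC).hom =
      ((iso B m hB).hom ⊗ₘ (iso C n hC).hom) ≫
        (U.tensorIso (X := (emptyFam B m).obj) (Y := (emptyFam C n).obj) hB hC h).hom ≫
          U.vmap h hBC _ hv
  unit (h : InH unitObj) : unitClass F ≫ (iso KSpace.pt (fun _ => 0) h).hom = (U.unitIso h).hom

end HGFT

namespace HGFT

open KSpace

/-! ### The category of h-graphs and homotopy equivalences -/

/-- The type of h-graphs. -/
structure HGraph : Type (u + 1) where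
  space : KSpace.{u}
  isHGraph : IsHGraph space

instance : CoeSort HGraph.{u} (Type u) := ⟨fun X => X.space⟩

namespace HGraph

instance : Category HGraph.{u} where
  Hom X Y := {f : C(X.space, Y.space) // IsHomotopyEquiv f}
  id X := ⟨ContinuousMap.id _, IsHomotopyEquiv.of_inv _ (ContinuousMap.id _) (fun _ => rfl)
    fun _ => rfl⟩
  comp f g := ⟨g.1.comp f.1, g.2.comp f.2⟩

/-- The continuous map underlying a morphism. -/
def toMap {X Y : HGraph.{u}} (f : X ⟶ Y) : C(X.space, Y.space) := f.1

lemma isHomotopyEquiv {X Y : HGraph.{u}} (f : X ⟶ Y) : IsHomotopyEquiv (toMap f) := f.2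

lemma hom_ext {X Y : HGraph.{u}} {f g : X ⟶ Y} (h : ∀ x, toMap f x = toMap g x) : f = g :=
  Subtype.ext (ContinuousMap.ext h)

/-- Mutually inverse continuous maps give an isomorphism. -/
def isoMk {X Y : HGraph.{u}} (f : C(X.space, Y.space)) (g : C(Y.space, X.space))
    (h₁ : ∀ x, g (f x) = x) (h₂ : ∀ y, f (g y) = y) : X ≅ Y where
  hom := ⟨f, IsHomotopyEquiv.of_inv f g h₁ h₂⟩
  inv := ⟨g, IsHomotopyEquiv.of_inv g f h₂ h₁⟩
  hom_inv_id := hom_ext h₁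
  inv_hom_id := hom_ext h₂

/-- The disjoint union of h-graphs. -/
def sum (X Y : HGraph.{u}) : HGraph.{u} := ⟨X.space.sum Y.space, X.isHGraph.sum Y.isHGraph⟩

/-- The empty h-graph. -/
def empty : HGraph.{u} := ⟨KSpace.empty, isHGraph_of_isEmpty _⟩

instance : MonoidalCategoryStruct HGraph.{u} where
  tensorObj := sum
  tensorHom f g := ⟨sumMap f.1 g.1, f.2.sumMap g.2⟩
  whiskerLeft _ _ _ g := ⟨sumMap (ContinuousMap.id _) g.1,
    (IsHomotopyEquiv.of_inv _ (ContinuousMap.id _) (fun _ => rfl) fun _ => rfl).sumMap g.2⟩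
  whiskerRight f _ := ⟨sumMap f.1 (ContinuousMap.id _),
    f.2.sumMap (IsHomotopyEquiv.of_inv _ (ContinuousMap.id _) (fun _ => rfl) fun _ => rfl)⟩
  tensorUnit := empty
  associator X Y Z := isoMk
    (Homeomorph.sumAssoc X.space Y.space Z.space : C((X ⊕ Y) ⊕ Z, X ⊕ Y ⊕ Z))
    ((Homeomorph.sumAssoc X.space Y.space Z.space).symm : C(X ⊕ Y ⊕ Z, (X ⊕ Y) ⊕ Z))
    (by rintro ((x | x) | x) <;> rfl) (by rintro (x | x | x) <;> rfl)
  leftUnitor X := isoMk (X := sum empty X)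
    ⟨elim (fun x => isEmptyElim (α := KSpace.empty) x) _root_.id,
      continuous_elim (continuous_iff_continuousAt.2 fun x => isEmptyElim (α := KSpace.empty) x)
        continuous_id⟩
    ⟨inr, KSpace.continuous_inr⟩ (by rintro (⟨⟨⟩⟩ | x); rfl) fun _ => rfl
  rightUnitor X := isoMk (X := sum X empty)
    ⟨elim _root_.id (fun x => isEmptyElim (α := KSpace.empty) x),
      continuous_elim continuous_id
        (continuous_iff_continuousAt.2 fun x => isEmptyElim (α := KSpace.empty) x)⟩
    ⟨inl, KSpace.continuous_inl⟩ (by rintro (x | ⟨⟨⟩⟩); rfl) fun _ => rfl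

instance : MonoidalCategory HGraph.{u} where
  tensorHom_def _ _ := hom_ext (by rintro (x | x) <;> rfl)
  id_tensorHom_id _ _ := hom_ext (by rintro (x | x) <;> rfl)
  tensorHom_comp_tensorHom _ _ _ _ := hom_ext (by rintro (x | x) <;> rfl)
  whiskerLeft_id _ _ := hom_ext (by rintro (x | x) <;> rfl)
  id_whiskerRight _ _ := hom_ext (by rintro (x | x) <;> rfl)
  associator_naturality _ _ _ := hom_ext (by rintro ((x | x) | x) <;> rfl)
  leftUnitor_naturality _ := hom_ext (by rintro (⟨⟨⟩⟩ | x); rfl)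
  rightUnitor_naturality _ := hom_ext (by rintro (x | ⟨⟨⟩⟩); rfl)
  pentagon _ _ _ _ := hom_ext (by rintro (((x | x) | x) | x) <;> rfl)
  triangle _ _ := hom_ext (by rintro ((x | ⟨⟨⟩⟩) | x) <;> rfl)

instance : BraidedCategory HGraph.{u} where
  braiding X Y := isoMk (Homeomorph.sumComm X.space Y.space : C(X ⊕ Y, Y ⊕ X))
    (Homeomorph.sumComm Y.space X.space : C(Y ⊕ X, X ⊕ Y))
    (by rintro (x | x) <;> rfl) (by rintro (x | x) <;> rfl)
  braiding_naturality_right _ _ _ _ := hom_ext (by rintro (x | x) <;> rfl)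
  braiding_naturality_left _ _ := hom_ext (by rintro (x | x) <;> rfl)
  hexagon_forward _ _ _ := hom_ext (by rintro ((x | x) | x) <;> rfl)
  hexagon_reverse _ _ _ := hom_ext (by rintro (x | x | x) <;> rfl)

instance : SymmetricCategory HGraph.{u} where
  symmetry _ _ := hom_ext (by rintro (x | x) <;> rfl)

end HGraph

/-! ### Families of h-graph cobordisms -/

/-- The data of a family of h-graph cobordisms from `X` to `Y` over `B`. -/
structure CobFam (X Y : HGraph.{u}) (B : KSpace.{u}) where
  total : KSpace.{u}
  proj : C(total, B)
  inn : C(B.prod X.space, total)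
  out : C(B.prod Y.space, total)
  proj_inn : ∀ z, proj (inn z) = fst z
  proj_out : ∀ z, proj (out z) = fst z

namespace CobFam

variable {X Y Z X' Y' : HGraph.{u}} {B C B' : KSpace.{u}}

/-- The incoming boundary of the fibre over `b`. -/
def innAt (S : CobFam X Y B) (b : B) : C(X.space, fibre S.proj b) :=
  ⟨fun x => fibreMk (S.inn (pair b x)) (S.proj_inn _), by fun_prop⟩

/-- The outgoing boundary of the fibre over `b`. -/
def outAt (S : CobFam X Y B) (b : B) : C(Y.space, fibre S.proj b) :=
  ⟨fun y => fibreMk (S.out (pair b y)) (S.proj_out _), by fun_prop⟩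

/-- A positive family of h-graph cobordisms. -/
structure IsPositiveFamily (S : CobFam X Y B) : Prop where
  family : IsHGraphFamily S.proj
  positive : ∀ b, IsPositive (S.innAt b)
  hEmbedding : ∀ b, IsHEmbedding (S.outAt b)
  cofibration : IsClosedFibrewiseCofibration (X := (B.prod X.space).sum (B.prod Y.space))
    ⟨elim fst fst, continuous_elim KSpace.continuous_fst KSpace.continuous_fst⟩ S.proj
    ⟨elim S.inn S.out, continuous_elim S.inn.2 S.out.2⟩

/-- The relative Euler characteristic `χ(S_b, X)`. -/
noncomputable def relEuler (F : Type u) [Field F] (S : CobFam X Y B) (b : B) : ℤ :=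
  eulerChar F (fibre S.proj b) - eulerChar F X.space

/-- The gluing relation of the external composite. -/
inductive CompRel (T : CobFam Y Z C) (S : CobFam X Y B) :
    (C.prod S.total).sum (T.total.prod B) → (C.prod S.total).sum (T.total.prod B) → Prop
  | glue (c : C) (b : B) (y : Y) :
      CompRel T S (inl (pair c (S.out (pair b y)))) (inr (pair (T.inn (pair c y)) b))

/-- The external composite `T ∘ S` over `C × B`. -/
def comp (T : CobFam Y Z C) (S : CobFam X Y B) : CobFam X Z (C.prod B) where
  total := ⟨Quot (CompRel T S)⟩
  proj := ⟨Quot.lift (elim (fun p => pair (fst p) (S.proj (snd p)))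
    (fun p => pair (T.proj (fst p)) (snd p))) (by
      rintro _ _ ⟨c, b, y⟩
      exact KSpace.prod_ext (T.proj_inn (pair c y)).symm (S.proj_out (pair b y))),
    continuous_quot_lift _ (continuous_elim (by fun_prop) (by fun_prop))⟩
  inn := ⟨fun p => Quot.mk _ (inl (pair (fst (fst p)) (S.inn (pair (snd (fst p)) (snd p))))),
    continuous_quot_mk.comp (by fun_prop)⟩
  out := ⟨fun p => Quot.mk _ (inr (pair (T.out (pair (fst (fst p)) (snd p))) (snd (fst p)))),
    continuous_quot_mk.comp (by fun_prop)⟩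
  proj_inn _ := KSpace.prod_ext rfl (S.proj_inn _)
  proj_out _ := KSpace.prod_ext (T.proj_out _) rfl

/-- The external disjoint union over `B × B'`. -/
def sum (S : CobFam X Y B) (S' : CobFam X' Y' B') : CobFam (X ⊗ X') (Y ⊗ Y') (B.prod B') where
  total := (S.total.prod B').sum (B.prod S'.total)
  proj := ⟨elim (fun q => pair (S.proj (fst q)) (snd q)) (fun q => pair (fst q) (S'.proj (snd q))),
    continuous_elim (by fun_prop) (by fun_prop)⟩
  inn := ⟨fun p => elim (X := X.space) (Y := X'.space)
      (fun x => inl (pair (S.inn (pair (fst (fst p)) x)) (snd (fst p))))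
      (fun x => inr (pair (fst (fst p)) (S'.inn (pair (snd (fst p)) x)))) (snd p),
    continuous_prod_sum (A := B.prod B') (X := X.space) (Y := X'.space) _
      (KSpace.continuous_inl.comp (continuous_pair (by fun_prop) (by fun_prop)))
      (KSpace.continuous_inr.comp (continuous_pair (by fun_prop) (by fun_prop)))⟩
  out := ⟨fun p => elim (X := Y.space) (Y := Y'.space)
      (fun x => inl (pair (S.out (pair (fst (fst p)) x)) (snd (fst p))))
      (fun x => inr (pair (fst (fst p)) (S'.out (pair (snd (fst p)) x)))) (snd p),
    continuous_prod_sum (A := B.prod B') (X := Y.space) (Y := Y'.space) _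
      (KSpace.continuous_inl.comp (continuous_pair (by fun_prop) (by fun_prop)))
      (KSpace.continuous_inr.comp (continuous_pair (by fun_prop) (by fun_prop)))⟩
  proj_inn := by
    rintro ⟨p, x | x⟩
    · exact KSpace.prod_ext (S.proj_inn _) rfl
    · exact KSpace.prod_ext rfl (S'.proj_inn _)
  proj_out := by
    rintro ⟨p, x | x⟩
    · exact KSpace.prod_ext (S.proj_out _) rfl
    · exact KSpace.prod_ext rfl (S'.proj_out _)

/-- The cylinder `X × I` over a point. -/
def cylinder (X : HGraph.{u}) : CobFam X X KSpace.pt where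
  total := X.space.cyl
  proj := ⟨fun _ => star, continuous_const⟩
  inn := ⟨fun p : KSpace.pt.prod X.space => Kify.mk (snd p, 0),
    Kify.continuous_mk_comp (KSpace.continuous_snd.prodMk continuous_const)⟩
  out := ⟨fun p : KSpace.pt.prod X.space => Kify.mk (snd p, 1),
    Kify.continuous_mk_comp (KSpace.continuous_snd.prodMk continuous_const)⟩
  proj_inn _ := rfl
  proj_out _ := rfl

/-- A 2-cell between families of h-graph cobordisms. -/
structure TwoCell (S : CobFam X Y B) (S' : CobFam X' Y' B') where
  onX : X ⟶ X'
  onY : Y ⟶ Y'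
  onBase : C(B, B')
  onTotal : C(S.total, S'.total)
  proj : ∀ s, S'.proj (onTotal s) = onBase (S.proj s)
  inn : ∀ b x, onTotal (S.inn (pair b x)) = S'.inn (pair (onBase b) (HGraph.toMap onX x))
  out : ∀ b y, onTotal (S.out (pair b y)) = S'.out (pair (onBase b) (HGraph.toMap onY y))
  isHomotopyEquiv : ∀ b, IsHomotopyEquiv (KSpace.fibreMap (p := S.proj) (p' := S'.proj) (b := b)
    (b' := onBase b) onTotal fun s hs => (proj s).trans (congrArg onBase hs))

lemma TwoCell.relEuler_eq (F : Type u) [Field F] {S : CobFam X Y B} {S' : CobFam X' Y' B'}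
    (φ : TwoCell S S') (b : B) : S'.relEuler F (φ.onBase b) = S.relEuler F b := by
  rw [relEuler, relEuler, eulerChar_eq F _ (HGraph.isHomotopyEquiv φ.onX),
    eulerChar_eq F _ (φ.isHomotopyEquiv b)]

end CobFam

/-! ### Homological h-graph field theories -/

/-- A positive homological h-graph field theory of degree `d` over `F`. -/
structure PosHHGFT (F : Type u) [Field F] [CharP F 2] (d : ℤ) where
  /-- The symmetric monoidal functor. -/
  functor : HGraph.{u} ⥤ GrMod F
  [braided : functor.Braided]
  /-- The operation of a positive family of cobordisms. -/
  op {X Y : HGraph.{u}} {B : KSpace.{u}} (S : CobFam X Y B) (hS : S.IsPositiveFamily) :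
    SH F B (fun b => d * S.relEuler F b) ⊗ functor.obj X ⟶ functor.obj Y
  baseChange {X Y X' Y' : HGraph.{u}} {B B' : KSpace.{u}} (S : CobFam X Y B)
    (S' : CobFam X' Y' B') (hS : S.IsPositiveFamily) (hS' : S'.IsPositiveFamily)
    (φ : CobFam.TwoCell S S') :
    op S hS ≫ functor.map φ.onY =
      (SH.map φ.onBase (fun b => congrArg (d * ·) (φ.relEuler_eq F b)) ⊗ₘ functor.map φ.onX) ≫
        op S' hS'
  /-- The gluing axiom. The conditions `h` and `hχ` always hold. -/
  gluing {X Y Z : HGraph.{u}} {B C : KSpace.{u}} (S : CobFam X Y B) (T : CobFam Y Z C)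
    (hS : S.IsPositiveFamily) (hT : T.IsPositiveFamily) (h : (T.comp S).IsPositiveFamily)
    (hχ : ∀ p : C.prod B, d * (T.comp S).relEuler F p =
      d * T.relEuler F (fst p) + d * S.relEuler F (snd p)) :
    SH F C _ ◁ op S hS ≫ op T hT =
      (α_ _ _ _).inv ≫ (SH.cross (fun c => d * T.relEuler F c) (fun b => d * S.relEuler F b) ≫
        SH.map (ContinuousMap.id (C.prod B)) hχ) ▷ functor.obj X ≫ op (T.comp S) h
  /-- The identity axiom. The conditions `h` and `hχ` always hold. -/
  identity (X : HGraph.{u}) (h : (CobFam.cylinder X).IsPositiveFamily)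
    (hχ : ∀ b : KSpace.pt, d * (CobFam.cylinder X).relEuler F b = 0) :
    (unitClass F ≫ SH.map (ContinuousMap.id KSpace.pt) hχ) ▷ functor.obj X ≫
      op (CobFam.cylinder X) h = (λ_ _).hom
  /-- The monoidality axiom. The conditions `h` and `hχ` always hold. -/
  monoidality {X X' Y Y' : HGraph.{u}} {B B' : KSpace.{u}} (S : CobFam X Y B)
    (S' : CobFam X' Y' B') (hS : S.IsPositiveFamily) (hS' : S'.IsPositiveFamily)
    (h : (S.sum S').IsPositiveFamily)
    (hχ : ∀ p : B.prod B', d * (S.sum S').relEuler F p =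
      d * S.relEuler F (fst p) + d * S'.relEuler F (snd p)) :
    (op S hS ⊗ₘ op S' hS') ≫ Functor.LaxMonoidal.μ functor Y Y' =
      tensorμ _ _ _ _ ≫
        ((SH.cross (fun b => d * S.relEuler F b) (fun b => d * S'.relEuler F b) ≫
          SH.map (ContinuousMap.id (B.prod B')) hχ) ⊗ₘ Functor.LaxMonoidal.μ functor X X') ≫
        op (S.sum S') h

attribute [instance] PosHHGFT.braided

end HGFT

namespace HGFT

open KSpace

/-! ### The push-pull diagram -/

/-- An h-graph as a family over a point, with degree shift zero. -/
def HGraph.fam (X : HGraph.{u}) : Fam KSpace.pt.{u} where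
  total := X.space
  proj := ⟨fun _ => star, continuous_const⟩
  shift _ := 0

/-- The trivial family over `B` with fibre `X`, with degree shift `m`. -/
def HGraph.trivialFam (X : HGraph.{u}) (B : KSpace.{u}) (m : B → ℤ) : Fam B where
  total := B.prod X.space
  proj := ⟨fst, KSpace.continuous_fst⟩
  shift := m

/-- The morphism `(Y, 0) → (X, 0)` over a point given by a map `X → Y`. -/
def HGraph.vert {X Y : HGraph.{u}} (f : X ⟶ Y) : Y.fam.obj ⟶ X.fam.obj :=
  FopHom.ofInv (ContinuousMap.id KSpace.pt) (ContinuousMap.id KSpace.pt) (fun _ => rfl)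
    (HGraph.toMap f) fun _ => rfl

/-- The comparison `(X, 0) ⊗ (Y, 0) → (X ⊔ Y, 0)`, which covers `pt × pt → pt`. -/
def HGraph.unionHom (X Y : HGraph.{u}) : (X.fam.tensor Y.fam).obj ⟶ (X ⊗ Y).fam.obj :=
  FopHom.ofInv (X := (X.fam.tensor Y.fam).obj) (Y := (X ⊗ Y).fam.obj)
    ⟨fun _ => star, continuous_const⟩ ⟨fun _ => pair star star, continuous_const⟩ (fun _ => rfl)
    ⟨elim (X := X.space) (Y := Y.space) (fun x => inl (pair x star)) (fun y => inr (pair star y)),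
      continuous_elim
        (KSpace.continuous_inl.comp (continuous_pair continuous_id continuous_const))
        (KSpace.continuous_inr.comp (continuous_pair continuous_const continuous_id))⟩
    (by rintro (x | y) <;> rfl)

namespace CobFam

variable {X Y : HGraph.{u}} {B : KSpace.{u}}

/-- The family of h-graphs underlying a family of cobordisms, with degree shift zero. -/
def fam (S : CobFam X Y B) : Fam B where
  total := S.total
  proj := S.proj
  shift _ := 0

/-- The morphism `α_S` from `(∅_B, m) ⊗ (X, 0)` to the trivial family, for any shift `m`. -/
def alpha (X : HGraph.{u}) (B : KSpace.{u}) (m : B → ℤ) :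
    ((emptyFam B m).tensor X.fam).obj ⟶ (X.trivialFam B m).obj :=
  FopHom.ofInv (X := ((emptyFam B m).tensor X.fam).obj) (Y := (X.trivialFam B m).obj)
    ⟨fst, KSpace.continuous_fst⟩
    ⟨fun b => pair b star, continuous_pair continuous_id continuous_const⟩ (fun _ => rfl)
    ⟨inr, KSpace.continuous_inr⟩ fun _ => rfl

/-- The horizontal morphism `β_S`, given by the incoming boundary. -/
def beta (S : CobFam X Y B) (m : B → ℤ) : HorMap S.fam (X.trivialFam B m) :=
  ⟨S.inn, S.proj_inn⟩

/-- The morphism `γ_S` from `(S, 0)` to `(Y, 0)`, given by the outgoing boundary. -/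
def gamma (S : CobFam X Y B) : S.fam.obj ⟶ Y.fam.obj where
  base := ⟨fun _ => star, continuous_const⟩
  map := ⟨fun z => S.out (pair (Pullback.fst z) (Pullback.snd z)),
    S.out.continuous.comp (continuous_pair Pullback.continuous_fst Pullback.continuous_snd)⟩
  proj_map _ := S.proj_out _

end CobFam

end HGFT

namespace HGFT

/-! ### Homotopy equivalences -/

section HomotopyEquiv

variable {X Y Z W : Type*} [TopologicalSpace X] [TopologicalSpace Y] [TopologicalSpace Z]
  [TopologicalSpace W]

lemma IsHomotopyEquiv.id : IsHomotopyEquiv (ContinuousMap.id X) :=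
  .of_inv _ (ContinuousMap.id X) (fun _ => rfl) fun _ => rfl

lemma IsHomotopyEquiv.congr {f g : C(X, Y)} (hf : IsHomotopyEquiv f) (h : f.Homotopic g) :
    IsHomotopyEquiv g := by
  obtain ⟨k, h₁, h₂⟩ := hf
  exact ⟨k, ((ContinuousMap.Homotopic.refl k).comp h.symm).trans h₁,
    (h.symm.comp (ContinuousMap.Homotopic.refl k)).trans h₂⟩

lemma IsHomotopyEquiv.of_one_sided {f : C(X, Y)} {l r : C(Y, X)}
    (hl : (l.comp f).Homotopic (ContinuousMap.id X))
    (hr : (f.comp r).Homotopic (ContinuousMap.id Y)) : IsHomotopyEquiv f := by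
  refine ⟨l, hl, ?_⟩
  have h : l.Homotopic r := by
    have h₁ : ((l.comp f).comp r).Homotopic r := hl.comp (.refl r)
    have h₂ : (l.comp (f.comp r)).Homotopic l := (ContinuousMap.Homotopic.refl l).comp hr
    exact h₂.symm.trans h₁
  exact ((ContinuousMap.Homotopic.refl f).comp h).trans hr

lemma IsHomotopyEquiv.of_comp_left {f : C(X, Y)} {g : C(Y, Z)} (hg : IsHomotopyEquiv g)
    (h : IsHomotopyEquiv (g.comp f)) : IsHomotopyEquiv f := by
  obtain ⟨g', h₁, h₂⟩ := hg
  refine IsHomotopyEquiv.congr (f := (g'.comp (g.comp f))) (.comp ⟨g, h₂, h₁⟩ h) ?_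
  exact h₁.comp (ContinuousMap.Homotopic.refl f)

lemma IsHomotopyEquiv.of_comp_right {f : C(X, Y)} {g : C(Y, Z)} (hf : IsHomotopyEquiv f)
    (h : IsHomotopyEquiv (g.comp f)) : IsHomotopyEquiv g := by
  obtain ⟨f', h₁, h₂⟩ := hf
  refine IsHomotopyEquiv.congr (f := (g.comp f).comp f') (.comp h ⟨f, h₂, h₁⟩) ?_
  exact (ContinuousMap.Homotopic.refl g).comp h₂

lemma IsHomotopyEquiv.of_two_of_six {f : C(X, Y)} {g : C(Y, Z)} {h : C(Z, W)}
    (h₁ : IsHomotopyEquiv (g.comp f)) (h₂ : IsHomotopyEquiv (h.comp g)) : IsHomotopyEquiv g := by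
  obtain ⟨a, -, ha⟩ := h₁
  obtain ⟨b, hb, -⟩ := h₂
  exact .of_one_sided (l := b.comp h) (r := f.comp a) hb ha

lemma IsHomotopyEquiv.homeo (e : X ≃ₜ Y) : IsHomotopyEquiv (e : C(X, Y)) :=
  .of_inv _ (e.symm : C(Y, X)) e.symm_apply_apply e.apply_symm_apply

lemma IsHomotopyEquiv.isPositive {f : C(X, Y)} (hf : IsHomotopyEquiv f) : IsPositive f := by
  obtain ⟨g, -, ⟨H⟩⟩ := hf
  exact fun y => ⟨g y, ⟨⟨⟨fun t => H (t, y), by fun_prop⟩, by simp, by simp⟩⟩⟩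

lemma Homotopic.of_map {f g : C(X, Y)} (H : C(X × I, Y)) (h₀ : ∀ x, H (x, 0) = f x)
    (h₁ : ∀ x, H (x, 1) = g x) : f.Homotopic g :=
  ⟨⟨⟨fun p => H (p.2, p.1), by fun_prop⟩, h₀, h₁⟩⟩

lemma Homotopic.exists_map {f g : C(X, Y)} (h : f.Homotopic g) :
    ∃ H : C(X × I, Y), (∀ x, H (x, 0) = f x) ∧ ∀ x, H (x, 1) = g x := by
  obtain ⟨H⟩ := h
  exact ⟨⟨fun p => H (p.2, p.1), by fun_prop⟩, fun x => H.map_zero_left x,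
    fun x => H.map_one_left x⟩

end HomotopyEquiv

/-! ### Double mapping cylinders -/

namespace DoubleCylinder

variable {A X B Z A' X' B' : Type*} [TopologicalSpace A] [TopologicalSpace X] [TopologicalSpace B]
  [TopologicalSpace Z] [TopologicalSpace A'] [TopologicalSpace X'] [TopologicalSpace B']

section Basic

variable (f : A → X) (g : A → B)

/-- The inclusion of the first end. -/
def inX : C(X, DoubleCylinder f g) :=
  ⟨fun x => Quot.mk _ (Sum.inl x), continuous_quot_mk.comp continuous_inl⟩

/-- The inclusion of the second end. -/
def inB : C(B, DoubleCylinder f g) :=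
  ⟨fun b => Quot.mk _ (Sum.inr (Sum.inr b)),
    continuous_quot_mk.comp (continuous_inr.comp continuous_inr)⟩

/-- The cylinder. -/
def cyl : C(A × I, DoubleCylinder f g) :=
  ⟨fun p => Quot.mk _ (Sum.inr (Sum.inl p)),
    continuous_quot_mk.comp (continuous_inr.comp continuous_inl)⟩

variable {f g}

@[simp] lemma cyl_zero (a : A) : cyl f g (a, 0) = inX f g (f a) := Quot.sound (.zero a)

@[simp] lemma cyl_one (a : A) : cyl f g (a, 1) = inB f g (g a) := Quot.sound (.one a)

@[elab_as_elim]
lemma ind {p : DoubleCylinder f g → Prop} (hX : ∀ x, p (inX f g x)) (hc : ∀ z, p (cyl f g z))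
    (hB : ∀ b, p (inB f g b)) (d) : p d := by
  obtain ⟨x | z | b⟩ := d
  exacts [hX x, hc z, hB b]

/-- A map out of the double mapping cylinder. -/
def desc (h : C(X, Z)) (k : C(A × I, Z)) (l : C(B, Z)) (h₀ : ∀ a, k (a, 0) = h (f a))
    (h₁ : ∀ a, k (a, 1) = l (g a)) : C(DoubleCylinder f g, Z) where
  toFun := Quot.lift (Sum.elim h (Sum.elim k l)) (by
    rintro _ _ (a | a)
    exacts [h₀ a, h₁ a])
  continuous_toFun := continuous_quot_lift _ (by fun_prop)

lemma exists_desc_homotopy (H : C(X × I, Z)) (K : C((A × I) × I, Z)) (L : C(B × I, Z))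
    (h₀ : ∀ a t, K ((a, 0), t) = H (f a, t)) (h₁ : ∀ a t, K ((a, 1), t) = L (g a, t)) :
    ∃ G : C(DoubleCylinder f g × I, Z), (∀ x t, G (inX f g x, t) = H (x, t)) ∧
      (∀ z t, G (cyl f g z, t) = K (z, t)) ∧ ∀ b t, G (inB f g b, t) = L (b, t) :=
  ⟨(desc (f := f) (g := g) H.curry K.curry L.curry (fun a => ContinuousMap.ext (h₀ a))
    fun a => ContinuousMap.ext (h₁ a)).uncurry, fun _ _ => rfl, fun _ _ => rfl, fun _ _ => rfl⟩

lemma homotopic_of {φ ψ : C(DoubleCylinder f g, Z)} (H : C(X × I, Z)) (K : C((A × I) × I, Z))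
    (L : C(B × I, Z)) (h₀ : ∀ a t, K ((a, 0), t) = H (f a, t))
    (h₁ : ∀ a t, K ((a, 1), t) = L (g a, t)) (H₀ : ∀ x, H (x, 0) = φ (inX f g x))
    (H₁ : ∀ x, H (x, 1) = ψ (inX f g x)) (K₀ : ∀ z, K (z, 0) = φ (cyl f g z))
    (K₁ : ∀ z, K (z, 1) = ψ (cyl f g z)) (L₀ : ∀ b, L (b, 0) = φ (inB f g b))
    (L₁ : ∀ b, L (b, 1) = ψ (inB f g b)) : φ.Homotopic ψ := by
  obtain ⟨G, h₁, h₂, h₃⟩ := exists_desc_homotopy H K L h₀ h₁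
  refine Homotopic.of_map G (fun d => ?_) fun d => ?_
  · induction d using ind with
    | hX x => rw [h₁, H₀]
    | hc z => rw [h₂, K₀]
    | hB b => rw [h₃, L₀]
  · induction d using ind with
    | hX x => rw [h₁, H₁]
    | hc z => rw [h₂, K₁]
    | hB b => rw [h₃, L₁]

/-- Functoriality of the double mapping cylinder. -/
def map {f' : A' → X'} {g' : A' → B'} (eA : C(A, A')) (eX : C(X, X')) (eB : C(B, B'))
    (hf : ∀ a, f' (eA a) = eX (f a)) (hg : ∀ a, g' (eA a) = eB (g a)) :
    C(DoubleCylinder f g, DoubleCylinder f' g') :=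
  desc ((inX f' g').comp eX) ((cyl f' g').comp (eA.prodMap (.id _))) ((inB f' g').comp eB)
    (fun a => by simp [hf]) fun a => by simp [hg]

end Basic

/-- Gluing of two maps on the two half lines. -/
lemma continuous_ite_le {T : Type*} [TopologicalSpace T] {w : T → ℝ} (hw : Continuous w)
    {a b : T → Z} (ha : Continuous a) (hb : Continuous b) (h : ∀ t, w t = 0 → a t = b t) :
    Continuous fun t => if w t ≤ 0 then a t else b t :=
  Continuous.if_le ha hb hw continuous_const h

/-- The clamping map to the unit interval. -/
noncomputable abbrev clamp (t : ℝ) : I := Set.projIcc 0 1 zero_le_one t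

lemma continuous_clamp : Continuous clamp := continuous_projIcc

@[simp] lemma clamp_zero : clamp 0 = 0 := Set.projIcc_left _
@[simp] lemma clamp_one : clamp 1 = 1 := Set.projIcc_right _

section Change

variable {f f' : A → X} {g : A → B}

/-- The path in the double cylinder that first runs along a homotopy of `f` and then along the
cylinder. -/
noncomputable def prolong (M : C(A × I, X)) (hM : ∀ a, M (a, 1) = f' a) :
    C(A × ℝ, DoubleCylinder f' g) where
  toFun p := if p.2 ≤ 0 then inX f' g (M (p.1, clamp (1 + p.2))) else cyl f' g (p.1, clamp p.2)
  continuous_toFun := by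
    have := continuous_clamp
    refine continuous_ite_le continuous_snd (by fun_prop) (by fun_prop) fun p hp => ?_
    rw [hp, add_zero, clamp_one, clamp_zero, cyl_zero, hM]

variable (M : C(A × I, X)) (h0 : ∀ a, M (a, 0) = f a) (h1 : ∀ a, M (a, 1) = f' a)

lemma prolong_of_nonpos (a : A) (w : ℝ) (hw : w ≤ 0) :
    prolong (g := g) M h1 (a, w) = inX f' g (M (a, clamp (1 + w))) := if_pos hw

lemma prolong_of_nonneg (a : A) (w : ℝ) (hw : 0 ≤ w) :
    prolong (g := g) M h1 (a, w) = cyl f' g (a, clamp w) := by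
  rcases hw.eq_or_lt with rfl | h
  · rw [prolong_of_nonpos M h1 a 0 le_rfl]
    simp [h1]
  · exact if_neg (not_le.2 h)

@[simp] lemma prolong_one (a : A) : prolong (g := g) M h1 (a, 1) = inB f' g (g a) := by
  rw [prolong_of_nonneg M h1 a 1 zero_le_one]; simp

/-- The comparison of double cylinders given by a homotopy. -/
noncomputable def change : C(DoubleCylinder f g, DoubleCylinder f' g) :=
  desc (inX f' g) ⟨fun p => prolong M h1 (p.1, 2 * p.2 - 1), by fun_prop⟩ (inB f' g)
    (fun a => by
      change prolong M h1 (a, 2 * ((0 : I) : ℝ) - 1) = _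
      rw [prolong_of_nonpos _ _ _ _ (by norm_num)]
      norm_num [h0])
    fun a => by
      change prolong M h1 (a, 2 * ((1 : I) : ℝ) - 1) = _
      norm_num

lemma change_comp_change (M' : C(A × I, X)) (hM' : ∀ a t, M' (a, t) = M (a, unitInterval.symm t)) :
    ((change (g := g) M' (fun a => by rw [hM', unitInterval.symm_zero, h1])
      (fun a => by rw [hM', unitInterval.symm_one, h0])).comp (change M h0 h1)).Homotopic
      (ContinuousMap.id (DoubleCylinder f g)) := by
  have h1' : ∀ a, M' (a, 1) = f a := fun a => by rw [hM', unitInterval.symm_one, h0]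
  have key : ∀ (a : A) (s : ℝ), 0 ≤ s → s ≤ 1 →
      M' (a, clamp (1 + -s)) = M (a, clamp s) := by
    intro a s hs hs'
    rw [hM']
    congr 2
    ext
    rw [unitInterval.coe_symm_eq, clamp, clamp, Set.projIcc_of_mem _ ⟨hs, hs'⟩,
      Set.projIcc_of_mem (x := 1 + -s) _ ⟨by linarith, by linarith⟩]
    ring
  refine homotopic_of ⟨fun p => inX f g p.1, by fun_prop⟩
    ⟨fun p => prolong M' h1' (p.1.1, (1 - p.2) * max (-2 * (p.1.2 : ℝ)) (4 * p.1.2 - 3) +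
      p.2 * p.1.2), by fun_prop⟩ ⟨fun p => inB f g p.1, by fun_prop⟩ ?_ ?_ (fun _ => rfl)
      (fun _ => rfl) ?_ ?_ (fun _ => rfl) (fun _ => rfl)
  · intro a t
    simp only [ContinuousMap.coe_mk, Set.Icc.coe_zero]
    norm_num
    rw [prolong_of_nonpos _ _ _ _ le_rfl]
    simp [h1']
  · intro a t
    simp only [ContinuousMap.coe_mk, Set.Icc.coe_one]
    rw [show (1 - (t : ℝ)) * max (-2 * 1) (4 * 1 - 3) + t * 1 = 1 by norm_num]
    simp
  · rintro ⟨a, t⟩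
    have e : ((change (g := g) M' (fun a => by rw [hM', unitInterval.symm_zero, h1]) h1').comp
      (change M h0 h1)) (cyl f g (a, t)) = change (g := g) M' (fun a => by
        rw [hM', unitInterval.symm_zero, h1]) h1' (prolong M h1 (a, 2 * t - 1)) := rfl
    rw [e]
    have ht := t.2.1
    have ht' := t.2.2
    simp only [ContinuousMap.coe_mk, Set.Icc.coe_zero, sub_zero, one_mul, zero_mul, add_zero]
    rcases le_total (t : ℝ) (1 / 2) with h | h
    · rw [max_eq_left (by linarith), prolong_of_nonpos _ _ _ _ (by linarith),
        prolong_of_nonpos _ _ _ _ (by linarith)]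
      have := key a (2 * t) (by linarith) (by linarith)
      rw [neg_mul, this]
      change _ = inX f g _
      congr 4
      ring
    · rw [max_eq_right (by linarith), prolong_of_nonneg _ _ _ (2 * (t : ℝ) - 1) (by linarith)]
      change _ = prolong M' h1' (a, 2 * (clamp (2 * (t : ℝ) - 1) : I) - 1)
      rw [clamp, Set.projIcc_of_mem _ (x := 2 * (t : ℝ) - 1) ⟨by linarith, by linarith⟩]
      congr 2
      ring
  · rintro ⟨a, t⟩
    simp only [ContinuousMap.coe_mk, Set.Icc.coe_one, sub_self, zero_mul, zero_add, one_mul]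
    rw [prolong_of_nonneg _ _ _ _ t.2.1]
    simp

lemma isHomotopyEquiv_change : IsHomotopyEquiv (change (g := g) M h0 h1) := by
  let M' : C(A × I, X) := ⟨fun p => M (p.1, unitInterval.symm p.2), by fun_prop⟩
  exact ⟨_, change_comp_change M h0 h1 M' fun _ _ => rfl,
    change_comp_change M' _ _ M fun a t => by simp [M']⟩

end Change

section Push

variable {f : A → X} {f' : A → X'} {g : A → B}

/-- The map of double cylinders induced by a map on the first end. -/
def push (v : C(X, X')) (hv : ∀ a, f' a = v (f a)) :
    C(DoubleCylinder f g, DoubleCylinder f' g) :=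
  map (.id A) v (.id B) hv fun _ => rfl

lemma isHomotopyEquiv_push_of_homotopic {f' : A → X} (hf : Continuous f) (v : C(X, X))
    (hv : ∀ a, f' a = v (f a)) (h : v.Homotopic (.id X)) :
    IsHomotopyEquiv (push (g := g) v hv) := by
  obtain ⟨L, L0, L1⟩ := Homotopic.exists_map h
  let M : C(A × I, X) := ⟨fun p => L (f p.1, p.2), by fun_prop⟩
  have h0 : ∀ a, M (a, 0) = f' a := fun a => (L0 _).trans (hv a).symm
  have h1 : ∀ a, M (a, 1) = f a := fun a => L1 _
  refine IsHomotopyEquiv.of_comp_left (isHomotopyEquiv_change (g := g) M h0 h1)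
    (IsHomotopyEquiv.id.congr (ContinuousMap.Homotopic.symm ?_))
  refine homotopic_of ⟨fun p => inX f g (L p), by fun_prop⟩
    ⟨fun p => prolong M h1 (p.1.1, (1 - p.1.2) * (p.2 - 1) + p.1.2), by fun_prop⟩
    ⟨fun p => inB f g p.1, by fun_prop⟩ ?_ ?_ (fun x => congrArg (inX f g) (L0 x))
    (fun x => congrArg (inX f g) (L1 x)) ?_ ?_ (fun _ => rfl) (fun _ => rfl)
  · intro a t
    simp only [ContinuousMap.coe_mk, Set.Icc.coe_zero]
    rw [prolong_of_nonpos _ _ _ _ (by linarith [t.2.2])]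
    simp [M]
  · intro a t
    simp
  · rintro ⟨a, t⟩
    change _ = prolong M h1 (a, 2 * t - 1)
    simp only [ContinuousMap.coe_mk, Set.Icc.coe_zero]
    congr 2
    ring
  · rintro ⟨a, t⟩
    simp only [ContinuousMap.coe_mk, Set.Icc.coe_one, sub_self, mul_zero, zero_add]
    rw [prolong_of_nonneg _ _ _ _ t.2.1]
    simp

lemma isHomotopyEquiv_inB_id (g : C(A, B)) : IsHomotopyEquiv (inB (_root_.id : A → A) g) := by
  let r : C(DoubleCylinder (_root_.id : A → A) g, B) :=
    desc g (g.comp .fst) (.id B) (fun _ => rfl) fun _ => rfl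
  refine ⟨r, .refl _, ?_⟩
  refine homotopic_of ⟨fun p => cyl _root_.id g (p.1, unitInterval.symm p.2), by fun_prop⟩
    ⟨fun p => cyl _root_.id g (p.1.1, max p.1.2 (unitInterval.symm p.2)), by fun_prop⟩
    ⟨fun p => inB _root_.id g p.1, by fun_prop⟩ ?_ ?_ ?_ ?_ ?_ ?_ (fun _ => rfl) (fun _ => rfl)
  · intro a t
    simp only [ContinuousMap.coe_mk]
    rw [max_eq_right unitInterval.nonneg']
    rfl
  · intro a t
    simp only [ContinuousMap.coe_mk]
    rw [max_eq_left unitInterval.le_one']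
    simp
  · intro a; simp only [ContinuousMap.coe_mk, unitInterval.symm_zero, cyl_one]; rfl
  · intro a; simp
  · rintro ⟨a, t⟩
    simp only [ContinuousMap.coe_mk, unitInterval.symm_zero]
    rw [max_eq_right unitInterval.le_one', cyl_one]
    rfl
  · rintro ⟨a, t⟩
    simp only [ContinuousMap.coe_mk, unitInterval.symm_one]
    rw [max_eq_left unitInterval.nonneg']
    simp

lemma isHomotopyEquiv_inB (f : C(A, X)) (g : C(A, B)) (hf : IsHomotopyEquiv f) :
    IsHomotopyEquiv (inB f g) := by
  obtain ⟨r, h₁, h₂⟩ := hf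
  let p₁ : C(DoubleCylinder f g, DoubleCylinder (r.comp f) g) := push r fun _ => rfl
  let p₂ : C(DoubleCylinder (r.comp f) g, DoubleCylinder (f.comp (r.comp f)) g) :=
    push f fun _ => rfl
  let p₃ : C(DoubleCylinder (f.comp (r.comp f)) g,
    DoubleCylinder (r.comp (f.comp (r.comp f))) g) := push r fun _ => rfl
  have e₁ : p₂.comp p₁ = push (f.comp r) fun _ => rfl :=
    ContinuousMap.ext fun d => by induction d using ind <;> rfl
  have e₂ : p₃.comp p₂ = push (r.comp f) fun _ => rfl :=
    ContinuousMap.ext fun d => by induction d using ind <;> rfl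
  have k₁ : IsHomotopyEquiv (p₂.comp p₁) := by
    rw [e₁]
    exact isHomotopyEquiv_push_of_homotopic f.continuous _ _ h₂
  have k₂ : IsHomotopyEquiv (p₃.comp p₂) := by
    rw [e₂]
    exact isHomotopyEquiv_push_of_homotopic (r.comp f).continuous _ _ h₁
  have k₃ := IsHomotopyEquiv.of_comp_left (IsHomotopyEquiv.of_two_of_six k₁ k₂) k₁
  refine .of_comp_left k₃ ?_
  let p₀ : C(DoubleCylinder (_root_.id : A → A) g, DoubleCylinder (r.comp f) g) :=
    push (r.comp f) fun _ => rfl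
  exact IsHomotopyEquiv.comp (g := p₀) (f := inB _ g)
    (isHomotopyEquiv_push_of_homotopic continuous_id _ _ h₁) (isHomotopyEquiv_inB_id g)

/-- The flip of the double mapping cylinder. -/
def flip (f : A → X) (g : A → B) : C(DoubleCylinder f g, DoubleCylinder g f) :=
  desc (inB g f) ⟨fun p => cyl g f (p.1, unitInterval.symm p.2), by fun_prop⟩ (inX g f)
    (fun a => by simp) fun a => by simp

lemma flip_flip (f : A → X) (g : A → B) (d : DoubleCylinder f g) : flip g f (flip f g d) = d := by
  induction d using ind with
  | hX x => rfl
  | hc z =>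
    change cyl f g (z.1, unitInterval.symm (unitInterval.symm z.2)) = _
    rw [unitInterval.symm_symm]
  | hB b => rfl

lemma isHomotopyEquiv_inX (f : C(A, X)) (g : C(A, B)) (hg : IsHomotopyEquiv g) :
    IsHomotopyEquiv (inX f g) :=
  IsHomotopyEquiv.comp (g := flip g f) (f := inB g f) (.of_inv _ (flip f g) (flip_flip _ _)
    (flip_flip _ _)) (isHomotopyEquiv_inB g f hg)

end Push

end DoubleCylinder

/-! ### Homotopy cofibre squares -/

section Squares

open DoubleCylinder

variable {A X B Y A' X' B' Y' : Type*} [TopologicalSpace A] [TopologicalSpace X]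
  [TopologicalSpace B] [TopologicalSpace Y] [TopologicalSpace A'] [TopologicalSpace X']
  [TopologicalSpace B'] [TopologicalSpace Y']

lemma IsHomotopyCofibreSquare.of_isHomotopyEquiv {f : C(A, X)} {g : C(A, B)} {h : C(X, Y)}
    {k : C(B, Y)} (comm : ∀ a, h (f a) = k (g a)) (hf : IsHomotopyEquiv f)
    (hk : IsHomotopyEquiv k) : IsHomotopyCofibreSquare f g h k :=
  ⟨comm, .of_comp_right (isHomotopyEquiv_inB f g hf) hk⟩

lemma IsHomotopyCofibreSquare.of_isHomotopyEquiv' {f : C(A, X)} {g : C(A, B)} {h : C(X, Y)}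
    {k : C(B, Y)} (comm : ∀ a, h (f a) = k (g a)) (hg : IsHomotopyEquiv g)
    (hh : IsHomotopyEquiv h) : IsHomotopyCofibreSquare f g h k :=
  ⟨comm, .of_comp_right (isHomotopyEquiv_inX f g hg) hh⟩

/-- Homotopy cofibre squares are invariant under homeomorphisms of the corners. -/
lemma IsHomotopyCofibreSquare.of_homeo {f : C(A, X)} {g : C(A, B)} {h : C(X, Y)} {k : C(B, Y)}
    {f' : C(A', X')} {g' : C(A', B')} {h' : C(X', Y')} {k' : C(B', Y')}
    (H : IsHomotopyCofibreSquare f g h k) (eA : A ≃ₜ A') (eX : X ≃ₜ X') (eB : B ≃ₜ B')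
    (eY : Y ≃ₜ Y') (hf : ∀ a, f' (eA a) = eX (f a)) (hg : ∀ a, g' (eA a) = eB (g a))
    (hh : ∀ x, h' (eX x) = eY (h x)) (hk : ∀ b, k' (eB b) = eY (k b)) :
    IsHomotopyCofibreSquare f' g' h' k' := by
  obtain ⟨comm, hc⟩ := H
  have comm' : ∀ a, h' (f' a) = k' (g' a) := fun a => by
    obtain ⟨a, rfl⟩ := eA.surjective a
    rw [hf, hg, hh, hk, comm]
  refine ⟨comm', ?_⟩
  let m : C(DoubleCylinder f g, DoubleCylinder f' g') := DoubleCylinder.map eA eX eB hf hg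
  let m' : C(DoubleCylinder f' g', DoubleCylinder f g) :=
    DoubleCylinder.map eA.symm eX.symm eB.symm
      (fun a => eX.injective (by simp [← hf])) fun a => eB.injective (by simp [← hg])
  have hm : IsHomotopyEquiv m := by
    refine .of_inv _ m' (fun d => ?_) fun d => ?_
    · induction d using ind with
      | hX x => exact congrArg (inX f g) (eX.symm_apply_apply x)
      | hc z => exact congrArg (cyl f g) (Prod.ext (eA.symm_apply_apply z.1) rfl)
      | hB b => exact congrArg (inB f g) (eB.symm_apply_apply b)
    · induction d using ind with
      | hX x => exact congrArg (inX f' g') (eX.apply_symm_apply x)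
      | hc z => exact congrArg (cyl f' g') (Prod.ext (eA.apply_symm_apply z.1) rfl)
      | hB b => exact congrArg (inB f' g') (eB.apply_symm_apply b)
  refine .of_comp_right hm ?_
  have : (cylinderMap f' g' h' k' comm').comp m = (eY : C(Y, Y')).comp
      (cylinderMap f g h k comm) := by
    refine ContinuousMap.ext fun d => ?_
    induction d using ind with
    | hX x => exact hh x
    | hc z => exact (congrArg h' (hf z.1)).trans (hh _)
    | hB b => exact hk b
  rw [this]
  exact (IsHomotopyEquiv.homeo eY).comp hc

end Squares

section HEP

open DoubleCylinder

variable {A X S P G : Type u} [TopologicalSpace A] [TopologicalSpace X] [TopologicalSpace S]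
  [TopologicalSpace P] [TopologicalSpace G]

/-- The homotopy extension property. -/
def HasHEP (i : C(A, X)) : Prop :=
  ∀ (Z : Type u) [TopologicalSpace Z] (f : C(X, Z)) (h : C(A × I, Z)),
    (∀ a, h (a, 0) = f (i a)) →
      ∃ H : C(X × I, Z), (∀ x, H (x, 0) = f x) ∧ ∀ a t, H (i a, t) = h (a, t)

/-- A square is a pushout of topological spaces. -/
structure IsPushoutSquare (i : C(A, X)) (g : C(A, S)) (h : C(X, P)) (k : C(S, P)) : Prop where
  comm : ∀ a, h (i a) = k (g a)
  exists_desc : ∀ (Z : Type u) [TopologicalSpace Z] (a : C(X, Z)) (b : C(S, Z)),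
    (∀ x, a (i x) = b (g x)) → ∃ φ : C(P, Z), (∀ x, φ (h x) = a x) ∧ ∀ s, φ (k s) = b s
  surj : ∀ p, (∃ x, h x = p) ∨ ∃ s, k s = p

lemma IsPushoutSquare.exists_homotopy {i : C(A, X)} {g : C(A, S)} {h : C(X, P)} {k : C(S, P)}
    (hP : IsPushoutSquare i g h k) {Z : Type u} [TopologicalSpace Z] (a : C(X × I, Z))
    (b : C(S × I, Z)) (hab : ∀ x t, a (i x, t) = b (g x, t)) :
    ∃ φ : C(P × I, Z), (∀ x t, φ (h x, t) = a (x, t)) ∧ ∀ s t, φ (k s, t) = b (s, t) := by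
  obtain ⟨φ, h₁, h₂⟩ := hP.exists_desc C(I, Z) a.curry b.curry
    fun x => ContinuousMap.ext (hab x)
  exact ⟨φ.uncurry, fun x t => DFunLike.congr_fun (h₁ x) t, fun s t => DFunLike.congr_fun (h₂ s) t⟩

/-- A pushout along a map with the homotopy extension property is a homotopy pushout. -/
lemma IsPushoutSquare.isHomotopyCofibreSquare {i : C(A, X)} {g : C(A, S)} {h : C(X, P)}
    {k : C(S, P)} (hP : IsPushoutSquare i g h k) (hi : HasHEP i) :
    IsHomotopyCofibreSquare i g h k := by
  refine ⟨hP.comm, ?_⟩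
  obtain ⟨H, H0, Hi⟩ := hi (DoubleCylinder i g) (inX i g) (cyl i g) fun a => cyl_zero a
  obtain ⟨ψ, hψ₁, hψ₂⟩ := hP.exists_desc (DoubleCylinder i g)
    (H.comp ⟨fun x => (x, 1), by fun_prop⟩) (inB i g) fun a => (Hi a 1).trans (cyl_one a)
  set φ := cylinderMap i g h k hP.comm
  refine ⟨ψ, ContinuousMap.Homotopic.symm ?_, ContinuousMap.Homotopic.symm ?_⟩
  · refine homotopic_of H ⟨fun p => cyl i g (p.1.1, max p.1.2 p.2), by fun_prop⟩
      ⟨fun p => inB i g p.1, by fun_prop⟩ ?_ ?_ H0 (fun x => (hψ₁ x).symm) ?_ ?_ (fun _ => rfl)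
      fun b => (hψ₂ b).symm
    · intro a t
      rw [Hi]
      simp only [ContinuousMap.coe_mk]
      rw [max_eq_right unitInterval.nonneg']
    · intro a t
      simp only [ContinuousMap.coe_mk]
      rw [max_eq_left unitInterval.le_one', cyl_one]
    · rintro ⟨a, t⟩
      simp only [ContinuousMap.coe_mk]
      rw [max_eq_left unitInterval.nonneg']
      rfl
    · rintro ⟨a, t⟩
      simp only [ContinuousMap.coe_mk]
      rw [max_eq_right unitInterval.le_one', cyl_one]
      refine ((congrArg ψ (hP.comm a)).trans (hψ₂ _)).symm
  · obtain ⟨K, K₁, K₂⟩ := hP.exists_homotopy (φ.comp H) ⟨fun p => k p.1, by fun_prop⟩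
      fun a t => by
        refine (congrArg φ (Hi a t)).trans ?_
        exact hP.comm a
    refine Homotopic.of_map K (fun p => ?_) fun p => ?_
    · rcases hP.surj p with ⟨x, rfl⟩ | ⟨s, rfl⟩
      · rw [K₁]
        exact congrArg φ (H0 x)
      · rw [K₂]
        rfl
    · rcases hP.surj p with ⟨x, rfl⟩ | ⟨s, rfl⟩
      · rw [K₁]
        exact congrArg φ (hψ₁ x).symm
      · rw [K₂]
        exact (congrArg φ (hψ₂ s)).symm

/-- Homotopy cofibre squares can be pasted with pushouts along maps with the homotopy extension
property. -/
lemma IsHomotopyCofibreSquare.paste {Y : Type u} [TopologicalSpace Y] {a : C(A, Y)} {b : C(A, G)}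
    {i : C(Y, X)} {g : C(Y, S)} {l : C(G, S)} {h : C(X, P)} {k : C(S, P)}
    (H : IsHomotopyCofibreSquare a b g l) (hP : IsPushoutSquare i g h k) (hi : HasHEP i) :
    IsHomotopyCofibreSquare (i.comp a) b h (k.comp l) := by
  obtain ⟨comm, hκ⟩ := H
  have comm' : ∀ z, h (i.comp a z) = k.comp l (b z) := fun z =>
    (hP.comm _).trans (congrArg k (comm z))
  refine ⟨comm', ?_⟩
  set κ := cylinderMap a b g l comm
  let j : C(DoubleCylinder a b, DoubleCylinder (i.comp a) b) := push i fun _ => rfl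
  have hj : HasHEP j := by
    intro Z _ f' h' h0
    obtain ⟨T, T0, Ti⟩ := hi Z (f'.comp (inX _ b)) ⟨fun p => h' (inX a b p.1, p.2), by fun_prop⟩
      fun y => h0 (inX a b y)
    obtain ⟨Q, Q₁, Q₂, Q₃⟩ := exists_desc_homotopy (f := i.comp a) (g := b) T
      ⟨fun p => h' (cyl a b p.1, p.2), by fun_prop⟩ ⟨fun p => h' (inB a b p.1, p.2), by fun_prop⟩
      (fun z t => by
        refine Eq.trans ?_ (Ti (a z) t).symm
        exact congrArg (fun q => h' (q, t)) (cyl_zero z))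
      (fun z t => congrArg (fun q => h' (q, t)) (cyl_one z))
    refine ⟨Q, fun d => ?_, fun d t => ?_⟩
    · induction d using ind with
      | hX x => rw [Q₁, T0]; rfl
      | hc z => rw [Q₂]; exact h0 (cyl a b z)
      | hB z => rw [Q₃]; exact h0 (inB a b z)
    · induction d using ind with
      | hX x => exact (Q₁ _ _).trans (Ti x t)
      | hc z => exact Q₂ z t
      | hB z => exact Q₃ z t
  have hPO : IsPushoutSquare j κ (cylinderMap (i.comp a) b h (k.comp l) comm') k := by
    refine ⟨fun d => ?_, fun Z _ f₁ f₂ hf => ?_, fun p => ?_⟩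
    · induction d using ind with
      | hX y => exact hP.comm y
      | hc z => exact hP.comm _
      | hB z => rfl
    · obtain ⟨φ, h₁, h₂⟩ := hP.exists_desc Z (f₁.comp (inX _ b)) f₂ fun y => hf (inX a b y)
      refine ⟨φ, fun d => ?_, h₂⟩
      induction d using ind with
      | hX y => exact h₁ y
      | hc z =>
        refine (h₁ (i (a z.1))).trans ?_
        exact (hf (inX a b (a z.1))).trans (hf (cyl a b z)).symm
      | hB z => exact (h₂ (l z)).trans (hf (inB a b z)).symm
    · rcases hP.surj p with ⟨x, rfl⟩ | ⟨s, rfl⟩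
      exacts [.inl ⟨inX _ b x, rfl⟩, .inr ⟨s, rfl⟩]
  obtain ⟨_, hc⟩ := hPO.isHomotopyCofibreSquare hj
  exact hc.comp (isHomotopyEquiv_inX j κ hκ)

lemma IsHEmbedding.pushout {Y : Type u} [TopologicalSpace Y]
    {i : C(Y, X)} {g : C(Y, S)} {h : C(X, P)} {k : C(S, P)}
    (H : IsHEmbedding g) (hP : IsPushoutSquare i g h k) (hi : HasHEP i) : IsHEmbedding h := by
  obtain ⟨A, B, f, g', l, hA, hB, hs⟩ := H
  exact ⟨A, B, i.comp f, g', k.comp l, hA, hB, hs.paste hP hi⟩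

lemma IsHomotopyEquiv.isHEmbedding {f : C(X, S)} (hf : IsHomotopyEquiv f) : IsHEmbedding f := by
  let e (T : Type u) [TopologicalSpace T] : C(KSpace.empty.{u}, T) :=
    ⟨fun x => isEmptyElim x, continuous_iff_continuousAt.2 fun x => isEmptyElim x⟩
  refine ⟨KSpace.empty, KSpace.empty, e _, .id _, e _,
    ⟨0, ⟨fun x => isEmptyElim x, continuous_iff_continuousAt.2 fun x => isEmptyElim x⟩, ?_⟩,
    isHGraph_of_isEmpty _, .of_isHomotopyEquiv' (fun x => isEmptyElim x) .id hf⟩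
  exact .of_inv _ ⟨fun x => isEmptyElim x, continuous_of_discreteTopology⟩
    (fun x => isEmptyElim x) fun x => isEmptyElim x

/-- h-embeddings are invariant under homeomorphisms. -/
lemma IsHEmbedding.of_homeo {X' S' : Type u} [TopologicalSpace X'] [TopologicalSpace S']
    {f : C(X, S)} {f' : C(X', S')} (hf : IsHEmbedding f) (eX : X ≃ₜ X') (eS : S ≃ₜ S')
    (h : ∀ x, f' (eX x) = eS (f x)) : IsHEmbedding f' := by
  obtain ⟨A, B, a, g, k, hA, hB, hs⟩ := hf
  exact ⟨A, B, (eX : C(X, X')).comp a, g, (eS : C(S, S')).comp k, hA, hB,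
    hs.of_homeo (.refl _) eX (.refl _) eS (fun _ => rfl) (fun _ => rfl) h fun _ => rfl⟩

end HEP

end HGFT

namespace HGFT

open KSpace

/-! ### k-spaces and weak Hausdorff spaces -/

instance isKSpace_prod_unitInterval (A : Type u) [TopologicalSpace A] [IsKSpace A] :
    IsKSpace (A × I) := by
  constructor
  let mk : A × I → Kify (A × I) := fun p => Kify.mk p
  have hc : ∀ a, Continuous fun t : I => mk (a, t) := fun a => by
    have : Continuous fun z : PUnit.{u + 1} × I => mk (a, z.2) :=
      Kify.continuous_mk_comp (by fun_prop)
    exact this.comp (by fun_prop : Continuous fun t : I => (PUnit.unit.{u + 1}, t))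
  have : Continuous fun a => (⟨fun t => mk (a, t), hc a⟩ : C(I, Kify (A × I))) := by
    rw [IsGeneratedBy.continuous_iff compHausFamily.{u}]
    intro K k
    have h : Continuous fun z : K × I => mk (k z.1, z.2) :=
      Kify.continuous_mk_comp (by fun_prop)
    exact (ContinuousMap.curry ⟨_, h⟩).continuous
  exact ContinuousMap.continuous_uncurry_of_continuous ⟨_, this⟩

instance isKSpace_closeds (K : CompHaus.{u}) (F : TopologicalSpace.Closeds (compHausFamily K)) :
    IsKSpace F :=
  have : CompactSpace F := isCompact_iff_compactSpace.1 F.isClosed.isCompact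
  inferInstance

lemma IsWeakHausdorff.of_t2 (B : Type u) [TopologicalSpace B] [T2Space B] : IsWeakHausdorff B :=
  fun _ _ _ _ k => (isCompact_range k.continuous).isClosed

lemma IsWeakHausdorff.isClosed_singleton {B : Type u} [TopologicalSpace B]
    (h : IsWeakHausdorff B) (b : B) : IsClosed {b} := by
  have := h PUnit ⟨fun _ => b, continuous_const⟩
  rwa [ContinuousMap.coe_mk, Set.range_const] at this

@[elab_as_elim]
lemma fibre_ind {E B : KSpace.{u}} {p : C(E, B)} {b : B} {motive : fibre p b → Prop}
    (mk : ∀ e (h : p e = b), motive (fibreMk e h)) (z) : motive z :=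
  mk (fibreVal z) (fibre_cond z)

lemma isClosedEmbedding_fibreVal {E B : KSpace.{u}} (p : C(E, B)) {b : B}
    (hb : IsClosed ({b} : Set B)) : IsClosedEmbedding (fibreVal : fibre p b → E) := by
  have hF : IsClosed {e | p e = b} := hb.preimage p.continuous
  have : IsKSpace {e : E // p e = b} := hF.isGeneratedBy
  have h : IsClosedEmbedding (Subtype.val : {e : E // p e = b} → E) := hF.isClosedEmbedding_subtypeVal
  exact h.comp (IsGeneratedBy.homeomorph (X := compHausFamily.{u})).isClosedEmbedding

/-! ### Partial maps with values in a fibre -/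

/-- The space `Z` together with a point that is dense open. -/
def Cone (Z : Type u) : Type u := Option Z

namespace Cone

variable {Z : Type u}

/-- The inclusion of `Z`. -/
def of (z : Z) : Cone Z := some z

/-- The additional point. -/
def tip : Cone Z := none

lemma of_injective : Function.Injective (of : Z → Cone Z) := Option.some_injective _

lemma tip_ne_of (z : Z) : (tip : Cone Z) ≠ of z := fun h => by cases h

variable [TopologicalSpace Z]

instance : TopologicalSpace (Cone Z) :=
  TopologicalSpace.generateFrom {U | ∃ C : Set Z, IsClosed C ∧ U = (of '' C)ᶜ}

lemma continuous_iff {T : Type*} [TopologicalSpace T] {f : T → Cone Z} :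
    Continuous f ↔ ∀ C : Set Z, IsClosed C → IsClosed {t | ∃ z ∈ C, f t = of z} := by
  have e : ∀ C : Set Z, {t | ∃ z ∈ C, f t = of z}ᶜ = f ⁻¹' (of '' C)ᶜ := fun C => by
    ext t
    exact not_congr (exists_congr fun z => and_congr_right fun _ => eq_comm)
  rw [continuous_generateFrom_iff]
  constructor
  · intro h C hC
    rw [← isOpen_compl_iff, e]
    exact h _ ⟨C, hC, rfl⟩
  · rintro h _ ⟨C, hC, rfl⟩
    rw [← e, isOpen_compl_iff]
    exact h C hC

lemma continuous_of_comp_of {T : Type*} [TopologicalSpace T] {f : T → Z}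
    (h : Continuous fun t => of (f t)) : Continuous f := by
  rw [continuous_iff_isClosed]
  intro C hC
  convert continuous_iff.1 h C hC using 1
  ext t
  exact ⟨fun h => ⟨_, h, rfl⟩, fun ⟨z, hz, h⟩ => Set.mem_preimage.2 ((of_injective h).symm ▸ hz)⟩

end Cone

/-- The space over `B` whose fibre over `b` is `Z` and whose other fibres are points: maps into it
over `B` correspond to maps of the fibre over `b` to `Z`. -/
def partialSpace (B : KSpace.{u}) (b : B) (Z : Type u) [TopologicalSpace Z] : KSpace.{u} :=
  ⟨Kify {p : B × Cone Z // (∃ z, p.2 = Cone.of z) ↔ p.1 = b}⟩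

namespace partialSpace

variable {B : KSpace.{u}} {b : B} {Z : Type u} [TopologicalSpace Z]

/-- The projection. -/
def proj : C(partialSpace B b Z, B) := ⟨fun z => (Kify.val z).1.1, by
  exact continuous_fst.comp (continuous_subtype_val.comp Kify.continuous_val)⟩

/-- The partially defined map to `Z`. -/
def coord : C(partialSpace B b Z, Cone Z) := ⟨fun z => (Kify.val z).1.2, by
  exact continuous_snd.comp (continuous_subtype_val.comp Kify.continuous_val)⟩

lemma exists_coord_eq (z : partialSpace B b Z) : (∃ w, coord z = Cone.of w) ↔ proj z = b :=
  (Kify.val z).2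

open Classical in
/-- The map with prescribed values on the part over `b`. -/
noncomputable def lift {T : Type u} [TopologicalSpace T] [IsKSpace T] (q : C(T, B))
    (f : ∀ t, q t = b → Z)
    (hf : ∀ C : Set Z, IsClosed C → IsClosed {t | ∃ h : q t = b, f t h ∈ C}) :
    C(T, partialSpace B b Z) where
  toFun t := Kify.mk ⟨(q t, if h : q t = b then Cone.of (f t h) else Cone.tip), by
    split_ifs with h
    · simp [h]
    · exact ⟨fun ⟨z, hz⟩ => (Cone.tip_ne_of z hz).elim, fun h' => (h h').elim⟩⟩
  continuous_toFun := by
    refine Kify.continuous_mk_comp (Continuous.subtype_mk (q.continuous.prodMk ?_) _)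
    rw [Cone.continuous_iff]
    intro C hC
    convert hf C hC using 1
    ext t
    constructor
    · rintro ⟨z, hz, h⟩
      split_ifs at h with hq
      · exact ⟨hq, Cone.of_injective h ▸ hz⟩
      · exact (Cone.tip_ne_of z h).elim
    · rintro ⟨hq, h⟩
      exact ⟨_, h, dif_pos hq⟩

variable {T : Type u} [TopologicalSpace T] [IsKSpace T] (q : C(T, B))
    (f : ∀ t, q t = b → Z)
    (hf : ∀ C : Set Z, IsClosed C → IsClosed {t | ∃ h : q t = b, f t h ∈ C})

lemma coord_lift (t : T) (h : q t = b) : coord (lift q f hf t) = Cone.of (f t h) := dif_pos h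

lemma coord_lift_of_ne (t : T) (h : q t ≠ b) : coord (lift q f hf t) = Cone.tip := dif_neg h

lemma ext {z w : partialSpace B b Z} (h : proj z = proj w) (h' : coord z = coord w) : z = w :=
  Kify.ext (Subtype.ext (Prod.ext h h'))

lemma lift_eq {T' : Type u} [TopologicalSpace T'] [IsKSpace T'] (q' : C(T', B))
    (f' : ∀ t, q' t = b → Z)
    (hf' : ∀ C : Set Z, IsClosed C → IsClosed {t | ∃ h : q' t = b, f' t h ∈ C}) (t : T) (t' : T')
    (h : q t = q' t') (hh : ∀ h h', f t h = f' t' h') : lift q f hf t = lift q' f' hf' t' := by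
  refine ext h ?_
  by_cases e : q t = b
  · rw [coord_lift q f hf t e, coord_lift q' f' hf' t' (h ▸ e), hh]
  · rw [coord_lift_of_ne q f hf t e, coord_lift_of_ne q' f' hf' t' (h ▸ e)]

/-- The continuous map to `Z` given by a map into the part over `b`. -/
lemma exists_value {T : Type*} [TopologicalSpace T] (F : C(T, partialSpace B b Z))
    (h : ∀ t, proj (F t) = b) : ∃ φ : C(T, Z), ∀ t, coord (F t) = Cone.of (φ t) := by
  have hs := fun t => (exists_coord_eq (F t)).2 (h t)
  choose φ hφ using hs
  refine ⟨⟨φ, Cone.continuous_of_comp_of ?_⟩, hφ⟩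
  exact (coord.continuous.comp F.continuous).congr hφ

end partialSpace

section FibreHEP

variable {X Y B : KSpace.{u}}

lemma isClosed_fibre_mem {E B : KSpace.{u}} (p : C(E, B)) {b : B} (hb : IsClosed ({b} : Set B))
    {C : Set (fibre p b)} (hC : IsClosed C) : IsClosed {e | ∃ h : p e = b, fibreMk e h ∈ C} := by
  convert (isClosedEmbedding_fibreVal p hb).isClosedMap _ hC using 1
  ext e
  constructor
  · rintro ⟨h, hc⟩
    exact ⟨_, hc, rfl⟩
  · rintro ⟨c, hc, rfl⟩
    exact ⟨fibre_cond c, hc⟩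

lemma isClosed_fibre_prod_mem {E B : KSpace.{u}} (p : C(E, B)) {b : B}
    (hb : IsClosed ({b} : Set B)) {C : Set (fibre p b × I)} (hC : IsClosed C) :
    IsClosed {e : E × I | ∃ h : p e.1 = b, (fibreMk e.1 h, e.2) ∈ C} := by
  convert ((isClosedEmbedding_fibreVal p hb).prodMap (IsClosedEmbedding.id (X := I))).isClosedMap
    _ hC using 1
  ext e
  constructor
  · rintro ⟨h, hc⟩
    exact ⟨_, hc, rfl⟩
  · rintro ⟨c, hc, rfl⟩
    exact ⟨fibre_cond c.1, hc⟩

/-- The fibres of a closed fibrewise cofibration have the homotopy extension property. -/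
lemma IsClosedFibrewiseCofibration.hasHEP {p : C(X, B)} {q : C(Y, B)} {i : C(X, Y)}
    (hi : IsClosedFibrewiseCofibration p q i) {b : B} (hb : IsClosed ({b} : Set B)) :
    HasHEP (KSpace.fibreMap (p := p) (p' := q) (b := b) (b' := b) i
      fun x hx => (hi.1 x).trans hx) := by
  intro Z _ f h h0
  let F : C(Y, partialSpace B b Z) := partialSpace.lift q (fun y hy => f (fibreMk y hy))
    fun C hC => isClosed_fibre_mem q hb (hC.preimage f.continuous)
  let K : C(X × I, partialSpace B b Z) := partialSpace.lift (p.comp .fst)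
    (fun x hx => h (fibreMk x.1 hx, x.2))
    fun C hC => isClosed_fibre_prod_mem p hb (hC.preimage h.continuous)
  obtain ⟨H, H₁, H₂, H₃⟩ := hi.2.2 _ partialSpace.proj F K (fun _ => rfl) (fun _ _ => rfl)
    fun x => partialSpace.lift_eq _ _ _ _ _ _ _ _ (hi.1 x).symm fun e _ => h0 (fibreMk x e)
  obtain ⟨φ, hφ⟩ := partialSpace.exists_value
    (H.comp ⟨fun z : fibre q b × I => (fibreVal z.1, z.2), by fun_prop⟩)
    fun z => (H₁ _ _).trans (fibre_cond z.1)
  refine ⟨φ, fun y => ?_, fun x t => ?_⟩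
  · apply Cone.of_injective
    rw [← hφ]
    refine (congrArg partialSpace.coord (H₂ (fibreVal y))).trans ?_
    exact partialSpace.coord_lift q _ _ (fibreVal y) (fibre_cond y)
  · apply Cone.of_injective
    rw [← hφ]
    refine (congrArg partialSpace.coord (H₃ (fibreVal x) t)).trans ?_
    exact partialSpace.coord_lift (p.comp .fst) _ _ (fibreVal x, t) (fibre_cond x)

end FibreHEP

namespace CobFam

variable {X Y Z : HGraph.{u}} {B C : KSpace.{u}}

lemma IsPositiveFamily.hasHEP_innAt {S : CobFam X Y B} (hS : S.IsPositiveFamily) (b : B) :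
    HasHEP (S.innAt b) := by
  have hb := hS.family.weakHausdorff.isClosed_singleton b
  have H := hS.cofibration.hasHEP hb
  intro Z _ f h h0
  let p : C((B.prod X.space).sum (B.prod Y.space), B) :=
    ⟨elim fst fst, continuous_elim KSpace.continuous_fst KSpace.continuous_fst⟩
  let s : C(fibre p b, X.space ⊕ Y.space) := ⟨fun z => elim (X := B.prod X.space)
      (Y := B.prod Y.space) (fun x => Sum.inl (snd x)) (fun y => Sum.inr (snd y)) (fibreVal z),
    (continuous_elim (by fun_prop) (by fun_prop)).comp continuous_fibreVal⟩
  let h' : C((X.space ⊕ Y.space) × I, Z) :=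
    ⟨fun z => Sum.elim (fun x => h (x, z.2)) (fun y => f (S.outAt b y)) z.1, by
      rw [← (Homeomorph.sumProdDistrib (X := X.space) (Y := Y.space)
        (Z := I)).symm.comp_continuous_iff', continuous_sum_dom]
      exact ⟨h.continuous, f.continuous.comp ((S.outAt b).continuous.comp continuous_fst)⟩⟩
  obtain ⟨K, K₁, K₂⟩ := H Z f (h'.comp (s.prodMap (.id I))) fun z => by
    induction z using fibre_ind with | mk e hc => ?_
    rcases e with e | e
    · obtain rfl : fst e = b := hc
      exact h0 _
    · obtain rfl : fst e = b := hc
      rfl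
  refine ⟨K, K₁, fun x t => ?_⟩
  exact K₂ (fibreMk (inl (pair b x)) rfl) t

/-- The inclusion of the second factor into the fibre of a composite. -/
def compInlAt (T : CobFam Y Z C) (S : CobFam X Y B) (c : C) (b : B) :
    C(fibre S.proj b, fibre (T.comp S).proj (pair c b)) :=
  ⟨fun s => fibreMk (Quot.mk _ (inl (pair c (fibreVal s))))
    (KSpace.prod_ext rfl (fibre_cond s)), continuous_fibreMk (continuous_quot_mk.comp
      (KSpace.continuous_inl.comp (by fun_prop))) _⟩

/-- The inclusion of the first factor into the fibre of a composite. -/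
def compInrAt (T : CobFam Y Z C) (S : CobFam X Y B) (c : C) (b : B) :
    C(fibre T.proj c, fibre (T.comp S).proj (pair c b)) :=
  ⟨fun t => fibreMk (Quot.mk _ (inr (pair (fibreVal t) b)))
    (KSpace.prod_ext (fibre_cond t) rfl), continuous_fibreMk (continuous_quot_mk.comp
      (KSpace.continuous_inr.comp (by fun_prop))) _⟩

/-- The fibres of the external composite are pushouts. -/
lemma isPushoutSquare_comp (T : CobFam Y Z C) (S : CobFam X Y B) {c : C} {b : B}
    (hc : IsClosed ({c} : Set C)) (hb : IsClosed ({b} : Set B)) :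
    IsPushoutSquare (T.innAt c) (S.outAt b) (compInrAt T S c b) (compInlAt T S c b) := by
  refine ⟨fun y => ?_, fun V _ f g hfg => ?_, fun p => ?_⟩
  · exact Kify.ext (Subtype.ext (Quot.sound (CompRel.glue c b y)).symm)
  · let q₁ : C(C.prod S.total, C.prod B) := prodMap (.id _) S.proj
    let q₂ : C(T.total.prod B, C.prod B) := prodMap T.proj (.id _)
    have h₁ : ∀ D : Set V, IsClosed D →
        IsClosed {z | ∃ hz : q₁ z = pair c b, g (fibreMk (snd z) (congrArg snd hz)) ∈ D} :=
      fun D hD => by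
        convert (hc.preimage (KSpace.continuous_fst (X := C) (Y := S.total))).inter
          ((isClosed_fibre_mem S.proj hb (hD.preimage g.continuous)).preimage
            (KSpace.continuous_snd (X := C) (Y := S.total))) using 1
        ext z
        exact ⟨fun ⟨h, h'⟩ => ⟨congrArg fst h, congrArg snd h, h'⟩,
          fun ⟨h, h', h''⟩ => ⟨KSpace.prod_ext h h', h''⟩⟩
    have h₂ : ∀ D : Set V, IsClosed D →
        IsClosed {z | ∃ hz : q₂ z = pair c b, f (fibreMk (fst z) (congrArg fst hz)) ∈ D} :=
      fun D hD => by
        convert (hb.preimage (KSpace.continuous_snd (X := T.total) (Y := B))).inter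
          ((isClosed_fibre_mem T.proj hc (hD.preimage f.continuous)).preimage
            (KSpace.continuous_fst (X := T.total) (Y := B))) using 1
        ext z
        exact ⟨fun ⟨h, h'⟩ => ⟨congrArg snd h, congrArg fst h, h'⟩,
          fun ⟨h, h', h''⟩ => ⟨KSpace.prod_ext h' h, h''⟩⟩
    let F₁ := partialSpace.lift q₁ _ h₁
    let F₂ := partialSpace.lift q₂ _ h₂
    let F : C((T.comp S).total, partialSpace (C.prod B) (pair c b) V) :=
      ⟨Quot.lift (elim F₁ F₂) (by
        rintro _ _ ⟨c', b', y⟩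
        refine partialSpace.lift_eq _ _ _ _ _ _ _ _
          (KSpace.prod_ext (T.proj_inn (pair c' y)).symm (S.proj_out (pair b' y))) fun h h' => ?_
        obtain rfl : c' = c := congrArg fst h
        obtain rfl : b' = b := congrArg snd h'
        exact (hfg y).symm), continuous_quot_lift _ (continuous_elim F₁.continuous F₂.continuous)⟩
    have hF : ∀ z, partialSpace.proj (F z) = (T.comp S).proj z := by
      rintro ⟨z | z⟩ <;> rfl
    obtain ⟨φ, hφ⟩ := partialSpace.exists_value (F.comp ⟨_, continuous_fibreVal⟩)
      fun z => (hF _).trans (fibre_cond z)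
    refine ⟨φ, fun x => ?_, fun s => ?_⟩
    · apply Cone.of_injective
      rw [← hφ]
      exact partialSpace.coord_lift q₂ _ h₂ (pair (fibreVal x) b)
        (KSpace.prod_ext (q := pair c b) (fibre_cond x) rfl)
    · apply Cone.of_injective
      rw [← hφ]
      exact partialSpace.coord_lift q₁ _ h₁ (pair c (fibreVal s))
        (KSpace.prod_ext (q := pair c b) rfl (fibre_cond s))
  · induction p using fibre_ind with | mk e hp => ?_
    obtain ⟨z | z⟩ := e
    · have h₁ : fst z = c := congrArg fst hp
      have h₂ : S.proj (snd z) = b := congrArg snd hp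
      subst h₁
      exact .inr ⟨fibreMk (snd z) h₂, rfl⟩
    · have h₁ : T.proj (fst z) = c := congrArg fst hp
      have h₂ : snd z = b := congrArg snd hp
      subst h₂
      exact .inl ⟨fibreMk (fst z) h₁, rfl⟩

end CobFam

end HGFT

namespace HGFT

open KSpace

/-! ### Fibres of the standard constructions -/

section FibreHomeo

/-- An h-graph is the fibre of the corresponding family over a point. -/
def HGraph.fibreFam (X : HGraph.{u}) (b : KSpace.pt.{u}) : X.space ≃ₜ fibre X.fam.proj b where
  toFun x := fibreMk (p := X.fam.proj) x (Subsingleton.elim _ _)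
  invFun := fibreVal
  left_inv _ := rfl
  right_inv _ := rfl
  continuous_toFun := continuous_fibreMk (p := X.fam.proj) continuous_id _
  continuous_invFun := continuous_fibreVal

/-- The fibres of a trivial family. -/
def HGraph.fibreTrivial (X : HGraph.{u}) {B : KSpace.{u}} (m : B → ℤ) (b : B) :
    X.space ≃ₜ fibre (X.trivialFam B m).proj b where
  toFun x := fibreMk (p := (X.trivialFam B m).proj) (pair b x) rfl
  invFun z := snd (fibreVal z)
  left_inv _ := rfl
  right_inv z := by
    induction z using fibre_ind with | mk e h => ?_
    obtain rfl : fst e = b := h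
    rfl
  continuous_toFun := continuous_fibreMk (p := (X.trivialFam B m).proj)
    (continuous_pair continuous_const continuous_id) _
  continuous_invFun := KSpace.continuous_snd.comp continuous_fibreVal

variable {B C E : KSpace.{u}}

/-- The projection of a pullback. -/
def pullbackProj (f : C(B, C)) (p : C(E, C)) : C(Pullback f p, B) :=
  ⟨Pullback.fst, Pullback.continuous_fst⟩

/-- The fibres of a pullback. -/
def fibrePullback (f : C(B, C)) (p : C(E, C)) (b : B) :
    fibre p (f b) ≃ₜ fibre (pullbackProj f p) b where
  toFun z := fibreMk (p := pullbackProj f p) (Pullback.mk b (fibreVal z) (fibre_cond z).symm) rfl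
  invFun z := fibreMk (Pullback.snd (fibreVal z))
    ((Pullback.cond _).symm.trans (congrArg f (fibre_cond z)))
  left_inv _ := rfl
  right_inv z := by
    induction z using fibre_ind with | mk e h => ?_
    obtain rfl : Pullback.fst e = b := h
    rfl
  continuous_toFun := continuous_fibreMk (p := pullbackProj f p)
    (Pullback.continuous_mk continuous_const continuous_fibreVal _) _
  continuous_invFun := continuous_fibreMk (Pullback.continuous_snd.comp continuous_fibreVal) _

/-- The fibres of an external disjoint union. -/
def fibreTensor (X : Fam B) (Y : Fam C) (p : B.prod C) :
    (fibre X.proj (fst p) ⊕ fibre Y.proj (snd p) : Type u) ≃ₜ fibre (X.tensor Y).proj p where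
  toFun := Sum.elim
    (fun x => fibreMk (p := (X.tensor Y).proj) (inl (pair (fibreVal x) (snd p)))
      (KSpace.prod_ext (fibre_cond x) rfl))
    (fun y => fibreMk (p := (X.tensor Y).proj) (inr (pair (fst p) (fibreVal y)))
      (KSpace.prod_ext rfl (fibre_cond y)))
  invFun z := match fibreVal z, fibre_cond z with
    | Sum.inl q, h => Sum.inl (fibreMk (fst q) (congrArg fst h))
    | Sum.inr q, h => Sum.inr (fibreMk (snd q) (congrArg snd h))
  left_inv := by rintro (x | y) <;> rfl
  right_inv z := by
    induction z using fibre_ind with | mk e h => ?_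
    rcases e with q | q
    · have : snd q = snd p := congrArg snd h
      change fibreMk (p := (X.tensor Y).proj) (inl (pair (fst q) (snd p))) _ = _
      congr 1
      exact congrArg inl (KSpace.prod_ext rfl this.symm)
    · have : fst q = fst p := congrArg fst h
      change fibreMk (p := (X.tensor Y).proj) (inr (pair (fst p) (snd q))) _ = _
      congr 1
      exact congrArg inr (KSpace.prod_ext this.symm rfl)
  continuous_toFun := Continuous.sumElim
    (continuous_fibreMk (p := (X.tensor Y).proj) (KSpace.continuous_inl.comp
      (continuous_pair continuous_fibreVal continuous_const)) _)
    (continuous_fibreMk (p := (X.tensor Y).proj) (KSpace.continuous_inr.comp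
      (continuous_pair continuous_const continuous_fibreVal)) _)
  continuous_invFun := by
    let s : C({e : (X.tensor Y).total // (X.tensor Y).proj e = p},
      (X.total.prod C : Type u) ⊕ (B.prod Y.total : Type u)) := ⟨Subtype.val, continuous_subtype_val⟩
    refine Kify.continuous_of_sum s _ (fun K _ _ _ k a h => ?_) (fun K _ _ _ k a h => ?_)
    · have h' : ∀ t, X.proj (fst (a t)) = fst p := fun t =>
        (congrArg (fun e => fst ((X.tensor Y).proj e)) (h t)).symm.trans (congrArg fst (k t).2)
      refine (continuous_inl.comp (continuous_fibreMk (p := X.proj) (b := fst p)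
        (KSpace.continuous_fst.comp a.continuous) h')).congr fun t => ?_
      have : k t = ⟨Sum.inl (a t), (congrArg _ (h t)).symm.trans (k t).2⟩ := Subtype.ext (h t)
      rw [this]
      rfl
    · have h' : ∀ t, Y.proj (snd (a t)) = snd p := fun t =>
        (congrArg (fun e => snd ((X.tensor Y).proj e)) (h t)).symm.trans (congrArg snd (k t).2)
      refine (continuous_inr.comp (continuous_fibreMk (p := Y.proj) (b := snd p)
        (KSpace.continuous_snd.comp a.continuous) h')).congr fun t => ?_
      have : k t = ⟨Sum.inr (a t), (congrArg _ (h t)).symm.trans (k t).2⟩ := Subtype.ext (h t)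
      rw [this]
      rfl

end FibreHomeo

lemma IsHGraph.of_homeo {X Y : Type u} [TopologicalSpace X] [TopologicalSpace Y]
    (hX : IsHGraph X) (e : X ≃ₜ Y) : IsHGraph Y := by
  obtain ⟨Z, _, hZ, f, hf⟩ := hX
  exact ⟨Z, _, hZ, f.comp (e.symm : C(Y, X)), hf.comp (IsHomotopyEquiv.homeo e.symm)⟩

/-! ### Hurewicz fibrations -/

section Hurewicz

variable {E B C : KSpace.{u}}

lemma IsHurewicz.pullback {p : C(E, C)} (hp : IsHurewicz p) (f : C(B, C)) :
    IsHurewicz (pullbackProj f p) := by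
  intro A h e he
  obtain ⟨H, h₁, h₂⟩ := hp A (f.comp h) ⟨fun a => Pullback.snd (e a), by fun_prop⟩ fun a =>
    (Pullback.cond (e a)).symm.trans (congrArg f (he a))
  refine ⟨⟨fun x => Pullback.mk (h x) (H x) (h₁ x).symm,
    Pullback.continuous_mk h.continuous H.continuous _⟩, fun _ => rfl, fun a => ?_⟩
  exact Kify.ext (Subtype.ext (Prod.ext (he a).symm (h₂ a)))

lemma isHurewicz_of_isEmpty [IsEmpty E] (p : C(E, B)) : IsHurewicz p := by
  intro A h e _
  exact ⟨⟨fun x => isEmptyElim (e x.1), continuous_iff_continuousAt.2 fun x => isEmptyElim (e x.1)⟩,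
    fun x => isEmptyElim (e x.1), fun a => isEmptyElim (e a)⟩

lemma HGraph.isHurewicz_trivialFam (X : HGraph.{u}) (m : B → ℤ) :
    IsHurewicz (X.trivialFam B m).proj := by
  intro A h e he
  exact ⟨⟨fun x => (pair (h x) (snd (X := B) (Y := X.space) (e x.1)) : B.prod X.space),
    continuous_pair h.continuous (KSpace.continuous_snd.comp
      (e.continuous.comp continuous_fst))⟩, fun _ => rfl,
    fun a => KSpace.prod_ext (he a).symm rfl⟩

lemma HGraph.isHurewicz_fam (X : HGraph.{u}) : IsHurewicz X.fam.proj := by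
  intro A h e _
  exact ⟨e.comp ⟨Prod.fst, continuous_fst⟩, fun _ => rfl, fun _ => rfl⟩

lemma IsHurewicz.tensor {X : Fam B} {Y : Fam C} (hX : IsHurewicz X.proj) (hY : IsHurewicz Y.proj) :
    IsHurewicz (X.tensor Y).proj := by
  intro A h e he
  let e' : C(A, (X.total.prod C : Type u) ⊕ (B.prod Y.total : Type u)) := e
  have hL : IsClopen (e' ⁻¹' Set.range Sum.inl) := isClopen_range_inl.preimage e'.continuous
  have hR : IsClopen (e' ⁻¹' Set.range Sum.inr) := isClopen_range_inr.preimage e'.continuous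
  have : IsKSpace (e' ⁻¹' Set.range Sum.inl) := hL.isClosed.isGeneratedBy
  have : IsKSpace (e' ⁻¹' Set.range Sum.inr) := hR.isClosed.isGeneratedBy
  let iL := (Topology.IsEmbedding.inl (X := X.total.prod C) (Y := B.prod Y.total)).toHomeomorph
  let iR := (Topology.IsEmbedding.inr (X := X.total.prod C) (Y := B.prod Y.total)).toHomeomorph
  let a : C(e' ⁻¹' Set.range Sum.inl, X.total.prod C) :=
    ⟨fun t => iL.symm ⟨e' t.1, t.2⟩, by fun_prop⟩
  let b : C(e' ⁻¹' Set.range Sum.inr, B.prod Y.total) :=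
    ⟨fun t => iR.symm ⟨e' t.1, t.2⟩, by fun_prop⟩
  have ha : ∀ t, e t.1 = inl (a t) := fun t =>
    (congrArg Subtype.val (iL.apply_symm_apply ⟨e' t.1, t.2⟩)).symm
  have hb : ∀ t, e t.1 = inr (b t) := fun t =>
    (congrArg Subtype.val (iR.apply_symm_apply ⟨e' t.1, t.2⟩)).symm
  obtain ⟨H, h₁, h₂⟩ := hX ⟨e' ⁻¹' Set.range Sum.inl⟩
    ⟨fun z => fst (h (z.1.1, z.2)), by fun_prop⟩ ⟨fun t => fst (a t), by fun_prop⟩ fun t => by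
      have := congrArg fst (he t.1)
      rw [ha] at this
      exact this
  obtain ⟨K, k₁, k₂⟩ := hY ⟨e' ⁻¹' Set.range Sum.inr⟩
    ⟨fun z => snd (h (z.1.1, z.2)), by fun_prop⟩ ⟨fun t => snd (b t), by fun_prop⟩ fun t => by
      have := congrArg snd (he t.1)
      rw [hb] at this
      exact this
  have hn : ∀ x, x ∉ e' ⁻¹' Set.range Sum.inl → x ∈ e' ⁻¹' Set.range Sum.inr := by
    intro x hx
    have : e' x ∈ Set.range Sum.inl ∪ Set.range Sum.inr := by
      rw [Set.range_inl_union_range_inr]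
      trivial
    exact this.resolve_left hx
  classical
  let G : A × I → (X.tensor Y).total := fun z =>
    if hz : z.1 ∈ e' ⁻¹' Set.range Sum.inl then inl (pair (H (⟨z.1, hz⟩, z.2)) (snd (h z)))
    else inr (pair (fst (h z)) (K (⟨z.1, hn _ hz⟩, z.2)))
  have gL : ContinuousOn G (Prod.fst ⁻¹' (e' ⁻¹' Set.range Sum.inl)) := by
    rw [continuousOn_iff_continuous_domRestrict]
    have hc : Continuous fun z : (e' ⁻¹' Set.range Sum.inl) × I =>
        (inl (pair (H z) (snd (h (z.1.1, z.2)))) : (X.tensor Y).total) :=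
      KSpace.continuous_inl.comp (continuous_pair H.continuous (by fun_prop))
    refine (hc.comp (f := fun z : ↥(Prod.fst ⁻¹' (e' ⁻¹' Set.range Sum.inl) : Set (A × I)) =>
      ((⟨z.1.1, z.2⟩, z.1.2) : (e' ⁻¹' Set.range Sum.inl) × I)) (by fun_prop)).congr fun z => ?_
    have hz : z.1.1 ∈ e' ⁻¹' Set.range Sum.inl := z.2
    change _ = G z.1
    have e : G z.1 = _ := dif_pos hz
    exact e.symm
  have gR : ContinuousOn G (Prod.fst ⁻¹' (e' ⁻¹' Set.range Sum.inr)) := by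
    rw [continuousOn_iff_continuous_domRestrict]
    have hc : Continuous fun z : (e' ⁻¹' Set.range Sum.inr) × I =>
        (inr (pair (fst (h (z.1.1, z.2))) (K z)) : (X.tensor Y).total) :=
      KSpace.continuous_inr.comp (continuous_pair (by fun_prop) K.continuous)
    refine (hc.comp (f := fun z : ↥(Prod.fst ⁻¹' (e' ⁻¹' Set.range Sum.inr) : Set (A × I)) =>
      ((⟨z.1.1, z.2⟩, z.1.2) : (e' ⁻¹' Set.range Sum.inr) × I)) (by fun_prop)).congr fun z => ?_
    have hz : z.1.1 ∉ e' ⁻¹' Set.range Sum.inl := by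
      rintro ⟨x, hx⟩
      obtain ⟨y, hy⟩ := z.2
      exact Sum.inl_ne_inr (hx.trans hy.symm)
    change _ = G z.1
    have e : G z.1 = _ := dif_neg hz
    exact e.symm
  have hG : Continuous G := by
    rw [← continuousOn_univ]
    have : (Set.univ : Set (A × I)) = (Prod.fst ⁻¹' (e' ⁻¹' Set.range Sum.inl)) ∪
        (Prod.fst ⁻¹' (e' ⁻¹' Set.range Sum.inr)) := by
      rw [← Set.preimage_union, ← Set.preimage_union, Set.range_inl_union_range_inr]
      rfl
    rw [this]
    exact gL.union_of_isOpen gR (hL.isOpen.preimage continuous_fst)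
      (hR.isOpen.preimage continuous_fst)
  refine ⟨⟨G, hG⟩, fun z => ?_, fun x => ?_⟩
  · by_cases hz : z.1 ∈ e' ⁻¹' Set.range Sum.inl
    · have : G z = _ := dif_pos hz
      change (X.tensor Y).proj (G z) = _
      rw [this]
      exact KSpace.prod_ext (h₁ _) rfl
    · have : G z = _ := dif_neg hz
      change (X.tensor Y).proj (G z) = _
      rw [this]
      exact KSpace.prod_ext rfl (k₁ _)
  · by_cases hz : x ∈ e' ⁻¹' Set.range Sum.inl
    · have : G (x, 0) = _ := dif_pos hz
      change G (x, 0) = _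
      rw [this, ha ⟨x, hz⟩]
      refine congrArg inl (KSpace.prod_ext (h₂ ⟨x, hz⟩) ?_)
      have := congrArg snd (he x)
      rw [ha ⟨x, hz⟩] at this
      exact this.symm
    · have : G (x, 0) = _ := dif_neg hz
      change G (x, 0) = _
      rw [this, hb ⟨x, hn x hz⟩]
      refine congrArg inr (KSpace.prod_ext ?_ (k₂ ⟨x, hn x hz⟩))
      have := congrArg fst (he x)
      rw [hb ⟨x, hn x hz⟩] at this
      exact this.symm

/-- The inclusion of a fibre of a Hurewicz fibration over an interval is a homotopy
equivalence. -/
lemma IsHurewicz.isHomotopyEquiv_fibreVal {p : C(E, (⟨ULift.{u} I⟩ : KSpace.{u}))}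
    (hp : IsHurewicz p) (t : ULift.{u} I) :
    IsHomotopyEquiv (⟨fibreVal, continuous_fibreVal⟩ : C(fibre p t, E)) := by
  let c : C(I × I × I, I) := ⟨fun z => ⟨(1 - z.1) * z.2.1 + z.1 * z.2.2, by
    have := z.1.2.1; have := z.1.2.2; have := z.2.1.2.1; have := z.2.1.2.2
    have := z.2.2.2.1; have := z.2.2.2.2
    constructor
    · exact add_nonneg (mul_nonneg (by linarith) (by assumption)) (mul_nonneg ‹_› ‹_›)
    · nlinarith⟩, by fun_prop⟩
  let h : C(E × I, (⟨ULift.{u} I⟩ : KSpace.{u})) :=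
    ⟨fun z => ULift.up (c (z.2, (p z.1 : ULift.{u} I).down, t.down)),
      continuous_uliftUp.comp (c.continuous.comp (continuous_snd.prodMk
        ((continuous_uliftDown.comp (p.continuous.comp continuous_fst)).prodMk continuous_const)))⟩
  obtain ⟨H, h₁, h₂⟩ := hp E h (ContinuousMap.id _) fun e => by
    apply ULift.ext
    apply Subtype.ext
    simp [h, c]
  have e₁ : ∀ e, p (H (e, 1)) = t := fun e => (h₁ _).trans (by
    apply ULift.ext
    apply Subtype.ext
    simp [h, c])
  have e₂ : ∀ (e : fibre p t) s, p (H (fibreVal e, s)) = t := fun e s => (h₁ _).trans (by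
    apply ULift.ext
    apply Subtype.ext
    simp [h, c, show p (fibreVal e) = t from fibre_cond e]
    ring)
  refine ⟨⟨fun e => fibreMk (H (e, 1)) (e₁ e), continuous_fibreMk (by fun_prop) _⟩, ?_, ?_⟩
  · refine ContinuousMap.Homotopic.symm ⟨⟨⟨fun z => fibreMk (H (fibreVal z.2, z.1)) (e₂ _ _), ?_⟩,
      fun x => ?_, fun x => rfl⟩⟩
    · exact (continuous_fibreMk (T := (fibre p t).carrier × I)
        (f := fun z => H (fibreVal z.1, z.2)) (by fun_prop) (fun z => e₂ _ _)).comp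
        continuous_swap
    · exact Kify.ext (Subtype.ext (h₂ _))
  · exact ContinuousMap.Homotopic.symm ⟨⟨⟨fun z => H (z.2, z.1), by fun_prop⟩,
      fun x => h₂ _, fun x => rfl⟩⟩

lemma IsHurewicz.eulerChar_eq_of_joined (F : Type u) [Field F] {p : C(E, B)} (hp : IsHurewicz p)
    {a b : B} (h : Joined a b) : eulerChar F (fibre p a) = eulerChar F (fibre p b) := by
  obtain ⟨γ⟩ := h
  let g : C((⟨ULift.{u} I⟩ : KSpace.{u}), B) := ⟨fun t => γ (ULift.down t), by
    exact γ.continuous.comp continuous_uliftDown⟩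
  have key : ∀ t : ULift.{u} I, eulerChar F (fibre p (g t)) = eulerChar F (Pullback g p) :=
    fun t => (eulerChar_eq F _ (IsHomotopyEquiv.homeo (fibrePullback g p t))).trans
      (eulerChar_eq F _ ((hp.pullback g).isHomotopyEquiv_fibreVal t))
  have h0 := key ⟨0⟩
  have h1 := key ⟨1⟩
  have e0 : g (ULift.up 0 : ULift.{u} I) = a := γ.source
  have e1 : g (ULift.up 1 : ULift.{u} I) = b := γ.target
  rw [e0] at h0
  rw [e1] at h1
  exact h0.trans h1.symm

end Hurewicz

/-! ### Path components -/

section PathComponents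

/-- Finitely many points meet all path components. -/
lemma IsFiniteGraph.exists_points {Y : Type u} [TopologicalSpace Y] (hY : IsFiniteGraph Y) :
    ∃ (n : ℕ) (y : Fin n → Y), ∀ z, ∃ i, Joined (y i) z := by
  obtain ⟨_, c, hf, hd⟩ := hY
  let J := Σ n : Fin 2, RelCWComplex.cell (Set.univ : Set Y) (n : ℕ)
  have : ∀ n, Finite (RelCWComplex.cell (Set.univ : Set Y) n) := hf
  have : Finite J := inferInstance
  obtain ⟨n, ⟨e⟩⟩ := Finite.exists_equiv_fin J
  let f : J → Y := fun j => RelCWComplex.map (C := (Set.univ : Set Y)) j.1 j.2 0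
  have key : ∀ z, ∃ j, Joined (f j) z := by
    intro z
    have hz := (CWComplex.union' (C := (Set.univ : Set Y))).ge (Set.mem_univ z)
    simp only [Set.mem_iUnion] at hz
    obtain ⟨k, j, x, hx, rfl⟩ := hz
    have hk : k < 2 := by
      by_contra h
      exact (hd k (not_lt.1 h)).false j
    refine ⟨⟨⟨k, hk⟩, j⟩, ?_⟩
    have hj : JoinedIn (Metric.closedBall (0 : Fin k → ℝ) 1) 0 x :=
      ((convex_closedBall (0 : Fin k → ℝ) 1).isPathConnected ⟨0, by simp⟩).joinedIn _ (by simp) _ hx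
    obtain ⟨γ, hγ⟩ := hj
    have hc : Continuous fun t => RelCWComplex.map (C := (Set.univ : Set Y)) k j (γ t) :=
      (RelCWComplex.continuousOn (C := (Set.univ : Set Y)) k j).comp_continuous γ.continuous hγ
    refine ⟨⟨⟨_, hc⟩, ?_, ?_⟩⟩
    · simp [f]
    · simp
      rfl
  refine ⟨n, fun i => f (e.symm i), fun z => ?_⟩
  obtain ⟨j, hj⟩ := key z
  exact ⟨e j, by simpa using hj⟩

lemma IsHGraph.exists_points {X : Type u} [TopologicalSpace X] (hX : IsHGraph X) :
    ∃ (n : ℕ) (x : Fin n → X), ∀ z, ∃ i, Joined (x i) z := by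
  obtain ⟨Y, _, hY, f, g, ⟨H⟩, -⟩ := hX
  obtain ⟨n, y, hy⟩ := hY.exists_points
  refine ⟨n, fun i => g (y i), fun z => ?_⟩
  obtain ⟨i, hi⟩ := hy (f z)
  exact ⟨i, (hi.map g.continuous).trans ⟨⟨⟨fun t => H (t, z), by fun_prop⟩, by simp, by simp⟩⟩⟩

end PathComponents

/-! ### Families over good bases -/

section InH

variable {B C : KSpace.{u}}

lemma IsGoodBase.t2Space {B : Type u} [TopologicalSpace B] (h : IsGoodBase B) : T2Space B := by
  obtain ⟨_, _, _, _, _, hf⟩ := h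
  exact hf.isEmbedding.t2Space

lemma IsGoodBase.isWeakHausdorff {B : Type u} [TopologicalSpace B] (h : IsGoodBase B) :
    IsWeakHausdorff B :=
  have := h.t2Space
  IsWeakHausdorff.of_t2 B

lemma IsGoodBase.of_homeo {B C : Type u} [TopologicalSpace B] [TopologicalSpace C]
    (h : IsGoodBase B) (e : C ≃ₜ B) : IsGoodBase C := by
  obtain ⟨Y, a, b, c, f, hf⟩ := h
  exact ⟨Y, a, b, c, f ∘ e, hf.comp e.isOpenEmbedding⟩

/-- Multiplication with a point. -/
def prodPt (B : KSpace.{u}) : (B.prod KSpace.pt : Type u) ≃ₜ B where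
  toFun := fst
  invFun b := pair b star
  left_inv _ := rfl
  right_inv _ := rfl
  continuous_toFun := KSpace.continuous_fst
  continuous_invFun := continuous_pair continuous_id continuous_const

lemma AdmitsBasepoints.of_finite {E : KSpace.{u}} {p : C(E, B)} {J : Type*} [Finite J]
    (s : J → C(B, E)) (hs : ∀ i b, p (s i b) = b)
    (h : ∀ b (e : fibre p b), ∃ i, Joined (fibreMk (s i b) (hs i b)) e) : AdmitsBasepoints p := by
  obtain ⟨n, ⟨φ⟩⟩ := Finite.exists_equiv_fin J
  refine ⟨n, fun i => s (φ.symm i), fun i b => hs _ _, fun b e => ?_⟩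
  obtain ⟨i, hi⟩ := h b e
  exact ⟨φ i, by simpa using hi⟩

lemma AdmitsBasepoints.of_isPositive {X : HGraph.{u}} {E : KSpace.{u}} {p : C(E, B)}
    (i : C(B.prod X.space, E)) (hi : ∀ z, p (i z) = fst z)
    (h : ∀ b, IsPositive (fun x => (fibreMk (i (pair b x)) (hi _) : fibre p b))) :
    AdmitsBasepoints p := by
  obtain ⟨n, x, hx⟩ := X.isHGraph.exists_points
  refine ⟨n, fun j => ⟨fun b => i (pair b (x j)),
    i.continuous.comp (continuous_pair continuous_id continuous_const)⟩, fun _ _ => hi _, ?_⟩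
  intro b e
  obtain ⟨y, hy⟩ := h b e
  obtain ⟨j, hj⟩ := hx y
  have hc : Continuous fun x => (fibreMk (i (pair b x)) (hi _) : fibre p b) :=
    continuous_fibreMk (i.continuous.comp (continuous_pair continuous_const continuous_id)) _
  exact ⟨j, (hj.map hc).trans hy⟩

lemma IsHGraphFamily.pullback {E : KSpace.{u}} {p : C(E, C)} (hp : IsHGraphFamily p) (f : C(B, C))
    (hB : IsWeakHausdorff B) : IsHGraphFamily (pullbackProj f p) :=
  ⟨hB, hp.hurewicz.pullback f, fun b => (hp.fibre (f b)).of_homeo (fibrePullback f p b)⟩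

lemma IsHGraphFamily.tensor {X : Fam B} {Y : Fam C} (hX : IsHGraphFamily X.proj)
    (hY : IsHGraphFamily Y.proj) (h : IsWeakHausdorff (B.prod C)) :
    IsHGraphFamily (X.tensor Y).proj :=
  ⟨h, hX.hurewicz.tensor hY.hurewicz,
    fun p => ((hX.fibre (fst p)).sum (hY.fibre (snd p))).of_homeo (fibreTensor X Y p)⟩

lemma AdmitsBasepoints.tensor {X : Fam B} {Y : Fam C} (hX : AdmitsBasepoints X.proj)
    (hY : AdmitsBasepoints Y.proj) : AdmitsBasepoints (X.tensor Y).proj := by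
  obtain ⟨n, s, hs, h⟩ := hX
  obtain ⟨n', s', hs', h'⟩ := hY
  let sec : Fin n ⊕ Fin n' → C(B.prod C, (X.tensor Y).total) := Sum.elim
    (fun i => ⟨fun p => inl (pair (s i (fst p)) (snd p)), KSpace.continuous_inl.comp (by fun_prop)⟩)
    (fun i => ⟨fun p => inr (pair (fst p) (s' i (snd p))), KSpace.continuous_inr.comp (by fun_prop)⟩)
  have hsec : ∀ i p, (X.tensor Y).proj (sec i p) = p := by
    rintro (i | i) p
    · exact KSpace.prod_ext (hs i _) rfl
    · exact KSpace.prod_ext rfl (hs' i _)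
  refine AdmitsBasepoints.of_finite sec hsec fun p e => ?_
  obtain ⟨e, rfl⟩ := (fibreTensor X Y p).surjective e
  rcases e with e | e
  · obtain ⟨i, hi⟩ := h _ e
    exact ⟨.inl i, (hi.map (continuous_inl (Y := fibre Y.proj (snd p)))).map
      (fibreTensor X Y p).continuous⟩
  · obtain ⟨i, hi⟩ := h' _ e
    exact ⟨.inr i, (hi.map (continuous_inr (X := fibre X.proj (fst p)))).map
      (fibreTensor X Y p).continuous⟩

lemma InH.tensor {X : Fam B} {Y : Fam C} (hX : InH X.obj) (hY : InH Y.obj)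
    (h : IsGoodBase (B.prod C)) : InH (X.tensor Y).obj where
  good := h
  family := IsHGraphFamily.tensor hX.family hY.family h.isWeakHausdorff
  basepoints := AdmitsBasepoints.tensor hX.basepoints hY.basepoints
  shift := (hX.shift.comp_continuous (f := fst) KSpace.continuous_fst).add
    (hY.shift.comp_continuous (f := snd) KSpace.continuous_snd)

lemma inH_emptyFam (hB : IsGoodBase B) {m : B → ℤ} (hm : IsLocallyConstant m) :
    InH (emptyFam B m).obj where
  good := hB
  family := ⟨hB.isWeakHausdorff, isHurewicz_of_isEmpty (E := KSpace.empty) _, fun _ =>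
    have : IsEmpty (fibre (emptyFam B m).proj ‹_›) :=
      ⟨fun e => isEmptyElim (α := KSpace.empty) (fibreVal e)⟩
    isHGraph_of_isEmpty _⟩
  basepoints := ⟨0, fun i => i.elim0, fun i => i.elim0, fun _ e =>
    isEmptyElim (α := KSpace.empty) (fibreVal e)⟩
  shift := hm

lemma HGraph.inH_trivialFam (X : HGraph.{u}) (hB : IsGoodBase B) {m : B → ℤ}
    (hm : IsLocallyConstant m) : InH (X.trivialFam B m).obj where
  good := hB
  family := ⟨hB.isWeakHausdorff, X.isHurewicz_trivialFam m, fun b =>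
    X.isHGraph.of_homeo (X.fibreTrivial m b)⟩
  basepoints := AdmitsBasepoints.of_isPositive (X := X) (ContinuousMap.id _) (fun _ => rfl)
    fun b => (IsHomotopyEquiv.homeo (X.fibreTrivial m b)).isPositive
  shift := hm

lemma HGraph.inH_fam (X : HGraph.{u}) (hpt : IsGoodBase KSpace.pt.{u}) : InH X.fam.obj where
  good := hpt
  family := ⟨hpt.isWeakHausdorff, X.isHurewicz_fam, fun b => X.isHGraph.of_homeo (X.fibreFam b)⟩
  basepoints := AdmitsBasepoints.of_isPositive (X := X) ⟨snd, KSpace.continuous_snd⟩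
    (fun _ => rfl) fun b => (IsHomotopyEquiv.homeo (X.fibreFam b)).isPositive
  shift := IsLocallyConstant.const _

end InH

end HGFT

namespace HGFT

open KSpace

/-! ### CW complexes -/

/-- A Hausdorff space that admits the structure of a CW complex. -/
def IsCW (X : Type u) [TopologicalSpace X] : Prop :=
  T2Space X ∧ Nonempty (CWComplex (Set.univ : Set X))

lemma IsCW.isGoodBase {X : Type u} [TopologicalSpace X] (h : IsCW X) : IsGoodBase X := by
  obtain ⟨h, ⟨c⟩⟩ := h
  exact ⟨X, _, h, c, id, IsOpenEmbedding.id⟩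

section Cells

variable {X Y : Type u} [TopologicalSpace X] [TopologicalSpace Y]

/-- Data presenting a space as a CW complex, the cells being indexed by a single type. -/
structure CellStructure (X : Type u) [TopologicalSpace X] where
  J : Type u
  dim : J → ℕ
  χ (j : J) : (Fin (dim j) → ℝ) → X
  inv (j : J) : X → (Fin (dim j) → ℝ)
  continuousOn (j : J) : ContinuousOn (χ j) (Metric.closedBall 0 1)
  continuousOn_inv (j : J) : ContinuousOn (inv j) (χ j '' Metric.ball 0 1)
  left_inv (j : J) : ∀ x ∈ Metric.ball 0 1, inv j (χ j x) = x
  disjoint (j k : J) (h : j ≠ k) : Disjoint (χ j '' Metric.ball 0 1) (χ k '' Metric.ball 0 1)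
  frontier (j : J) : ∃ s : Finset J, (∀ k ∈ s, dim k < dim j) ∧
    Set.MapsTo (χ j) (Metric.sphere 0 1) (⋃ k ∈ s, χ k '' Metric.closedBall 0 1)
  isClosed (A : Set X) (h : ∀ j, IsClosed (A ∩ χ j '' Metric.closedBall 0 1)) : IsClosed A
  cover (x : X) : ∃ j, x ∈ χ j '' Metric.closedBall 0 1

namespace CellStructure

variable (c : CellStructure X)

/-- The characteristic map, as a partial equivalence. -/
def partialEquiv (j : c.J) : PartialEquiv (Fin (c.dim j) → ℝ) X where
  toFun := c.χ j
  invFun := c.inv j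
  source := Metric.ball 0 1
  target := c.χ j '' Metric.ball 0 1
  map_source' x hx := ⟨x, hx, rfl⟩
  map_target' := by
    rintro _ ⟨x, hx, rfl⟩
    rwa [c.left_inv j x hx]
  left_inv' := c.left_inv j
  right_inv' := by
    rintro _ ⟨x, hx, rfl⟩
    rw [c.left_inv j x hx]

/-- The characteristic map of a cell of dimension `n`. -/
def cellMap (n : ℕ) (i : {j : c.J // c.dim j = n}) : PartialEquiv (Fin n → ℝ) X :=
  i.2 ▸ c.partialEquiv i.1

/-- The CW complex given by a cell structure. -/
@[reducible]
def cwComplex : CWComplex (Set.univ : Set X) where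
  cell n := {j : c.J // c.dim j = n}
  map := c.cellMap
  source_eq := by
    rintro _ ⟨j, rfl⟩
    rfl
  continuousOn := by
    rintro _ ⟨j, rfl⟩
    exact c.continuousOn j
  continuousOn_symm := by
    rintro _ ⟨j, rfl⟩
    exact c.continuousOn_inv j
  pairwiseDisjoint' := by
    rintro ⟨_, j, rfl⟩ - ⟨_, k, rfl⟩ - h
    exact c.disjoint j k fun e => h (by subst e; rfl)
  mapsTo' := by
    classical
    rintro _ ⟨j, rfl⟩
    obtain ⟨s, hs, h⟩ := c.frontier j
    refine ⟨fun m => s.subtype (fun k => c.dim k = m), fun x hx => ?_⟩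
    obtain ⟨k, hk, y, hy, e⟩ := Set.mem_iUnion₂.1 (h hx)
    exact Set.mem_iUnion₂.2 ⟨c.dim k, hs k hk, Set.mem_iUnion₂.2
      ⟨⟨k, rfl⟩, by simpa using hk, y, hy, e⟩⟩
  closed' A _ h := c.isClosed A fun j => h _ ⟨j, rfl⟩
  union' := by
    rw [Set.eq_univ_iff_forall]
    intro x
    obtain ⟨j, hj⟩ := c.cover x
    exact Set.mem_iUnion₂.2 ⟨_, ⟨j, rfl⟩, hj⟩

lemma isCW [h : T2Space X] (c : CellStructure X) : IsCW X := ⟨h, ⟨c.cwComplex⟩⟩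

/-- The cell structure of a CW complex. -/
def ofCW [CWComplex (Set.univ : Set X)] : CellStructure X where
  J := Σ n, RelCWComplex.cell (Set.univ : Set X) n
  dim j := j.1
  χ j := RelCWComplex.map j.1 j.2
  inv j := (RelCWComplex.map j.1 j.2).symm
  continuousOn j := RelCWComplex.continuousOn j.1 j.2
  continuousOn_inv j := by
    rw [← RelCWComplex.source_eq (C := (Set.univ : Set X)) j.1 j.2,
      PartialEquiv.image_source_eq_target]
    exact RelCWComplex.continuousOn_symm j.1 j.2
  left_inv j x hx := (RelCWComplex.map j.1 j.2).left_inv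
    ((RelCWComplex.source_eq (C := (Set.univ : Set X)) j.1 j.2).symm ▸ hx)
  disjoint j k h := RelCWComplex.disjoint_openCell_of_ne h
  frontier j := by
    classical
    obtain ⟨s, hs⟩ := CWComplex.mapsTo (C := (Set.univ : Set X)) j.1 j.2
    refine ⟨(Finset.range j.1).sigma s, fun k hk => ?_, fun x hx => ?_⟩
    · simpa using (Finset.mem_sigma.1 hk).1
    · obtain ⟨m, hm, h⟩ := Set.mem_iUnion₂.1 (hs hx)
      obtain ⟨k, hk, h⟩ := Set.mem_iUnion₂.1 h
      exact Set.mem_iUnion₂.2 ⟨⟨m, k⟩, Finset.mem_sigma.2 ⟨by simpa using hm, hk⟩, h⟩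
  isClosed A h := CWComplex.closed' A (Set.subset_univ _) fun n j => h ⟨n, j⟩
  cover x := by
    obtain ⟨n, j, h⟩ := Set.mem_iUnion₂.1
      ((CWComplex.union' (C := (Set.univ : Set X))).ge (Set.mem_univ x))
    exact ⟨⟨n, j⟩, h⟩

/-- The open cell. -/
def openCell (j : c.J) : Set X := c.χ j '' Metric.ball 0 1

/-- The closed cell. -/
def closedCell (j : c.J) : Set X := c.χ j '' Metric.closedBall 0 1

lemma openCell_subset (j : c.J) : c.openCell j ⊆ c.closedCell j :=
  Set.image_mono Metric.ball_subset_closedBall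

/-- Every point lies in an open cell. -/
lemma exists_mem_openCell (x : X) : ∃ j, x ∈ c.openCell j := by
  have key : ∀ n j, c.dim j = n → x ∈ c.closedCell j → ∃ j, x ∈ c.openCell j := by
    intro n
    induction n using Nat.strong_induction_on with
    | _ n ih =>
      rintro j rfl ⟨y, hy, rfl⟩
      by_cases h : y ∈ Metric.ball 0 1
      · exact ⟨j, y, h, rfl⟩
      · have hs : y ∈ Metric.sphere (0 : Fin (c.dim j) → ℝ) 1 := by
          rw [← Metric.closedBall_sdiff_ball]
          exact ⟨hy, h⟩
        obtain ⟨s, hd, hm⟩ := c.frontier j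
        obtain ⟨k, hk, h⟩ := Set.mem_iUnion₂.1 (hm hs)
        exact ih _ (hd k hk) k rfl h
  obtain ⟨j, hj⟩ := c.cover x
  exact key _ j rfl hj

lemma finite_inter_closedCell (A : Set X) (hA : ∀ j, (A ∩ c.openCell j).Finite) (j : c.J) :
    (A ∩ c.closedCell j).Finite := by
  have key : ∀ n j, c.dim j = n → (A ∩ c.closedCell j).Finite := by
    intro n
    induction n using Nat.strong_induction_on with
    | _ n ih =>
      rintro j rfl
      obtain ⟨s, hd, hm⟩ := c.frontier j
      refine ((hA j).union (s.finite_toSet.biUnion fun k hk => ih _ (hd k hk) k rfl)).subset ?_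
      rintro _ ⟨hx, y, hy, rfl⟩
      by_cases h : y ∈ Metric.ball 0 1
      · exact .inl ⟨hx, y, h, rfl⟩
      · have hs : y ∈ Metric.sphere (0 : Fin (c.dim j) → ℝ) 1 := by
          rw [← Metric.closedBall_sdiff_ball]
          exact ⟨hy, h⟩
        obtain ⟨k, hk, h⟩ := Set.mem_iUnion₂.1 (hm hs)
        exact .inr (Set.mem_iUnion₂.2 ⟨k, hk, hx, h⟩)
  exact key _ j rfl

/-- A compact subset meets only finitely many open cells. -/
lemma finite_of_isCompact [T2Space X] {K : Set X} (hK : IsCompact K) :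
    {j | (K ∩ c.openCell j).Nonempty}.Finite := by
  by_contra hinf
  have hch : ∀ j : {j | (K ∩ c.openCell j).Nonempty}, ∃ x, x ∈ K ∩ c.openCell j := fun j => j.2
  choose f hf using hch
  have hfi : Function.Injective f := by
    intro j k h
    by_contra hne
    exact (c.disjoint j k fun e => hne (Subtype.ext e)).ne_of_mem (hf j).2 (hf k).2 h
  have hfin : ∀ A ⊆ Set.range f, IsClosed A := by
    intro A hA
    refine c.isClosed A fun j => (c.finite_inter_closedCell A (fun j => ?_) j).isClosed
    refine Set.Subsingleton.finite ?_
    rintro x ⟨hx, hxj⟩ y ⟨hy, hyj⟩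
    obtain ⟨k, rfl⟩ := hA hx
    obtain ⟨l, rfl⟩ := hA hy
    have h₁ : (k : c.J) = j := by
      by_contra h
      exact (c.disjoint _ _ h).ne_of_mem (hf k).2 hxj rfl
    have h₂ : (l : c.J) = j := by
      by_contra h
      exact (c.disjoint _ _ h).ne_of_mem (hf l).2 hyj rfl
    rw [Subtype.ext (h₁.trans h₂.symm)]
  have hR : IsCompact (Set.range f) := hK.of_isClosed_subset (hfin _ subset_rfl)
    (by rintro _ ⟨j, rfl⟩; exact (hf j).1)
  have hD : DiscreteTopology (Set.range f) := by
    rw [discreteTopology_iff_forall_isClosed]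
    intro s
    have : s = Subtype.val ⁻¹' (Subtype.val '' s) :=
      (Set.preimage_image_eq _ Subtype.val_injective).symm
    rw [this]
    exact (hfin _ (by rintro _ ⟨x, -, rfl⟩; exact x.2)).preimage continuous_subtype_val
  have : (Set.range f).Finite := hR.finite (isDiscrete_iff_discreteTopology.2 hD)
  rw [Set.finite_range_iff] at this
  · exact hinf (Set.toFinite _)
  · exact hfi

lemma ball_iff {m n : ℕ} (x : Fin (m + n) → ℝ) : x ∈ Metric.ball 0 1 ↔
    (fun i => x (Fin.castAdd n i)) ∈ Metric.ball (0 : Fin m → ℝ) 1 ∧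
      (fun i => x (Fin.natAdd m i)) ∈ Metric.ball (0 : Fin n → ℝ) 1 := by
  simp only [mem_ball_zero_iff, pi_norm_lt_iff one_pos]
  exact ⟨fun h => ⟨fun i => h _, fun i => h _⟩, fun h i => Fin.addCases h.1 h.2 i⟩

lemma closedBall_iff {m n : ℕ} (x : Fin (m + n) → ℝ) : x ∈ Metric.closedBall 0 1 ↔
    (fun i => x (Fin.castAdd n i)) ∈ Metric.closedBall (0 : Fin m → ℝ) 1 ∧
      (fun i => x (Fin.natAdd m i)) ∈ Metric.closedBall (0 : Fin n → ℝ) 1 := by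
  simp only [mem_closedBall_zero_iff, pi_norm_le_iff_of_nonneg zero_le_one]
  exact ⟨fun h => ⟨fun i => h _, fun i => h _⟩, fun h i => Fin.addCases h.1 h.2 i⟩

/-- The product cell structure on the k-ified product. -/
noncomputable def prod {X Y : KSpace.{u}} [T2Space X] [T2Space Y] (c : CellStructure X)
    (c' : CellStructure Y) : CellStructure (X.prod Y) :=
  have hclosed : ∀ j : c.J × c'.J, (fun x : Fin (c.dim j.1 + c'.dim j.2) → ℝ =>
      (KSpace.pair (c.χ j.1 fun i => x (Fin.castAdd _ i)) (c'.χ j.2 fun i => x (Fin.natAdd _ i)) :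
        X.prod Y)) '' Metric.closedBall 0 1 =
      {p | fst p ∈ c.closedCell j.1 ∧ snd p ∈ c'.closedCell j.2} := by
    intro j
    ext p
    constructor
    · rintro ⟨x, hx, rfl⟩
      have := (closedBall_iff x).1 hx
      exact ⟨⟨_, this.1, rfl⟩, ⟨_, this.2, rfl⟩⟩
    · rintro ⟨⟨x, hx, h⟩, ⟨y, hy, h'⟩⟩
      refine ⟨Fin.append x y, ?_, ?_⟩
      · rw [closedBall_iff]
        simp only [Fin.append_left, Fin.append_right]
        exact ⟨hx, hy⟩
      · simp only [Fin.append_left, Fin.append_right]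
        exact KSpace.prod_ext h h'
  { J := c.J × c'.J
    dim j := c.dim j.1 + c'.dim j.2
    χ j x := KSpace.pair (c.χ j.1 fun i => x (Fin.castAdd _ i)) (c'.χ j.2 fun i => x (Fin.natAdd _ i))
    inv j p := Fin.append (c.inv j.1 (fst p)) (c'.inv j.2 (snd p))
    continuousOn j := by
      rw [continuousOn_iff_continuous_domRestrict]
      have h₁ : Continuous fun x : Metric.closedBall (0 : Fin (c.dim j.1 + c'.dim j.2) → ℝ) 1 =>
          c.χ j.1 fun i => x.1 (Fin.castAdd _ i) :=
        (c.continuousOn j.1).comp_continuous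
          (continuous_pi fun i => (continuous_apply _).comp continuous_subtype_val)
          fun x => ((closedBall_iff x.1).1 x.2).1
      have h₂ : Continuous fun x : Metric.closedBall (0 : Fin (c.dim j.1 + c'.dim j.2) → ℝ) 1 =>
          c'.χ j.2 fun i => x.1 (Fin.natAdd _ i) :=
        (c'.continuousOn j.2).comp_continuous
          (continuous_pi fun i => (continuous_apply _).comp continuous_subtype_val)
          fun x => ((closedBall_iff x.1).1 x.2).2
      have : CompactSpace (Metric.closedBall (0 : Fin (c.dim j.1 + c'.dim j.2) → ℝ) 1) :=
        isCompact_iff_compactSpace.1 (isCompact_closedBall _ _)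
      have h : Continuous fun x : ULift.{u} (Metric.closedBall
          (0 : Fin (c.dim j.1 + c'.dim j.2) → ℝ) 1) =>
          KSpace.pair (c.χ j.1 fun i => x.down.1 (Fin.castAdd _ i))
            (c'.χ j.2 fun i => x.down.1 (Fin.natAdd _ i)) :=
        continuous_pair (h₁.comp continuous_uliftDown) (h₂.comp continuous_uliftDown)
      exact h.comp continuous_uliftUp
    continuousOn_inv j := by
      have e : Set.MapsTo (fst : X.prod Y → X) ((fun x : Fin (c.dim j.1 + c'.dim j.2) → ℝ =>
          (KSpace.pair (c.χ j.1 fun i => x (Fin.castAdd _ i))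
            (c'.χ j.2 fun i => x (Fin.natAdd _ i)) : X.prod Y)) '' Metric.ball 0 1)
          (c.χ j.1 '' Metric.ball 0 1) := by
        rintro _ ⟨x, hx, rfl⟩
        exact ⟨_, ((ball_iff x).1 hx).1, rfl⟩
      have e' : Set.MapsTo (snd : X.prod Y → Y) ((fun x : Fin (c.dim j.1 + c'.dim j.2) → ℝ =>
          (KSpace.pair (c.χ j.1 fun i => x (Fin.castAdd _ i))
            (c'.χ j.2 fun i => x (Fin.natAdd _ i)) : X.prod Y)) '' Metric.ball 0 1)
          (c'.χ j.2 '' Metric.ball 0 1) := by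
        rintro _ ⟨x, hx, rfl⟩
        exact ⟨_, ((ball_iff x).1 hx).2, rfl⟩
      have h₁ := (c.continuousOn_inv j.1).comp (KSpace.continuous_fst (Y := Y)).continuousOn e
      have h₂ := (c'.continuousOn_inv j.2).comp (KSpace.continuous_snd (X := X)).continuousOn e'
      rw [continuousOn_pi] at h₁ h₂ ⊢
      intro i
      refine Fin.addCases (fun i => ?_) (fun i => ?_) i
      · simpa using h₁ i
      · simpa using h₂ i
    left_inv j x hx := by
      have := (ball_iff x).1 hx
      rw [fst_pair, snd_pair, c.left_inv j.1 _ this.1, c'.left_inv j.2 _ this.2]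
      ext i
      refine Fin.addCases (fun i => ?_) (fun i => ?_) i <;> simp
    disjoint j k hne := by
      rw [Set.disjoint_left]
      rintro _ ⟨x, hx, rfl⟩ ⟨y, hy, e⟩
      have hx := (ball_iff x).1 hx
      have hy := (ball_iff y).1 hy
      have e₁ := congrArg fst e
      have e₂ := congrArg snd e
      apply hne
      refine Prod.ext ?_ ?_
      · by_contra h
        exact (c.disjoint _ _ h).ne_of_mem ⟨_, hx.1, rfl⟩ ⟨_, hy.1, rfl⟩ e₁.symm
      · by_contra h
        exact (c'.disjoint _ _ h).ne_of_mem ⟨_, hx.2, rfl⟩ ⟨_, hy.2, rfl⟩ e₂.symm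
    frontier j := by
      classical
      obtain ⟨s, hs, h⟩ := c.frontier j.1
      obtain ⟨s', hs', h'⟩ := c'.frontier j.2
      refine ⟨s ×ˢ {j.2} ∪ {j.1} ×ˢ s', fun k hk => ?_, fun x hx => ?_⟩
      · rcases Finset.mem_union.1 hk with hk | hk
        · obtain ⟨h₁, h₂⟩ := Finset.mem_product.1 hk
          rw [Finset.mem_singleton.1 h₂]
          exact Nat.add_lt_add_right (hs _ h₁) _
        · obtain ⟨h₁, h₂⟩ := Finset.mem_product.1 hk
          rw [Finset.mem_singleton.1 h₁]
          exact Nat.add_lt_add_left (hs' _ h₂) _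
      · have hc := (closedBall_iff x).1 (Metric.sphere_subset_closedBall hx)
        have hb : x ∉ Metric.ball 0 1 := by
          rw [← Metric.closedBall_sdiff_ball] at hx
          exact hx.2
        rw [ball_iff, not_and_or] at hb
        rcases hb with hb | hb
        · have hx' : (fun i => x (Fin.castAdd _ i)) ∈ Metric.sphere (0 : Fin (c.dim j.1) → ℝ) 1 := by
            rw [← Metric.closedBall_sdiff_ball]
            exact ⟨hc.1, hb⟩
          obtain ⟨k, hk, hm⟩ := Set.mem_iUnion₂.1 (h hx')
          refine Set.mem_iUnion₂.2 ⟨(k, j.2), Finset.mem_union_left _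
            (Finset.mem_product.2 ⟨hk, Finset.mem_singleton_self _⟩), ?_⟩
          rw [hclosed]
          exact ⟨hm, _, hc.2, rfl⟩
        · have hx' : (fun i => x (Fin.natAdd _ i)) ∈ Metric.sphere (0 : Fin (c'.dim j.2) → ℝ) 1 := by
            rw [← Metric.closedBall_sdiff_ball]
            exact ⟨hc.2, hb⟩
          obtain ⟨k, hk, hm⟩ := Set.mem_iUnion₂.1 (h' hx')
          refine Set.mem_iUnion₂.2 ⟨(j.1, k), Finset.mem_union_right _
            (Finset.mem_product.2 ⟨Finset.mem_singleton_self _, hk⟩), ?_⟩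
          rw [hclosed]
          exact ⟨⟨_, hc.1, rfl⟩, hm⟩
    isClosed A hA := by
      simp only [hclosed] at hA
      rw [IsGeneratedBy.isClosed_iff compHausFamily.{u}]
      intro K k
      have f₁ := c.finite_of_isCompact (isCompact_range
        ((KSpace.continuous_fst (X := X) (Y := Y)).comp k.continuous))
      have f₂ := c'.finite_of_isCompact (isCompact_range
        ((KSpace.continuous_snd (X := X) (Y := Y)).comp k.continuous))
      have : k ⁻¹' A = ⋃ j ∈ {j | (Set.range (fst ∘ k) ∩ c.openCell j).Nonempty} ×ˢ
          {j | (Set.range (snd ∘ k) ∩ c'.openCell j).Nonempty},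
          k ⁻¹' (A ∩ {p | fst p ∈ c.closedCell j.1 ∧ snd p ∈ c'.closedCell j.2}) := by
        ext t
        constructor
        · intro ht
          obtain ⟨i, hi⟩ := c.exists_mem_openCell (fst (k t))
          obtain ⟨j, hj⟩ := c'.exists_mem_openCell (snd (k t))
          exact Set.mem_iUnion₂.2 ⟨(i, j), ⟨⟨_, ⟨t, rfl⟩, hi⟩, ⟨_, ⟨t, rfl⟩, hj⟩⟩, ht,
            c.openCell_subset _ hi, c'.openCell_subset _ hj⟩
        · intro ht
          obtain ⟨j, -, h, -⟩ := Set.mem_iUnion₂.1 ht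
          exact h
      rw [this]
      exact (f₁.prod f₂).isClosed_biUnion fun j _ => (hA j).preimage k.continuous
    cover p := by
      obtain ⟨i, hi⟩ := c.cover (fst p)
      obtain ⟨j, hj⟩ := c'.cover (snd p)
      refine ⟨(i, j), ?_⟩
      rw [hclosed]
      exact ⟨hi, hj⟩ }

end CellStructure

lemma IsCW.prod {X Y : KSpace.{u}} (hX : IsCW X) (hY : IsCW Y) : IsCW (X.prod Y) := by
  obtain ⟨_, ⟨c⟩⟩ := hX
  obtain ⟨_, ⟨c'⟩⟩ := hY
  have : T2Space (X.prod Y) := T2Space.of_injective_continuous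
    (f := fun p : X.prod Y => (fst p, snd p)) (fun _ _ h => KSpace.prod_ext (congrArg Prod.fst h)
      (congrArg Prod.snd h)) (KSpace.continuous_fst.prodMk KSpace.continuous_snd)
  exact (CellStructure.ofCW.prod CellStructure.ofCW).isCW

lemma isCW_pt : IsCW KSpace.pt.{u} := by
  have : T2Space KSpace.pt.{u} := inferInstanceAs (T2Space PUnit)
  let c : CellStructure KSpace.pt.{u} :=
    { J := PUnit
      dim := fun _ => 0
      χ := fun _ _ => star
      inv := fun _ _ => 0
      continuousOn := fun _ => continuousOn_const
      continuousOn_inv := fun _ => continuousOn_const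
      left_inv := fun _ _ _ => Subsingleton.elim _ _
      disjoint := fun j k h => (h (Subsingleton.elim j k)).elim
      frontier := fun _ => ⟨∅, by simp, fun x hx => by
        rw [mem_sphere_zero_iff_norm, Subsingleton.elim x 0, norm_zero] at hx
        exact (zero_ne_one hx).elim⟩
      isClosed := fun A _ => (Set.toFinite A).isClosed
      cover := fun x => ⟨PUnit.unit, 0, by simp, Subsingleton.elim _ _⟩ }
  exact c.isCW

/-- A function on a good base that is constant along paths is locally constant. -/
lemma IsGoodBase.isLocallyConstant {B : Type u} [TopologicalSpace B] (h : IsGoodBase B)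
    {Z : Type*} (m : B → Z) (hm : ∀ a b, Joined a b → m a = m b) : IsLocallyConstant m := by
  obtain ⟨Y, _, _, cw, f, hf⟩ := h
  let c : CellStructure Y := CellStructure.ofCW
  intro s
  rw [hf.isOpen_iff_image_isOpen, ← isClosed_compl_iff]
  refine c.isClosed _ fun j => ?_
  let V := f '' (m ⁻¹' s)
  have hK : IsClosed (Metric.closedBall (0 : Fin (c.dim j) → ℝ) 1 ∩ (c.χ j ⁻¹' V)ᶜ) := by
    rw [← isOpen_compl_iff, Metric.isOpen_iff]
    intro x hx
    by_cases hxb : x ∈ Metric.closedBall (0 : Fin (c.dim j) → ℝ) 1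
    · have hxV : c.χ j x ∈ V := by
        by_contra h
        exact hx ⟨hxb, h⟩
      have hU : Set.range f ∈ 𝓝 (c.χ j x) :=
        hf.isOpen_range.mem_nhds (Set.image_subset_range _ _ hxV)
      obtain ⟨ε, hε, hε'⟩ := Metric.mem_nhdsWithin_iff.1 (c.continuousOn j x hxb hU)
      refine ⟨ε, hε, fun y hy => ?_⟩
      rintro ⟨hyb, hyV⟩
      apply hyV
      have hconv : Convex ℝ (Metric.ball x ε ∩ Metric.closedBall (0 : Fin (c.dim j) → ℝ) 1) :=
        (convex_ball _ _).inter (convex_closedBall _ _)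
      have hj : JoinedIn (Metric.ball x ε ∩ Metric.closedBall (0 : Fin (c.dim j) → ℝ) 1) x y :=
        (hconv.isPathConnected ⟨x, Metric.mem_ball_self hε, hxb⟩).joinedIn _
          ⟨Metric.mem_ball_self hε, hxb⟩ _ ⟨hy, hyb⟩
      obtain ⟨γ, hγ⟩ := hj
      obtain ⟨a, ha, hax⟩ := hxV
      obtain ⟨b, hb⟩ := hε' ⟨hy, hyb⟩
      let ψ := hf.isEmbedding.toHomeomorph
      have hc : Continuous fun t => (⟨c.χ j (γ t), hε' (hγ t)⟩ : Set.range f) :=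
        Continuous.subtype_mk ((c.continuousOn j).comp_continuous γ.continuous
          fun t => (hγ t).2) _
      have hab : Joined a b := by
        refine ⟨⟨⟨fun t => ψ.symm ⟨c.χ j (γ t), hε' (hγ t)⟩, ψ.symm.continuous.comp hc⟩, ?_, ?_⟩⟩
        · apply ψ.injective
          simp only [Homeomorph.apply_symm_apply]
          apply Subtype.ext
          simp only [γ.source]
          exact hax.symm
        · apply ψ.injective
          simp only [Homeomorph.apply_symm_apply]
          apply Subtype.ext
          simp only [γ.target]
          exact hb.symm
      refine ⟨b, ?_, hb⟩
      rw [Set.mem_preimage, ← hm a b hab]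
      exact ha
    · obtain ⟨ε, hε, h⟩ := Metric.isOpen_iff.1 Metric.isClosed_closedBall.isOpen_compl x hxb
      exact ⟨ε, hε, fun y hy hy' => h hy hy'.1⟩
  have hcomp := (isCompact_closedBall (0 : Fin (c.dim j) → ℝ) 1).of_isClosed_subset hK
    Set.inter_subset_left
  convert (hcomp.image_of_continuousOn ((c.continuousOn j).mono Set.inter_subset_left)).isClosed
    using 1
  ext y
  constructor
  · rintro ⟨hy, x, hx, rfl⟩
    exact ⟨x, ⟨hx, hy⟩, rfl⟩
  · rintro ⟨x, ⟨hx, hy⟩, rfl⟩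
    exact ⟨hy, x, hx, rfl⟩

end Cells

end HGFT

namespace HGFT

open KSpace Simplicial Opposite

/-! ### The fat realization of a simplicial set -/

section SimplexModel

variable (n : ℕ)

/-- The closed corner simplex. -/
def cornerSimplex : Set (Fin n → ℝ) := {x | (∀ i, 0 ≤ x i) ∧ ∑ i, x i ≤ 1}

/-- The open corner simplex. -/
def openCorner : Set (Fin n → ℝ) := {x | (∀ i, 0 < x i) ∧ ∑ i, x i < 1}

lemma openCorner_subset : openCorner n ⊆ cornerSimplex n :=
  fun _ h => ⟨fun i => (h.1 i).le, h.2.le⟩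

lemma isOpen_openCorner : IsOpen (openCorner n) := by
  have : openCorner n = (⋂ i, {x | 0 < x i}) ∩ {x | ∑ i, x i < 1} := by
    ext x
    simp [openCorner]
  rw [this]
  exact (isOpen_iInter_of_finite fun i => isOpen_lt continuous_const (continuous_apply i)).inter
    (isOpen_lt (by fun_prop) continuous_const)

lemma isClosed_cornerSimplex : IsClosed (cornerSimplex n) := by
  have : cornerSimplex n = (⋂ i, {x | 0 ≤ x i}) ∩ {x | ∑ i, x i ≤ 1} := by
    ext x
    simp [cornerSimplex]
  rw [this]
  exact (isClosed_iInter fun i => isClosed_le continuous_const (continuous_apply i)).inter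
    (isClosed_le (by fun_prop) continuous_const)

lemma convex_cornerSimplex : Convex ℝ (cornerSimplex n) := by
  intro x hx y hy a b ha hb hab
  refine ⟨fun i => ?_, ?_⟩
  · simp only [Pi.add_apply, Pi.smul_apply, smul_eq_mul]
    exact add_nonneg (mul_nonneg ha (hx.1 i)) (mul_nonneg hb (hy.1 i))
  · simp only [Pi.add_apply, Pi.smul_apply, smul_eq_mul, Finset.sum_add_distrib, ← Finset.mul_sum]
    nlinarith [hx.2, hy.2]

lemma interior_cornerSimplex : interior (cornerSimplex n) = openCorner n := by
  refine Set.Subset.antisymm (fun x hx => ?_) (interior_maximal (openCorner_subset n)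
    (isOpen_openCorner n))
  have hx' := interior_subset hx
  have key : ∀ v : Fin n → ℝ, ∃ s : ℝ, 0 < s ∧ x + s • v ∈ cornerSimplex n := by
    intro v
    have hc : ContinuousAt (fun s : ℝ => x + s • v) 0 := by fun_prop
    have : (fun s : ℝ => x + s • v) ⁻¹' cornerSimplex n ∈ 𝓝 0 := by
      apply hc
      simpa using mem_interior_iff_mem_nhds.1 hx
    obtain ⟨ε, hε, h⟩ := Metric.mem_nhds_iff.1 this
    refine ⟨ε / 2, by positivity, h ?_⟩
    rw [mem_ball_zero_iff, Real.norm_of_nonneg (by positivity)]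
    linarith
  refine ⟨fun i => ?_, ?_⟩
  · obtain ⟨s, hs, h⟩ := key (-Pi.single i 1)
    have := h.1 i
    simp at this
    linarith
  · rcases Nat.eq_zero_or_pos n with rfl | hn
    · simp
    · obtain ⟨s, hs, h⟩ := key 1
      have := h.2
      simp [Finset.sum_add_distrib] at this
      have : (0 : ℝ) < n * s := by positivity
      linarith

lemma exists_corner_homeomorph : ∃ e : (Fin n → ℝ) ≃ₜ (Fin n → ℝ),
    (∀ y ∈ Metric.ball 0 1, e.symm y ∈ openCorner n) ∧
    (∀ y ∈ Metric.sphere 0 1, e.symm y ∈ cornerSimplex n \ openCorner n) ∧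
    ∀ x ∈ cornerSimplex n, e x ∈ Metric.closedBall 0 1 := by
  have hne : (interior (cornerSimplex n)).Nonempty := by
    rw [interior_cornerSimplex]
    refine ⟨fun _ => 1 / (n + 1 : ℝ), fun i => by positivity, ?_⟩
    simp only [Finset.sum_const, Finset.card_univ, Fintype.card_fin, nsmul_eq_mul]
    rw [mul_one_div, div_lt_one (by positivity)]
    linarith
  have hb : Bornology.IsBounded (cornerSimplex n) := by
    refine (Metric.isBounded_closedBall (x := (0 : Fin n → ℝ)) (r := 1)).subset fun x hx => ?_
    rw [mem_closedBall_zero_iff, pi_norm_le_iff_of_nonneg zero_le_one]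
    intro i
    rw [Real.norm_of_nonneg (hx.1 i)]
    exact (Finset.single_le_sum (f := x) (fun j _ => hx.1 j) (Finset.mem_univ i)).trans hx.2
  obtain ⟨e, h₁, h₂, h₃⟩ := exists_homeomorph_image_interior_closure_frontier_eq_unitBall
    (convex_cornerSimplex n) hne hb
  rw [(isClosed_cornerSimplex n).closure_eq] at h₂
  rw [frontier, (isClosed_cornerSimplex n).closure_eq] at h₃
  rw [interior_cornerSimplex] at h₁ h₃
  refine ⟨e, fun y hy => ?_, fun y hy => ?_, fun x hx => h₂ ▸ ⟨x, hx, rfl⟩⟩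
  · rw [← h₁] at hy
    obtain ⟨x, hx, rfl⟩ := hy
    rwa [e.symm_apply_apply]
  · rw [← h₃] at hy
    obtain ⟨x, hx, rfl⟩ := hy
    rwa [e.symm_apply_apply]

/-- The homeomorphism of the corner simplex with the cube. -/
noncomputable def cornerHomeo : (Fin n → ℝ) ≃ₜ (Fin n → ℝ) := (exists_corner_homeomorph n).choose

lemma cornerHomeo_symm_ball {y : Fin n → ℝ} (hy : y ∈ Metric.ball 0 1) :
    (cornerHomeo n).symm y ∈ openCorner n := (exists_corner_homeomorph n).choose_spec.1 y hy

lemma cornerHomeo_symm_sphere {y : Fin n → ℝ} (hy : y ∈ Metric.sphere 0 1) :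
    (cornerHomeo n).symm y ∈ cornerSimplex n \ openCorner n :=
  (exists_corner_homeomorph n).choose_spec.2.1 y hy

lemma cornerHomeo_mem {x : Fin n → ℝ} (hx : x ∈ cornerSimplex n) :
    cornerHomeo n x ∈ Metric.closedBall 0 1 := (exists_corner_homeomorph n).choose_spec.2.2 x hx

end SimplexModel

/-- The topological simplex. -/
abbrev Smplx (n : ℕ) : Type u := SimplexCategory.toTop.{u}.obj ⦋n⦌

namespace Smplx

instance (n : ℕ) : CompactSpace (Smplx.{u} n) :=
  inferInstanceAs (CompactSpace (ULift (stdSimplex ℝ (Fin (n + 1)))))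

instance (n : ℕ) : T2Space (Smplx.{u} n) :=
  inferInstanceAs (T2Space (ULift (stdSimplex ℝ (Fin (n + 1)))))

variable {m n : ℕ}

/-- The barycentric coordinates. -/
def crd (t : Smplx.{u} n) (i : Fin (n + 1)) : ℝ := (ULift.down t : stdSimplex ℝ (Fin (n + 1))).1 i

lemma continuous_crd (i : Fin (n + 1)) : Continuous fun t : Smplx.{u} n => crd t i :=
  (continuous_apply i).comp (continuous_subtype_val.comp continuous_uliftDown)

lemma crd_nonneg (t : Smplx.{u} n) (i) : 0 ≤ crd t i := (ULift.down t).2.1 i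

lemma sum_crd (t : Smplx.{u} n) : ∑ i, crd t i = 1 := (ULift.down t).2.2

lemma ext {s t : Smplx.{u} n} (h : ∀ i, crd s i = crd t i) : s = t :=
  ULift.ext _ _ (Subtype.ext (funext h))

/-- The point with given barycentric coordinates. -/
def mk (x : Fin (n + 1) → ℝ) (h : ∀ i, 0 ≤ x i) (h' : ∑ i, x i = 1) : Smplx.{u} n :=
  ULift.up (⟨x, h, h'⟩ : stdSimplex ℝ (Fin (n + 1)))

@[simp] lemma crd_mk (x : Fin (n + 1) → ℝ) (h h' i) : crd (mk.{u} x h h') i = x i := rfl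

/-- The map of simplices induced by a map of vertices. -/
noncomputable def push (θ : ⦋m⦌ ⟶ ⦋n⦌) (t : Smplx.{u} m) : Smplx.{u} n :=
  (SimplexCategory.toTop.{u}.map θ).hom t

lemma crd_push (θ : ⦋m⦌ ⟶ ⦋n⦌) (t : Smplx.{u} m) (i) :
    crd (push θ t) i = ∑ j with θ.toOrderHom j = i, crd t j :=
  FunOnFinite.linearMap_apply_apply ℝ ℝ θ.toOrderHom t.down.1 i

lemma crd_push_of_injective (θ : ⦋m⦌ ⟶ ⦋n⦌) (hθ : Function.Injective θ.toOrderHom)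
    (t : Smplx.{u} m) (j) : crd (push θ t) (θ.toOrderHom j) = crd t j := by
  rw [crd_push, Finset.sum_eq_single j]
  · intro k hk hne
    exact (hne (hθ (Finset.mem_filter.1 hk).2)).elim
  · simp

lemma crd_push_of_notMem (θ : ⦋m⦌ ⟶ ⦋n⦌) (t : Smplx.{u} m) (i)
    (h : ∀ j, θ.toOrderHom j ≠ i) : crd (push θ t) i = 0 := by
  rw [crd_push]
  refine Finset.sum_eq_zero fun j hj => (h j (Finset.mem_filter.1 hj).2).elim

/-- The unnormalized coordinates of a point near the corner simplex. -/
noncomputable def rawCrd (x : Fin n → ℝ) : Fin (n + 1) → ℝ :=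
  Fin.cons (max (1 - ∑ i, x i) 0) fun i => max (x i) 0

lemma rawCrd_nonneg (x : Fin n → ℝ) (i) : 0 ≤ rawCrd x i := by
  refine Fin.cases ?_ (fun i => ?_) i <;> simp [rawCrd]

lemma sum_rawCrd_pos (x : Fin n → ℝ) : 0 < ∑ i, rawCrd x i := by
  by_contra h
  have h0 : ∑ i, rawCrd x i = 0 :=
    le_antisymm (not_lt.1 h) (Finset.sum_nonneg fun i _ => rawCrd_nonneg x i)
  rw [Finset.sum_eq_zero_iff_of_nonneg fun i _ => rawCrd_nonneg x i] at h0
  have h1 := h0 0 (Finset.mem_univ _)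
  have h2 : ∀ i, x i ≤ 0 := fun i => by
    have := h0 i.succ (Finset.mem_univ _)
    simp only [rawCrd, Fin.cons_succ] at this
    exact max_eq_right_iff.1 this
  simp only [rawCrd, Fin.cons_zero] at h1
  have h3 := max_eq_right_iff.1 h1
  have := Finset.sum_nonpos fun i (_ : i ∈ Finset.univ) => h2 i
  linarith

/-- The retraction to the simplex. -/
noncomputable def ofCorner (x : Fin n → ℝ) : Smplx.{u} n :=
  mk (fun i => rawCrd x i / ∑ i, rawCrd x i)
    (fun i => div_nonneg (rawCrd_nonneg x i) (sum_rawCrd_pos x).le)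
    (by rw [← Finset.sum_div, div_self (sum_rawCrd_pos x).ne'])

lemma continuous_rawCrd (i : Fin (n + 1)) : Continuous fun x : Fin n → ℝ => rawCrd x i := by
  refine Fin.cases ?_ (fun i => ?_) i
  · simp only [rawCrd, Fin.cons_zero]
    fun_prop
  · simp only [rawCrd, Fin.cons_succ]
    fun_prop

lemma continuous_ofCorner : Continuous (ofCorner : (Fin n → ℝ) → Smplx.{u} n) := by
  refine continuous_uliftUp.comp (Continuous.subtype_mk (continuous_pi fun i => ?_) _)
  exact (continuous_rawCrd i).div (continuous_finsetSum _ fun i _ => continuous_rawCrd i)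
    fun x => (sum_rawCrd_pos x).ne'

lemma rawCrd_of_mem {x : Fin n → ℝ} (hx : x ∈ cornerSimplex n) :
    rawCrd x = Fin.cons (1 - ∑ i, x i) x := by
  ext i
  refine Fin.cases ?_ (fun i => ?_) i
  · simp only [rawCrd, Fin.cons_zero]
    exact max_eq_left (by linarith [hx.2])
  · simp only [rawCrd, Fin.cons_succ]
    exact max_eq_left (hx.1 i)

lemma crd_ofCorner {x : Fin n → ℝ} (hx : x ∈ cornerSimplex n) (i) :
    crd (ofCorner.{u} x) i = (Fin.cons (1 - ∑ i, x i) x : Fin (n + 1) → ℝ) i := by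
  have : ∑ i, rawCrd x i = 1 := by
    rw [rawCrd_of_mem hx, Fin.sum_univ_succ]
    simp
  rw [ofCorner, crd_mk, this, div_one, rawCrd_of_mem hx]

lemma crd_ofCorner_pos {x : Fin n → ℝ} (hx : x ∈ openCorner n) (i) :
    0 < crd (ofCorner.{u} x) i := by
  rw [crd_ofCorner (openCorner_subset n hx)]
  refine Fin.cases ?_ (fun i => ?_) i
  · simpa using hx.2
  · simpa using hx.1 i

lemma exists_ofCorner (t : Smplx.{u} n) : ∃ x ∈ cornerSimplex n, ofCorner x = t := by
  have hs := sum_crd t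
  rw [Fin.sum_univ_succ] at hs
  have h0 := crd_nonneg t 0
  have hx : (fun i : Fin n => crd t i.succ) ∈ cornerSimplex n :=
    ⟨fun i => crd_nonneg _ _, by linarith⟩
  refine ⟨_, hx, ext fun i => ?_⟩
  rw [crd_ofCorner hx]
  refine Fin.cases ?_ (fun i => ?_) i
  · simp only [Fin.cons_zero]
    linarith
  · simp

/-- Every point is an interior point of a face. -/
lemma exists_push (t : Smplx.{u} n) : ∃ (m : ℕ) (θ : ⦋m⦌ ⟶ ⦋n⦌) (s : Smplx.{u} m),
    Function.Injective θ.toOrderHom ∧ (∀ i, 0 < crd s i) ∧ push θ s = t ∧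
      ((∃ i, crd t i = 0) → m < n) := by
  classical
  let A : Finset (Fin (n + 1)) := Finset.univ.filter fun i => 0 < crd t i
  have hA : A.Nonempty := by
    by_contra h
    have h0 : ∀ i, crd t i = 0 := fun i => by
      by_contra hi
      exact h ⟨i, by simpa [A] using lt_of_le_of_ne (crd_nonneg t i) (Ne.symm hi)⟩
    have := sum_crd t
    simp [h0] at this
  obtain ⟨m, hm⟩ : ∃ m, A.card = m + 1 := Nat.exists_eq_succ_of_ne_zero hA.card_ne_zero
  let ι := A.orderEmbOfFin hm
  let θ : ⦋m⦌ ⟶ ⦋n⦌ := SimplexCategory.mkHom ι.toOrderHom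
  have hr : ∀ i, crd t i ≠ 0 → ∃ j, ι j = i := fun i hi => by
    have : i ∈ Set.range ι := by
      rw [Finset.range_orderEmbOfFin]
      simpa [A] using lt_of_le_of_ne (crd_nonneg t i) (Ne.symm hi)
    exact this
  have hsum : ∑ j, crd t (ι j) = 1 := by
    rw [← sum_crd t]
    refine Finset.sum_of_injOn ι ι.injective.injOn (fun _ _ => Finset.mem_coe.2 (Finset.mem_univ _))
      (fun i _ hi => ?_) fun _ _ => rfl
    by_contra h
    obtain ⟨j, hj⟩ := hr i h
    exact hi ⟨j, by simp, hj⟩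
  refine ⟨m, θ, mk (fun j => crd t (ι j)) (fun j => crd_nonneg _ _) hsum, ι.injective, fun j => ?_,
    ext fun i => ?_, ?_⟩
  · have := A.orderEmbOfFin_mem hm j
    exact (Finset.mem_filter.1 this).2
  · by_cases h : ∃ j, ι j = i
    · obtain ⟨j, rfl⟩ := h
      exact crd_push_of_injective θ ι.injective _ j
    · rw [crd_push_of_notMem θ _ i fun j hj => h ⟨j, hj⟩]
      by_contra h'
      exact h (hr i (Ne.symm h'))
  · rintro ⟨i, hi⟩
    have : A ⊂ Finset.univ := Finset.ssubset_univ_iff.2 fun h => by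
      have : i ∈ A := h ▸ Finset.mem_univ i
      exact (Finset.mem_filter.1 this).2.ne' hi
    have := Finset.card_lt_card this
    rw [hm, Finset.card_univ, Fintype.card_fin] at this
    omega

end Smplx

section Realization

variable (S : SSet.{u})

/-- The gluing relation of the fat realization. -/
def FatRel (x y : Σ p : (Σ n, S _⦋n⦌), Smplx.{u} p.1) : Prop :=
  ∃ (m n : ℕ) (θ : ⦋m⦌ ⟶ ⦋n⦌) (_ : Function.Injective θ.toOrderHom) (ς : S _⦋n⦌) (t : Smplx.{u} m),
    x = ⟨⟨n, ς⟩, Smplx.push θ t⟩ ∧ y = ⟨⟨m, S.map θ.op ς⟩, t⟩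

/-- The fat realization of a simplicial set, in which only faces are identified. -/
def Fat : Type u := Quot (FatRel S)

namespace Fat

instance : TopologicalSpace (Fat S) := inferInstanceAs (TopologicalSpace (Quot _))

instance : IsKSpace (Fat S) := by
  have : ∀ p : (Σ n, S _⦋n⦌), IsKSpace (Smplx.{u} p.1) := fun p => inferInstance
  exact inferInstanceAs (IsKSpace (Quot _))

variable {S}

/-- The point of the realization given by a point of a simplex. -/
def mk {n : ℕ} (ς : S _⦋n⦌) (t : Smplx.{u} n) : Fat S := Quot.mk _ ⟨⟨n, ς⟩, t⟩

lemma continuous_mk {n : ℕ} (ς : S _⦋n⦌) : Continuous (mk ς) :=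
  continuous_quot_mk.comp (@continuous_sigmaMk _ (fun p : (Σ n, S _⦋n⦌) => Smplx.{u} p.1) _ ⟨n, ς⟩)

lemma mk_push {m n : ℕ} (θ : ⦋m⦌ ⟶ ⦋n⦌) (hθ : Function.Injective θ.toOrderHom) (ς : S _⦋n⦌)
    (t : Smplx.{u} m) : mk ς (Smplx.push θ t) = mk (S.map θ.op ς) t :=
  Quot.sound ⟨m, n, θ, hθ, ς, t, rfl, rfl⟩

/-- A map out of the realization. -/
def desc {T : Type*} (f : ∀ n, S _⦋n⦌ → Smplx.{u} n → T)
    (h : ∀ {m n : ℕ} (θ : ⦋m⦌ ⟶ ⦋n⦌), Function.Injective θ.toOrderHom → ∀ (ς : S _⦋n⦌) t,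
      f n ς (Smplx.push θ t) = f m (S.map θ.op ς) t) : Fat S → T :=
  Quot.lift (fun p => f p.1.1 p.1.2 p.2) (by
    rintro _ _ ⟨m, n, θ, hθ, ς, t, rfl, rfl⟩
    exact h θ hθ ς t)

lemma continuous_desc {T : Type*} [TopologicalSpace T] (f : ∀ n, S _⦋n⦌ → Smplx.{u} n → T) (h)
    (hf : ∀ n ς, Continuous (f n ς)) : Continuous (desc f h) :=
  continuous_quot_lift _ (continuous_sigma fun p => hf p.1 p.2)

lemma exists_interior (x : Fat S) : ∃ (n : ℕ) (ς : S _⦋n⦌) (t : Smplx.{u} n),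
    (∀ i, 0 < Smplx.crd t i) ∧ mk ς t = x := by
  obtain ⟨⟨⟨n, ς⟩, t⟩⟩ := x
  obtain ⟨m, θ, s, hθ, hs, rfl, -⟩ := Smplx.exists_push t
  exact ⟨m, S.map θ.op ς, s, hs, (mk_push θ hθ ς s).symm⟩

section Weight

variable {q : ℕ} (τ : S _⦋q⦌) (h : C(Fin (q + 1) → ℝ, ℝ))

/-- The faces of `ς` that agree with `τ`. -/
noncomputable def faces {n : ℕ} (ς : S _⦋n⦌) : Finset (⦋q⦌ ⟶ ⦋n⦌) :=
  (Set.toFinite (Set.ofPred fun a : ⦋q⦌ ⟶ ⦋n⦌ => Function.Injective a.toOrderHom ∧ S.map a.op ς = τ)).toFinset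

lemma mem_faces {n : ℕ} {ς : S _⦋n⦌} {a : ⦋q⦌ ⟶ ⦋n⦌} :
    a ∈ faces τ ς ↔ Function.Injective a.toOrderHom ∧ S.map a.op ς = τ := by
  rw [faces, Set.Finite.mem_toFinset]
  rfl

/-- The function on the realization given by a function on the faces that agree with `τ`. -/
noncomputable def weight : Fat S → ℝ :=
  desc (fun _ ς t => ∑ a ∈ faces τ ς, (∏ j, Smplx.crd t (a.toOrderHom j)) *
    h fun j => Smplx.crd t (a.toOrderHom j)) (by
    intro m n θ hθ ς t
    symm
    refine Finset.sum_of_injOn (fun b => b ≫ θ) ?_ ?_ ?_ ?_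
    · intro b _ c _ e
      ext j : 3
      exact hθ (DFunLike.congr_fun (congrArg SimplexCategory.Hom.toOrderHom e) j)
    · intro b hb
      obtain ⟨hb, e⟩ := (mem_faces τ).1 hb
      refine Finset.mem_coe.2 ((mem_faces τ).2 ⟨hθ.comp hb, ?_⟩)
      rw [← e]
      exact Functor.map_comp_apply S θ.op b.op ς
    · intro a ha hn
      obtain ⟨ha, e⟩ := (mem_faces τ).1 ha
      by_cases hc : ∀ j, ∃ k, θ.toOrderHom k = a.toOrderHom j
      · choose b hb using hc
        have hmono : Monotone b := fun i j hij => by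
          have := a.toOrderHom.monotone hij
          rw [← hb, ← hb] at this
          exact (θ.toOrderHom.monotone.strictMono_of_injective hθ).le_iff_le.1 this
        have he : SimplexCategory.mkHom ⟨b, hmono⟩ ≫ θ = a := by
          ext j : 3
          exact hb j
        refine (hn ⟨SimplexCategory.mkHom ⟨b, hmono⟩, Finset.mem_coe.2 ((mem_faces τ).2
          ⟨fun i j hij => ha ?_, ?_⟩), he⟩).elim
        · rw [← hb, ← hb]
          exact congrArg θ.toOrderHom hij
        · rw [← e, ← he]
          exact (Functor.map_comp_apply S θ.op _ ς).symm
      · push Not at hc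
        obtain ⟨j, hj⟩ := hc
        rw [Finset.prod_eq_zero (Finset.mem_univ j) (Smplx.crd_push_of_notMem θ t _ hj), zero_mul]
    · intro b _
      have : ∀ j, Smplx.crd (Smplx.push θ t) ((b ≫ θ).toOrderHom j) =
          Smplx.crd t (b.toOrderHom j) := fun j => Smplx.crd_push_of_injective θ hθ t _
      simp only [this])

lemma continuous_weight : Continuous (weight τ h) := by
  refine continuous_desc _ _ fun n ς => continuous_finsetSum _ fun a _ => ?_
  exact (continuous_finsetProd _ fun j _ => Smplx.continuous_crd _).mul
    (h.continuous.comp (continuous_pi fun j => Smplx.continuous_crd _))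

lemma eq_id_of_injective {n : ℕ} (a : ⦋n⦌ ⟶ ⦋n⦌) (ha : Function.Injective a.toOrderHom) : a = 𝟙 _ :=
  have : Mono a := SimplexCategory.mono_iff_injective.2 ha
  SimplexCategory.eq_id_of_mono a

lemma weight_mk_self (t : Smplx.{u} q) :
    weight τ h (mk τ t) = (∏ j, Smplx.crd t j) * h (Smplx.crd t) := by
  have : faces τ τ = {𝟙 _} := by
    ext a
    rw [mem_faces, Finset.mem_singleton]
    refine ⟨fun h => eq_id_of_injective a h.1, ?_⟩
    rintro rfl
    exact ⟨Function.injective_id, Functor.map_id_apply S _ τ⟩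
  refine (Finset.sum_congr this fun _ _ => rfl).trans ?_
  rw [Finset.sum_singleton]
  rfl

lemma exists_face_of_weight_ne_zero {n : ℕ} {ς : S _⦋n⦌} {t : Smplx.{u} n}
    (hw : weight τ h (mk ς t) ≠ 0) :
    ∃ a : ⦋q⦌ ⟶ ⦋n⦌, Function.Injective a.toOrderHom ∧ S.map a.op ς = τ := by
  obtain ⟨a, ha, -⟩ := Finset.exists_ne_zero_of_sum_ne_zero hw
  exact ⟨a, (mem_faces τ).1 ha⟩

end Weight

lemma weight_one_pos {n : ℕ} (ς : S _⦋n⦌) {t : Smplx.{u} n} (ht : ∀ i, 0 < Smplx.crd t i) :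
    0 < weight ς (.const _ 1) (mk ς t) := by
  rw [weight_mk_self]
  simpa using Finset.prod_pos fun i _ => ht i

/-- The coordinate functions separate interior points. -/
lemma eq_of_weight_eq {m n : ℕ} {ς : S _⦋n⦌} {τ : S _⦋m⦌} {t : Smplx.{u} n} {s : Smplx.{u} m}
    (ht : ∀ i, 0 < Smplx.crd t i) (hs : ∀ i, 0 < Smplx.crd s i)
    (h : ∀ (q : ℕ) (ρ : S _⦋q⦌) h, weight ρ h (mk ς t) = weight ρ h (mk τ s)) :
    (⟨⟨n, ς⟩, t⟩ : Σ p : (Σ n, S _⦋n⦌), Smplx.{u} p.1) = ⟨⟨m, τ⟩, s⟩ := by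
  obtain ⟨a, ha, ea⟩ := exists_face_of_weight_ne_zero τ (.const _ 1)
    (ς := ς) (t := t) (by rw [h]; exact (weight_one_pos τ hs).ne')
  obtain ⟨b, hb, -⟩ := exists_face_of_weight_ne_zero ς (.const _ 1)
    (ς := τ) (t := s) (by rw [← h]; exact (weight_one_pos ς ht).ne')
  have h₁ := Fintype.card_le_of_injective _ ha
  have h₂ := Fintype.card_le_of_injective _ hb
  simp only [SimplexCategory.len_mk, Fintype.card_fin] at h₁ h₂
  obtain rfl : m = n := by omega
  rw [eq_id_of_injective a ha] at ea
  obtain rfl : ς = τ := (Functor.map_id_apply S _ ς).symm.trans ea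
  have e₁ := h m ς (.const _ 1)
  simp only [weight_mk_self, ContinuousMap.const_apply, mul_one] at e₁
  have hts : t = s := Smplx.ext fun i => by
    have e₂ := h m ς ⟨fun x => x i, continuous_apply i⟩
    simp only [weight_mk_self, ContinuousMap.coe_mk] at e₂
    rw [e₁] at e₂
    exact mul_left_cancel₀ (Finset.prod_pos fun i _ => hs i).ne' e₂
  rw [hts]

instance : T2Space (Fat S) := by
  refine ⟨fun x y hxy => ?_⟩
  obtain ⟨n, ς, t, ht, rfl⟩ := exists_interior x
  obtain ⟨m, τ, s, hs, rfl⟩ := exists_interior y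
  have : ∃ (q : ℕ) (ρ : S _⦋q⦌) (h : C(Fin (q + 1) → ℝ, ℝ)),
      weight ρ h (mk ς t) ≠ weight ρ h (mk τ s) := by
    by_contra hne
    push Not at hne
    exact hxy (congrArg (Quot.mk _) (eq_of_weight_eq ht hs hne))
  obtain ⟨q, ρ, h, hne⟩ := this
  exact separated_by_continuous (continuous_weight ρ h) hne

variable (S)

/-- The cell structure of the realization. -/
noncomputable def cellStructure : CellStructure (Fat S) where
  J := Σ n, S _⦋n⦌
  dim j := j.1
  χ j y := mk j.2 (Smplx.ofCorner ((cornerHomeo j.1).symm y))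
  inv j x := cornerHomeo j.1 fun i => weight j.2 ⟨fun x => x i.succ, continuous_apply _⟩ x /
    weight j.2 (.const _ 1) x
  continuousOn j := ((continuous_mk j.2).comp (Smplx.continuous_ofCorner.comp
    (cornerHomeo j.1).symm.continuous)).continuousOn
  continuousOn_inv j := by
    refine (cornerHomeo j.1).continuous.comp_continuousOn (continuousOn_pi.2 fun i =>
      (continuous_weight _ _).continuousOn.div (continuous_weight _ _).continuousOn ?_)
    rintro _ ⟨y, hy, rfl⟩
    exact (weight_one_pos j.2 (Smplx.crd_ofCorner_pos (cornerHomeo_symm_ball _ hy))).ne'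
  left_inv j y hy := by
    have hx := cornerHomeo_symm_ball _ hy
    rw [← Homeomorph.eq_symm_apply]
    ext i
    have hp := weight_one_pos j.2 (Smplx.crd_ofCorner_pos.{u} hx)
    rw [weight_mk_self] at hp ⊢
    rw [weight_mk_self]
    simp only [ContinuousMap.const_apply, mul_one, ContinuousMap.coe_mk] at hp ⊢
    rw [mul_div_cancel_left₀ _ hp.ne', Smplx.crd_ofCorner (openCorner_subset _ hx), Fin.cons_succ]
  disjoint j k hne := by
    rw [Set.disjoint_left]
    rintro _ ⟨x, hx, rfl⟩ ⟨y, hy, e⟩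
    have := eq_of_weight_eq (Smplx.crd_ofCorner_pos.{u} (cornerHomeo_symm_ball _ hx))
      (Smplx.crd_ofCorner_pos.{u} (cornerHomeo_symm_ball _ hy)) fun q ρ h =>
        congrArg (weight ρ h) e.symm
    exact hne (congrArg Sigma.fst this)
  frontier j := by
    have hfin := Set.finite_range fun p : (Σ m : Fin j.1, ⦋(m : ℕ)⦌ ⟶ ⦋j.1⦌) =>
      (⟨p.1, S.map p.2.op j.2⟩ : Σ n, S _⦋n⦌)
    refine ⟨hfin.toFinset, fun k hk => ?_, fun y hy => ?_⟩
    · obtain ⟨p, rfl⟩ := hfin.mem_toFinset.1 hk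
      exact p.1.2
    · obtain ⟨hx, hx'⟩ := cornerHomeo_symm_sphere _ hy
      obtain ⟨m, θ, s, hθ, -, e, hm⟩ :=
        Smplx.exists_push (Smplx.ofCorner.{u} ((cornerHomeo j.1).symm y))
      have hz : ∃ i, Smplx.crd (Smplx.ofCorner.{u} ((cornerHomeo j.1).symm y)) i = 0 := by
        by_contra h
        push Not at h
        simp only [Smplx.crd_ofCorner hx] at h
        apply hx'
        refine ⟨fun i => lt_of_le_of_ne (hx.1 i) (Ne.symm ?_), lt_of_le_of_ne hx.2 fun e => ?_⟩
        · simpa using h i.succ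
        · exact h 0 (by simp [e])
      obtain ⟨x, hx, rfl⟩ := Smplx.exists_ofCorner s
      refine Set.mem_iUnion₂.2 ⟨⟨m, S.map θ.op j.2⟩, hfin.mem_toFinset.2 ⟨⟨⟨m, hm hz⟩, θ⟩, rfl⟩,
        cornerHomeo m x, cornerHomeo_mem m hx, ?_⟩
      dsimp only
      rw [Homeomorph.symm_apply_apply, ← e, mk_push θ hθ]
  isClosed A hA := by
    refine (isQuotientMap_quot_mk (r := FatRel S)).isClosed_preimage.1 ?_
    rw [isClosed_sigma_iff]
    rintro ⟨n, ς⟩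
    convert (hA ⟨n, ς⟩).preimage (continuous_mk ς) using 1
    ext t
    refine ⟨fun h => ⟨h, ?_⟩, fun h => h.1⟩
    obtain ⟨x, hx, rfl⟩ := Smplx.exists_ofCorner t
    exact ⟨cornerHomeo n x, cornerHomeo_mem n hx, by dsimp only; rw [Homeomorph.symm_apply_apply]⟩
  cover x := by
    obtain ⟨n, ς, t, -, rfl⟩ := exists_interior x
    obtain ⟨x, hx, rfl⟩ := Smplx.exists_ofCorner t
    exact ⟨⟨n, ς⟩, cornerHomeo n x, cornerHomeo_mem n hx, by
      dsimp only; rw [Homeomorph.symm_apply_apply]⟩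

lemma isCW : IsCW (Fat S) := (cellStructure S).isCW

variable {S}

/-- The map of realizations induced by a map of simplicial sets. -/
def map {T : SSet.{u}} (f : S ⟶ T) : C(Fat S, Fat T) :=
  ⟨desc (fun _ ς t => mk (f.app _ ς) t) fun θ hθ ς t => by
    rw [mk_push θ hθ]
    exact congrArg (fun τ => mk τ t) (NatTrans.naturality_apply f θ.op ς).symm,
    continuous_desc _ _ fun _ ς => continuous_mk _⟩

end Fat
end Realization

/-! ### The realization of the singular set of a space -/

/-- The realization of the singular set of a space. -/
noncomputable def singReal (B : Type u) [TopologicalSpace B] : KSpace.{u} :=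
  ⟨Fat (TopCat.toSSet.obj (TopCat.of B))⟩

lemma isCW_singReal (B : Type u) [TopologicalSpace B] : IsCW (singReal B) := Fat.isCW _

/-- The evaluation map. -/
noncomputable def singEval (B : Type u) [TopologicalSpace B] : C(singReal B, B) :=
  ⟨Fat.desc (fun _ ς t => ς.down.hom t) fun _ _ _ _ => rfl,
    Fat.continuous_desc _ _ fun _ ς => ς.down.hom.continuous⟩

/-- The map induced by a continuous map. -/
noncomputable def singRealMap {B C : Type u} [TopologicalSpace B] [TopologicalSpace C] (f : C(B, C)) :
    C(singReal B, singReal C) := Fat.map (TopCat.toSSet.map (TopCat.ofHom f))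

lemma singEval_map {B C : Type u} [TopologicalSpace B] [TopologicalSpace C] (f : C(B, C))
    (x : singReal B) : singEval C (singRealMap f x) = f (singEval B x) := by
  obtain ⟨⟨⟨n, ς⟩, t⟩⟩ := x
  rfl

end HGFT

namespace HGFT

open Simplicial Opposite

section HomologyMap

variable {F : Type u} [Field F] {K L : ChainComplex (ModuleCat.{u} F) ℕ} (φ : K ⟶ L) (n : ℕ)

lemma map_mem_cyc (z : Cyc K n) : (φ.f n).hom z.1 ∈ Cyc L n := by
  have h := congrArg (fun g : K.X n ⟶ L.X (n - 1) => g.hom z.1) (φ.comm n (n - 1))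
  have hz : (K.d n (n - 1)).hom z.1 = 0 := z.2
  refine h.trans ?_
  change (φ.f (n - 1)).hom ((K.d n (n - 1)).hom z.1) = 0
  rw [hz, map_zero]

lemma homologyMap_cls (z : Cyc K n) : (HomologicalComplex.homologyMap φ n).hom (cls K n z) =
    cls L n ⟨_, map_mem_cyc φ n z⟩ := by
  have h := HomologicalComplex.homologyπ_naturality φ n
  refine Eq.trans (congrArg (fun g => g.hom ((K.liftCycles (A := ModuleCat.of F (Cyc K n))
    (ModuleCat.ofHom (Cyc K n).subtype) (n - 1) (next_down n) (by ext z; exact z.2)).hom z)) h) ?_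
  refine congrArg (L.homologyπ n).hom ?_
  have inj : Function.Injective (L.iCycles n) := (ModuleCat.mono_iff_injective _).1 inferInstance
  apply inj
  refine (congrArg (fun g => g.hom ((K.liftCycles (A := ModuleCat.of F (Cyc K n))
    (ModuleCat.ofHom (Cyc K n).subtype) (n - 1) (next_down n) (by ext z; exact z.2)).hom z))
    (HomologicalComplex.cyclesMap_i φ n)).trans ?_
  refine Eq.trans (congrArg (φ.f n).hom ?_) (congrArg (fun g => g.hom (⟨_, map_mem_cyc φ n z⟩ : Cyc L n))
    (L.liftCycles_i (A := ModuleCat.of F (Cyc L n)) (ModuleCat.ofHom (Cyc L n).subtype) (n - 1)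
      (next_down n) (by ext z; exact z.2))).symm
  exact congrArg (fun g => g.hom z)
    (K.liftCycles_i (A := ModuleCat.of F (Cyc K n)) (ModuleCat.ofHom (Cyc K n).subtype) (n - 1)
      (next_down n) (by ext z; exact z.2))

end HomologyMap

section Natural

variable {F : Type u} [Field F] {X Y T X' Y' T' : SSet.{u}}

lemma chainMap_basisChain (f : X ⟶ X') {n : ℕ} (x : X _⦋n⦌) :
    ((SSet.chainComplexMap f (ModuleCat.of F F)).f n).hom (basisChain x) =
      basisChain (f.app _ x) :=
  congrArg (fun g => g.hom (1 : F)) (SSet.ι_chainComplexMap_f X X' f (ModuleCat.of F F) x)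

variable (μ : Pairing X Y T) (μ' : Pairing X' Y' T') (f : X ⟶ X') (g : Y ⟶ Y') (h : T ⟶ T')
  (hμ : ∀ n x y, h.app n (μ.app n x y) = μ'.app n (f.app n x) (g.app n y))

include hμ in
lemma chainMap_pathChain {p q : ℕ} (x : X _⦋p⦌) (y : Y _⦋q⦌) (n : ℕ)
    (l : List (Fin (p + 1) × Fin (q + 1))) :
    ((SSet.chainComplexMap h (ModuleCat.of F F)).f n).hom (pathChain μ.app x y n l) =
      pathChain μ'.app (f.app _ x) (g.app _ y) n l := by
  by_cases hl : ∃ a : Fin (n + 1) →o Fin (p + 1) × Fin (q + 1), l = List.ofFn a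
  · obtain ⟨a, rfl⟩ := hl
    rw [pathChain_ofFn, pathChain_ofFn, chainMap_basisChain]
    congr 1
    refine (hμ _ _ _).trans ?_
    simp only [pathSimplex]
    congr 1
    · exact NatTrans.naturality_apply f _ x
    · exact NatTrans.naturality_apply g _ y
  · rw [pathChain, pathChain, dif_neg hl, dif_neg hl, map_zero]

include hμ in
lemma chainMap_chainCross (p q n : ℕ) (a : (Chains F X).X p) (b : (Chains F Y).X q) :
    ((SSet.chainComplexMap h (ModuleCat.of F F)).f n).hom (chainCross μ.app p q n a b) =
      chainCross μ'.app p q n (((SSet.chainComplexMap f (ModuleCat.of F F)).f p).hom a)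
        (((SSet.chainComplexMap g (ModuleCat.of F F)).f q).hom b) := by
  have : (chainCross μ.app p q n).compr₂ ((SSet.chainComplexMap h (ModuleCat.of F F)).f n).hom =
      (chainCross μ'.app p q n).compl₁₂ ((SSet.chainComplexMap f (ModuleCat.of F F)).f p).hom
        ((SSet.chainComplexMap g (ModuleCat.of F F)).f q).hom := by
    refine chain_ext fun x => chain_ext fun y => ?_
    simp only [LinearMap.compr₂_apply, LinearMap.compl₁₂_apply]
    rw [chainMap_basisChain, chainMap_basisChain]
    simp only [chainCross, chainDesc_basisChain, shuffle]
    have e := map_pathSum ((SSet.chainComplexMap h (ModuleCat.of F F)).f n).hom.toAddMonoidHom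
      (pathChain (F := F) μ.app x y n) (List.finRange (p + 1)) (List.finRange (q + 1))
    refine e.trans (congrArg (fun k => pathSum k _ _) (funext fun l => ?_))
    exact chainMap_pathChain μ μ' f g h hμ x y n l
  exact LinearMap.congr_fun₂ this a b

variable [CharP F 2]

include hμ in
lemma homologyMap_homologyCross (p q n : ℕ) (a : (Chains F X).homology p)
    (b : (Chains F Y).homology q) :
    (HomologicalComplex.homologyMap (SSet.chainComplexMap h (ModuleCat.of F F)) n).hom
        (homologyCross μ p q n a b) =
      homologyCross μ' p q n
        ((HomologicalComplex.homologyMap (SSet.chainComplexMap f (ModuleCat.of F F)) p).hom a)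
        ((HomologicalComplex.homologyMap (SSet.chainComplexMap g (ModuleCat.of F F)) q).hom b) := by
  obtain ⟨a, rfl⟩ := cls_surjective _ _ a
  obtain ⟨b, rfl⟩ := cls_surjective _ _ b
  rw [homologyCross_cls, homologyMap_cls, homologyMap_cls, homologyMap_cls, homologyCross_cls]
  exact congrArg (cls _ n) (Subtype.ext (chainMap_chainCross μ μ' f g h hμ p q n a.1 b.1))

end Natural

/-! ### The characteristic chain map -/

section Char

variable {F : Type u} [Field F]

/-- The characteristic simplex of a simplex in the realization. -/
noncomputable def charSimplex (S : SSet.{u}) {n : ℕ} (x : S _⦋n⦌) :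
    (TopCat.toSSet.obj (TopCat.of (Fat S))) _⦋n⦌ :=
  ULift.up (TopCat.ofHom ⟨Fat.mk x, Fat.continuous_mk x⟩)

lemma δ_charSimplex (S : SSet.{u}) {n : ℕ} (x : S _⦋n + 1⦌) (i : Fin (n + 2)) :
    (TopCat.toSSet.obj (TopCat.of (Fat S))).δ i (charSimplex S x) = charSimplex S (S.δ i x) := by
  refine congrArg ULift.up (TopCat.hom_ext (ContinuousMap.ext fun t => ?_))
  exact Fat.mk_push (SimplexCategory.δ i) (Fin.succAbove_right_injective) x t

variable (F) in
/-- The linear map sending a simplex to its characteristic simplex. -/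
noncomputable def charLin (S : SSet.{u}) (n : ℕ) :
    (Chains F S).X n →ₗ[F] (Chains F (TopCat.toSSet.obj (TopCat.of (Fat S)))).X n :=
  chainDesc fun x => basisChain (charSimplex S x)

lemma charLin_basisChain (S : SSet.{u}) {n : ℕ} (x : S _⦋n⦌) :
    charLin F S n (basisChain x) = basisChain (charSimplex S x) := chainDesc_basisChain _ x

variable [CharP F 2]

variable (F) in
/-- The chain map from a simplicial set to the singular set of its realization. -/
noncomputable def charChain (S : SSet.{u}) :
    Chains F S ⟶ Chains F (TopCat.toSSet.obj (TopCat.of (Fat S))) where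
  f n := ModuleCat.ofHom (charLin F S n)
  comm' i j hij := by
    obtain rfl : j + 1 = i := hij
    refine ModuleCat.hom_ext (chain_ext fun x => ?_)
    change ((Chains F _).d (j + 1) j).hom (charLin F S (j + 1) (basisChain x)) =
      charLin F S j (((Chains F S).d (j + 1) j).hom (basisChain x))
    rw [charLin_basisChain, d_basisChain, d_basisChain, map_sum]
    refine Finset.sum_congr rfl fun k _ => ?_
    rw [δ_charSimplex, charLin_basisChain]

variable (F) in
/-- The map from singular homology to the homology of the realization of the singular set. -/
noncomputable def charHom (n : ℕ) (L : Type u) [TopologicalSpace L] :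
    HH F n L ⟶ HH F n (singReal L) :=
  HomologicalComplex.homologyMap (charChain F (TopCat.toSSet.obj (TopCat.of L))) n

lemma charHom_naturality (n : ℕ) {L M : Type u} [TopologicalSpace L] [TopologicalSpace M]
    (f : C(L, M)) :
    charHom F n L ≫ HH.map F n (singRealMap f) = HH.map F n f ≫ charHom F n M := by
  have h : charChain F (TopCat.toSSet.obj (TopCat.of L)) ≫
      SSet.chainComplexMap (TopCat.toSSet.map (TopCat.ofHom (singRealMap f))) (ModuleCat.of F F) =
      SSet.chainComplexMap (TopCat.toSSet.map (TopCat.ofHom f)) (ModuleCat.of F F) ≫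
        charChain F (TopCat.toSSet.obj (TopCat.of M)) := by
    ext n : 1
    refine ModuleCat.hom_ext (chain_ext fun x => ?_)
    refine (congrArg (((SSet.chainComplexMap _ (ModuleCat.of F F)).f n).hom)
      (charLin_basisChain _ x)).trans ?_
    refine (chainMap_basisChain _ _).trans ?_
    refine Eq.trans ?_ (congrArg ((charChain F _).f n).hom (chainMap_basisChain _ x)).symm
    exact (charLin_basisChain (F := F) (TopCat.toSSet.obj (TopCat.of M))
      ((TopCat.toSSet.map (TopCat.ofHom f)).app _ x)).symm
  refine (HomologicalComplex.homologyMap_comp _ _ n).symm.trans ?_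
  exact (congrArg (fun k => HomologicalComplex.homologyMap k n) h).trans
    (HomologicalComplex.homologyMap_comp _ _ n)

lemma charHom_eval (n : ℕ) (L : Type u) [TopologicalSpace L] :
    charHom F n L ≫ HH.map F n (singEval L) = 𝟙 _ := by
  have h : charChain F (TopCat.toSSet.obj (TopCat.of L)) ≫
      SSet.chainComplexMap (TopCat.toSSet.map (TopCat.ofHom (singEval L))) (ModuleCat.of F F) =
      𝟙 _ := by
    ext n : 1
    refine ModuleCat.hom_ext (chain_ext fun x => ?_)
    refine (congrArg (((SSet.chainComplexMap _ (ModuleCat.of F F)).f n).hom)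
      (charLin_basisChain _ x)).trans ?_
    exact (chainMap_basisChain _ _)
  refine (HomologicalComplex.homologyMap_comp _ _ n).symm.trans ?_
  exact (congrArg (fun k => HomologicalComplex.homologyMap k n) h).trans
    (HomologicalComplex.homologyMap_id _ n)

end Char
end HGFT

namespace HGFT

open KSpace DirectSum

section Shifted

variable {F : Type u} [Field F] {B C D B' C' : KSpace.{u}} {l : B → ℤ} {m : C → ℤ} {n : D → ℤ}

lemma HH.map_comp (i : ℕ) {X Y Z : Type u} [TopologicalSpace X] [TopologicalSpace Y]
    [TopologicalSpace Z] (f : C(X, Y)) (g : C(Y, Z)) :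
    HH.map F i (g.comp f) = HH.map F i f ≫ HH.map F i g :=
  ((AlgebraicTopology.singularHomologyFunctor (ModuleCat.{u} F) i).obj (ModuleCat.of F F)).map_comp
    (TopCat.ofHom f) (TopCat.ofHom g)

lemma HH.map_id (i : ℕ) (X : Type u) [TopologicalSpace X] :
    HH.map F i (ContinuousMap.id X) = 𝟙 _ :=
  ((AlgebraicTopology.singularHomologyFunctor (ModuleCat.{u} F) i).obj (ModuleCat.of F F)).map_id
    (TopCat.of X)

lemma lmap_hom_ext {V W : ℕ → ModuleCat.{u} F} {f g : ∀ i, V i ⟶ W i} (h : ∀ i, f i = g i) :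
    DirectSum.lmap (fun i => (f i).hom) = DirectSum.lmap fun i => (g i).hom := by
  obtain rfl : f = g := funext h
  rfl

lemma lmap_comp_hom {V W Z : ℕ → ModuleCat.{u} F} (f : ∀ i, V i ⟶ W i) (g : ∀ i, W i ⟶ Z i) :
    ModuleCat.ofHom (DirectSum.lmap (fun i => (f i).hom)) ≫
      ModuleCat.ofHom (DirectSum.lmap fun i => (g i).hom) =
      ModuleCat.ofHom (DirectSum.lmap fun i => (f i ≫ g i).hom) := by
  refine ModuleCat.hom_ext (DirectSum.linearMap_ext F fun i => LinearMap.ext fun x => ?_)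
  simp only [ModuleCat.hom_comp, LinearMap.comp_apply, ModuleCat.hom_ofHom, DirectSum.lmap_lof]

lemma lmap_id_hom (V : ℕ → ModuleCat.{u} F) :
    ModuleCat.ofHom (DirectSum.lmap (fun i => (𝟙 (V i) : V i ⟶ V i).hom)) =
      𝟙 (ModuleCat.of F (⨁ i, V i)) := by
  refine ModuleCat.hom_ext (DirectSum.linearMap_ext F fun i => LinearMap.ext fun x => ?_)
  simp only [LinearMap.comp_apply, ModuleCat.hom_ofHom, DirectSum.lmap_lof]
  rfl

lemma SH.map_id (h : ∀ b, l (ContinuousMap.id B b) = l b) :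
    SH.map (F := F) (ContinuousMap.id B) h = 𝟙 _ := by
  funext q
  refine Eq.trans ?_ (lmap_id_hom _)
  exact congrArg ModuleCat.ofHom (lmap_hom_ext fun i => HH.map_id i _)

lemma singEval_levelIncl (l : B → ℤ) (i : ℕ) (q : ℤ) (x : singReal {b : B // l b + i = q}) :
    l (singEval B (singRealMap (B := {b : B // l b + i = q}) ⟨_, continuous_subtype_val⟩ x)) + i =
      q := by
  rw [singEval_map (B := {b : B // l b + i = q})]
  exact (singEval {b : B // l b + i = q} x).2

/-- The inclusion of the realization of the singular set of a part of `B`. -/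
noncomputable def levelIncl (l : B → ℤ) (i : ℕ) (q : ℤ) : C(singReal {b : B // l b + i = q},
    {x : singReal B // l (singEval B x) + i = q}) :=
  ⟨fun x => ⟨_, singEval_levelIncl l i q x⟩, Continuous.subtype_mk (ContinuousMap.continuous _) _⟩

lemma SH.map_lof (f : C(B, C)) (hf : ∀ b, m (f b) = l b) (i : ℕ) (q : ℤ)
    (a : HH F i {b : B // l b + i = q}) :
    (SH.map (F := F) f hf q).hom
        (DirectSum.lof F ℕ (fun i : ℕ => HH F i {b : B // l b + i = q}) i a) =
      DirectSum.lof F ℕ (fun i : ℕ => HH F i {b : C // m b + i = q}) i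
        ((HH.map F i (levelMap f hf i q)).hom a) :=
  DirectSum.lmap_lof _ _ _

variable [CharP F 2]

/-- The map from the homology of a space to that of the realization of its singular set. -/
noncomputable def SH.sing (l : B → ℤ) :
    SH F B l ⟶ SH F (singReal B) (fun x => l (singEval B x)) := fun q =>
  ModuleCat.ofHom (DirectSum.lmap fun i : ℕ =>
    (charHom F i {b : B // l b + i = q} ≫ HH.map F i (levelIncl l i q)).hom)

lemma SH.sing_eval (l : B → ℤ) :
    SH.sing l ≫ SH.map (singEval B) (fun _ => rfl) = 𝟙 (SH F B l) := by
  funext q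
  refine (lmap_comp_hom _ _).trans (Eq.trans ?_ (lmap_id_hom _))
  refine congrArg ModuleCat.ofHom (lmap_hom_ext fun i => ?_)
  rw [Category.assoc, ← HH.map_comp]
  refine Eq.trans ?_ (charHom_eval i _)
  congr 2
  ext x
  exact singEval_map (B := {b : B // l b + i = q}) ⟨Subtype.val, continuous_subtype_val⟩ x

lemma singRealMap_comp {X Y Z : Type u} [TopologicalSpace X] [TopologicalSpace Y]
    [TopologicalSpace Z] (f : C(X, Y)) (g : C(Y, Z)) (x : singReal X) :
    singRealMap (g.comp f) x = singRealMap g (singRealMap f x) := by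
  obtain ⟨⟨⟨n, ς⟩, t⟩⟩ := x
  rfl

lemma SH.sing_naturality (f : C(B, C)) (hf : ∀ b, m (f b) = l b) :
    SH.map (F := F) f hf ≫ SH.sing m = SH.sing l ≫ SH.map (singRealMap f) fun x =>
      (congrArg m (singEval_map f x)).trans (hf _) := by
  funext q
  refine (lmap_comp_hom _ _).trans (Eq.trans ?_ (lmap_comp_hom _ _).symm)
  refine congrArg ModuleCat.ofHom (lmap_hom_ext fun i => ?_)
  rw [← Category.assoc, ← charHom_naturality, Category.assoc, Category.assoc, ← HH.map_comp,
    ← HH.map_comp]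
  congr 2
  refine ContinuousMap.ext fun x => Subtype.ext ?_
  exact (singRealMap_comp (X := {b : B // l b + i = q}) (levelMap f hf i q)
    ⟨Subtype.val, continuous_subtype_val⟩ x).symm.trans (singRealMap_comp
    (X := {b : B // l b + i = q}) ⟨Subtype.val, continuous_subtype_val⟩ f x)

/-- The pairing of parts of spaces underlying the cross product. -/
noncomputable def levelPairing (m : B → ℤ) (n : C → ℤ) (i j : ℕ) {q r k : ℤ} (h : q + r = k) :
    Pairing (TopCat.toSSet.obj (TopCat.of {b : B // m b + i = q}))
      (TopCat.toSSet.obj (TopCat.of {c : C // n c + j = r}))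
      (TopCat.toSSet.obj (TopCat.of
        {p : B.prod C // (m (fst p) + n (snd p)) + (i + j : ℕ) = k})) :=
  spacePairing (A := {b : B // m b + i = q}) (B := {c : C // n c + j = r})
    (T := {p : B.prod C // (m (fst p) + n (snd p)) + (i + j : ℕ) = k})
    (fun b c => ⟨(levelPair b c).1, (levelPair b c).2.trans h⟩) (fun K _ _ _ a b => by
      refine Continuous.subtype_mk ?_ _
      exact continuous_pair (by fun_prop) (by fun_prop))

/-- The cross product of components of given degrees, as a bilinear map. -/
noncomputable def crossLin (m : B → ℤ) (n : C → ℤ) {q r k : ℤ} (h : q + r = k) :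
    (⨁ i : ℕ, HH F i {b : B // m b + i = q}) →ₗ[F] (⨁ j : ℕ, HH F j {c : C // n c + j = r}) →ₗ[F]
      (⨁ l : ℕ, HH F l {p : B.prod C // (m (fst p) + n (snd p)) + l = k}) :=
  DirectSum.toModule F ℕ _ fun i => LinearMap.flip (DirectSum.toModule F ℕ _ fun j =>
    LinearMap.flip ((homologyCross (levelPairing m n i j h) i j (i + j)).compr₂
      (DirectSum.lof F ℕ (fun l : ℕ => HH F l
        {p : B.prod C // (m (fst p) + n (snd p)) + l = k}) (i + j))))

lemma crossLin_lof (m : B → ℤ) (n : C → ℤ) {q r k : ℤ} (h : q + r = k) (i j : ℕ)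
    (a : HH F i {b : B // m b + i = q}) (b : HH F j {c : C // n c + j = r}) :
    crossLin m n h
      (DirectSum.lof F ℕ (fun i : ℕ => HH F i {b : B // m b + i = q}) i a)
        (DirectSum.lof F ℕ (fun j : ℕ => HH F j {c : C // n c + j = r}) j b) =
      DirectSum.lof F ℕ (fun l : ℕ => HH F l {p : B.prod C // (m (fst p) + n (snd p)) + l = k})
        (i + j) (homologyCross (levelPairing m n i j h) i j (i + j) a b) := by
  rw [crossLin, DirectSum.toModule_lof, LinearMap.flip_apply, DirectSum.toModule_lof]
  rfl

/-- The cross product of components of given degrees. -/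
noncomputable def crossPart (m : B → ℤ) (n : C → ℤ) {q r k : ℤ} (h : q + r = k) :
    SH F B m q ⊗ SH F C n r ⟶ SH F (B.prod C) (fun p => m (fst p) + n (snd p)) k :=
  ModuleCat.ofHom (TensorProduct.lift (crossLin m n h))

lemma ι_cross (m : B → ℤ) (n : C → ℤ) {q r k : ℤ} (h : q + r = k) :
    GradedObject.Monoidal.ιTensorObj (SH F B m) (SH F C n) q r k h ≫ SH.cross m n k =
      crossPart m n h :=
  GradedObject.Monoidal.ι_tensorObjDesc _ q r h

lemma crossPart_lof (m : B → ℤ) (n : C → ℤ) {q r k : ℤ} (h : q + r = k) (i j : ℕ)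
    (a : HH F i {b : B // m b + i = q}) (b : HH F j {c : C // n c + j = r}) :
    (crossPart m n h).hom
      (DirectSum.lof F ℕ (fun i : ℕ => HH F i {b : B // m b + i = q}) i a ⊗ₜ[F]
        DirectSum.lof F ℕ (fun j : ℕ => HH F j {c : C // n c + j = r}) j b) =
      DirectSum.lof F ℕ (fun l : ℕ => HH F l {p : B.prod C // (m (fst p) + n (snd p)) + l = k})
        (i + j) (homologyCross (levelPairing m n i j h) i j (i + j) a b) :=
  (TensorProduct.lift.tmul (f' := crossLin m n h) _ _).trans (crossLin_lof m n h i j a b)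

lemma SH.cross_naturality {m' : B' → ℤ} {n' : C' → ℤ} (f : C(B, B')) (g : C(C, C'))
    (hf : ∀ b, m' (f b) = l b) (hg : ∀ c, n' (g c) = m c) :
    (SH.map (F := F) f hf ⊗ₘ SH.map g hg) ≫ SH.cross m' n' =
      SH.cross l m ≫ SH.map (prodMap f g) fun _ => congrArg₂ (· + ·) (hf _) (hg _) := by
  funext k
  refine GradedObject.Monoidal.tensorObj_ext _ _ fun q r h => ?_
  have e₁ : GradedObject.Monoidal.ιTensorObj (SH F B l) (SH F C m) q r k h ≫
      (SH.map (F := F) f hf ⊗ₘ SH.map g hg) k = _ :=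
    GradedObject.Monoidal.ι_tensorHom (SH.map (F := F) f hf) (SH.map g hg) q r k h
  refine ((Category.assoc _ _ _).symm.trans (congrArg (· ≫ SH.cross m' n' k) e₁)).trans ?_
  refine (Category.assoc _ _ _).trans ?_
  refine (congrArg (_ ≫ ·) (ι_cross _ _ h)).trans ?_
  refine Eq.trans ?_ ((congrArg (· ≫ SH.map (prodMap f g) _ k)
    (ι_cross _ _ h)).symm.trans (Category.assoc _ _ _))
  refine ModuleCat.hom_ext (TensorProduct.ext (DirectSum.linearMap_ext F fun i =>
    LinearMap.ext fun a => DirectSum.linearMap_ext F fun j => LinearMap.ext fun b => ?_))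
  refine (congrArg (crossPart m' n' h).hom (congrArg₂ (· ⊗ₜ[F] ·) (SH.map_lof f hf i q a)
    (SH.map_lof g hg j r b))).trans ?_
  refine Eq.trans ?_ (congrArg (SH.map (prodMap f g) _ k).hom (crossPart_lof l m h i j a b)).symm
  refine (crossPart_lof m' n' h i j _ _).trans (Eq.trans ?_ (SH.map_lof _ _ _ _ _).symm)
  refine congrArg _ ?_
  exact (homologyMap_homologyCross (levelPairing l m i j h) (levelPairing m' n' i j h)
    (TopCat.toSSet.map (TopCat.ofHom (levelMap f hf i q)))
    (TopCat.toSSet.map (TopCat.ofHom (levelMap g hg j r)))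
    (TopCat.toSSet.map (TopCat.ofHom (levelMap (prodMap f g)
      (fun _ => congrArg₂ (· + ·) (hf _) (hg _)) (i + j) k))) (fun _ _ _ => rfl) i j (i + j) a b).symm

end Shifted

end HGFT

namespace HGFT

open KSpace

/-! ### Fibrewise equivalences -/

section FibreMaps

variable {X Y Z W X' Y' : Obj.{u}}

lemma FopHom.map_congr {f g : X ⟶ Y} (e : f = g) (b : X.base) (y : Y.total)
    (h : FopHom.base f b = Y.proj y) (h' : FopHom.base g b = Y.proj y) :
    FopHom.map f (Pullback.mk b y h) = FopHom.map g (Pullback.mk b y h') := by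
  subst e
  rfl

lemma FopHom.fibreMap_comp (f : X ⟶ Y) (g : Y ⟶ Z) {a : X.base} {b : Y.base} {c : Z.base}
    (h : FopHom.base f a = b) (h' : FopHom.base g b = c) (h'' : FopHom.base (f ≫ g) a = c) :
    FopHom.fibreMap (f ≫ g) h'' = (FopHom.fibreMap f h).comp (FopHom.fibreMap g h') := by
  subst h
  subst h'
  rfl

/-- A morphism preserving shifts and given by homotopy equivalences of fibres. -/
structure IsVEq (f : X ⟶ Y) : Prop where
  shift : ∀ b, X.shift b = Y.shift (FopHom.base f b)
  isHomotopyEquiv : ∀ b, IsHomotopyEquiv (FopHom.fibreMap f (b := b) rfl)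

lemma IsVEq.fibre {f : X ⟶ Y} (hf : IsVEq f) {b : X.base} {c : Y.base}
    (h : FopHom.base f b = c) : IsHomotopyEquiv (FopHom.fibreMap f h) := by
  subst h
  exact hf.isHomotopyEquiv b

lemma IsVEq.isVertical {f : X ⟶ Y} (hf : IsVEq f) : IsVertical f :=
  ⟨hf.shift, fun b => (hf.isHomotopyEquiv b).isHEmbedding⟩

lemma IsVEq.id (X : Obj.{u}) : IsVEq (𝟙 X) :=
  ⟨fun _ => rfl, fun _ => IsHomotopyEquiv.id⟩

lemma IsVEq.comp {f : X ⟶ Y} {g : Y ⟶ Z} (hf : IsVEq f) (hg : IsVEq g) : IsVEq (f ≫ g) :=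
  ⟨fun b => (hf.shift b).trans (hg.shift _), fun b =>
    (hf.isHomotopyEquiv b).comp (hg.isHomotopyEquiv (FopHom.base f b))⟩

lemma FopHom.base_hom_inv (e : X ≅ Y) (b : X.base) :
    FopHom.base e.inv (FopHom.base e.hom b) = b :=
  congrArg (fun f : X ⟶ X => FopHom.base f b) e.hom_inv_id

lemma FopHom.isHomotopyEquiv_iso (e : X ≅ Y) {b : X.base} {c : Y.base}
    (h : FopHom.base e.hom b = c) : IsHomotopyEquiv (FopHom.fibreMap e.hom h) := by
  subst h
  have h' := FopHom.base_hom_inv e b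
  have h'' : FopHom.base e.hom b = FopHom.base e.hom b := rfl
  refine IsHomotopyEquiv.of_inv _ (FopHom.fibreMap e.inv h') (fun x => ?_) fun y => ?_
  · have h₁ : FopHom.base (e.inv ≫ e.hom) (FopHom.base e.hom b) = FopHom.base e.hom b :=
      congrArg (FopHom.base e.hom) h'
    refine (congrArg (fun k => k x) (FopHom.fibreMap_comp e.inv e.hom h' h'' h₁)).symm.trans ?_
    revert h₁
    rw [e.inv_hom_id]
    intro h₁
    rfl
  · have h₁ : FopHom.base (e.hom ≫ e.inv) b = b := h'
    refine (congrArg (fun k => k y) (FopHom.fibreMap_comp e.hom e.inv h'' h' h₁)).symm.trans ?_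
    revert h₁
    rw [e.hom_inv_id]
    intro h₁
    rfl

lemma IsVEq.iso (e : X ≅ Y) (h : ∀ b, X.shift b = Y.shift (FopHom.base e.hom b)) :
    IsVEq e.hom := ⟨h, fun _ => FopHom.isHomotopyEquiv_iso e rfl⟩

lemma IsVEq.iso_inv (e : X ≅ Y) (h : ∀ b, X.shift b = Y.shift (FopHom.base e.hom b)) :
    IsVEq e.inv :=
  ⟨fun c => (congrArg Y.shift (FopHom.base_hom_inv e.symm c)).symm.trans (h _).symm,
    fun _ => FopHom.isHomotopyEquiv_iso e.symm rfl⟩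

lemma FopHom.fibreMap_tensor (f : X ⟶ X') (g : Y ⟶ Y') (p : X.base.prod Y.base)
    {q : X'.base.prod Y'.base} (hp : prodMap (FopHom.base f) (FopHom.base g) p = q) (z) :
    FopHom.fibreMap (X := (X.fam.tensor Y.fam).obj) (Y := (X'.fam.tensor Y'.fam).obj)
        (FopHom.tensor f g) hp (fibreTensor X'.fam Y'.fam q z) =
      fibreTensor X.fam Y.fam p (Sum.map (FopHom.fibreMap f (congrArg fst hp))
        (FopHom.fibreMap g (congrArg snd hp)) z) := by
  subst hp
  rcases z with z | z <;> rfl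

lemma IsHomotopyEquiv.of_conj {A B A' B' : Type*} [TopologicalSpace A] [TopologicalSpace B]
    [TopologicalSpace A'] [TopologicalSpace B'] {f : C(A, B)} {f' : C(A', B')}
    (hf : IsHomotopyEquiv f) (e : A ≃ₜ A') (e' : B ≃ₜ B') (h : ∀ a, f' (e a) = e' (f a)) :
    IsHomotopyEquiv f' := by
  refine IsHomotopyEquiv.of_comp_right (IsHomotopyEquiv.homeo e) ?_
  rw [show f'.comp (e : C(A, A')) = (e' : C(B, B')).comp f from ContinuousMap.ext h]
  exact (IsHomotopyEquiv.homeo e').comp hf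

lemma IsVEq.tensor {f : X ⟶ X'} {g : Y ⟶ Y'} (hf : IsVEq f) (hg : IsVEq g) :
    IsVEq (X := (X.fam.tensor Y.fam).obj) (Y := (X'.fam.tensor Y'.fam).obj)
      (FopHom.tensor f g) where
  shift p := congrArg₂ (· + ·) (hf.shift (fst p)) (hg.shift (snd p))
  isHomotopyEquiv p := by
    refine ((hf.isHomotopyEquiv (fst p)).sumMap (hg.isHomotopyEquiv (snd p))).of_conj
      (fibreTensor X'.fam Y'.fam (prodMap (FopHom.base f) (FopHom.base g) p))
      (fibreTensor X.fam Y.fam p) fun z => ?_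
    exact FopHom.fibreMap_tensor f g p rfl z

end FibreMaps

/-! ### Two-cells -/

section TwoCells

variable {B C : KSpace.{u}} {X Y : Fam B} {Z W : Fam C} {top : HorMap X Y} {bot : HorMap Z W}
  {left : X.obj ⟶ Z.obj} {right : Y.obj ⟶ W.obj}

lemma fibre_comm (h : top.toHom ≫ right = left ≫ bot.toHom) {b : B} {c : C}
    (hl : FopHom.base left b = c) (hr : FopHom.base right b = c) (w : fibre W.proj c) :
    FopHom.fibreMap left hl (bot.fibreMap c w) = top.fibreMap b (FopHom.fibreMap right hr w) := by
  refine congrArg Kify.mk (Subtype.ext ?_)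
  exact (FopHom.map_congr h b (fibreVal w) (hr.trans (fibre_cond w).symm)
    (hl.trans (fibre_cond w).symm)).symm

lemma IsTwoCell.of_vertical (h : top.toHom ≫ right = left ≫ bot.toHom) (hl : IsVEq left)
    (hr : IsVEq right) : IsTwoCell top bot left right :=
  ⟨h, fun _ _ h₁ h₂ => IsHomotopyCofibreSquare.of_isHomotopyEquiv' (fibre_comm h h₁ h₂)
    (hr.fibre h₂) (hl.fibre h₁)⟩

lemma IsTwoCell.of_horizontal (h : top.toHom ≫ right = left ≫ bot.toHom)
    (ht : ∀ b, IsHomotopyEquiv (top.fibreMap b)) (hb : ∀ c, IsHomotopyEquiv (bot.fibreMap c)) :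
    IsTwoCell top bot left right :=
  ⟨h, fun b c h₁ h₂ => IsHomotopyCofibreSquare.of_isHomotopyEquiv (fibre_comm h h₁ h₂)
    (hb c) (ht b)⟩

end TwoCells

lemma FopHom.ext_of_leftInverse {X Y : Obj.{u}} {f g : X ⟶ Y} (k : Y.base → X.base)
    (hk : ∀ b, k (FopHom.base f b) = b) (hb : ∀ b, FopHom.base f b = FopHom.base g b)
    (hm : ∀ y h h', FopHom.map f (Pullback.mk (k (Y.proj y)) y h) =
      FopHom.map g (Pullback.mk (k (Y.proj y)) y h')) : f = g :=
  FopHom.ext' hb fun b y h h' => by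
    obtain rfl : k (Y.proj y) = b := (congrArg k h).symm.trans (hk b)
    exact hm y h h'

lemma FopHom.tensor_id (X Y : Obj.{u}) :
    FopHom.tensor (𝟙 X : X ⟶ X) (𝟙 Y : Y ⟶ Y) = FopHom.id (X.fam.tensor Y.fam).obj :=
  FopHom.ext_of_leftInverse (X := (X.fam.tensor Y.fam).obj) (Y := (X.fam.tensor Y.fam).obj)
    _root_.id (fun _ => rfl) (fun _ => rfl) (by rintro (q | q) _ _ <;> rfl)

lemma FopHom.tensor_comp {X Y Z X' Y' Z' : Obj.{u}} (f : X ⟶ Y) (f' : Y ⟶ Z) (g : X' ⟶ Y')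
    (g' : Y' ⟶ Z') : (FopHom.tensor f g).comp (FopHom.tensor f' g') =
      FopHom.tensor (f ≫ f' : X ⟶ Z) (g ≫ g' : X' ⟶ Z') :=
  FopHom.ext' (fun _ => rfl) (by rintro b (q | q) h h' <;> rfl)

/-! ### The symmetric monoidal category of families over CW complexes -/

/-- The families of h-graphs over CW complexes, admitting basepoints, with degree shifts. -/
structure CWFam : Type (u + 1) where
  obj : Obj.{u}
  inH : InH obj
  isCW : IsCW obj.base

namespace CWFam

instance : Category CWFam.{u} where
  Hom X Y := {f : X.obj ⟶ Y.obj // IsVEq f}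
  id X := ⟨𝟙 X.obj, IsVEq.id _⟩
  comp f g := ⟨f.1 ≫ g.1, f.2.comp g.2⟩

/-- The underlying morphism. -/
def hom {X Y : CWFam.{u}} (f : X ⟶ Y) : X.obj ⟶ Y.obj := f.1

lemma isVEq {X Y : CWFam.{u}} (f : X ⟶ Y) : IsVEq (hom f) := f.2

/-- A morphism given by a fibrewise equivalence. -/
def mkHom {X Y : CWFam.{u}} (f : X.obj ⟶ Y.obj) (hf : IsVEq f) : X ⟶ Y := ⟨f, hf⟩

lemma hom_ext {X Y : CWFam.{u}} {f g : X ⟶ Y} (h : hom f = hom g) : f = g := Subtype.ext h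

/-- The external disjoint union. -/
def tensor (X Y : CWFam.{u}) : CWFam.{u} where
  obj := (X.obj.fam.tensor Y.obj.fam).obj
  inH := InH.tensor (X := X.obj.fam) (Y := Y.obj.fam) X.inH Y.inH (X.isCW.prod Y.isCW).isGoodBase
  isCW := X.isCW.prod Y.isCW

/-- The unit. -/
def unit : CWFam.{u} where
  obj := unitObj
  inH := inH_emptyFam isCW_pt.isGoodBase (IsLocallyConstant.const 0)
  isCW := isCW_pt

/-- An isomorphism given by an isomorphism preserving shifts. -/
def isoMk {X Y : CWFam.{u}} (e : X.obj ≅ Y.obj)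
    (h : ∀ b, X.obj.shift b = Y.obj.shift (FopHom.base e.hom b)) : X ≅ Y where
  hom := ⟨e.hom, IsVEq.iso e h⟩
  inv := ⟨e.inv, IsVEq.iso_inv e h⟩
  hom_inv_id := Subtype.ext e.hom_inv_id
  inv_hom_id := Subtype.ext e.inv_hom_id

instance : MonoidalCategoryStruct CWFam.{u} where
  tensorObj := tensor
  tensorHom f g := ⟨FopHom.tensor f.1 g.1, f.2.tensor g.2⟩
  whiskerLeft X _ _ g := ⟨FopHom.tensor (𝟙 X.obj) g.1, (IsVEq.id _).tensor g.2⟩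
  whiskerRight f Y := ⟨FopHom.tensor f.1 (𝟙 Y.obj), f.2.tensor (IsVEq.id _)⟩
  tensorUnit := unit
  associator X Y Z := isoMk (associatorIso X.obj Y.obj Z.obj) fun _ => add_assoc _ _ _
  leftUnitor X := isoMk (leftUnitorIso X.obj) fun _ => zero_add _
  rightUnitor X := isoMk (rightUnitorIso X.obj) fun _ => add_zero _

instance : MonoidalCategory CWFam.{u} where
  tensorHom_def _ _ := hom_ext (FopHom.ext' (fun _ => rfl) (by rintro b (q | q) h h' <;> rfl))
  id_tensorHom_id X Y := hom_ext (FopHom.tensor_id X.obj Y.obj)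
  tensorHom_comp_tensorHom _ _ _ _ := hom_ext (FopHom.tensor_comp _ _ _ _)
  whiskerLeft_id X Y := hom_ext (FopHom.tensor_id X.obj Y.obj)
  id_whiskerRight X Y := hom_ext (FopHom.tensor_id X.obj Y.obj)
  associator_naturality _ _ _ := hom_ext (FopHom.ext' (fun _ => rfl)
    (by rintro _ (q | ⟨b, q | q⟩) _ _ <;> rfl))
  leftUnitor_naturality _ := hom_ext (FopHom.ext' (fun _ => rfl) (by rintro _ _ _ _; rfl))
  rightUnitor_naturality _ := hom_ext (FopHom.ext' (fun _ => rfl) (by rintro _ _ _ _; rfl))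
  pentagon _ _ _ _ := hom_ext (FopHom.ext_of_leftInverse
    (fun p => pair (pair (pair (fst p) (fst (snd p))) (fst (snd (snd p)))) (snd (snd (snd p))))
    (fun _ => rfl) (fun _ => rfl) (by rintro (q | ⟨b, q | ⟨c, q | q⟩⟩) _ _ <;> rfl))
  triangle X Y := hom_ext (FopHom.ext_of_leftInverse
    (fun p => pair (pair (fst p) star) (snd p))
    (fun _ => rfl) (fun _ => rfl) (by rintro (q | q) _ _ <;> rfl))

instance : BraidedCategory CWFam.{u} where
  braiding X Y := isoMk (braidIso X.obj Y.obj) fun _ => add_comm _ _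
  braiding_naturality_right _ _ _ _ := hom_ext (FopHom.ext' (fun _ => rfl)
    (by rintro _ (q | q) _ _ <;> rfl))
  braiding_naturality_left _ _ := hom_ext (FopHom.ext' (fun _ => rfl)
    (by rintro _ (q | q) _ _ <;> rfl))
  hexagon_forward _ _ _ := hom_ext (FopHom.ext_of_leftInverse
    (fun p => pair (pair (snd (snd p)) (fst p)) (fst (snd p)))
    (fun _ => rfl) (fun _ => rfl) (by rintro (q | ⟨b, q | q⟩) _ _ <;> rfl))
  hexagon_reverse _ _ _ := hom_ext (FopHom.ext_of_leftInverse
    (fun p => pair (snd (fst p)) (pair (snd p) (fst (fst p))))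
    (fun _ => rfl) (fun _ => rfl) (by rintro (⟨q | q, b⟩ | q) _ _ <;> rfl))

variable {F : Type u} [Field F] {d : ℤ} (U : SymmMonDoubleFunctor F d)

/-- The vertical part of a symmetric monoidal double functor, on families over CW complexes. -/
def functor : CWFam.{u} ⥤ GrMod F where
  obj X := U.obj X.obj X.inH
  map f := U.vmap _ _ (hom f) (isVEq f).isVertical
  map_id _ := U.vmap_id _ _
  map_comp _ _ := U.vmap_comp _ _ _ _ _ _ _ _

/-- The monoidality constraints of the vertical part. -/
def coreMonoidal : (functor U).CoreMonoidal where
  εIso := U.unitIso unit.inH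
  μIso X Y := U.tensorIso X.inH Y.inH (tensor X Y).inH
  μIso_hom_natural_left {X Y} f Z := by
    have := U.tensorIso_vmap X.inH Z.inH (tensor X Z).inH Y.inH Z.inH (tensor Y Z).inH (hom f)
      (𝟙 Z.obj) (isVEq f).isVertical (IsVEq.id _).isVertical
      ((isVEq f).tensor (IsVEq.id _)).isVertical
    rw [U.vmap_id, tensorHom_id] at this
    exact this
  μIso_hom_natural_right {Y Z} X f := by
    have := U.tensorIso_vmap X.inH Y.inH (tensor X Y).inH X.inH Z.inH (tensor X Z).inH (𝟙 X.obj)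
      (hom f) (IsVEq.id _).isVertical (isVEq f).isVertical
      ((IsVEq.id _).tensor (isVEq f)).isVertical
    rw [U.vmap_id, id_tensorHom] at this
    exact this
  associativity X Y Z := U.associativity X.inH Y.inH Z.inH (tensor X Y).inH (tensor Y Z).inH
    (tensor (tensor X Y) Z).inH (tensor X (tensor Y Z)).inH (isVEq (α_ X Y Z).hom).isVertical
  left_unitality X := U.left_unitality unit.inH X.inH (tensor unit X).inH
    (isVEq (λ_ X).hom).isVertical
  right_unitality X := U.right_unitality unit.inH X.inH (tensor X unit).inH
    (isVEq (ρ_ X).hom).isVertical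

noncomputable instance : (functor U).Monoidal := (coreMonoidal U).toMonoidal

noncomputable instance : (functor U).Braided where
  braided X Y := U.symmetry X.inH Y.inH (tensor X Y).inH (tensor Y X).inH
    (isVEq (β_ X Y).hom).isVertical |>.symm

end CWFam

end HGFT

namespace HGFT

open KSpace

namespace HGraph

variable {X Y Z : HGraph.{u}}

lemma inH (X : HGraph.{u}) : InH X.fam.obj := X.inH_fam isCW_pt.isGoodBase

/-- An h-graph as a family over a point. -/
@[reducible] def toCW (X : HGraph.{u}) : CWFam.{u} := ⟨X.fam.obj, X.inH, isCW_pt⟩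

lemma isHomotopyEquiv_fibre {f : X ⟶ Y} {b c : KSpace.pt.{u}}
    (k : C(fibre X.fam.proj b, fibre Y.fam.proj c))
    (h : ∀ x, fibreVal (k x) = toMap f (fibreVal x)) :
    IsHomotopyEquiv k :=
  (isHomotopyEquiv f).of_conj (X.fibreFam b) (Y.fibreFam c) fun _ =>
    congrArg Kify.mk (Subtype.ext (h _))

lemma isVEq_vert (f : X ⟶ Y) : IsVEq (vert f) :=
  ⟨fun _ => rfl, fun _ => isHomotopyEquiv_fibre (f := f) _ fun _ => rfl⟩

/-- The morphism of families given by a homotopy equivalence. -/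
def toCWVert (f : X ⟶ Y) : Y.toCW ⟶ X.toCW := CWFam.mkHom (vert f) (isVEq_vert f)

lemma toCWVert_id (X : HGraph.{u}) : toCWVert (𝟙 X) = 𝟙 _ := rfl

lemma toCWVert_comp (f : X ⟶ Y) (g : Y ⟶ Z) : toCWVert (f ≫ g) = toCWVert g ≫ toCWVert f := rfl

/-- The horizontal morphism given by a homotopy equivalence. -/
def horMap (f : X ⟶ Y) : HorMap Y.fam X.fam := ⟨toMap f, fun _ => rfl⟩

lemma isHomotopyEquiv_horMap (f : X ⟶ Y) (b) : IsHomotopyEquiv ((horMap f).fibreMap b) :=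
  isHomotopyEquiv_fibre (f := f) _ fun _ => rfl

lemma isHorizontal_of_isHomotopyEquiv (F : Type u) [Field F] (d : ℤ) {B : KSpace.{u}} {X Y : Fam B}
    {h : HorMap X Y} (hh : ∀ b, IsHomotopyEquiv (h.fibreMap b)) (hs : ∀ b, X.shift b = Y.shift b) :
    IsHorizontal F d h :=
  ⟨fun b => (hh b).isPositive, fun b => by rw [hs, eulerChar_eq F _ (hh b)]; simp⟩

lemma isHorizontal_horMap (F : Type u) [Field F] (d : ℤ) (f : X ⟶ Y) :
    IsHorizontal F d (horMap f) :=
  isHorizontal_of_isHomotopyEquiv F d (isHomotopyEquiv_horMap f) fun _ => rfl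

/-- The comparison of the disjoint union of h-graphs with the external disjoint union. -/
def unionIso (X Y : HGraph.{u}) : X.toCW ⊗ Y.toCW ≅ (X ⊗ Y).toCW :=
  CWFam.isoMk
    { hom := unionHom X Y
      inv := FopHom.ofInv (X := (X ⊗ Y).fam.obj) (Y := (X.fam.tensor Y.fam).obj)
        ⟨fun _ => pair star star, continuous_const⟩ ⟨fun _ => star, continuous_const⟩ (fun _ => rfl)
        ⟨elim (fun q => (inl (fst q) : X.space.sum Y.space)) (fun q => inr (snd q)),
          continuous_elim (KSpace.continuous_inl.comp KSpace.continuous_fst)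
            (KSpace.continuous_inr.comp KSpace.continuous_snd)⟩ (by rintro (q | q) <;> rfl)
      hom_inv_id := FopHom.ext' (fun _ => rfl) (by rintro _ (q | q) _ _ <;> rfl)
      inv_hom_id := FopHom.ext' (fun _ => rfl) (by rintro _ (q | q) _ _ <;> rfl) }
    fun _ => rfl

/-- The comparison of the unit objects. -/
def unitJIso : 𝟙_ CWFam.{u} ≅ (𝟙_ HGraph.{u}).toCW :=
  CWFam.isoMk
    { hom := FopHom.ofInv (X := unitObj) (Y := (𝟙_ HGraph.{u}).fam.obj) (ContinuousMap.id KSpace.pt)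
        (ContinuousMap.id KSpace.pt) (fun _ => rfl) (ContinuousMap.id KSpace.empty)
        fun x => isEmptyElim (α := KSpace.empty) x
      inv := FopHom.ofInv (X := (𝟙_ HGraph.{u}).fam.obj) (Y := unitObj) (ContinuousMap.id KSpace.pt)
        (ContinuousMap.id KSpace.pt) (fun _ => rfl) (ContinuousMap.id KSpace.empty)
        fun x => isEmptyElim (α := KSpace.empty) x
      hom_inv_id := FopHom.ext' (fun _ => rfl) fun _ _ _ _ => rfl
      inv_hom_id := FopHom.ext' (fun _ => rfl) fun _ _ _ _ => rfl }
    fun _ => rfl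

lemma union_natural_left (f : X ⟶ Y) (Z : HGraph.{u}) :
    toCWVert f ▷ Z.toCW ≫ (unionIso X Z).hom = (unionIso Y Z).hom ≫ toCWVert (f ▷ Z) :=
  CWFam.hom_ext (FopHom.ext' (fun _ => rfl) (by rintro _ (q | q) _ _ <;> rfl))

lemma union_natural_right (f : X ⟶ Y) (Z : HGraph.{u}) :
    Z.toCW ◁ toCWVert f ≫ (unionIso Z X).hom = (unionIso Z Y).hom ≫ toCWVert (Z ◁ f) :=
  CWFam.hom_ext (FopHom.ext' (fun _ => rfl) (by rintro _ (q | q) _ _ <;> rfl))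

lemma union_assoc (X Y Z : HGraph.{u}) :
    (unionIso X Y).hom ▷ Z.toCW ≫ (unionIso (X ⊗ Y) Z).hom ≫ toCWVert (α_ X Y Z).inv =
      (α_ _ _ _).hom ≫ X.toCW ◁ (unionIso Y Z).hom ≫ (unionIso X (Y ⊗ Z)).hom :=
  CWFam.hom_ext (FopHom.ext' (fun _ => rfl) (by rintro _ (q | q | q) _ _ <;> rfl))

lemma union_left_unit (X : HGraph.{u}) :
    unitJIso.hom ▷ X.toCW ≫ (unionIso (𝟙_ _) X).hom ≫ toCWVert (λ_ X).inv = (λ_ X.toCW).hom :=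
  CWFam.hom_ext (FopHom.ext' (fun _ => rfl) (by rintro _ q _ _; rfl))

lemma union_right_unit (X : HGraph.{u}) :
    X.toCW ◁ unitJIso.hom ≫ (unionIso X (𝟙_ _)).hom ≫ toCWVert (ρ_ X).inv = (ρ_ X.toCW).hom :=
  CWFam.hom_ext (FopHom.ext' (fun _ => rfl) (by rintro _ q _ _; rfl))

lemma union_braid (X Y : HGraph.{u}) :
    (unionIso X Y).hom ≫ toCWVert (β_ X Y).inv = (β_ _ _).hom ≫ (unionIso Y X).hom :=
  CWFam.hom_ext (FopHom.ext' (fun _ => rfl) (by rintro _ (q | q) _ _ <;> rfl))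

end HGraph

/-! ### The underlying symmetric monoidal functor of the field theory -/

section Functor

variable {F : Type u} [Field F] {d : ℤ} (U : SymmMonDoubleFunctor F d)

open HGraph

/-- The vertical part of the double functor. -/
local notation "V" => CWFam.functor U

lemma isHorizontal_id {B : KSpace.{u}} (X : Fam B) : IsHorizontal F d (HorMap.id X) :=
  isHorizontal_of_isHomotopyEquiv F d (fun _ => IsHomotopyEquiv.id) fun _ => rfl

/-- The map given by a homotopy equivalence as a horizontal morphism. -/
def hor {X Y : HGraph.{u}} (f : X ⟶ Y) : (V).obj X.toCW ⟶ (V).obj Y.toCW :=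
  U.hmap Y.inH X.inH (horMap f) (isHorizontal_horMap F d f)

lemma hor_vert {X Y : HGraph.{u}} (f : X ⟶ Y) : hor U f ≫ (V).map (toCWVert f) = 𝟙 _ := by
  have := U.cell Y.inH X.inH X.inH X.inH (horMap f) (HorMap.id X.fam)
    (vert f) (𝟙 X.fam.obj) (isHorizontal_horMap F d f) (isHorizontal_id _)
    (isVEq_vert f).isVertical (IsVEq.id _).isVertical
    (IsTwoCell.of_horizontal rfl (isHomotopyEquiv_horMap f) fun _ => IsHomotopyEquiv.id)
  rw [U.vmap_id, U.hmap_id, Category.id_comp] at this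
  exact this

lemma vert_hor {X Y : HGraph.{u}} (f : X ⟶ Y) : (V).map (toCWVert f) ≫ hor U f = 𝟙 _ := by
  have := U.cell Y.inH Y.inH Y.inH X.inH (HorMap.id Y.fam) (horMap f)
    (𝟙 Y.fam.obj) (vert f) (isHorizontal_id _) (isHorizontal_horMap F d f)
    (IsVEq.id _).isVertical (isVEq_vert f).isVertical
    (IsTwoCell.of_horizontal rfl (fun _ => IsHomotopyEquiv.id) (isHomotopyEquiv_horMap f))
  rw [U.vmap_id, U.hmap_id, Category.id_comp] at this
  exact this.symm

/-- The isomorphism given by a homotopy equivalence. -/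
def horIso {X Y : HGraph.{u}} (f : X ⟶ Y) : (V).obj X.toCW ≅ (V).obj Y.toCW where
  hom := hor U f
  inv := (V).map (toCWVert f)
  hom_inv_id := hor_vert U f
  inv_hom_id := vert_hor U f

lemma horIso_inv {X Y : HGraph.{u}} (f : X ⟶ Y) : (horIso U f).inv = (V).map (toCWVert f) := rfl

lemma hor_iso {X Y : HGraph.{u}} (e : X ≅ Y) : hor U e.hom = (V).map (toCWVert e.inv) := by
  rw [← cancel_epi (horIso U e.hom).inv, horIso_inv, vert_hor, ← (V).map_comp,
    ← toCWVert_comp, e.inv_hom_id, toCWVert_id, (V).map_id]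

open Functor.LaxMonoidal Functor.Monoidal

/-- The monoidality constraint on h-graphs. -/
noncomputable def unionU (X Y : HGraph.{u}) :
    (V).obj X.toCW ⊗ (V).obj Y.toCW ≅ (V).obj (X ⊗ Y).toCW :=
  μIso (V) X.toCW Y.toCW ≪≫ (V).mapIso (unionIso X Y)

/-- The unit constraint on h-graphs. -/
noncomputable def unitU : 𝟙_ (GrMod F) ≅ (V).obj (𝟙_ HGraph.{u}).toCW :=
  εIso (V) ≪≫ (V).mapIso unitJIso

lemma unionU_hom (X Y : HGraph.{u}) :
    (unionU U X Y).hom = μ (V) X.toCW Y.toCW ≫ (V).map (unionIso X Y).hom := rfl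

lemma unitU_hom : (unitU U).hom = ε (V) ≫ (V).map unitJIso.hom := rfl

lemma vert_unionU_left {X Y : HGraph.{u}} (f : X ⟶ Y) (Z : HGraph.{u}) :
    (V).map (toCWVert f) ▷ (V).obj Z.toCW ≫ (unionU U X Z).hom =
      (unionU U Y Z).hom ≫ (V).map (toCWVert (f ▷ Z)) := by
  rw [unionU_hom, unionU_hom, μ_natural_left_assoc, Category.assoc, ← (V).map_comp,
    ← (V).map_comp, union_natural_left]

lemma vert_unionU_right {X Y : HGraph.{u}} (f : X ⟶ Y) (Z : HGraph.{u}) :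
    (V).obj Z.toCW ◁ (V).map (toCWVert f) ≫ (unionU U Z X).hom =
      (unionU U Z Y).hom ≫ (V).map (toCWVert (Z ◁ f)) := by
  rw [unionU_hom, unionU_hom, μ_natural_right_assoc, Category.assoc, ← (V).map_comp,
    ← (V).map_comp, union_natural_right]

lemma hor_unionU_left {X Y : HGraph.{u}} (f : X ⟶ Y) (Z : HGraph.{u}) :
    hor U f ▷ (V).obj Z.toCW ≫ (unionU U Y Z).hom = (unionU U X Z).hom ≫ hor U (f ▷ Z) := by
  rw [← cancel_mono (horIso U (f ▷ Z)).inv, horIso_inv, Category.assoc, Category.assoc, hor_vert,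
    ← vert_unionU_left, ← comp_whiskerRight_assoc, hor_vert, id_whiskerRight, Category.id_comp,
    Category.comp_id]

lemma hor_unionU_right {X Y : HGraph.{u}} (f : X ⟶ Y) (Z : HGraph.{u}) :
    (V).obj Z.toCW ◁ hor U f ≫ (unionU U Z Y).hom = (unionU U Z X).hom ≫ hor U (Z ◁ f) := by
  rw [← cancel_mono (horIso U (Z ◁ f)).inv, horIso_inv, Category.assoc, Category.assoc, hor_vert,
    ← vert_unionU_right, ← whiskerLeft_comp_assoc, hor_vert, whiskerLeft_id, Category.id_comp,
    Category.comp_id]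

lemma unionU_assoc (X Y Z : HGraph.{u}) :
    (unionU U X Y).hom ▷ (V).obj Z.toCW ≫ (unionU U (X ⊗ Y) Z).hom ≫ hor U (α_ X Y Z).hom =
      (α_ _ _ _).hom ≫ (V).obj X.toCW ◁ (unionU U Y Z).hom ≫ (unionU U X (Y ⊗ Z)).hom := by
  simp only [hor_iso, unionU_hom, comp_whiskerRight, whiskerLeft_comp, Category.assoc,
    μ_natural_left_assoc, μ_natural_right_assoc]
  rw [← (V).map_comp, ← (V).map_comp, ← (V).map_comp, union_assoc, (V).map_comp,
    Functor.LaxMonoidal.associativity_assoc]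

lemma unionU_left_unit (X : HGraph.{u}) :
    (λ_ ((V).obj X.toCW)).hom =
      (unitU U).hom ▷ (V).obj X.toCW ≫ (unionU U (𝟙_ _) X).hom ≫ hor U (λ_ X).hom := by
  simp only [hor_iso, unionU_hom, unitU_hom, comp_whiskerRight, Category.assoc,
    μ_natural_left_assoc]
  rw [← (V).map_comp, ← (V).map_comp, union_left_unit, ← Functor.LaxMonoidal.left_unitality]

lemma unionU_right_unit (X : HGraph.{u}) :
    (ρ_ ((V).obj X.toCW)).hom =
      (V).obj X.toCW ◁ (unitU U).hom ≫ (unionU U X (𝟙_ _)).hom ≫ hor U (ρ_ X).hom := by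
  simp only [hor_iso, unionU_hom, unitU_hom, whiskerLeft_comp, Category.assoc,
    μ_natural_right_assoc]
  rw [← (V).map_comp, ← (V).map_comp, union_right_unit, ← Functor.LaxMonoidal.right_unitality]

lemma unionU_braid (X Y : HGraph.{u}) :
    (unionU U X Y).hom ≫ hor U (β_ X Y).hom = (β_ _ _).hom ≫ (unionU U Y X).hom := by
  simp only [hor_iso, unionU_hom, Category.assoc]
  rw [← (V).map_comp, union_braid, (V).map_comp, Functor.LaxBraided.braided_assoc]

/-- The functor on h-graphs given by horizontal morphisms. -/
def phi : HGraph.{u} ⥤ GrMod F where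
  obj X := (V).obj X.toCW
  map f := hor U f
  map_id X := U.hmap_id X.inH _
  map_comp {X Y Z} f g := U.hmap_comp Z.inH Y.inH X.inH (horMap g) (horMap f) _ _ _

/-- The monoidality constraints of the functor on h-graphs. -/
noncomputable def phiCore : (phi U).CoreMonoidal where
  εIso := unitU U
  μIso X Y := unionU U X Y
  μIso_hom_natural_left f Z := hor_unionU_left U f Z
  μIso_hom_natural_right Z f := hor_unionU_right U f Z
  associativity X Y Z := unionU_assoc U X Y Z
  left_unitality X := unionU_left_unit U X
  right_unitality X := unionU_right_unit U X

noncomputable instance : (phi U).Monoidal := (phiCore U).toMonoidal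

noncomputable instance : (phi U).Braided where
  braided X Y := unionU_braid U X Y

end Functor
end HGFT

namespace HGFT

open KSpace

namespace CobFam

variable {X Y X' Y' : HGraph.{u}} {B B' : KSpace.{u}}

/-- The conditions on a family of cobordisms over a good base under which it acts. -/
structure IsAdmissible (S : CobFam X Y B) : Prop where
  good : IsGoodBase B
  family : IsHGraphFamily S.proj
  positive : ∀ b, IsPositive (S.innAt b)
  hEmbedding : ∀ b, IsHEmbedding (S.outAt b)

lemma IsPositiveFamily.isAdmissible {S : CobFam X Y B} (hS : S.IsPositiveFamily)
    (hB : IsGoodBase B) : S.IsAdmissible := ⟨hB, hS.family, hS.positive, hS.hEmbedding⟩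

/-- The pullback of a family of cobordisms. -/
def pullback (S : CobFam X Y B') (f : C(B, B')) : CobFam X Y B where
  total := Pullback f S.proj
  proj := pullbackProj f S.proj
  inn := ⟨fun z => Pullback.mk (fst z) (S.inn (pair (f (fst z)) (snd z)))
    (S.proj_inn (pair (f (fst z)) (snd z))).symm,
    Pullback.continuous_mk (by fun_prop) (by fun_prop) _⟩
  out := ⟨fun z => Pullback.mk (fst z) (S.out (pair (f (fst z)) (snd z)))
    (S.proj_out (pair (f (fst z)) (snd z))).symm,
    Pullback.continuous_mk (by fun_prop) (by fun_prop) _⟩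
  proj_inn _ := rfl
  proj_out _ := rfl

lemma relEuler_pullback (F : Type u) [Field F] (S : CobFam X Y B') (f : C(B, B')) (b : B) :
    (S.pullback f).relEuler F b = S.relEuler F (f b) :=
  congrArg (· - _) (eulerChar_eq F _ (IsHomotopyEquiv.homeo (fibrePullback f S.proj b))).symm

lemma isPositive_pullback {S : CobFam X Y B'} {f : C(B, B')} {b : B}
    (h : IsPositive (S.innAt (f b))) : IsPositive ((S.pullback f).innAt b) := by
  intro y
  obtain ⟨x, ⟨γ⟩⟩ := h ((fibrePullback f S.proj b).symm y)
  refine ⟨x, ⟨(γ.map (fibrePullback f S.proj b).continuous).cast rfl ?_⟩⟩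
  exact ((fibrePullback f S.proj b).apply_symm_apply y).symm

lemma isAdmissible_pullback {S : CobFam X Y B'} (f : C(B, B')) (hB : IsGoodBase B)
    (h₁ : IsHGraphFamily S.proj) (h₂ : ∀ b, IsPositive (S.innAt b))
    (h₃ : ∀ b, IsHEmbedding (S.outAt b)) : (S.pullback f).IsAdmissible where
  good := hB
  family := h₁.pullback f hB.isWeakHausdorff
  positive b := isPositive_pullback (h₂ (f b))
  hEmbedding b := (h₃ (f b)).of_homeo (Homeomorph.refl _) (fibrePullback f S.proj b) fun _ => rfl

/-- The map from a pullback to the family. -/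
def pullbackHom (S : CobFam X Y B') (f : C(B, B')) : (S.pullback f).fam.obj ⟶ S.fam.obj where
  base := f
  map := ContinuousMap.id (Pullback f S.proj)
  proj_map _ := rfl

lemma isVEq_pullbackHom (S : CobFam X Y B') (f : C(B, B')) : IsVEq (S.pullbackHom f) :=
  ⟨fun _ => rfl, fun b => IsHomotopyEquiv.homeo (fibrePullback f S.proj b)⟩

/-- The two-cell from a pullback to the family. -/
def pullbackTwoCell (S : CobFam X Y B') (f : C(B, B')) : TwoCell (S.pullback f) S where
  onX := 𝟙 X
  onY := 𝟙 Y
  onBase := f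
  onTotal := ⟨Pullback.snd, Pullback.continuous_snd⟩
  proj z := (Pullback.cond z).symm
  inn _ _ := rfl
  out _ _ := rfl
  isHomotopyEquiv b := IsHomotopyEquiv.homeo (fibrePullback f S.proj b).symm

variable {S : CobFam X Y B}

lemma IsAdmissible.isLocallyConstant_relEuler (F : Type u) [Field F] (hS : S.IsAdmissible) (d : ℤ) :
    IsLocallyConstant fun b => d * S.relEuler F b :=
  hS.good.isLocallyConstant _ fun _ _ h =>
    congrArg (fun z => d * (z - _)) (hS.family.hurewicz.eulerChar_eq_of_joined F h)

lemma IsAdmissible.inH (hS : S.IsAdmissible) : InH S.fam.obj where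
  good := hS.good
  family := hS.family
  basepoints := AdmitsBasepoints.of_isPositive S.inn S.proj_inn hS.positive
  shift := IsLocallyConstant.const 0

/-- The isomorphism from `(∅_B, m) ⊗ (X, 0)` to the trivial family. -/
def alphaIso (X : HGraph.{u}) (B : KSpace.{u}) (m : B → ℤ) :
    ((emptyFam B m).tensor X.fam).obj ≅ (X.trivialFam B m).obj where
  hom := alpha X B m
  inv := FopHom.ofInv (X := (X.trivialFam B m).obj) (Y := ((emptyFam B m).tensor X.fam).obj)
    ⟨fun b => pair b star, continuous_pair continuous_id continuous_const⟩
    ⟨fst, KSpace.continuous_fst⟩ (fun _ => rfl)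
    ⟨elim (fun q => isEmptyElim (α := KSpace.empty) (fst q)) _root_.id,
      continuous_elim (continuous_iff_continuousAt.2 fun q =>
        isEmptyElim (α := KSpace.empty) (fst q)) continuous_id⟩
    (by rintro (⟨⟨⟩, _⟩ | q); rfl)
  hom_inv_id := FopHom.ext' (fun _ => rfl) (by rintro _ (⟨⟨⟩, _⟩ | q) _ _; rfl)
  inv_hom_id := FopHom.ext' (fun _ => rfl) (by rintro _ _ _ _; rfl)

lemma isVEq_alpha (X : HGraph.{u}) (B : KSpace.{u}) (m : B → ℤ) : IsVEq (alpha X B m) :=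
  IsVEq.iso (alphaIso X B m) fun _ => add_zero _

lemma IsAdmissible.isVertical_gamma (hS : S.IsAdmissible) : IsVertical S.gamma :=
  ⟨fun _ => rfl, fun b => (hS.hEmbedding b).of_homeo (Y.fibreFam _) (Homeomorph.refl _)
    fun _ => rfl⟩

lemma IsAdmissible.isHorizontal_beta {F : Type u} [Field F] {d : ℤ} (hS : S.IsAdmissible)
    {m : B → ℤ} (hm : ∀ b, m b = d * S.relEuler F b) : IsHorizontal F d (S.beta m) where
  positive b z := by
    obtain ⟨x, hx⟩ := hS.positive b z
    exact ⟨X.fibreTrivial m b x, hx⟩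
  shift b := by
    have e := eulerChar_eq F _ (IsHomotopyEquiv.homeo (X.fibreTrivial m b))
    change 0 - m b = _
    rw [hm, relEuler, e]
    change _ = -d * (eulerChar F (fibre S.proj b) - _)
    ring

end CobFam

/-! ### The operation of an admissible family -/

section Op

variable {F : Type u} [Field F] {d : ℤ} {X Y X' Y' : HGraph.{u}} {B B' : KSpace.{u}}

lemma isGoodBase_prodPt (hB : IsGoodBase B) : IsGoodBase (B.prod KSpace.pt) :=
  hB.of_homeo (prodPt B)

lemma inH_empty_tensor (X : HGraph.{u}) (hB : IsGoodBase B) {m : B → ℤ} (hm : IsLocallyConstant m) :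
    InH ((emptyFam B m).tensor X.fam).obj :=
  (inH_emptyFam hB hm).tensor (X := emptyFam B m) (Y := X.fam) X.inH (isGoodBase_prodPt hB)

lemma CobFam.IsAdmissible.isLocallyConstant {S : CobFam X Y B} (hS : S.IsAdmissible) {m : B → ℤ}
    (hm : ∀ b, m b = d * S.relEuler F b) : IsLocallyConstant m := by
  rw [show m = _ from funext hm]
  exact hS.isLocallyConstant_relEuler F d

lemma IsHorizontal.comp {X Y Z : Fam B} {h : HorMap X Y} {k : HorMap Y Z}
    (hh : IsHorizontal F d h) (hk : IsHorizontal F d k) : IsHorizontal F d (h.comp k) where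
  positive b x := by
    obtain ⟨y, ⟨γ⟩⟩ := hh.positive b x
    obtain ⟨z, ⟨δ⟩⟩ := hk.positive b y
    exact ⟨z, ⟨(δ.map (h.fibreMap b).continuous).trans γ⟩⟩
  shift b := by
    have h₁ := hh.shift b
    have h₂ := hk.shift b
    linear_combination h₁ + h₂

lemma HorMap.hom_ext {X Y : Fam B} {f g : HorMap X Y} (h : ∀ z, f.map z = g.map z) : f = g := by
  cases f
  cases g
  congr 1
  exact ContinuousMap.ext h

lemma hmap_comp_eq (U : SymmMonDoubleFunctor F d) {X Y Y' Z : Fam B} (hX : InH X.obj)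
    (hY : InH Y.obj) (hY' : InH Y'.obj) (hZ : InH Z.obj) (f : HorMap X Y) (g : HorMap Y Z)
    (f' : HorMap X Y') (g' : HorMap Y' Z) (hf : IsHorizontal F d f) (hg : IsHorizontal F d g)
    (hf' : IsHorizontal F d f') (hg' : IsHorizontal F d g')
    (e : ∀ z, f.map (g.map z) = f'.map (g'.map z)) :
    U.hmap hY hZ g hg ≫ U.hmap hX hY f hf = U.hmap hY' hZ g' hg' ≫ U.hmap hX hY' f' hf' := by
  rw [← U.hmap_comp hX hY hZ f g hf hg (hf.comp hg), ← U.hmap_comp hX hY' hZ f' g' hf' hg'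
    (hf'.comp hg')]
  congr 1
  exact HorMap.hom_ext e

lemma vmap_comp_eq (U : SymmMonDoubleFunctor F d) {X Y Y' Z : Obj.{u}} (hX : InH X) (hY : InH Y)
    (hY' : InH Y') (hZ : InH Z) (f : X ⟶ Y) (g : Y ⟶ Z) (f' : X ⟶ Y') (g' : Y' ⟶ Z)
    (hf : IsVertical f) (hg : IsVertical g) (hf' : IsVertical f') (hg' : IsVertical g')
    (hfg : IsVertical (f ≫ g)) (e : f ≫ g = f' ≫ g') :
    U.vmap hX hY f hf ≫ U.vmap hY hZ g hg = U.vmap hX hY' f' hf' ≫ U.vmap hY' hZ g' hg' := by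
  rw [← U.vmap_comp hX hY hZ f g hf hg hfg, ← U.vmap_comp hX hY' hZ f' g' hf' hg' (e ▸ hfg)]
  congr 1

variable [CharP F 2] (U : SymmMonDoubleFunctor F d) (θ : Homological U)

/-- The operation of an admissible family over a good base. -/
noncomputable def opGood {S : CobFam X Y B} (hS : S.IsAdmissible) {m : B → ℤ}
    (hm : ∀ b, m b = d * S.relEuler F b) :
    SH F B m ⊗ U.obj X.fam.obj X.inH ⟶ U.obj Y.fam.obj Y.inH :=
  (θ.iso B m (inH_emptyFam hS.good (hS.isLocallyConstant hm))).hom ▷ _ ≫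
    (U.tensorIso (X := (emptyFam B m).obj) (Y := X.fam.obj) _ X.inH
      (inH_empty_tensor X hS.good (hS.isLocallyConstant hm))).hom ≫
    U.vmap _ (X.inH_trivialFam hS.good (hS.isLocallyConstant hm)) (CobFam.alpha X B m)
      (CobFam.isVEq_alpha X B m).isVertical ≫
    U.hmap hS.inH _ (S.beta m) (hS.isHorizontal_beta hm) ≫
    U.vmap hS.inH Y.inH S.gamma hS.isVertical_gamma

/-- The map given by a homotopy equivalence as a horizontal morphism. -/
def horU (f : X ⟶ Y) : U.obj X.fam.obj X.inH ⟶ U.obj Y.fam.obj Y.inH :=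
  U.hmap Y.inH X.inH (HGraph.horMap f) (HGraph.isHorizontal_horMap F d f)

/-- The map of trivial families given by a homotopy equivalence. -/
def trivMap (f : X ⟶ X') (B : KSpace.{u}) (m : B → ℤ) :
    HorMap (X'.trivialFam B m) (X.trivialFam B m) :=
  ⟨prodMap (ContinuousMap.id B) (HGraph.toMap f), fun _ => rfl⟩

lemma isHomotopyEquiv_trivMap (f : X ⟶ X') (m : B → ℤ) (b : B) :
    IsHomotopyEquiv ((trivMap f B m).fibreMap b) :=
  (HGraph.isHomotopyEquiv f).of_conj (X.fibreTrivial m b) (X'.fibreTrivial m b) fun _ => rfl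

lemma alpha_trivMap (f : X ⟶ X') (m : B → ℤ) :
    ((HorMap.id (emptyFam B m)).tensor (HGraph.horMap f)).toHom ≫ CobFam.alpha X B m =
      CobFam.alpha X' B m ≫ (trivMap f B m).toHom :=
  FopHom.ext' (fun _ => rfl) fun _ _ _ _ => rfl

lemma isHomotopyEquiv_tensor_horMap (f : X ⟶ X') (m : B → ℤ) (p) :
    IsHomotopyEquiv (((HorMap.id (emptyFam B m)).tensor (HGraph.horMap f)).fibreMap p) := by
  have h₁ := (CobFam.isVEq_alpha X B m).isHomotopyEquiv p
  refine IsHomotopyEquiv.of_comp_right h₁ ?_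
  have h₂ := ((CobFam.isVEq_alpha X' B m).isHomotopyEquiv p).comp
    (isHomotopyEquiv_trivMap f m (fst p))
  refine Eq.subst (motive := IsHomotopyEquiv) (ContinuousMap.ext fun x => ?_) h₂
  exact fibre_comm (alpha_trivMap f m) rfl rfl x

/-- The map of trivial families covering a map of bases. -/
def trivHom (X : HGraph.{u}) {m : B → ℤ} {m' : B' → ℤ} (f : C(B, B')) :
    (X.trivialFam B m).obj ⟶ (X.trivialFam B' m').obj where
  base := f
  map := ⟨fun z => (pair (Pullback.fst z) (snd (X := B') (Y := X.space) (Pullback.snd z)) :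
      B.prod X.space), continuous_pair Pullback.continuous_fst
        (KSpace.continuous_snd.comp Pullback.continuous_snd)⟩
  proj_map _ := rfl

lemma isVEq_trivHom (X : HGraph.{u}) {m : B → ℤ} {m' : B' → ℤ} (f : C(B, B'))
    (hf : ∀ b, m' (f b) = m b) : IsVEq (trivHom (m := m) (m' := m') X f) :=
  ⟨fun b => (hf b).symm, fun b => IsHomotopyEquiv.homeo
    ((X.fibreTrivial m' (f b)).symm.trans (X.fibreTrivial m b))⟩

lemma IsHomotopyEquiv.of_isEmpty {A A' : Type*} [TopologicalSpace A] [TopologicalSpace A']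
    [IsEmpty A] [IsEmpty A'] (f : C(A, A')) : IsHomotopyEquiv f :=
  .of_inv _ ⟨fun z => isEmptyElim z, continuous_iff_continuousAt.2 fun z => isEmptyElim z⟩
    (fun z => isEmptyElim z) fun z => isEmptyElim z

lemma isEmpty_fibre_emptyFam (m : B → ℤ) (b : B) : IsEmpty (fibre (emptyFam B m).proj b) :=
  ⟨fun z => isEmptyElim (α := KSpace.empty) (fibreVal z)⟩

lemma isVEq_toEmpty {m : B → ℤ} {m' : B' → ℤ} (f : C(B, B')) (hf : ∀ b, m' (f b) = m b) :
    IsVEq (toEmpty (emptyFam B m).obj f m') :=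
  ⟨fun b => (hf b).symm, fun b => by
    have h₁ := isEmpty_fibre_emptyFam m b
    have h₂ := isEmpty_fibre_emptyFam m' (f b)
    exact @IsHomotopyEquiv.of_isEmpty _ _ _ _ h₂ h₁ _⟩

/-- The map to the pullback given by a two-cell. -/
def CobFam.TwoCell.toPullback {S : CobFam X Y B} {S' : CobFam X' Y' B'} (φ : CobFam.TwoCell S S') :
    HorMap (S'.pullback φ.onBase).fam S.fam where
  map := ⟨fun s => Pullback.mk (S.proj s) (φ.onTotal s) (φ.proj s).symm,
    Pullback.continuous_mk S.proj.continuous φ.onTotal.continuous _⟩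
  proj_map _ := rfl

lemma CobFam.TwoCell.isHomotopyEquiv_toPullback {S : CobFam X Y B} {S' : CobFam X' Y' B'}
    (φ : CobFam.TwoCell S S') (b : B) : IsHomotopyEquiv (φ.toPullback.fibreMap b) :=
  (φ.isHomotopyEquiv b).of_conj (Homeomorph.refl _) (fibrePullback φ.onBase S'.proj b) fun s =>
    congrArg Kify.mk (Subtype.ext (congrArg Kify.mk (Subtype.ext
      (Prod.ext (fibre_cond s) rfl))))

/-- The operations on good bases are compatible with base change. -/
lemma opGood_baseChange {S : CobFam X Y B} {S' : CobFam X' Y' B'} (hS : S.IsAdmissible)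
    (hS' : S'.IsAdmissible) {m : B → ℤ} {m' : B' → ℤ} (hm : ∀ b, m b = d * S.relEuler F b)
    (hm' : ∀ b, m' b = d * S'.relEuler F b) (φ : CobFam.TwoCell S S')
    (hf : ∀ b, m' (φ.onBase b) = m b) :
    opGood U θ hS hm ≫ horU U φ.onY =
      (SH.map φ.onBase hf ⊗ₘ horU U φ.onX) ≫ opGood U θ hS' hm' := by
  have lc := hS.isLocallyConstant hm
  have lc' := hS'.isLocallyConstant hm'
  have hP : (S'.pullback φ.onBase).IsAdmissible := CobFam.isAdmissible_pullback φ.onBase hS.good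
    hS'.family hS'.positive hS'.hEmbedding
  have hmP : ∀ b, m b = d * (S'.pullback φ.onBase).relEuler F b := fun b => by
    rw [CobFam.relEuler_pullback, ← hm', hf]
  have hE := inH_emptyFam hS.good lc
  have hE' := inH_emptyFam hS'.good lc'
  have hT := X.inH_trivialFam hS.good lc
  have hT' := X'.inH_trivialFam hS.good lc
  have hT'' := X'.inH_trivialFam hS'.good lc'
  have i₁ := HGraph.isHorizontal_of_isHomotopyEquiv F d φ.isHomotopyEquiv_toPullback fun _ => rfl
  have i₂ := HGraph.isHorizontal_of_isHomotopyEquiv F d (isHomotopyEquiv_trivMap φ.onX m)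
    fun _ => rfl
  have i₃ := HGraph.isHorizontal_of_isHomotopyEquiv F d (isHomotopyEquiv_tensor_horMap φ.onX m)
    fun _ => rfl
  have hS_β := hS.isHorizontal_beta hm
  have hP_β := hP.isHorizontal_beta hmP
  have hS_β' := hS'.isHorizontal_beta hm'
  have hE₁ := inH_empty_tensor X hS.good lc
  have hE₂ := inH_empty_tensor X' hS.good lc
  have hE₃ := inH_empty_tensor X' hS'.good lc'
  have v₁ := CobFam.isVEq_alpha X B m
  have v₂ := CobFam.isVEq_alpha X' B m
  have v₃ := CobFam.isVEq_alpha X' B' m'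
  have v₄ := isVEq_trivHom X' φ.onBase hf
  have v₅ := isVEq_toEmpty φ.onBase hf
  have v₆ : IsVEq (FopHom.tensor (toEmpty (emptyFam B m).obj φ.onBase m') (𝟙 X'.fam.obj) :
    ((emptyFam B m).tensor X'.fam).obj ⟶ ((emptyFam B' m').tensor X'.fam).obj) :=
    v₅.tensor (IsVEq.id X'.fam.obj)
  -- the outgoing boundary
  have e₁ : U.vmap hS.inH Y.inH S.gamma hS.isVertical_gamma ≫ horU U φ.onY =
      U.hmap hP.inH hS.inH φ.toPullback i₁ ≫
        U.vmap hP.inH Y'.inH (S'.pullback φ.onBase).gamma hP.isVertical_gamma :=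
    (U.cell hP.inH hS.inH Y'.inH Y.inH φ.toPullback (HGraph.horMap φ.onY) _ S.gamma
      i₁ (HGraph.isHorizontal_horMap F d φ.onY) hP.isVertical_gamma hS.isVertical_gamma
      (IsTwoCell.of_horizontal (FopHom.ext' (fun _ => rfl) fun b y _ _ => congrArg Kify.mk
        (Subtype.ext (Prod.ext (S.proj_out (pair b y)) (φ.out b y))))
        φ.isHomotopyEquiv_toPullback (HGraph.isHomotopyEquiv_horMap φ.onY))).symm
  have e₂ : U.vmap hP.inH Y'.inH (S'.pullback φ.onBase).gamma hP.isVertical_gamma =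
      U.vmap hP.inH hS'.inH (S'.pullbackHom φ.onBase) (S'.isVEq_pullbackHom _).isVertical ≫
        U.vmap hS'.inH Y'.inH S'.gamma hS'.isVertical_gamma :=
    U.vmap_comp _ _ _ (S'.pullbackHom φ.onBase) S'.gamma _ _ hP.isVertical_gamma
  -- the incoming boundary
  have e₃ : U.hmap hS.inH hT (S.beta m) hS_β ≫ U.hmap hP.inH hS.inH φ.toPullback i₁ =
      U.hmap hT' hT (trivMap φ.onX B m) i₂ ≫
        U.hmap hP.inH hT' ((S'.pullback φ.onBase).beta m) hP_β :=
    hmap_comp_eq U _ _ _ _ _ _ _ _ _ _ _ _ fun z => congrArg Kify.mk (Subtype.ext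
      (Prod.ext (S.proj_inn z) (φ.inn (fst z) (snd z))))
  have e₄ : U.hmap hP.inH hT' ((S'.pullback φ.onBase).beta m) hP_β ≫
      U.vmap hP.inH hS'.inH (S'.pullbackHom φ.onBase) (S'.isVEq_pullbackHom _).isVertical =
      U.vmap hT' hT'' (trivHom X' φ.onBase) v₄.isVertical ≫
        U.hmap hS'.inH hT'' (S'.beta m') hS_β' :=
    U.cell _ _ _ _ _ _ _ _ _ _ _ _ (IsTwoCell.of_vertical
      (FopHom.ext' (fun _ => rfl) (by
        rintro b ⟨y, x⟩ h _
        obtain rfl : φ.onBase b = y := h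
        rfl)) (S'.isVEq_pullbackHom _) v₄)
  have e₅ : U.vmap hE₁ hT (CobFam.alpha X B m) v₁.isVertical ≫
      U.hmap hT' hT (trivMap φ.onX B m) i₂ =
      U.hmap hE₂ hE₁ ((HorMap.id (emptyFam B m)).tensor (HGraph.horMap φ.onX)) i₃ ≫
        U.vmap hE₂ hT' (CobFam.alpha X' B m) v₂.isVertical :=
    (U.cell _ _ _ _ _ _ _ _ _ _ _ _ (IsTwoCell.of_vertical (alpha_trivMap φ.onX m) v₂ v₁)).symm
  have e₆ : U.vmap hE₂ hT' (CobFam.alpha X' B m) v₂.isVertical ≫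
      U.vmap hT' hT'' (trivHom X' φ.onBase) v₄.isVertical =
      U.vmap hE₂ hE₃ (FopHom.tensor (toEmpty (emptyFam B m).obj φ.onBase m') (𝟙 X'.fam.obj) :
        ((emptyFam B m).tensor X'.fam).obj ⟶ ((emptyFam B' m').tensor X'.fam).obj) v₆.isVertical ≫
        U.vmap hE₃ hT'' (CobFam.alpha X' B' m') v₃.isVertical :=
    vmap_comp_eq U _ _ _ _ _ _ _ _ _ _ _ _ (v₂.comp v₄).isVertical
      (FopHom.ext' (fun _ => rfl) fun _ _ _ _ => rfl)
  have e₇ := U.tensorIso_hmap hE X'.inH hE₂ hE X.inH hE₁ (HorMap.id (emptyFam B m))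
    (HGraph.horMap φ.onX) (isHorizontal_id _) (HGraph.isHorizontal_horMap F d φ.onX) i₃
  have e₈ := U.tensorIso_vmap hE X'.inH hE₂ hE' X'.inH hE₃
    (toEmpty (emptyFam B m).obj φ.onBase m') (𝟙 X'.fam.obj) v₅.isVertical (IsVEq.id _).isVertical
    v₆.isVertical
  have e₉ := θ.naturality m m' hE hE' φ.onBase hf v₅.isVertical
  rw [U.hmap_id] at e₇
  rw [U.vmap_id] at e₈
  simp only [opGood, Category.assoc]
  rw [e₁, e₂, reassoc_of% e₃, reassoc_of% e₄, reassoc_of% e₅, reassoc_of% e₆]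
  rw [← reassoc_of% e₇, ← reassoc_of% e₈]
  simp only [← Category.assoc]
  congr 4
  rw [← tensorHom_id, ← tensorHom_id, MonoidalCategory.tensorHom_comp_tensorHom,
    MonoidalCategory.tensorHom_comp_tensorHom, MonoidalCategory.tensorHom_comp_tensorHom, e₉]
  simp only [Category.id_comp, Category.comp_id]
  rfl

end Op
end HGFT

namespace HGFT

open KSpace

/-! ### Gluing over good bases -/

section Gluing

variable {B C : KSpace.{u}} {X Y Z : HGraph.{u}}

/-- The fibres of the external disjoint union with an empty family. -/
def fibreEmptyTensor (m : C → ℤ) (Y : Fam B) (p : C.prod B) :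
    fibre Y.proj (snd p) ≃ₜ fibre ((emptyFam C m).tensor Y).proj p :=
  have := isEmpty_fibre_emptyFam m (fst p)
  (Homeomorph.emptySum _ _).symm.trans (fibreTensor (emptyFam C m) Y p)

variable {F : Type u} [Field F] {d : ℤ}

/-- Horizontality is invariant under homotopy equivalences of fibres. -/
lemma IsHorizontal.of_fibre {X Y : Fam B} {X' Y' : Fam C} {h : HorMap X Y} {k : HorMap X' Y'}
    (hk : IsHorizontal F d k) (r : B → C)
    (hs : ∀ b, X.shift b - Y.shift b = X'.shift (r b) - Y'.shift (r b))
    (f : ∀ b, C(fibre X'.proj (r b), fibre X.proj b))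
    (g : ∀ b, C(fibre Y'.proj (r b), fibre Y.proj b)) (hf : ∀ b, IsHomotopyEquiv (f b))
    (hg : ∀ b, IsHomotopyEquiv (g b))
    (hfg : ∀ b y, h.fibreMap b (g b y) = f b (k.fibreMap (r b) y)) : IsHorizontal F d h where
  positive b x := by
    obtain ⟨x', ⟨γ⟩⟩ := (hf b).isPositive x
    obtain ⟨y, ⟨δ⟩⟩ := hk.positive (r b) x'
    refine ⟨g b y, ⟨Path.trans ?_ γ⟩⟩
    exact (δ.map (f b).continuous).cast (hfg b y) rfl
  shift b := by
    rw [hs, hk.shift, eulerChar_eq F _ (hf b), eulerChar_eq F _ (hg b)]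

namespace CobFam

/-- A family of cobordisms whose fibres are homotopy pushouts of the fibres of two families. -/
structure Gluing (S : CobFam X Y B) (T : CobFam Y Z C) (W : CobFam X Z (C.prod B)) where
  inl : C(C.prod S.total, W.total)
  inr : C(T.total.prod B, W.total)
  proj_inl : ∀ q, W.proj (inl q) = pair (fst q) (S.proj (snd q))
  proj_inr : ∀ q, W.proj (inr q) = pair (T.proj (fst q)) (snd q)
  inn : ∀ p x, W.inn (pair p x) = inl (pair (fst p) (S.inn (pair (snd p) x)))
  out : ∀ p z, W.out (pair p z) = inr (pair (T.out (pair (fst p) z)) (snd p))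
  glue : ∀ p y, inl (pair (fst p) (S.out (pair (snd p) y))) =
    inr (pair (T.inn (pair (fst p) y)) (snd p))
  square : ∀ p : C.prod B, IsHomotopyCofibreSquare (T.innAt (fst p)) (S.outAt (snd p))
    (⟨fun t => fibreMk (inr (pair (fibreVal t) (snd p))) ((proj_inr _).trans
      (KSpace.prod_ext (fibre_cond t) rfl)), by fun_prop⟩ :
      C(fibre T.proj (fst p), fibre W.proj p))
    (⟨fun s => fibreMk (inl (pair (fst p) (fibreVal s))) ((proj_inl _).trans
      (KSpace.prod_ext rfl (fibre_cond s))), by fun_prop⟩ :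
      C(fibre S.proj (snd p), fibre W.proj p))
  hEmbedding : ∀ p : C.prod B, IsHEmbedding
    (⟨fun t => fibreMk (inr (pair (fibreVal t) (snd p))) ((proj_inr _).trans
      (KSpace.prod_ext (fibre_cond t) rfl)), by fun_prop⟩ :
      C(fibre T.proj (fst p), fibre W.proj p))

namespace Gluing

variable {S : CobFam X Y B} {T : CobFam Y Z C} {W : CobFam X Z (C.prod B)} (G : Gluing S T W)

/-- The horizontal morphism given by the inclusion of the second family. -/
def top (m : C → ℤ) : HorMap W.fam ((emptyFam C m).tensor S.fam) where
  map := ⟨elim (fun q => isEmptyElim (α := KSpace.empty) (fst q)) G.inl,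
    continuous_elim (continuous_iff_continuousAt.2 fun q =>
      isEmptyElim (α := KSpace.empty) (fst q)) G.inl.continuous⟩
  proj_map := by
    rintro (q | q)
    · exact isEmptyElim (α := KSpace.empty) (fst q)
    · exact G.proj_inl q

/-- The vertical morphism given by the inclusion of the first family. -/
def left : W.fam.obj ⟶ T.fam.obj where
  base := ⟨fst, KSpace.continuous_fst⟩
  map := ⟨fun z => G.inr (pair (Pullback.snd z) (snd (Pullback.fst z))),
    G.inr.continuous.comp (continuous_pair Pullback.continuous_snd
      (KSpace.continuous_snd.comp Pullback.continuous_fst))⟩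
  proj_map z := (G.proj_inr _).trans (KSpace.prod_ext (Pullback.cond z).symm rfl)

lemma isVertical_left : IsVertical G.left := ⟨fun _ => rfl, G.hEmbedding⟩

/-- The vertical morphism given by the outgoing boundary of the second family. -/
def right (S : CobFam X Y B) (m : C → ℤ) :
    ((emptyFam C m).tensor S.fam).obj ⟶ ((emptyFam C m).tensor Y.fam).obj :=
  FopHom.tensor (𝟙 (emptyFam C m).obj) S.gamma

lemma isVertical_right (hS : S.IsAdmissible) (m : C → ℤ) : IsVertical (right S m) where
  shift _ := rfl
  hEmbedding p := (hS.hEmbedding (snd p)).of_homeo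
    ((Y.fibreFam star).trans (fibreEmptyTensor m Y.fam (pair (fst p) star)))
    (fibreEmptyTensor m S.fam p) fun _ => rfl

lemma isVertical_right_alpha (hS : S.IsAdmissible) (m : C → ℤ) :
    IsVertical (right S m ≫ alpha Y C m) where
  shift _ := add_zero _
  hEmbedding p := (hS.hEmbedding (snd p)).of_homeo (Y.fibreTrivial m (fst p))
    (fibreEmptyTensor m S.fam p) fun _ => rfl

lemma isTwoCell (m : C → ℤ) :
    IsTwoCell (G.top m) (T.beta m) G.left (right S m ≫ alpha Y C m) where
  comm := FopHom.ext' (fun _ => rfl) (by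
    rintro p ⟨c, y⟩ h _
    obtain rfl : fst p = c := h
    exact G.glue p y)
  square p c hl hr := by
    obtain rfl : fst p = c := hl
    exact (G.square p).of_homeo (Y.fibreTrivial m (fst p)) (.refl _)
      (fibreEmptyTensor m S.fam p) (.refl _) (fun _ => rfl) (fun _ => rfl) (fun _ => rfl)
      fun _ => rfl

lemma isHorizontal_top (hW : W.IsAdmissible) {m : C → ℤ} {n : B → ℤ}
    (hS : ∀ b, n b = d * S.relEuler F b)
    (hmn : ∀ p, m (fst p) + n (snd p) = d * W.relEuler F p) : IsHorizontal F d (G.top m) where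
  positive p w := by
    obtain ⟨x, hx⟩ := hW.positive p w
    refine ⟨fibreEmptyTensor m S.fam p (S.innAt (snd p) x), ?_⟩
    exact (congrArg (Joined · w) (congrArg Kify.mk (Subtype.ext (G.inn p x)))).mp hx
  shift p := by
    have e := eulerChar_eq F _ (IsHomotopyEquiv.homeo (fibreEmptyTensor m S.fam p))
    have h₁ := hS (snd p)
    have h₂ := hmn p
    rw [relEuler] at h₁ h₂
    change 0 - (m (fst p) + 0) = -d * (eulerChar F (fibre W.proj p) - _)
    rw [← e]
    change _ = -d * (eulerChar F (fibre W.proj p) - eulerChar F (fibre S.proj (snd p)))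
    linear_combination h₁ - h₂

end Gluing

end CobFam

/-- The comparison of trivial families over a product. -/
def prodTrivHom (X : HGraph.{u}) (m : C → ℤ) (n : B → ℤ) :
    ((emptyFam C m).tensor (X.trivialFam B n)).obj ⟶
      (X.trivialFam (C.prod B) fun p => m (fst p) + n (snd p)).obj :=
  FopHom.ofInv (X := ((emptyFam C m).tensor (X.trivialFam B n)).obj)
    (Y := (X.trivialFam (C.prod B) fun p => m (fst p) + n (snd p)).obj)
    (ContinuousMap.id _) (ContinuousMap.id _) (fun _ => rfl)
    ⟨fun q : (C.prod B).prod X.space => inr (pair (fst (fst q)) (pair (snd (fst q)) (snd q))),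
      KSpace.continuous_inr.comp (by fun_prop)⟩ fun _ => rfl

lemma isVEq_prodTrivHom (X : HGraph.{u}) (m : C → ℤ) (n : B → ℤ) : IsVEq (prodTrivHom X m n) :=
  ⟨fun _ => rfl, fun p => (IsHomotopyEquiv.homeo (((X.fibreTrivial _ p).symm.trans
    (X.fibreTrivial n (snd p))).trans (fibreEmptyTensor m (X.trivialFam B n) p))).of_conj
    (.refl _) (.refl _) fun x => by
      induction x using fibre_ind with | mk e h => ?_
      obtain rfl : fst e = p := h
      rfl⟩

lemma isHorizontal_empty_tensor {m : C → ℤ} {X Y : Fam B} {h : HorMap X Y}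
    (hh : IsHorizontal F d h) : IsHorizontal F d ((HorMap.id (emptyFam C m)).tensor h) :=
  hh.of_fibre snd (fun p => add_sub_add_left_eq_sub _ _ (m (fst p)))
    (fun p => (fibreEmptyTensor m X p : C(_, _))) (fun p => (fibreEmptyTensor m Y p : C(_, _)))
    (fun _ => IsHomotopyEquiv.homeo _) (fun _ => IsHomotopyEquiv.homeo _) fun _ _ => rfl

lemma isVEq_toEmpty_tensor (m : C → ℤ) (n : B → ℤ) :
    IsVEq (toEmpty ((emptyFam C m).tensor (emptyFam B n)).obj
      (ContinuousMap.id (C.prod B)) fun p => m (fst p) + n (snd p)) where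
  shift _ := rfl
  isHomotopyEquiv p := by
    have h₁ : IsEmpty (fibre ((emptyFam C m).tensor (emptyFam B n)).proj p) :=
      have := isEmpty_fibre_emptyFam n (snd p)
      (fibreEmptyTensor m (emptyFam B n) p).symm.isEmpty
    have h₂ := isEmpty_fibre_emptyFam (fun p : C.prod B => m (fst p) + n (snd p)) p
    exact @IsHomotopyEquiv.of_isEmpty _ _ _ _ h₂ h₁ _

variable [CharP F 2] (U : SymmMonDoubleFunctor F d) (θ : Homological U)

/-- The operations on CW complexes are compatible with gluing. -/
lemma opGood_gluing {S : CobFam X Y B} {T : CobFam Y Z C} {W : CobFam X Z (C.prod B)}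
    (G : CobFam.Gluing S T W) (hB : IsCW B) (hC : IsCW C) (hS : S.IsAdmissible)
    (hT : T.IsAdmissible) (hW : W.IsAdmissible) {m : C → ℤ} {n : B → ℤ}
    (hm : ∀ c, m c = d * T.relEuler F c) (hn : ∀ b, n b = d * S.relEuler F b)
    (hmn : ∀ p, m (fst p) + n (snd p) = d * W.relEuler F p) :
    (α_ _ _ _).hom ≫ SH F C m ◁ opGood U θ hS hn ≫ opGood U θ hT hm =
      SH.cross m n ▷ _ ≫ opGood U θ hW hmn := by
  have lm := hT.isLocallyConstant hm
  have ln := hS.isLocallyConstant hn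
  have lmn := hW.isLocallyConstant hmn
  have hP := inH_emptyFam hC.isGoodBase lm
  have hQ := inH_emptyFam hB.isGoodBase ln
  have hR := inH_emptyFam hW.good lmn
  have hPQ : InH ((emptyFam C m).tensor (emptyFam B n)).obj := hP.tensor hQ hW.good
  have hQX := inH_empty_tensor X hB.isGoodBase ln
  have hRX := inH_empty_tensor X hW.good lmn
  have hPQX₁ : InH (((emptyFam C m).tensor (emptyFam B n)).tensor X.fam).obj :=
    hPQ.tensor X.inH ((hC.prod hB).prod isCW_pt).isGoodBase
  have hPQX₂ : InH ((emptyFam C m).tensor ((emptyFam B n).tensor X.fam)).obj :=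
    hP.tensor hQX (hC.prod (hB.prod isCW_pt)).isGoodBase
  have hXB := X.inH_trivialFam hB.isGoodBase ln
  have hXW := X.inH_trivialFam hW.good lmn
  have hYC := Y.inH_trivialFam hC.isGoodBase lm
  have hPXB : InH ((emptyFam C m).tensor (X.trivialFam B n)).obj := hP.tensor hXB hW.good
  have hPS : InH ((emptyFam C m).tensor S.fam).obj := hP.tensor hS.inH hW.good
  have hPY := inH_empty_tensor Y hC.isGoodBase lm
  have i₁ := hS.isHorizontal_beta hn
  have i₂ := hT.isHorizontal_beta hm
  have i₃ := hW.isHorizontal_beta hmn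
  have i₄ := isHorizontal_empty_tensor (m := m) i₁
  have i₅ := G.isHorizontal_top hW hn hmn
  have v₁ := CobFam.isVEq_alpha X B n
  have v₂ := CobFam.isVEq_alpha Y C m
  have v₃ := CobFam.isVEq_alpha X (C.prod B) fun p => m (fst p) + n (snd p)
  have v₄ := isVEq_prodTrivHom X m n
  have v₅ : IsVEq (toEmpty ((emptyFam C m).tensor (emptyFam B n)).obj
      (ContinuousMap.id (C.prod B)) fun p => m (fst p) + n (snd p)) := isVEq_toEmpty_tensor m n
  have v₆ : IsVEq (FopHom.tensor (𝟙 (emptyFam C m).obj) (CobFam.alpha X B n) :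
      ((emptyFam C m).tensor ((emptyFam B n).tensor X.fam)).obj ⟶
        ((emptyFam C m).tensor (X.trivialFam B n)).obj) := (IsVEq.id _).tensor v₁
  have v₇ : IsVEq (FopHom.tensor (toEmpty ((emptyFam C m).tensor (emptyFam B n)).obj
      (ContinuousMap.id (C.prod B)) fun p => m (fst p) + n (snd p)) (𝟙 X.fam.obj) :
      (((emptyFam C m).tensor (emptyFam B n)).tensor X.fam).obj ⟶ _) :=
    v₅.tensor (IsVEq.id X.fam.obj)
  have v₈ : IsVEq (associatorIso (emptyFam C m).obj (emptyFam B n).obj X.fam.obj).hom :=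
    IsVEq.iso _ fun _ => add_assoc _ _ _
  have w₁ := CobFam.Gluing.isVertical_right hS m
  have w₂ := CobFam.Gluing.isVertical_right_alpha hS m
  have w₃ := G.isVertical_left
  -- the two squares
  have e₁ : U.vmap hPS hPY (CobFam.Gluing.right S m) w₁ ≫
      U.vmap hPY hYC (CobFam.alpha Y C m) v₂.isVertical = U.vmap hPS hYC _ w₂ :=
    (U.vmap_comp _ _ _ _ _ _ _ w₂).symm
  have e₂ : U.vmap hPS hYC _ w₂ ≫ U.hmap hT.inH hYC (T.beta m) i₂ =
      U.hmap hW.inH hPS (G.top m) i₅ ≫ U.vmap hW.inH hT.inH G.left w₃ :=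
    (U.cell _ _ _ _ _ _ _ _ _ _ _ _ (G.isTwoCell m)).symm
  have e₃ : U.vmap hW.inH hT.inH G.left w₃ ≫ U.vmap hT.inH Z.inH T.gamma hT.isVertical_gamma =
      U.vmap hW.inH Z.inH W.gamma hW.isVertical_gamma := by
    have : G.left ≫ T.gamma = W.gamma := FopHom.ext' (fun _ => rfl) fun p z _ _ => (G.out p z).symm
    rw [← U.vmap_comp _ _ _ _ _ _ _ (this ▸ hW.isVertical_gamma)]
    congr 1
  have e₄ : U.hmap hPS hPXB _ i₄ ≫ U.hmap hW.inH hPS (G.top m) i₅ =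
      U.vmap hPXB hXW (prodTrivHom X m n) v₄.isVertical ≫ U.hmap hW.inH hXW (W.beta _) i₃ := by
    have := U.cell hW.inH hPXB hW.inH hXW
      ((G.top m).comp ((HorMap.id (emptyFam C m)).tensor (S.beta n))) (W.beta _) (𝟙 W.fam.obj)
      (prodTrivHom X m n) (i₅.comp i₄) i₃ (IsVEq.id _).isVertical v₄.isVertical
      (IsTwoCell.of_vertical (FopHom.ext' (fun _ => rfl)
        (by rintro _ ⟨p, x⟩ _ _; exact (G.inn p x).symm)) (IsVEq.id _) v₄)
    rwa [U.vmap_id, Category.comp_id, U.hmap_comp hW.inH hPS hPXB (G.top m) _ i₅ i₄] at this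
  -- the identity of vertical morphisms
  have e₅ : U.vmap hPQX₁ hPQX₂ _ v₈.isVertical ≫ U.vmap hPQX₂ hPXB _ v₆.isVertical ≫
      U.vmap hPXB hXW (prodTrivHom X m n) v₄.isVertical =
      U.vmap hPQX₁ hRX _ v₇.isVertical ≫ U.vmap hRX hXW (CobFam.alpha X _ _) v₃.isVertical := by
    rw [← U.vmap_comp _ _ _ _ _ _ _ (v₆.comp v₄).isVertical]
    exact vmap_comp_eq U _ _ _ _ _ _ _ _ _ _ _ _ (v₈.comp (v₆.comp v₄)).isVertical
      (FopHom.ext' (fun _ => rfl) (by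
        rintro ⟨p, _⟩ ⟨q, x⟩ h _
        obtain rfl : p = q := h
        rfl))
  -- monoidality
  have e₆ := U.tensorIso_vmap hP hQX hPQX₂ hP hXB hPXB (𝟙 (emptyFam C m).obj) (CobFam.alpha X B n)
    (IsVEq.id _).isVertical v₁.isVertical v₆.isVertical
  have e₇ := U.tensorIso_hmap hP hS.inH hPS hP hXB hPXB (HorMap.id (emptyFam C m)) (S.beta n)
    (isHorizontal_id _) i₁ i₄
  have e₈ := U.tensorIso_vmap hP hS.inH hPS hP Y.inH hPY (𝟙 (emptyFam C m).obj) S.gamma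
    (IsVEq.id _).isVertical hS.isVertical_gamma w₁
  have e₉ := U.associativity hP hQ X.inH hPQ hQX hPQX₁ hPQX₂ v₈.isVertical
  have e₁₀ := U.tensorIso_vmap hPQ X.inH hPQX₁ hR X.inH hRX _ (𝟙 X.fam.obj) v₅.isVertical
    (IsVEq.id _).isVertical v₇.isVertical
  have e₁₁ := θ.tensor m n hP hQ hPQ hR v₅.isVertical
  rw [U.vmap_id, id_tensorHom] at e₆ e₈
  change _ = _ ≫ U.vmap hPS hPY (CobFam.Gluing.right S m) w₁ at e₈
  rw [U.hmap_id, id_tensorHom] at e₇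
  rw [U.vmap_id, tensorHom_id] at e₁₀
  rw [opGood.eq_1 U θ hT, whisker_exchange_assoc, opGood.eq_1 U θ hS, opGood.eq_1 U θ hW]
  simp only [whiskerLeft_comp, Category.assoc]
  rw [reassoc_of% e₈, reassoc_of% e₁, reassoc_of% e₂, e₃, reassoc_of% e₇, reassoc_of% e₄,
    reassoc_of% e₆, ← comp_whiskerRight_assoc, e₁₁]
  simp only [comp_whiskerRight, Category.assoc]
  rw [reassoc_of% e₁₀, ← reassoc_of% e₅, reassoc_of% e₉]
  simp only [MonoidalCategory.tensorHom_def, comp_whiskerRight, whisker_assoc, Category.assoc,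
    Iso.hom_inv_id_assoc, Iso.inv_hom_id_assoc, whiskerRight_tensor]

end Gluing
end HGFT

namespace HGFT

open KSpace

/-! ### Disjoint unions over good bases -/

section Union

variable {B B' : KSpace.{u}} {X Y X' Y' : HGraph.{u}} {F : Type u} [Field F] {d : ℤ}

/-- The comparison of the external disjoint union of families and that of cobordisms. -/
def CobFam.sumHom (S : CobFam X Y B) (S' : CobFam X' Y' B') :
    (S.fam.tensor S'.fam).obj ⟶ (S.sum S').fam.obj :=
  FopHom.ofInv (X := (S.fam.tensor S'.fam).obj) (Y := (S.sum S').fam.obj)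
    (ContinuousMap.id _) (ContinuousMap.id _) (fun _ => rfl) (ContinuousMap.id _) fun _ => rfl

lemma CobFam.isVEq_sumHom (S : CobFam X Y B) (S' : CobFam X' Y' B') : IsVEq (S.sumHom S') :=
  ⟨fun _ => rfl, fun _ => IsHomotopyEquiv.id⟩

/-- The distributivity of trivial families over disjoint unions. -/
def sumTrivHom (X X' : HGraph.{u}) (m : B → ℤ) (n : B' → ℤ) :
    ((X.trivialFam B m).tensor (X'.trivialFam B' n)).obj ⟶
      ((X ⊗ X').trivialFam (B.prod B') fun p => m (fst p) + n (snd p)).obj :=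
  FopHom.ofInv (X := ((X.trivialFam B m).tensor (X'.trivialFam B' n)).obj)
    (Y := ((X ⊗ X').trivialFam (B.prod B') fun p => m (fst p) + n (snd p)).obj)
    (ContinuousMap.id _) (ContinuousMap.id _) (fun _ => rfl)
    ⟨fun p => elim (X := X.space) (Y := X'.space)
      (fun x => inl (pair (pair (fst (fst p)) x) (snd (fst p))))
      (fun x => inr (pair (fst (fst p)) (pair (snd (fst p)) x))) (snd p),
    continuous_prod_sum (A := B.prod B') (X := X.space) (Y := X'.space) _
      (KSpace.continuous_inl.comp (continuous_pair (by fun_prop) (by fun_prop)))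
      (KSpace.continuous_inr.comp (continuous_pair (by fun_prop) (by fun_prop)))⟩
    (by rintro ⟨p, x | x⟩ <;> rfl)

lemma isVEq_sumTrivHom (X X' : HGraph.{u}) (m : B → ℤ) (n : B' → ℤ) :
    IsVEq (sumTrivHom X X' m n) :=
  ⟨fun _ => rfl, fun p => (IsHomotopyEquiv.homeo
    ((((X ⊗ X').fibreTrivial _ p).symm.trans ((X.fibreTrivial m (fst p)).sumCongr
      (X'.fibreTrivial n (snd p)))).trans (fibreTensor (X.trivialFam B m) (X'.trivialFam B' n)
        p))).of_conj (.refl _) (.refl _) fun x => by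
      induction x using fibre_ind with | mk e h => ?_
      rcases e with ⟨q, x | x⟩ <;> obtain rfl : q = p := h <;> rfl⟩

variable {S : CobFam X Y B} {S' : CobFam X' Y' B'}

lemma comm_sum (S : CobFam X Y B) (S' : CobFam X' Y' B') (m : B → ℤ) (n : B' → ℤ) :
    ((S.beta m).tensor (S'.beta n)).toHom ≫ sumTrivHom X X' m n =
      S.sumHom S' ≫ ((S.sum S').beta fun p => m (fst p) + n (snd p)).toHom :=
  FopHom.ext' (fun _ => rfl) (by rintro _ ⟨p, x | x⟩ _ _ <;> rfl)

lemma isHorizontal_beta_tensor (hW : (S.sum S').IsAdmissible) {m : B → ℤ} {n : B' → ℤ}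
    (hmn : ∀ p, m (fst p) + n (snd p) = d * (S.sum S').relEuler F p) :
    IsHorizontal F d ((S.beta m).tensor (S'.beta n)) :=
  (hW.isHorizontal_beta hmn).of_fibre id (fun _ => rfl) (fun p => (.id (fibre (S.sum S').proj p)))
    (fun p => FopHom.fibreMap (sumTrivHom X X' m n) (b := p) rfl) (fun _ => IsHomotopyEquiv.id)
    (isVEq_sumTrivHom X X' m n).isHomotopyEquiv fun p x =>
      (fibre_comm (comm_sum S S' m n) (b := p) rfl rfl x).symm

lemma isVertical_gamma_tensor (hW : (S.sum S').IsAdmissible) :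
    IsVertical (X := (S.fam.tensor S'.fam).obj) (Y := (Y.fam.tensor Y'.fam).obj)
      (FopHom.tensor S.gamma S'.gamma) where
  shift _ := rfl
  hEmbedding p := (hW.hEmbedding p).of_homeo (((Y.fibreFam star).sumCongr (Y'.fibreFam star)).trans
    (fibreTensor Y.fam Y'.fam (pair star star))) (.refl _) (by rintro (y | y) <;> rfl)

lemma gamma_tensor_unionHom (S : CobFam X Y B) (S' : CobFam X' Y' B') :
    (FopHom.tensor S.gamma S'.gamma : (S.fam.tensor S'.fam).obj ⟶ (Y.fam.tensor Y'.fam).obj) ≫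
      HGraph.unionHom Y Y' = S.sumHom S' ≫ (S.sum S').gamma :=
  FopHom.ext' (fun _ => rfl) (by rintro p (y | y) _ _ <;> rfl)

/-- An empty family over a CW complex. -/
def emptyCW (hB : IsCW B) {m : B → ℤ} (hm : IsLocallyConstant m) : CWFam.{u} :=
  ⟨(emptyFam B m).obj, inH_emptyFam hB.isGoodBase hm, hB⟩

lemma alpha_tensor_sumTrivHom (hB : IsCW B) (hB' : IsCW B') {m : B → ℤ} {n : B' → ℤ}
    (hm : IsLocallyConstant m) (hn : IsLocallyConstant n) :
    (FopHom.tensor (CobFam.alpha X B m) (CobFam.alpha X' B' n) :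
      (((emptyFam B m).tensor X.fam).tensor ((emptyFam B' n).tensor X'.fam)).obj ⟶
        ((X.trivialFam B m).tensor (X'.trivialFam B' n)).obj) ≫ sumTrivHom X X' m n =
      CWFam.hom (tensorμ (emptyCW hB hm) X.toCW (emptyCW hB' hn) X'.toCW) ≫
      (FopHom.tensor (toEmpty ((emptyFam B m).tensor (emptyFam B' n)).obj
        (ContinuousMap.id (B.prod B')) fun p => m (fst p) + n (snd p)) (HGraph.unionHom X X') :
        (((emptyFam B m).tensor (emptyFam B' n)).tensor (X.fam.tensor X'.fam)).obj ⟶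
          ((emptyFam (B.prod B') fun p => m (fst p) + n (snd p)).tensor (X ⊗ X').fam).obj) ≫
      CobFam.alpha (X ⊗ X') (B.prod B') fun p => m (fst p) + n (snd p) :=
  FopHom.ext' (fun _ => rfl) (by
    rintro ⟨⟨b, _⟩, ⟨b', _⟩⟩ ⟨q, x | x⟩ h _ <;> obtain rfl : pair b b' = q := h <;> rfl)

variable [CharP F 2] (U : SymmMonDoubleFunctor F d) (θ : Homological U)

lemma inH_tensor_fam (X X' : HGraph.{u}) : InH (X.fam.tensor X'.fam).obj :=
  (X.toCW ⊗ X'.toCW : CWFam.{u}).inH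

/-- The monoidality constraint on h-graphs, in terms of the double functor. -/
noncomputable def tensorUnion (X X' : HGraph.{u}) : U.obj X.fam.obj X.inH ⊗ U.obj X'.fam.obj X'.inH ⟶
    U.obj (X ⊗ X').fam.obj (X ⊗ X').inH :=
  (U.tensorIso X.inH X'.inH (inH_tensor_fam X X')).hom ≫
    U.vmap _ _ (HGraph.unionHom X X') (CWFam.isVEq (HGraph.unionIso X X').hom).isVertical

/-- The operations on CW complexes are compatible with disjoint unions. -/
lemma opGood_sum (hB : IsCW B) (hB' : IsCW B') (hS : S.IsAdmissible) (hS' : S'.IsAdmissible)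
    (hW : (S.sum S').IsAdmissible) {m : B → ℤ} {n : B' → ℤ} (hm : ∀ b, m b = d * S.relEuler F b)
    (hn : ∀ b, n b = d * S'.relEuler F b)
    (hmn : ∀ p, m (fst p) + n (snd p) = d * (S.sum S').relEuler F p) :
    (opGood U θ hS hm ⊗ₘ opGood U θ hS' hn) ≫ tensorUnion U Y Y' =
      tensorμ _ _ _ _ ≫ (SH.cross m n ⊗ₘ tensorUnion U X X') ≫ opGood U θ hW hmn := by
  have lm := hS.isLocallyConstant hm
  have ln := hS'.isLocallyConstant hn
  have lmn := hW.isLocallyConstant hmn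
  have hP := inH_emptyFam hB.isGoodBase lm
  have hQ := inH_emptyFam hB'.isGoodBase ln
  have hR := inH_emptyFam hW.good lmn
  have hPQ : InH ((emptyFam B m).tensor (emptyFam B' n)).obj := hP.tensor hQ hW.good
  have hPX := inH_empty_tensor X hB.isGoodBase lm
  have hQX := inH_empty_tensor X' hB'.isGoodBase ln
  have hRX := inH_empty_tensor (X ⊗ X') hW.good lmn
  have hXX : InH (X.fam.tensor X'.fam).obj := inH_tensor_fam X X'
  have hYY : InH (Y.fam.tensor Y'.fam).obj := inH_tensor_fam Y Y'
  have hPXQX : InH (((emptyFam B m).tensor X.fam).tensor ((emptyFam B' n).tensor X'.fam)).obj :=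
    hPX.tensor hQX ((hB.prod isCW_pt).prod (hB'.prod isCW_pt)).isGoodBase
  have hPQXX : InH (((emptyFam B m).tensor (emptyFam B' n)).tensor (X.fam.tensor X'.fam)).obj :=
    hPQ.tensor hXX ((hB.prod hB').prod (isCW_pt.prod isCW_pt)).isGoodBase
  have hT := X.inH_trivialFam hB.isGoodBase lm
  have hT' := X'.inH_trivialFam hB'.isGoodBase ln
  have hTW := (X ⊗ X').inH_trivialFam hW.good lmn
  have hTT : InH ((X.trivialFam B m).tensor (X'.trivialFam B' n)).obj := hT.tensor hT' hW.good
  have hSS : InH (S.fam.tensor S'.fam).obj := hS.inH.tensor hS'.inH hW.good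
  have i₁ := hS.isHorizontal_beta hm
  have i₂ := hS'.isHorizontal_beta hn
  have i₃ := hW.isHorizontal_beta hmn
  have i₄ := isHorizontal_beta_tensor hW hmn
  have v₁ := CobFam.isVEq_alpha X B m
  have v₂ := CobFam.isVEq_alpha X' B' n
  have v₃ := CobFam.isVEq_alpha (X ⊗ X') (B.prod B') fun p => m (fst p) + n (snd p)
  have v₄ := isVEq_sumTrivHom X X' m n
  have v₅ := isVEq_toEmpty_tensor m n
  have v₆ : IsVEq (FopHom.tensor (CobFam.alpha X B m) (CobFam.alpha X' B' n) :
      (((emptyFam B m).tensor X.fam).tensor ((emptyFam B' n).tensor X'.fam)).obj ⟶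
        ((X.trivialFam B m).tensor (X'.trivialFam B' n)).obj) := v₁.tensor v₂
  have vX : IsVEq (HGraph.unionHom X X') := CWFam.isVEq (HGraph.unionIso X X').hom
  have vY : IsVEq (HGraph.unionHom Y Y') := CWFam.isVEq (HGraph.unionIso Y Y').hom
  have v₇ : IsVEq (FopHom.tensor (toEmpty ((emptyFam B m).tensor (emptyFam B' n)).obj
        (ContinuousMap.id (B.prod B')) fun p => m (fst p) + n (snd p)) (HGraph.unionHom X X') :
        (((emptyFam B m).tensor (emptyFam B' n)).tensor (X.fam.tensor X'.fam)).obj ⟶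
          ((emptyFam (B.prod B') fun p => m (fst p) + n (snd p)).tensor (X ⊗ X').fam).obj) :=
    v₅.tensor vX
  have v₈ : IsVEq (CWFam.hom (tensorμ (emptyCW hB lm) X.toCW (emptyCW hB' ln) X'.toCW)) :=
    CWFam.isVEq _
  have w₁ := isVertical_gamma_tensor hW
  have w₂ := S.isVEq_sumHom S'
  have w₃ := hW.isVertical_gamma
  have e₁ : U.vmap hSS hYY _ w₁ ≫ U.vmap hYY (Y ⊗ Y').inH (HGraph.unionHom Y Y') vY.isVertical =
      U.vmap hSS hW.inH _ w₂.isVertical ≫ U.vmap hW.inH (Y ⊗ Y').inH _ w₃ :=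
    vmap_comp_eq U _ _ _ _ _ _ _ _ _ _ _ _
      ((gamma_tensor_unionHom S S').symm ▸ ⟨fun _ => rfl, w₃.hEmbedding⟩)
      (gamma_tensor_unionHom S S')
  have e₂ : U.hmap hSS hTT _ i₄ ≫ U.vmap hSS hW.inH _ w₂.isVertical =
      U.vmap hTT hTW _ v₄.isVertical ≫ U.hmap hW.inH hTW _ i₃ :=
    U.cell _ _ _ _ _ _ _ _ _ _ _ _ (IsTwoCell.of_vertical (comm_sum S S' m n) w₂ v₄)
  have e₃ : U.vmap hPXQX hTT _ v₆.isVertical ≫ U.vmap hTT hTW _ v₄.isVertical =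
      U.vmap hPXQX hPQXX _ v₈.isVertical ≫ U.vmap hPQXX hRX _ v₇.isVertical ≫
        U.vmap hRX hTW _ v₃.isVertical := by
    rw [← U.vmap_comp hPQXX hRX hTW _ _ _ _ (v₇.comp v₃).isVertical]
    exact vmap_comp_eq U _ _ _ _ _ _ _ _ _ _ _ _ (v₆.comp v₄).isVertical
      (alpha_tensor_sumTrivHom hB hB' lm ln)
  have e₄ := U.tensorIso_vmap hPX hQX hPXQX hT hT' hTT _ _ v₁.isVertical v₂.isVertical
    v₆.isVertical
  have e₅ := U.tensorIso_hmap hS.inH hS'.inH hSS hT hT' hTT (S.beta m) (S'.beta n) i₁ i₂ i₄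
  have e₆ := U.tensorIso_vmap hS.inH hS'.inH hSS Y.inH Y'.inH hYY _ _ hS.isVertical_gamma
    hS'.isVertical_gamma w₁
  have e₇ := U.tensorIso_vmap hPQ hXX hPQXX hR (X ⊗ X').inH hRX _ _ v₅.isVertical vX.isVertical
    v₇.isVertical
  have e₈ := θ.tensor m n hP hQ hPQ hR v₅.isVertical
  have e₉ : tensorμ _ _ _ _ ≫
      ((U.tensorIso hP hQ hPQ).hom ⊗ₘ (U.tensorIso X.inH X'.inH hXX).hom) ≫
      (U.tensorIso hPQ hXX hPQXX).hom =
      ((U.tensorIso hP X.inH hPX).hom ⊗ₘ (U.tensorIso hQ X'.inH hQX).hom) ≫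
      (U.tensorIso hPX hQX hPXQX).hom ≫ U.vmap hPXQX hPQXX _ v₈.isVertical :=
    tensorμ_comp_μ_tensorHom_μ_comp_μ (CWFam.functor U) (emptyCW hB lm) X.toCW
      (emptyCW hB' ln) X'.toCW
  have e₁₀ : (SH.cross m n ⊗ₘ ((U.tensorIso X.inH X'.inH hXX).hom ≫
      U.vmap hXX (X ⊗ X').inH (HGraph.unionHom X X') vX.isVertical)) ≫
      (θ.iso (B.prod B') _ hR).hom ▷ _ ≫ (U.tensorIso hR (X ⊗ X').inH hRX).hom =
      (((θ.iso B m hP).hom ⊗ₘ (θ.iso B' n hQ).hom) ⊗ₘ (𝟙 _ ⊗ₘ 𝟙 _)) ≫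
      ((U.tensorIso hP hQ hPQ).hom ⊗ₘ (U.tensorIso X.inH X'.inH hXX).hom) ≫
      (U.tensorIso hPQ hXX hPQXX).hom ≫ U.vmap hPQXX hRX _ v₇.isVertical := by
    rw [← e₇, id_tensorHom_id, MonoidalCategory.tensorHom_comp_tensorHom_assoc,
      MonoidalCategory.tensorHom_comp_tensorHom_assoc, ← tensorHom_id,
      MonoidalCategory.tensorHom_comp_tensorHom_assoc, e₈, Category.comp_id, Category.id_comp]
    simp only [Category.assoc]
  rw [opGood.eq_1 U θ hS, opGood.eq_1 U θ hS', opGood.eq_1 U θ hW, tensorUnion, tensorUnion]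
  simp only [← MonoidalCategory.tensorHom_comp_tensorHom, Category.assoc]
  rw [reassoc_of% e₆, e₁, reassoc_of% e₅, reassoc_of% e₂, reassoc_of% e₄, reassoc_of% e₃,
    ← reassoc_of% e₉, ← tensorHom_id, ← tensorHom_id, tensorμ_natural_assoc, ← reassoc_of% e₁₀]

end Union
end HGFT

namespace HGFT

open KSpace

/-! ### Cylinders -/

section Cylinder

/-- The fibre of a space over a point. -/
def fibrePt {E : KSpace.{u}} (p : C(E, KSpace.pt.{u})) (b : KSpace.pt.{u}) : E ≃ₜ fibre p b where
  toFun x := fibreMk x (Subsingleton.elim _ _)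
  invFun := fibreVal
  left_inv _ := rfl
  right_inv _ := rfl
  continuous_toFun := continuous_fibreMk continuous_id _
  continuous_invFun := continuous_fibreVal

lemma isCylinder_projection (X : KSpace.{u}) :
    ∃ q : C(X.cyl, X), IsHomotopyEquiv q ∧ ∀ x t, q (Kify.mk (x, t)) = x := by
  let v : C(X.cyl, X × I) := ⟨Kify.val, Kify.continuous_val⟩
  let q : C(X.cyl, X) := ContinuousMap.fst.comp v
  refine ⟨q, ⟨⟨fun x => Kify.mk (x, 1),
    Kify.continuous_mk_comp (continuous_id.prodMk continuous_const)⟩,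
    ⟨ContinuousMap.Homotopy.symm ⟨⟨fun z => Kify.mk ((v z.2).1,
      unitInterval.symm (unitInterval.symm (v z.2).2 * unitInterval.symm z.1)), ?_⟩, fun z => ?_,
      fun z => ?_⟩⟩, ⟨ContinuousMap.Homotopy.refl _⟩⟩, fun _ _ => rfl⟩
  · have hv : Continuous fun z : X.cyl × I => v z.1 := v.continuous.comp continuous_fst
    have h : Continuous fun z : X.cyl × I => ((v z.1).1,
        unitInterval.symm (unitInterval.symm (v z.1).2 * unitInterval.symm z.2)) :=
      hv.fst.prodMk (unitInterval.continuous_symm.comp ((unitInterval.continuous_symm.comp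
        hv.snd).mul (unitInterval.continuous_symm.comp continuous_snd)))
    exact (Kify.continuous_mk_comp h).comp continuous_swap
  · change Kify.mk ((v z).1, unitInterval.symm (unitInterval.symm (v z).2 * unitInterval.symm 0)) = z
    rw [unitInterval.symm_zero, mul_one, unitInterval.symm_symm]
    exact Kify.mk_val z
  · change Kify.mk ((v z).1, unitInterval.symm (unitInterval.symm (v z).2 * unitInterval.symm 1)) = _
    rw [unitInterval.symm_one, mul_zero, unitInterval.symm_zero]
    rfl

variable {X : HGraph.{u}} {F : Type u} [Field F] {d : ℤ} [CharP F 2]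
  (U : SymmMonDoubleFunctor F d) (θ : Homological U)

/-- The operation of a cylinder is the identity. -/
lemma opGood_cylinder (hS : (CobFam.cylinder X).IsAdmissible)
    (hm : ∀ b, (0 : ℤ) = d * (CobFam.cylinder X).relEuler F b) :
    unitClass F ▷ _ ≫ opGood U θ hS (m := fun _ => 0) hm = (λ_ _).hom := by
  obtain ⟨p, hp, hpx⟩ := isCylinder_projection X.space
  let q : HorMap X.fam (CobFam.cylinder X).fam := ⟨p, fun _ => rfl⟩
  have hq : ∀ b, IsHomotopyEquiv (q.fibreMap b) := fun b =>
    hp.of_conj (fibrePt _ b) (fibrePt _ b) fun _ => rfl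
  let r : HorMap X.fam (X.trivialFam KSpace.pt fun _ => 0) :=
    ⟨⟨snd, KSpace.continuous_snd⟩, fun _ => rfl⟩
  have hr : ∀ b, IsHomotopyEquiv (r.fibreMap b) := fun b =>
    (IsHomotopyEquiv.homeo (X.fibreTrivial (fun _ => 0) b).symm).of_conj (.refl _) (X.fibreFam b)
      fun _ => rfl
  let ρ : (X.trivialFam KSpace.pt fun _ => 0).obj ⟶ X.fam.obj :=
    FopHom.ofInv (X := (X.trivialFam KSpace.pt fun _ => 0).obj) (Y := X.fam.obj)
      (ContinuousMap.id _) (ContinuousMap.id _) (fun _ => rfl)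
      ⟨fun x => (pair star x : KSpace.pt.prod X.space),
        continuous_pair continuous_const continuous_id⟩ fun _ => rfl
  have hρ : IsVEq ρ := ⟨fun _ => rfl, fun b => (IsHomotopyEquiv.homeo ((X.fibreFam b).symm.trans
    (X.fibreTrivial (fun _ => 0) b))).of_conj (.refl _) (.refl _) fun _ => rfl⟩
  have lc : IsLocallyConstant fun _ : KSpace.pt.{u} => (0 : ℤ) := IsLocallyConstant.const 0
  have hI : InH unitObj := inH_emptyFam hS.good lc
  have hIX : InH (unitObj.fam.tensor X.fam).obj := inH_empty_tensor X hS.good lc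
  have hT := X.inH_trivialFam hS.good lc
  have i₁ := HGraph.isHorizontal_of_isHomotopyEquiv F d hq fun _ => rfl
  have i₂ := HGraph.isHorizontal_of_isHomotopyEquiv F d hr fun _ => rfl
  have i₃ := hS.isHorizontal_beta hm
  have v₁ : IsVEq (leftUnitorIso X.fam.obj).hom := IsVEq.iso _ fun _ => zero_add _
  have v₂ := CobFam.isVEq_alpha X KSpace.pt fun _ => 0
  have e₁ : U.hmap X.inH hS.inH q i₁ = U.vmap hS.inH X.inH _ hS.isVertical_gamma := by
    have := U.cell X.inH hS.inH X.inH X.inH q (HorMap.id _) (𝟙 X.fam.obj)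
      (CobFam.cylinder X).gamma i₁ (isHorizontal_id _) (IsVEq.id _).isVertical hS.isVertical_gamma
      (IsTwoCell.of_horizontal (FopHom.ext' (fun _ => rfl) fun b y _ _ => hpx y 1) hq
        fun _ => IsHomotopyEquiv.id)
    rwa [U.vmap_id, U.hmap_id, Category.comp_id, Category.comp_id] at this
  have e₂ : U.hmap X.inH hT r i₂ = U.vmap hT X.inH ρ hρ.isVertical := by
    have := U.cell X.inH hT X.inH X.inH r (HorMap.id _) (𝟙 X.fam.obj)
      ρ i₂ (isHorizontal_id _) (IsVEq.id _).isVertical hρ.isVertical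
      (IsTwoCell.of_horizontal (FopHom.ext' (fun _ => rfl) fun _ _ _ _ => rfl) hr
        fun _ => IsHomotopyEquiv.id)
    rwa [U.vmap_id, U.hmap_id, Category.comp_id, Category.comp_id] at this
  have e₃ : U.hmap hS.inH hT _ i₃ ≫ U.hmap X.inH hS.inH q i₁ = U.hmap X.inH hT r i₂ := by
    rw [← U.hmap_comp X.inH hS.inH hT q _ i₁ i₃ (i₁.comp i₃)]
    congr 1
    exact HorMap.hom_ext fun z => hpx (snd z) 0
  have e₄ : U.vmap hIX hT (CobFam.alpha X KSpace.pt fun _ => 0) v₂.isVertical ≫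
      U.vmap hT X.inH ρ hρ.isVertical =
      U.vmap hIX X.inH (leftUnitorIso X.fam.obj).hom v₁.isVertical := by
    have : CobFam.alpha X KSpace.pt (fun _ => 0) ≫ ρ = (leftUnitorIso X.fam.obj).hom :=
      FopHom.ext' (fun _ => rfl) fun _ _ _ _ => rfl
    refine (U.vmap_comp hIX hT X.inH _ _ _ _ (this ▸ v₁.isVertical)).symm.trans ?_
    congr 1
  have e₅ := U.left_unitality hI X.inH hIX v₁.isVertical
  rw [e₅, opGood, ← comp_whiskerRight_assoc, θ.unit hI, ← e₄, ← e₂, ← e₃, e₁]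
  rfl

end Cylinder
end HGFT

namespace HGFT

open KSpace

/-! ### The operation of a family over an arbitrary base -/

section Families

variable {B B' C C' : KSpace.{u}} {X Y Z X' Y' : HGraph.{u}}

namespace CobFam

lemma TwoCell.isHomotopyEquiv_of_eq {S : CobFam X Y B} {S' : CobFam X' Y' B'} (φ : TwoCell S S')
    {b : B} {b' : B'} (hb : b' = φ.onBase b) (h) :
    IsHomotopyEquiv (KSpace.fibreMap (p := S.proj) (p' := S'.proj) (b := b) (b' := b')
      φ.onTotal h) := by
  subst hb
  exact φ.isHomotopyEquiv b

/-- The two-cell of pullbacks induced by a two-cell. -/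
def TwoCell.pullback {S : CobFam X Y B} {S' : CobFam X' Y' B'} (φ : TwoCell S S') (f : C(C, B))
    (f' : C(C', B')) (g : C(C, C')) (h : ∀ c, f' (g c) = φ.onBase (f c)) :
    TwoCell (S.pullback f) (S'.pullback f') where
  onX := φ.onX
  onY := φ.onY
  onBase := g
  onTotal := ⟨fun z => Pullback.mk (g (Pullback.fst z)) (φ.onTotal (Pullback.snd z))
    ((h _).trans ((congrArg φ.onBase (Pullback.cond z)).trans (φ.proj _).symm)),
    Pullback.continuous_mk (g.continuous.comp Pullback.continuous_fst)
      (φ.onTotal.continuous.comp Pullback.continuous_snd) _⟩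
  proj _ := rfl
  inn c _ := congrArg Kify.mk (Subtype.ext (Prod.ext rfl ((φ.inn _ _).trans
    (congrArg (fun b => S'.inn (pair b _)) (h c).symm))))
  out c _ := congrArg Kify.mk (Subtype.ext (Prod.ext rfl ((φ.out _ _).trans
    (congrArg (fun b => S'.out (pair b _)) (h c).symm))))
  isHomotopyEquiv c := (φ.isHomotopyEquiv_of_eq (h c) fun s hs =>
    (φ.proj s).trans ((congrArg φ.onBase hs).trans (h c).symm)).of_conj
      (fibrePullback f S.proj c) (fibrePullback f' S'.proj (g c)) fun _ => rfl

variable {S : CobFam X Y B} {T : CobFam Y Z C}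

/-- The conditions on a family of cobordisms under which it acts. -/
structure IsWeaklyPositive (S : CobFam X Y B) : Prop where
  family : IsHGraphFamily S.proj
  positive : ∀ b, IsPositive (S.innAt b)
  hEmbedding : ∀ b, IsHEmbedding (S.outAt b)

lemma IsPositiveFamily.isWeaklyPositive (hS : S.IsPositiveFamily) : S.IsWeaklyPositive :=
  ⟨hS.family, hS.positive, hS.hEmbedding⟩

lemma IsAdmissible.isWeaklyPositive (hS : S.IsAdmissible) : S.IsWeaklyPositive :=
  ⟨hS.family, hS.positive, hS.hEmbedding⟩

lemma IsWeaklyPositive.isAdmissible_pullback (hS : S.IsWeaklyPositive) (f : C(B', B))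
    (hB : IsGoodBase B') : (S.pullback f).IsAdmissible :=
  CobFam.isAdmissible_pullback f hB hS.family hS.positive hS.hEmbedding

/-- The fibres of the external composite of pullbacks are homotopy pushouts. -/
def gluingPullback (hS : S.IsPositiveFamily) (hT : T.IsPositiveFamily) (f : C(B', B))
    (g : C(C', C)) :
    Gluing (S.pullback f) (T.pullback g) ((T.comp S).pullback (prodMap g f)) where
  inl := ⟨fun q => Pullback.mk (pair (fst q) (Pullback.fst (snd q)))
      (Quot.mk (CompRel T S) (inl (pair (g (fst q)) (Pullback.snd (snd q)))))
      (KSpace.prod_ext rfl (Pullback.cond (snd q))),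
    Pullback.continuous_mk (continuous_pair KSpace.continuous_fst
      (Pullback.continuous_fst.comp KSpace.continuous_snd)) (continuous_quot_mk.comp
        (KSpace.continuous_inl.comp (continuous_pair (g.continuous.comp KSpace.continuous_fst)
          (Pullback.continuous_snd.comp KSpace.continuous_snd)))) _⟩
  inr := ⟨fun q => Pullback.mk (pair (Pullback.fst (fst q)) (snd q))
      (Quot.mk (CompRel T S) (inr (pair (Pullback.snd (fst q)) (f (snd q)))))
      (KSpace.prod_ext (Pullback.cond (fst q)) rfl),
    Pullback.continuous_mk (continuous_pair (Pullback.continuous_fst.comp KSpace.continuous_fst)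
      KSpace.continuous_snd) (continuous_quot_mk.comp (KSpace.continuous_inr.comp (continuous_pair
        (Pullback.continuous_snd.comp KSpace.continuous_fst)
        (f.continuous.comp KSpace.continuous_snd)))) _⟩
  proj_inl _ := rfl
  proj_inr _ := rfl
  inn _ _ := rfl
  out _ _ := rfl
  glue p y := congrArg Kify.mk (Subtype.ext (Prod.ext rfl
    (Quot.sound (CompRel.glue (g (fst p)) (f (snd p)) y))))
  square p := ((isPushoutSquare_comp T S (hT.family.weakHausdorff.isClosed_singleton _)
    (hS.family.weakHausdorff.isClosed_singleton _)).isHomotopyCofibreSquare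
    (hT.hasHEP_innAt (g (fst p)))).of_homeo (.refl _) (fibrePullback g T.proj (fst p))
      (fibrePullback f S.proj (snd p)) (fibrePullback (prodMap g f) (T.comp S).proj p)
      (fun _ => rfl) (fun _ => rfl) (fun _ => rfl) fun _ => rfl
  hEmbedding p := ((hS.hEmbedding (f (snd p))).pushout (isPushoutSquare_comp T S
    (hT.family.weakHausdorff.isClosed_singleton _) (hS.family.weakHausdorff.isClosed_singleton _))
    (hT.hasHEP_innAt (g (fst p)))).of_homeo (fibrePullback g T.proj (fst p))
      (fibrePullback (prodMap g f) (T.comp S).proj p) fun _ => rfl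

/-- The fibres of the external disjoint union of pullbacks. -/
def fibreSumPullback (S : CobFam X Y B) (S' : CobFam X' Y' B') (f : C(C, B)) (f' : C(C', B'))
    (p : C.prod C') : fibre (S.sum S').proj (prodMap f f' p) ≃ₜ
      fibre ((S.pullback f).sum (S'.pullback f')).proj p :=
  (fibreTensor S.fam S'.fam (prodMap f f' p)).symm.trans
    (((fibrePullback f S.proj (fst p)).sumCongr (fibrePullback f' S'.proj (snd p))).trans
      (fibreTensor (S.pullback f).fam (S'.pullback f').fam p))

lemma innAt_sumPullback (S : CobFam X Y B) (S' : CobFam X' Y' B') (f : C(C, B)) (f' : C(C', B'))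
    (p : C.prod C') (x : (X ⊗ X' : HGraph.{u}).space) :
    fibreSumPullback S S' f f' p ((S.sum S').innAt (prodMap f f' p) x) =
      ((S.pullback f).sum (S'.pullback f')).innAt p x := by
  rcases x with x | x <;> rfl

lemma outAt_sumPullback (S : CobFam X Y B) (S' : CobFam X' Y' B') (f : C(C, B)) (f' : C(C', B'))
    (p : C.prod C') (y : (Y ⊗ Y' : HGraph.{u}).space) :
    fibreSumPullback S S' f f' p ((S.sum S').outAt (prodMap f f' p) y) =
      ((S.pullback f).sum (S'.pullback f')).outAt p y := by
  rcases y with y | y <;> rfl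

/-- The two-cell from the external disjoint union of pullbacks. -/
def sumPullback (S : CobFam X Y B) (S' : CobFam X' Y' B') (f : C(C, B)) (f' : C(C', B')) :
    TwoCell ((S.pullback f).sum (S'.pullback f')) (S.sum S') where
  onX := 𝟙 _
  onY := 𝟙 _
  onBase := prodMap f f'
  onTotal := ⟨elim (X := (⟨Pullback f S.proj⟩ : KSpace.{u}).prod C')
      (Y := C.prod ⟨Pullback f' S'.proj⟩)
      (fun q => inl (pair (Pullback.snd (fst q)) (f' (snd q))))
      (fun q => inr (pair (f (fst q)) (Pullback.snd (snd q)))),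
    continuous_elim
      (KSpace.continuous_inl.comp (continuous_pair (Pullback.continuous_snd.comp
        KSpace.continuous_fst) (f'.continuous.comp KSpace.continuous_snd)))
      (KSpace.continuous_inr.comp (continuous_pair (f.continuous.comp KSpace.continuous_fst)
        (Pullback.continuous_snd.comp KSpace.continuous_snd)))⟩
  proj := by
    rintro (q | q)
    · exact KSpace.prod_ext (Pullback.cond (fst q)).symm rfl
    · exact KSpace.prod_ext rfl (Pullback.cond (snd q)).symm
  inn := by rintro p (x | x) <;> rfl
  out := by rintro p (x | x) <;> rfl
  isHomotopyEquiv p := IsHomotopyEquiv.id.of_conj (fibreSumPullback S S' f f' p) (.refl _)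
    fun z => by
      obtain ⟨w, rfl⟩ := (fibreTensor S.fam S'.fam (prodMap f f' p)).surjective z
      rcases w with w | w <;> rfl

lemma relEuler_sumPullback (F : Type u) [Field F] (S : CobFam X Y B) (S' : CobFam X' Y' B')
    (f : C(C, B)) (f' : C(C', B')) (p : C.prod C') :
    ((S.pullback f).sum (S'.pullback f')).relEuler F p = (S.sum S').relEuler F (prodMap f f' p) :=
  congrArg (· - _)
    (eulerChar_eq F _ (IsHomotopyEquiv.homeo (fibreSumPullback S S' f f' p))).symm

lemma isAdmissible_sumPullback {S : CobFam X Y B} {S' : CobFam X' Y' B'} (f : C(C, B))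
    (f' : C(C', B')) (h : IsGoodBase (C.prod C')) (hS : (S.sum S').IsWeaklyPositive)
    (h₁ : IsHGraphFamily S.proj) (h₂ : IsHGraphFamily S'.proj) (hC : IsWeakHausdorff C)
    (hC' : IsWeakHausdorff C') : ((S.pullback f).sum (S'.pullback f')).IsAdmissible where
  good := h
  family := IsHGraphFamily.tensor (X := (S.pullback f).fam) (Y := (S'.pullback f').fam)
    (h₁.pullback f hC) (h₂.pullback f' hC') h.isWeakHausdorff
  positive p z := by
    obtain ⟨x, ⟨γ⟩⟩ := hS.positive (prodMap f f' p) ((fibreSumPullback S S' f f' p).symm z)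
    exact ⟨x, ⟨(γ.map (fibreSumPullback S S' f f' p).continuous).cast
      (innAt_sumPullback S S' f f' p x).symm (Homeomorph.apply_symm_apply _ z).symm⟩⟩
  hEmbedding p := (hS.hEmbedding (prodMap f f' p)).of_homeo (.refl _) (fibreSumPullback S S' f f' p)
    fun y => (outAt_sumPullback S S' f f' p y).symm

end CobFam

variable {F : Type u} [Field F] {d : ℤ} (U : SymmMonDoubleFunctor F d)

lemma horU_id (X : HGraph.{u}) : horU U (𝟙 X) = 𝟙 _ := U.hmap_id X.inH _

variable [CharP F 2] (θ : Homological U)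

lemma opGood_shift {S : CobFam X Y B} (hS : S.IsAdmissible) {m n : B → ℤ}
    (hm : ∀ b, m b = d * S.relEuler F b) (hn : ∀ b, n b = d * S.relEuler F b)
    (h : ∀ b, n (ContinuousMap.id B b) = m b) :
    SH.map (ContinuousMap.id B) h ▷ _ ≫ opGood U θ hS hn = opGood U θ hS hm := by
  obtain rfl : n = m := funext h
  rw [SH.map_id, id_whiskerRight, Category.id_comp]

/-- The shift of the pullback of a family to the realization of the singular complex. -/
lemma sing_shift (F : Type u) [Field F] (d : ℤ) (S : CobFam X Y B) (x : singReal B) :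
    d * S.relEuler F (singEval B x) = d * (S.pullback (singEval B)).relEuler F x := by
  rw [CobFam.relEuler_pullback]

/-- The operation of a family. -/
noncomputable def opFam (S : CobFam X Y B) (hS : S.IsWeaklyPositive) :
    SH F B (fun b => d * S.relEuler F b) ⊗ U.obj X.fam.obj X.inH ⟶ U.obj Y.fam.obj Y.inH :=
  SH.sing (F := F) (fun b => d * S.relEuler F b) ▷ U.obj X.fam.obj X.inH ≫
    opGood U θ (hS.isAdmissible_pullback (singEval B) (isCW_singReal B).isGoodBase)
      (sing_shift F d S)

lemma opFam_baseChange (S : CobFam X Y B) (S' : CobFam X' Y' B') (hS : S.IsWeaklyPositive)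
    (hS' : S'.IsWeaklyPositive) (φ : CobFam.TwoCell S S') :
    opFam U θ S hS ≫ horU U φ.onY =
      (SH.map φ.onBase (fun b => congrArg (d * ·) (φ.relEuler_eq F b)) ⊗ₘ horU U φ.onX) ≫
        opFam U θ S' hS' := by
  have h := opGood_baseChange U θ (hS.isAdmissible_pullback (singEval B)
    (isCW_singReal B).isGoodBase) (hS'.isAdmissible_pullback (singEval B')
    (isCW_singReal B').isGoodBase) (sing_shift F d S) (sing_shift F d S')
    (φ.pullback (singEval B) (singEval B') (singRealMap φ.onBase) (singEval_map φ.onBase))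
    fun x => (congrArg (fun b => d * S'.relEuler F b) (singEval_map φ.onBase x)).trans
      (congrArg (d * ·) (φ.relEuler_eq F _))
  rw [opFam, opFam, Category.assoc]
  refine (congrArg (_ ≫ ·) h).trans ?_
  rw [← tensorHom_id, ← tensorHom_id, MonoidalCategory.tensorHom_comp_tensorHom_assoc,
    MonoidalCategory.tensorHom_comp_tensorHom_assoc, Category.id_comp, Category.comp_id,
    SH.sing_naturality]
  rfl

/-- Over good bases, the operation is the push-pull operation. -/
lemma opFam_eq (S : CobFam X Y B) (hS : S.IsAdmissible) :
    opFam U θ S hS.isWeaklyPositive = opGood U θ hS fun _ => rfl := by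
  have h := opGood_baseChange U θ (hS.isWeaklyPositive.isAdmissible_pullback (singEval B)
    (isCW_singReal B).isGoodBase) hS (sing_shift F d S) (fun _ => rfl)
    (S.pullbackTwoCell (singEval B)) fun _ => rfl
  change _ ≫ horU U (𝟙 Y) = (_ ⊗ₘ horU U (𝟙 X)) ≫ _ at h
  rw [horU_id, horU_id, Category.comp_id, tensorHom_id] at h
  rw [opFam, h, ← comp_whiskerRight_assoc]
  refine (congrArg (· ▷ _ ≫ _) (SH.sing_eval _)).trans ?_
  rw [id_whiskerRight, Category.id_comp]

/-- The operation of a family over a good base is determined by a two-cell to another family. -/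
lemma opGood_twoCell {W : CobFam X Y C} {S : CobFam X Y B} (hW : W.IsAdmissible)
    (hS : S.IsWeaklyPositive) (φ : CobFam.TwoCell W S) (hX : φ.onX = 𝟙 X) (hY : φ.onY = 𝟙 Y)
    {m : C → ℤ} (hm : ∀ c, m c = d * W.relEuler F c)
    (hf : ∀ c, d * S.relEuler F (φ.onBase c) = m c) :
    opGood U θ hW hm = SH.map φ.onBase hf ▷ _ ≫ opFam U θ S hS := by
  obtain rfl : m = _ := funext hm
  have h := opFam_baseChange U θ W S hW.isWeaklyPositive hS φ
  rwa [hX, hY, horU_id, horU_id, Category.comp_id, tensorHom_id, opFam_eq U θ W hW] at h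

lemma sing_cross {m : C → ℤ} {n : B → ℤ} (k : C.prod B → ℤ)
    (hk : ∀ p, k p = m (fst p) + n (snd p)) :
    (SH.sing (F := F) m ⊗ₘ SH.sing n) ≫ SH.cross _ _ ≫
      SH.map (prodMap (singEval C) (singEval B)) (fun _ => hk _) =
      SH.cross m n ≫ SH.map (ContinuousMap.id (C.prod B)) hk := by
  obtain rfl : k = _ := funext hk
  rw [← SH.cross_naturality (singEval C) (singEval B) (fun _ => rfl) fun _ => rfl,
    MonoidalCategory.tensorHom_comp_tensorHom_assoc, SH.sing_eval, SH.sing_eval,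
    id_tensorHom_id, Category.id_comp]
  exact (Category.comp_id _).symm.trans (congrArg (_ ≫ ·) (SH.map_id hk).symm)

lemma opFam_gluing (S : CobFam X Y B) (T : CobFam Y Z C)
    (hS : S.IsPositiveFamily) (hT : T.IsPositiveFamily) (h : (T.comp S).IsPositiveFamily)
    (hχ : ∀ p : C.prod B, d * (T.comp S).relEuler F p =
      d * T.relEuler F (fst p) + d * S.relEuler F (snd p)) :
    SH F C _ ◁ opFam U θ S hS.isWeaklyPositive ≫ opFam U θ T hT.isWeaklyPositive =
      (α_ _ _ _).inv ≫ (SH.cross (fun c => d * T.relEuler F c) (fun b => d * S.relEuler F b) ≫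
        SH.map (ContinuousMap.id (C.prod B)) hχ) ▷ _ ≫
        opFam U θ (T.comp S) h.isWeaklyPositive := by
  have hB := isCW_singReal B
  have hC := isCW_singReal C
  have hS' := hS.isWeaklyPositive.isAdmissible_pullback (singEval B) hB.isGoodBase
  have hT' := hT.isWeaklyPositive.isAdmissible_pullback (singEval C) hC.isGoodBase
  have hW := h.isWeaklyPositive.isAdmissible_pullback (prodMap (singEval C) (singEval B))
    (hC.prod hB).isGoodBase
  have hmn : ∀ p : (singReal C).prod (singReal B), d * T.relEuler F (singEval C (fst p)) +
      d * S.relEuler F (singEval B (snd p)) =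
      d * ((T.comp S).pullback (prodMap (singEval C) (singEval B))).relEuler F p := fun p => by
    rw [CobFam.relEuler_pullback, hχ]
    rfl
  have e₁ := opGood_gluing U θ (CobFam.gluingPullback hS hT (singEval B) (singEval C)) hB hC hS' hT'
    hW (sing_shift F d T) (sing_shift F d S) hmn
  have e₂ := opGood_twoCell U θ hW h.isWeaklyPositive (CobFam.pullbackTwoCell _ _) rfl rfl hmn
    fun p => hχ _
  have e₃ := (Iso.eq_inv_comp _).2 e₁
  rw [opFam.eq_1 U θ S, opFam.eq_1 U θ T, whiskerLeft_comp, Category.assoc,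
    whisker_exchange_assoc, e₃, e₂, ← sing_cross _ hχ]
  simp only [MonoidalCategory.tensorHom_def, comp_whiskerRight, Category.assoc, whisker_assoc]
  rw [associator_naturality_left_assoc, Iso.inv_hom_id_assoc, ← whisker_exchange_assoc]
  rfl

lemma opFam_sum (S : CobFam X Y B) (S' : CobFam X' Y' B') (hS : S.IsPositiveFamily)
    (hS' : S'.IsPositiveFamily) (h : (S.sum S').IsPositiveFamily)
    (hχ : ∀ p : B.prod B', d * (S.sum S').relEuler F p =
      d * S.relEuler F (fst p) + d * S'.relEuler F (snd p)) :
    (opFam U θ S hS.isWeaklyPositive ⊗ₘ opFam U θ S' hS'.isWeaklyPositive) ≫ tensorUnion U Y Y' =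
      tensorμ _ _ _ _ ≫
        ((SH.cross (fun b => d * S.relEuler F b) (fun b => d * S'.relEuler F b) ≫
          SH.map (ContinuousMap.id (B.prod B')) hχ) ⊗ₘ tensorUnion U X X') ≫
        opFam U θ (S.sum S') h.isWeaklyPositive := by
  have hB := isCW_singReal B
  have hB' := isCW_singReal B'
  have h₁ := hS.isWeaklyPositive.isAdmissible_pullback (singEval B) hB.isGoodBase
  have h₂ := hS'.isWeaklyPositive.isAdmissible_pullback (singEval B') hB'.isGoodBase
  have hW := CobFam.isAdmissible_sumPullback (singEval B) (singEval B') (hB.prod hB').isGoodBase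
    h.isWeaklyPositive hS.family hS'.family hB.isGoodBase.isWeakHausdorff
    hB'.isGoodBase.isWeakHausdorff
  have hmn : ∀ p : (singReal B).prod (singReal B'), d * S.relEuler F (singEval B (fst p)) +
      d * S'.relEuler F (singEval B' (snd p)) =
      d * ((S.pullback (singEval B)).sum (S'.pullback (singEval B'))).relEuler F p := fun p => by
    rw [CobFam.relEuler_sumPullback, hχ]
    rfl
  have e₁ := opGood_sum U θ hB hB' h₁ h₂ hW (sing_shift F d S) (sing_shift F d S') hmn
  have e₂ := opGood_twoCell U θ hW h.isWeaklyPositive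
    (CobFam.sumPullback S S' (singEval B) (singEval B')) rfl rfl hmn fun p => hχ _
  rw [opFam.eq_1 U θ S, opFam.eq_1 U θ S', ← MonoidalCategory.tensorHom_comp_tensorHom,
    Category.assoc, e₁, e₂, ← sing_cross _ hχ, ← tensorHom_id, ← tensorHom_id,
    tensorμ_natural_assoc, id_tensorHom_id, ← tensorHom_id,
    MonoidalCategory.tensorHom_comp_tensorHom_assoc,
    MonoidalCategory.tensorHom_comp_tensorHom_assoc, Category.id_comp, Category.comp_id]
  simp only [Category.assoc]
  rfl

lemma opFam_cylinder (X : HGraph.{u}) (h : (CobFam.cylinder X).IsPositiveFamily)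
    (hχ : ∀ b : KSpace.pt, d * (CobFam.cylinder X).relEuler F b = 0) :
    (unitClass F ≫ SH.map (ContinuousMap.id KSpace.pt) hχ) ▷ _ ≫
      opFam U θ (CobFam.cylinder X) h.isWeaklyPositive = (λ_ _).hom := by
  have hS := h.isAdmissible isCW_pt.isGoodBase
  rw [opFam_eq U θ _ hS, comp_whiskerRight, Category.assoc]
  refine (congrArg (_ ≫ ·) (opGood_shift U θ hS (fun b => (hχ b).symm) (fun _ => rfl) hχ)).trans ?_
  exact opGood_cylinder U θ hS fun b => (hχ b).symm

end Families
end HGFT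

namespace HGFT

variable {F : Type u} [Field F] [CharP F 2] {d : ℤ} (U : SymmMonDoubleFunctor F d)
  (θ : Homological U)

/-- The field theory of a homological symmetric monoidal double functor. -/
noncomputable def fieldTheory : PosHHGFT F d where
  functor := phi U
  op S hS := opFam U θ S hS.isWeaklyPositive
  baseChange S S' hS hS' φ := opFam_baseChange U θ S S' hS.isWeaklyPositive hS'.isWeaklyPositive φ
  gluing S T hS hT h hχ := opFam_gluing U θ S T hS hT h hχ
  identity X h hχ := opFam_cylinder U θ X h hχ
  monoidality S S' hS hS' h hχ := opFam_sum U θ S S' hS hS' h hχ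

end HGFT

theorem mainTheorem5 {F : Type u} [Field F] [CharP F 2] (d : ℤ)
    (U : HGFT.SymmMonDoubleFunctor F d) (θ : HGFT.Homological U) :
    ∃ (Φ : HGFT.PosHHGFT F d) (hX : ∀ X : HGFT.HGraph.{u}, HGFT.InH X.fam.obj)
      (hobj : ∀ X : HGFT.HGraph.{u}, Φ.functor.obj X = U.obj X.fam.obj (hX X)),
      (∀ (X Y : HGFT.HGraph.{u}) (f : X ⟶ Y),
        ∃ hf : HGFT.IsVertical (HGFT.HGraph.vert f),
          IsIso (U.vmap (hX Y) (hX X) (HGFT.HGraph.vert f) hf) ∧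
          Φ.functor.map f ≫ eqToHom (hobj Y) ≫
            U.vmap (hX Y) (hX X) (HGFT.HGraph.vert f) hf = eqToHom (hobj X)) ∧
      (∀ X Y : HGFT.HGraph.{u},
        ∃ (hXY : HGFT.InH (X.fam.tensor Y.fam).obj)
          (hv : HGFT.IsVertical (HGFT.HGraph.unionHom X Y)),
          Functor.LaxMonoidal.μ Φ.functor X Y ≫ eqToHom (hobj (X ⊗ Y)) =
            (eqToHom (hobj X) ⊗ₘ eqToHom (hobj Y)) ≫
              (U.tensorIso (X := X.fam.obj) (Y := Y.fam.obj) (hX X) (hX Y) hXY).hom ≫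
              U.vmap hXY (hX (X ⊗ Y)) (HGFT.HGraph.unionHom X Y) hv) ∧
      ∀ (X Y : HGFT.HGraph.{u}) (B : HGFT.KSpace.{u}) (_ : HGFT.IsGoodBase B)
        (S : HGFT.CobFam X Y B) (hS : S.IsPositiveFamily),
        ∃ (hB : HGFT.InH (HGFT.emptyFam B fun b => d * S.relEuler F b).obj)
          (hBX : HGFT.InH ((HGFT.emptyFam B fun b => d * S.relEuler F b).tensor X.fam).obj)
          (hT : HGFT.InH (X.trivialFam B fun b => d * S.relEuler F b).obj)
          (hSB : HGFT.InH S.fam.obj)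
          (hα : HGFT.IsVertical (HGFT.CobFam.alpha X B fun b => d * S.relEuler F b))
          (hβ : HGFT.IsHorizontal F d (S.beta fun b => d * S.relEuler F b))
          (hγ : HGFT.IsVertical S.gamma),
          Φ.op S hS =
            ((θ.iso B (fun b => d * S.relEuler F b) hB).hom ⊗ₘ eqToHom (hobj X)) ≫
              (U.tensorIso (X := (HGFT.emptyFam B fun b => d * S.relEuler F b).obj)
                (Y := X.fam.obj) hB (hX X) hBX).hom ≫
              U.vmap hBX hT (HGFT.CobFam.alpha X B fun b => d * S.relEuler F b) hα ≫
              U.hmap hSB hT (S.beta fun b => d * S.relEuler F b) hβ ≫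
              U.vmap hSB (hX Y) S.gamma hγ ≫ eqToHom (hobj Y).symm := by
  refine ⟨HGFT.fieldTheory U θ, fun X => X.inH, fun _ => rfl, fun X Y f => ?_, fun X Y => ?_,
    fun X Y B hB S hS => ?_⟩
  · refine ⟨(HGFT.HGraph.isVEq_vert f).isVertical,
      (inferInstance : IsIso (HGFT.horIso U f).inv), ?_⟩
    exact (congrArg (_ ≫ ·) (Category.id_comp _)).trans (HGFT.hor_vert U f)
  · refine ⟨HGFT.inH_tensor_fam X Y,
      (HGFT.CWFam.isVEq (HGFT.HGraph.unionIso X Y).hom).isVertical, ?_⟩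
    refine (Category.comp_id _).trans (Eq.trans ?_ (congrArg (· ≫ _)
      (MonoidalCategory.id_tensorHom_id _ _)).symm)
    exact (Category.id_comp _).symm
  · have h := hS.isAdmissible hB
    refine ⟨HGFT.inH_emptyFam hB (h.isLocallyConstant fun _ => rfl),
      HGFT.inH_empty_tensor X hB (h.isLocallyConstant fun _ => rfl),
      X.inH_trivialFam hB (h.isLocallyConstant fun _ => rfl), h.inH,
      (HGFT.CobFam.isVEq_alpha X B _).isVertical, h.isHorizontal_beta fun _ => rfl,
      h.isVertical_gamma, ?_⟩
    refine (HGFT.opFam_eq U θ S h).trans ?_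
    rw [HGFT.opGood, ← tensorHom_id]
    rfl
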